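/- Let $n\ge 1$ be an integer and let $m>0$ be a real number with $m\neq 1$. Let $(M^n,g)$ be a connected complete smooth Riemannian manifold, possibly with boundary, and let $w:M\to\mathbb{R}$ be a smooth function such that $(M,g,w)$ is a $(0,n+m)$-Einstein manifold, that is, $$\mathrm{Hess}\,w=\frac{w}{m}\,\mathrm{Ric},\qquad w>0 \text{ on } \mathrm{int}(M),\qquad w=0 \text{ on } \partial M.$$ If the scalar curvature of $g$ is constant, then one of the following holds: (1) $(M,g)$ is Ricci flat and $\partial M=\emptyset$; or (2) there are a smooth Riemannian manifold $(F,g_F)$ of dimension $n-1$ without boundary which is Ricci flat, and an isometry (a diffeomorphism preserving the metrics) of $(M,g)$ onto $(F\times[0,\infty),\,g_F+\mathrm{d}r^2)$, under which $w$ becomes a linear function of $r$: $w=a\,r$ for some constant $a>0$. -/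

import Mathlib

open Set Manifold Bundle Topology
open scoped ContDiff

noncomputable section

namespace WarpedEinstein

/-! ## Curvature in coordinates

`s` is the region of `ℝⁿ` in which the coordinates take their values (the whole space, or a half
space for a manifold with boundary) and `G y = (g_ij(y))` is a Riemannian metric in coordinates.
Derivatives are taken within `s`, so that they make sense at boundary points. -/

/-- The partial derivative `∂_i f` at `y`, within `s`. -/
def partialDeriv {n : ℕ} (s : Set (EuclideanSpace ℝ (Fin n))) (i : Fin n)
    (f : EuclideanSpace ℝ (Fin n) → ℝ) (y : EuclideanSpace ℝ (Fin n)) : ℝ :=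
  fderivWithin ℝ f s y (EuclideanSpace.single i 1)

/-- Christoffel symbols `Γ^k_ij = ½ ∑_l g^{kl} (∂_i g_jl + ∂_j g_il - ∂_l g_ij)`. -/
def christoffel {n : ℕ} (s : Set (EuclideanSpace ℝ (Fin n)))
    (G : EuclideanSpace ℝ (Fin n) → Matrix (Fin n) (Fin n) ℝ) (k i j : Fin n)
    (y : EuclideanSpace ℝ (Fin n)) : ℝ :=
  (1 / 2 : ℝ) * ∑ l, (G y)⁻¹ k l *
    (partialDeriv s i (fun z => G z j l) y + partialDeriv s j (fun z => G z i l) y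
      - partialDeriv s l (fun z => G z i j) y)

/-- Ricci tensor
`R_ij = ∑_k (∂_k Γ^k_ij - ∂_j Γ^k_ik) + ∑_{k,l} (Γ^k_kl Γ^l_ij - Γ^k_jl Γ^l_ik)`. -/
def coordRicci {n : ℕ} (s : Set (EuclideanSpace ℝ (Fin n)))
    (G : EuclideanSpace ℝ (Fin n) → Matrix (Fin n) (Fin n) ℝ) (i j : Fin n)
    (y : EuclideanSpace ℝ (Fin n)) : ℝ :=
  ∑ k, (partialDeriv s k (christoffel s G k i j) y - partialDeriv s j (christoffel s G k i k) y)
    + ∑ k, ∑ l, (christoffel s G k k l y * christoffel s G l i j y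
      - christoffel s G k j l y * christoffel s G l i k y)

/-- Hessian `(Hess f)_ij = ∂_i ∂_j f - ∑_k Γ^k_ij ∂_k f`. -/
def coordHess {n : ℕ} (s : Set (EuclideanSpace ℝ (Fin n)))
    (G : EuclideanSpace ℝ (Fin n) → Matrix (Fin n) (Fin n) ℝ)
    (f : EuclideanSpace ℝ (Fin n) → ℝ) (i j : Fin n) (y : EuclideanSpace ℝ (Fin n)) : ℝ :=
  partialDeriv s i (partialDeriv s j f) y - ∑ k, christoffel s G k i j y * partialDeriv s k f y

/-! ## Riemannian manifolds, possibly with boundary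

A tensor field on `M` is handled through its components in all charts of the maximal smooth
atlas. In the definitions below `e` is such a chart and `x` a point of its domain. -/

section Manifold

variable {n : ℕ} {H : Type*} [TopologicalSpace H]
  (I : ModelWithCorners ℝ (EuclideanSpace ℝ (Fin n)) H)
  {M : Type*} [TopologicalSpace M] [ChartedSpace H M]

/-- The coordinate vector field `∂_i` of the chart `e`, at the point with coordinates `y`. -/
def coordVector (e : OpenPartialHomeomorph M H) (i : Fin n) (y : EuclideanSpace ℝ (Fin n)) :
    TangentSpace I ((e.extend I).symm y) :=
  mfderivWithin 𝓘(ℝ, EuclideanSpace ℝ (Fin n)) I (e.extend I).symm (range I) y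
    ((NormedSpace.fromTangentSpace y).symm (EuclideanSpace.single i 1))

/-- A function on `M` written in the chart `e`. -/
def inChart (e : OpenPartialHomeomorph M H) (f : M → ℝ) (y : EuclideanSpace ℝ (Fin n)) : ℝ :=
  f ((e.extend I).symm y)

variable [RiemannianBundle (fun x : M => TangentSpace I x)]

/-- The metric in the chart `e`: `g_ij = g(∂_i, ∂_j)`. -/
def chartMetric (e : OpenPartialHomeomorph M H) (y : EuclideanSpace ℝ (Fin n)) :
    Matrix (Fin n) (Fin n) ℝ :=
  Matrix.of fun i j => inner ℝ (coordVector I e i y) (coordVector I e j y)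

/-- Components of the metric at `x` in the chart `e`. -/
def metricComp (e : OpenPartialHomeomorph M H) (x : M) (i j : Fin n) : ℝ :=
  chartMetric I e (e.extend I x) i j

/-- Components of the inverse metric at `x` in the chart `e`. -/
def invMetricComp (e : OpenPartialHomeomorph M H) (x : M) (i j : Fin n) : ℝ :=
  (chartMetric I e (e.extend I x))⁻¹ i j

/-- Components of the Ricci tensor at `x` in the chart `e`. -/
def ricciComp (e : OpenPartialHomeomorph M H) (x : M) (i j : Fin n) : ℝ :=
  coordRicci (range I) (chartMetric I e) i j (e.extend I x)

/-- Components of the Hessian of `f` at `x` in the chart `e`. -/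
def hessComp (e : OpenPartialHomeomorph M H) (f : M → ℝ) (x : M) (i j : Fin n) : ℝ :=
  coordHess (range I) (chartMetric I e) (inChart I e f) i j (e.extend I x)

/-- The scalar curvature `∑ g^{ij} R_ij` at `x`, computed in the chart `e`. -/
def scalarCurvature (e : OpenPartialHomeomorph M H) (x : M) : ℝ :=
  ∑ i, ∑ j, invMetricComp I e x i j * ricciComp I e x i j

/-- The Laplacian `∑ g^{ij} (Hess f)_ij` at `x`, computed in the chart `e`. -/
def laplacian (e : OpenPartialHomeomorph M H) (f : M → ℝ) (x : M) : ℝ :=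
  ∑ i, ∑ j, invMetricComp I e x i j * hessComp I e f x i j

variable (M)

/-- The Ricci tensor of `M` vanishes identically. -/
def IsRicciFlat : Prop :=
  ∀ e ∈ IsManifold.maximalAtlas I ∞ M, ∀ x ∈ e.source, ∀ i j, ricciComp I e x i j = 0

/-- The scalar curvature of `M` is a constant function. -/
def HasConstantScalarCurvature : Prop :=
  ∃ c : ℝ, ∀ e ∈ IsManifold.maximalAtlas I ∞ M, ∀ x ∈ e.source, scalarCurvature I e x = c

variable {M}

/-- `w` turns the Riemannian manifold `M`, whose dimension is `n`, into a
`(lam, n + m)`-Einstein manifold: `w` is smooth, `Hess w = (w / m) (Ric - lam g)`, `w` is positive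
in the interior and zero on the boundary of `M`, and if `m = 1` then `Δ w = -lam w`. -/
structure IsQuasiEinstein (lam m : ℝ) (w : M → ℝ) : Prop where
  smooth : ContMDiff I 𝓘(ℝ, ℝ) ∞ w
  hess_eq : ∀ e ∈ IsManifold.maximalAtlas I ∞ M, ∀ x ∈ e.source, ∀ i j,
    hessComp I e w x i j = w x / m * (ricciComp I e x i j - lam * metricComp I e x i j)
  pos : ∀ x ∈ I.interior M, 0 < w x
  zero : ∀ x ∈ I.boundary M, w x = 0
  laplacian_eq : m = 1 → ∀ e ∈ IsManifold.maximalAtlas I ∞ M, ∀ x ∈ e.source,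
    laplacian I e w x = -lam * w x

end Manifold

/-- The coordinate `r` on the half-line `[0, ∞)`, realised as `EuclideanHalfSpace 1`. -/
def halfLineCoord (t : EuclideanHalfSpace 1) : ℝ := t.1 0

/-- `Φ` is an isometry of `M` onto the Riemannian product `(F × [0, ∞), g_F + dr²)`:
it is a diffeomorphism (by its type) and the pull-back of `g_F + dr²` is the metric of `M`. -/
def IsProductIsometry {n k : ℕ} {H : Type*} [TopologicalSpace H]
    (I : ModelWithCorners ℝ (EuclideanSpace ℝ (Fin n)) H)
    {M : Type*} [TopologicalSpace M] [ChartedSpace H M]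
    [RiemannianBundle (fun x : M => TangentSpace I x)]
    {F : Type*} [TopologicalSpace F] [ChartedSpace (EuclideanSpace ℝ (Fin k)) F]
    [RiemannianBundle (fun p : F => TangentSpace (𝓡 k) p)]
    (Φ : M ≃ₘ^∞⟮I, (𝓡 k).prod (𝓡∂ 1)⟯ (F × EuclideanHalfSpace 1)) : Prop :=
  ∀ (x : M) (u v : TangentSpace I x),
    inner ℝ u v =
      inner ℝ (mfderiv I (𝓡 k) (fun z => (Φ z).1) x u) (mfderiv I (𝓡 k) (fun z => (Φ z).1) x v)
      + mvfderiv I (fun z => halfLineCoord (Φ z).2) x u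
        * mvfderiv I (fun z => halfLineCoord (Φ z).2) x v

end WarpedEinstein

end

open WarpedEinstein

universe u

/-! ## Inverse functions within a set -/

/-! Write `c` for the scalar curvature and `R` for the Ricci tensor. Commuting covariant derivatives
of `∇w` gives `∇Δw - div Hess w = -R(∇w)`. Into this goes `Hess w = (w/m) R`, whose trace is `c
w/m`, together with `div R = 0`, which is the contracted Bianchi identity for constant `c`. The
outcome is `(m-1) R(∇w) = -c ∇w`, hence `∇|∇w|² = (2w/m) R(∇w)`, so that `|∇w|² + c w²/(m(m-1))` has
zero differential. Taking the Laplacian of this first integral where `w ≠ 0` gives `(m-1)|R|² =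
-c²`. By Cauchy–Schwarz, `c²|∇w|² = (m-1)²|R(∇w)|² ≤ (m-1)²|R|²|∇w|² = (1-m)c²|∇w|²`, that is `m c²
|∇w|² ≤ 0`. So `c = 0` as soon as `∇w` is nonzero at one interior point; otherwise `Hess w = 0`
inside, and the equation gives `R = 0` and again `c = 0`. Once `c = 0`, the identity for `|R|²`
gives `R = 0`, whence `Hess w = 0` and `|∇w|` is constant, up to the boundary by continuity. The
steps are `IsNormalAt.sum_coordRicci_mul_partialDeriv`, `IsNormalAt.sum_coordRicci_sq`,
`IsNormalAt.scalar_eq_zero` and `coordRicci_eq_zero_of_scalarCurvature`.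

If the boundary is empty, this is the first alternative. Otherwise `|∇w|` is a positive constant
`a`, and `r = w/a` has unit gradient, zero Hessian and the boundary as its zero set. Flowing along
`∇r` produces charts in which the metric is `dr² + g'` with `g'` independent of `r`
(`IsHeight.exists_boxChart`). The integral curves have unit speed, so completeness extends them to
all heights in `[0, ∞)` (`IsFlowBoxFamily.exists_isLine_univ`). Moving points along them to a fixed
height kills `∇r` and preserves inner products of horizontal vectors
(`IsHeight.inner_mfderiv_transport`). With `F = {r = 0}`, the map sending `x` to its transport to
height zero together with `r x` is the required isometry, and `dr² + g'` has the Ricci tensor of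
`g'` in horizontal directions.

Two technical points shape the argument. Charts take values in a half-space, so the inverse function
theorem (`exists_halfSpace_localDiffeo`) and smooth dependence for differential equations
(`exists_smooth_flow`) are needed up to the boundary. Tensors are given by components in charts, and
the identities are computed at the centre of a chart normal to first order. Only the invariance of
`|∇w|²` and of the vanishing of the Hessian is used to pass to other charts. -/

theorem ContDiffOn.of_leftInverse {E F : Type*} [NormedAddCommGroup E] [NormedSpace ℝ E]
    [CompleteSpace E] [NormedAddCommGroup F] [NormedSpace ℝ F] {f : E → F} {g : F → E}
    {S : Set E} {T : Set F} (hf : ContDiffOn ℝ ∞ f S) (hS : UniqueDiffOn ℝ S)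
    (hT : UniqueDiffOn ℝ T) (hg : ContinuousOn g T) (hgS : MapsTo g T S)
    (hfg : ∀ y ∈ T, f (g y) = y) (hinv : ∀ x ∈ S, (fderivWithin ℝ f S x).IsInvertible) :
    ContDiffOn ℝ ∞ g T := by
  -- No openness of `S` or `T` is needed: continuity of `g` is assumed, so its derivative within `T`
  -- is forced to be the inverse of that of `f`. The sets in view are pieces of half-spaces and
  -- slabs over a closed time interval.
  have hd : ∀ y ∈ T, HasFDerivWithinAt g (fderivWithin ℝ f S (g y)).inverse T y := by
    intro y hy
    obtain ⟨A, hA⟩ := hinv (g y) (hgS hy)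
    have h1 : HasFDerivWithinAt f (A : E →L[ℝ] F) S (g y) := by
      rw [hA]; exact (hf.differentiableOn (by simp) _ (hgS hy)).hasFDerivWithinAt
    rw [← hA, ContinuousLinearMap.inverse_equiv]
    refine h1.of_local_left_inverse ?_ hy ?_
    · exact tendsto_nhdsWithin_iff.2 ⟨hg y hy, by filter_upwards [self_mem_nhdsWithin] using hgS⟩
    · filter_upwards [self_mem_nhdsWithin] using hfg
  rw [contDiffOn_infty]
  intro k
  -- Bootstrapping: the derivative of `g` is composed of operator inversion, the derivative of `f`,
  -- and `g` itself. It is therefore as smooth as `g`, and each pass gains one order.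
  induction k with
  | zero => simpa using hg
  | succ k ih =>
    push_cast
    rw [contDiffOn_succ_iff_hasFDerivWithinAt_of_uniqueDiffOn hT]
    refine ⟨by simp, _, ?_, hd⟩
    have h2 : ContDiffOn ℝ k (fderivWithin ℝ f S) S :=
      (hf.fderivWithin hS (m := k) (by exact_mod_cast le_top))
    intro y hy
    exact ((hinv (g y) (hgS hy)).contDiffAt_map_inverse (n := k)).comp_contDiffWithinAt y
      ((h2.comp ih hgS) y hy)

/-! ## The half-space -/

section HalfSpace

variable {n : ℕ} [NeZero n]

theorem mem_range_halfSpace {y : EuclideanSpace ℝ (Fin n)} : y ∈ range (𝓡∂ n) ↔ 0 ≤ y 0 := by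
  rw [range_modelWithCornersEuclideanHalfSpace]; rfl

theorem halfSpace_symm_of_mem {y : EuclideanSpace ℝ (Fin n)} (hy : 0 ≤ y 0) :
    ((𝓡∂ n).symm y).1 = y :=
  (𝓡∂ n).right_inv (mem_range_halfSpace.2 hy)

theorem halfSpace_symm_coord_zero (y : EuclideanSpace ℝ (Fin n)) :
    ((𝓡∂ n).symm y).1 0 = max (y 0) 0 := by
  simp [modelWithCornersEuclideanHalfSpace]

theorem halfSpace_symm_coord_ne (y : EuclideanSpace ℝ (Fin n)) {i : Fin n} (hi : i ≠ 0) :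
    ((𝓡∂ n).symm y).1 i = y i := by
  simp [modelWithCornersEuclideanHalfSpace, hi]

/-- Only the first coordinate is clipped, and clipping does not increase distances. Extending a map
across the boundary along this retraction thus costs nothing in Lipschitz estimates. -/
theorem norm_halfSpace_symm_sub_le (x y : EuclideanSpace ℝ (Fin n)) :
    ‖((𝓡∂ n).symm x).1 - ((𝓡∂ n).symm y).1‖ ≤ ‖x - y‖ := by
  rw [EuclideanSpace.norm_eq, EuclideanSpace.norm_eq]
  apply Real.sqrt_le_sqrt
  apply Finset.sum_le_sum
  intro i _
  rw [Real.norm_eq_abs, Real.norm_eq_abs]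
  apply pow_le_pow_left₀ (abs_nonneg _)
  by_cases hi : i = 0
  · subst hi
    simp only [PiLp.sub_apply, halfSpace_symm_coord_zero]
    exact abs_max_sub_max_le_abs _ _ _
  · simp only [PiLp.sub_apply, halfSpace_symm_coord_ne _ hi]; rfl

theorem isOpen_coord_zero_pos : IsOpen {y : EuclideanSpace ℝ (Fin n) | 0 < y 0} :=
  isOpen_lt continuous_const (by fun_prop)

theorem convex_range_halfSpace : Convex ℝ (range (𝓡∂ n)) := by
  rw [range_modelWithCornersEuclideanHalfSpace]
  exact EuclideanHalfSpace.convex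

/-- Extension of `f` from the half-space by its linear part `A` in the normal direction. -/
noncomputable def halfSpaceExtension (f : EuclideanSpace ℝ (Fin n) → EuclideanSpace ℝ (Fin n))
    (A : EuclideanSpace ℝ (Fin n) →L[ℝ] EuclideanSpace ℝ (Fin n)) (x : EuclideanSpace ℝ (Fin n)) :
    EuclideanSpace ℝ (Fin n) :=
  f ((𝓡∂ n).symm x).1 + A (x - ((𝓡∂ n).symm x).1)

theorem halfSpaceExtension_of_mem {f : EuclideanSpace ℝ (Fin n) → EuclideanSpace ℝ (Fin n)}
    {A : EuclideanSpace ℝ (Fin n) →L[ℝ] EuclideanSpace ℝ (Fin n)} {x : EuclideanSpace ℝ (Fin n)}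
    (hx : 0 ≤ x 0) : halfSpaceExtension f A x = f x := by
  simp [halfSpaceExtension, halfSpace_symm_of_mem hx]

theorem sub_halfSpace_symm {x : EuclideanSpace ℝ (Fin n)} (hx : x 0 ≤ 0) :
    x - ((𝓡∂ n).symm x).1 = x 0 • EuclideanSpace.single 0 1 := by
  ext i
  by_cases hi : i = 0
  · subst hi
    simp [halfSpace_symm_coord_zero, hx]
  · simp [halfSpace_symm_coord_ne x hi, hi]

/-- At a boundary point, the normal derivative of the normal component of a diffeomorphism of the
half-space is positive. -/
theorem normal_deriv_pos {f : EuclideanSpace ℝ (Fin n) → EuclideanSpace ℝ (Fin n)}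
    {A : EuclideanSpace ℝ (Fin n) ≃L[ℝ] EuclideanSpace ℝ (Fin n)}
    {U : Set (EuclideanSpace ℝ (Fin n))} {y₀ : EuclideanSpace ℝ (Fin n)} (hU : U ∈ 𝓝 y₀)
    (hA : HasFDerivWithinAt f (A : EuclideanSpace ℝ (Fin n) →L[ℝ] EuclideanSpace ℝ (Fin n))
      (range (𝓡∂ n)) y₀)
    (hmaps : MapsTo f (range (𝓡∂ n) ∩ U) (range (𝓡∂ n)))
    (hbd : ∀ y ∈ U, y 0 = 0 → f y 0 = 0) (h0 : y₀ 0 = 0) :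
    0 < A (EuclideanSpace.single 0 1) 0 := by
  have hA0 : HasFDerivWithinAt (fun y => f y 0)
      ((EuclideanSpace.proj 0 : EuclideanSpace ℝ (Fin n) →L[ℝ] ℝ).comp
        (A : EuclideanSpace ℝ (Fin n) →L[ℝ] EuclideanSpace ℝ (Fin n))) (range (𝓡∂ n)) y₀ :=
    (EuclideanSpace.proj (𝕜 := ℝ) (0 : Fin n)).hasFDerivAt.comp_hasFDerivWithinAt y₀ hA
  -- A ray pointing into the half-space is mapped into the half-space, so the one-sided derivative
  -- of the normal component is nonnegative. A tangential ray stays in the boundary, where the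
  -- normal component vanishes identically.
  have key : ∀ v : EuclideanSpace ℝ (Fin n), 0 ≤ v 0 → 0 ≤ A v 0 ∧ (v 0 = 0 → A v 0 = 0) := by
    intro v hv
    have hline : HasDerivWithinAt (fun t : ℝ => y₀ + t • v) v (Ici 0) 0 := by
      simpa using (((hasDerivAt_id (0 : ℝ)).smul_const v).const_add y₀).hasDerivWithinAt
    have hmapsl : MapsTo (fun t : ℝ => y₀ + t • v) (Ici 0) (range (𝓡∂ n)) := by
      intro t ht
      rw [mem_range_halfSpace]
      simp only [PiLp.add_apply, PiLp.smul_apply, h0, smul_eq_mul, zero_add]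
      exact mul_nonneg ht hv
    have hc : HasDerivWithinAt (fun t : ℝ => f (y₀ + t • v) 0) (A v 0) (Ici 0) 0 := by
      have := HasFDerivWithinAt.comp_hasDerivWithinAt_of_eq (0 : ℝ) hA0 hline hmapsl (by simp)
      exact this
    have hev : ∀ᶠ t : ℝ in 𝓝[Ici 0] 0, y₀ + t • v ∈ U := by
      have : Filter.Tendsto (fun t : ℝ => y₀ + t • v) (𝓝[Ici 0] 0) (𝓝 y₀) := by
        simpa using hline.continuousWithinAt.tendsto
      exact this hU
    have hz : f y₀ 0 = 0 := hbd y₀ (mem_of_mem_nhds hU) h0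
    constructor
    · have hc' := hc.mono Ioi_subset_Ici_self
      rw [hasDerivWithinAt_iff_tendsto_slope' (by simp)] at hc'
      refine ge_of_tendsto hc' ?_
      filter_upwards [nhdsWithin_mono _ Ioi_subset_Ici_self hev, self_mem_nhdsWithin] with t ht ht0
      have h1 := mem_range_halfSpace.1 (hmaps ⟨hmapsl (mem_Ici.2 (le_of_lt ht0)), ht⟩)
      rw [slope_def_field]
      simp only [zero_smul, add_zero, hz, sub_zero]
      exact div_nonneg h1 (le_of_lt ht0)
    · intro hv0
      have hconst : HasDerivWithinAt (fun t : ℝ => f (y₀ + t • v) 0) 0 (Ici 0) 0 := by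
        refine (hasDerivWithinAt_const (0 : ℝ) (Ici (0 : ℝ)) (0 : ℝ)).congr_of_eventuallyEq ?_
          (by simpa using hz)
        filter_upwards [hev] with t ht
        exact hbd _ ht (by simp [h0, hv0])
      exact (uniqueDiffOn_Ici (0 : ℝ) 0 self_mem_Ici).eq_deriv _ hc hconst
  have hsingle := key (EuclideanSpace.single 0 1) (by simp)
  -- If the normal derivative were zero, the normal component of `A` would vanish on all vectors,
  -- and `A` would not be surjective.
  refine lt_of_le_of_ne hsingle.1 fun h => ?_
  have hall : ∀ v, A v 0 = 0 := by
    intro v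
    have hdec : v = v 0 • EuclideanSpace.single 0 1 + (v - v 0 • EuclideanSpace.single 0 1) := by
      abel
    rw [hdec, map_add, map_smul, PiLp.add_apply, PiLp.smul_apply, ← h,
      (key (v - v 0 • EuclideanSpace.single 0 1) (by simp)).2 (by simp)]
    simp
  have := hall (A.symm (EuclideanSpace.single 0 1))
  simp at this

/-- The inverse function theorem on the half-space. -/
theorem exists_halfSpace_localDiffeo
    {f : EuclideanSpace ℝ (Fin n) → EuclideanSpace ℝ (Fin n)}
    {U : Set (EuclideanSpace ℝ (Fin n))} (hU : IsOpen U) {p₀ : EuclideanHalfSpace n}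
    (hp₀ : p₀.1 ∈ U) (hf : ContDiffOn ℝ ∞ f (range (𝓡∂ n) ∩ U))
    (hmaps : MapsTo f (range (𝓡∂ n) ∩ U) (range (𝓡∂ n)))
    (hbd : ∀ y ∈ U, y 0 = 0 → f y 0 = 0)
    (hinv : (fderivWithin ℝ f (range (𝓡∂ n)) p₀.1).IsInvertible) :
    ∃ h ∈ contDiffGroupoid ∞ (𝓡∂ n), p₀ ∈ h.source ∧ (∀ p ∈ h.source, p.1 ∈ U) ∧
      ∀ p ∈ h.source, (h p).1 = f p.1 := by
  set I := 𝓡∂ n with hI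
  set y₀ := p₀.1 with hy₀
  have hy₀r : y₀ ∈ range I := ⟨p₀, rfl⟩
  obtain ⟨A, hA⟩ := hinv
  set S := range I ∩ U with hS
  have hSu : UniqueDiffOn ℝ S := I.uniqueDiffOn.inter hU
  have hfd : ∀ y ∈ S, fderivWithin ℝ f S y = fderivWithin ℝ f (range I) y := fun y hy =>
    fderivWithin_inter (hU.mem_nhds hy.2)
  have hcont : ContinuousOn (fderivWithin ℝ f S) S := hf.continuousOn_fderivWithin hSu (by simp)
  have hAS : fderivWithin ℝ f S y₀ = A := by rw [hfd y₀ ⟨hy₀r, hp₀⟩, hA]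
  have hHA : HasFDerivWithinAt f (A : EuclideanSpace ℝ (Fin n) →L[ℝ] EuclideanSpace ℝ (Fin n))
      (range I) y₀ := by
    rw [← hasFDerivWithinAt_inter (hU.mem_nhds hp₀), ← hAS]
    exact (hf.differentiableOn (by simp) y₀ ⟨hy₀r, hp₀⟩).hasFDerivWithinAt
  have : Nontrivial (EuclideanSpace ℝ (Fin n)) :=
    ⟨⟨EuclideanSpace.single 0 1, 0, by simp⟩⟩
  -- Half of the threshold below which a Lipschitz perturbation of `A` is still a homeomorphism onto
  -- an open set.
  set c : NNReal := ‖(A.symm : EuclideanSpace ℝ (Fin n) →L[ℝ] EuclideanSpace ℝ (Fin n))‖₊⁻¹ / 2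
    with hc
  have hN : 0 < ‖(A.symm : EuclideanSpace ℝ (Fin n) →L[ℝ] EuclideanSpace ℝ (Fin n))‖₊⁻¹ :=
    inv_pos.2 A.nnnorm_symm_pos
  have hcpos : 0 < c := half_pos hN
  have hclt : c < ‖(A.symm : EuclideanSpace ℝ (Fin n) →L[ℝ] EuclideanSpace ℝ (Fin n))‖₊⁻¹ :=
    half_lt_self hN
  -- The second clause keeps the ball off the boundary when `y₀` is interior. A ball point with
  -- negative first coordinate can then occur only if `y₀` is a boundary point.
  obtain ⟨δ, hδ, hball⟩ : ∃ δ > 0, ∀ x ∈ Metric.ball y₀ δ, x ∈ U ∧ (0 < y₀ 0 → 0 < x 0) ∧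
      (x ∈ range I → ‖fderivWithin ℝ f S x - A‖ ≤ c ∧ (fderivWithin ℝ f S x).IsInvertible) := by
    have e1 : ∀ᶠ x in 𝓝 y₀, x ∈ U := hU.mem_nhds hp₀
    have e2 : ∀ᶠ x in 𝓝 y₀, (0 < y₀ 0 → 0 < x 0) := by
      by_cases h : 0 < y₀ 0
      · filter_upwards [isOpen_coord_zero_pos.mem_nhds h] with x hx _ using hx
      · exact Filter.Eventually.of_forall fun x hx => absurd hx h
    have hcw := hcont y₀ ⟨hy₀r, hp₀⟩
    have e3 : ∀ᶠ x in 𝓝[S] y₀,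
        ‖fderivWithin ℝ f S x - A‖ ≤ c ∧ (fderivWithin ℝ f S x).IsInvertible := by
      unfold ContinuousWithinAt at hcw
      rw [hAS] at hcw
      refine Filter.Eventually.and ?_ ?_
      · filter_upwards [hcw (Metric.closedBall_mem_nhds _ (NNReal.coe_pos.2 hcpos))] with x hx
        simpa [dist_eq_norm] using hx
      · exact hcw (A.nhds)
    rw [show 𝓝[S] y₀ = 𝓝[range I] y₀ from nhdsWithin_inter_of_mem' (nhdsWithin_le_nhds e1)] at e3
    rw [Metric.eventually_nhds_iff_ball.symm]
    exact e1.and (e2.and (eventually_nhdsWithin_iff.1 e3))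
  set B := Metric.ball y₀ δ with hB
  set ρ : EuclideanSpace ℝ (Fin n) → EuclideanSpace ℝ (Fin n) := fun x => (I.symm x).1 with hρ
  have hρr : ∀ x, ρ x ∈ range I := fun x => ⟨I.symm x, rfl⟩
  have hρB : ∀ x ∈ B, ρ x ∈ B := by
    intro x hx
    have h1 := norm_halfSpace_symm_sub_le x y₀
    rw [halfSpace_symm_of_mem (mem_range_halfSpace.1 hy₀r)] at h1
    rw [hB, mem_ball_iff_norm] at hx ⊢
    exact lt_of_le_of_lt h1 hx
  set F := halfSpaceExtension f
    (A : EuclideanSpace ℝ (Fin n) →L[ℝ] EuclideanSpace ℝ (Fin n)) with hF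
  -- The extension need not be differentiable across the boundary, so it is compared with `A`
  -- directly. Its deviation from `A` between two points equals that of `f` between the retracted
  -- points, which the mean value inequality on the convex half-ball controls.
  have happ : ApproximatesLinearOn F
      (A : EuclideanSpace ℝ (Fin n) →L[ℝ] EuclideanSpace ℝ (Fin n)) B c := by
    intro x hx y hy
    have hconv : Convex ℝ (range I ∩ B) := convex_range_halfSpace.inter (convex_ball _ _)
    have hsub : range I ∩ B ⊆ S := fun z hz => ⟨hz.1, (hball z hz.2).1⟩
    have := hconv.norm_image_sub_le_of_norm_hasFDerivWithin_le' (f := f)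
      (f' := fderivWithin ℝ f S)
      (φ := (A : EuclideanSpace ℝ (Fin n) →L[ℝ] EuclideanSpace ℝ (Fin n))) (C := c)
      (fun z hz => (hf.differentiableOn (by simp) z (hsub hz)).hasFDerivWithinAt.mono hsub)
      (fun z hz => ((hball z hz.2).2.2 hz.1).1)
      (⟨hρr y, hρB y hy⟩ : ρ y ∈ range I ∩ B) (⟨hρr x, hρB x hx⟩ : ρ x ∈ range I ∩ B)
    have h2 : F x - F y - A (x - y) = f (ρ x) - f (ρ y) - A (ρ x - ρ y) := by
      simp only [hF, halfSpaceExtension, hρ, map_sub, ContinuousLinearEquiv.coe_coe]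
      abel
    rw [ContinuousLinearEquiv.coe_coe, h2]
    refine this.trans ?_
    exact mul_le_mul_of_nonneg_left (norm_halfSpace_symm_sub_le x y) c.2
  set Φ := happ.toOpenPartialHomeomorph F B (Or.inr hclt) Metric.isOpen_ball with hΦ
  have hΦF : ∀ x, Φ x = F x := fun x => rfl
  -- The extension respects the two sides of the boundary: at a point with negative first
  -- coordinate, the new first coordinate is the old one times the positive normal derivative. Hence
  -- the homeomorphism restricts to one between open subsets of the half-space.
  have hFmem : ∀ x ∈ B, (0 ≤ F x 0 ↔ 0 ≤ x 0) := by
    intro x hx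
    constructor
    · intro h
      by_contra hneg
      push Not at hneg
      have hy00 : y₀ 0 = 0 := by
        have h1 := mem_range_halfSpace.1 hy₀r
        by_contra hne
        exact absurd ((hball x hx).2.1 (lt_of_le_of_ne h1 (Ne.symm hne))) (not_lt.2 hneg.le)
      have hpos := normal_deriv_pos (hU.mem_nhds hp₀) hHA hmaps hbd hy00
      have h3 : F x 0 = x 0 * A (EuclideanSpace.single 0 1) 0 := by
        simp only [hF, halfSpaceExtension, PiLp.add_apply, sub_halfSpace_symm hneg.le, map_smul,
          PiLp.smul_apply, smul_eq_mul, ContinuousLinearEquiv.coe_coe]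
        rw [hbd _ (hball _ (hρB x hx)).1 ((halfSpace_symm_coord_zero x).trans (max_eq_right hneg.le)), zero_add]
      rw [h3] at h
      exact absurd (mul_neg_of_neg_of_pos hneg hpos) (not_lt.2 h)
    · intro h
      rw [hF, halfSpaceExtension_of_mem h]
      exact mem_range_halfSpace.1 (hmaps ⟨mem_range_halfSpace.2 h, (hball x hx).1⟩)
  have hFf : ∀ p : EuclideanHalfSpace n, F p.1 = f p.1 := fun p => halfSpaceExtension_of_mem p.2
  have hcF : ContinuousOn F B := Φ.continuousOn
  let h : OpenPartialHomeomorph (EuclideanHalfSpace n) (EuclideanHalfSpace n) :=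
    { toFun := fun p => I.symm (F p.1)
      invFun := fun p => I.symm (Φ.symm p.1)
      source := I ⁻¹' B
      target := I ⁻¹' Φ.target
      map_source' := by
        intro p hp
        change (I.symm (F p.1)).1 ∈ Φ.target
        rw [halfSpace_symm_of_mem ((hFmem p.1 hp).2 p.2)]
        exact Φ.map_source hp
      map_target' := by
        intro p hp
        change (I.symm (Φ.symm p.1)).1 ∈ B
        have h1 : Φ.symm p.1 ∈ B := Φ.map_target hp
        have h2 : F (Φ.symm p.1) = p.1 := Φ.right_inv hp
        rw [halfSpace_symm_of_mem ((hFmem _ h1).1 (by rw [h2]; exact p.2))]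
        exact h1
      left_inv' := by
        intro p hp
        rw [halfSpace_symm_of_mem ((hFmem p.1 hp).2 p.2), ← hΦF, show Φ.symm (Φ p.1) = p.1 from Φ.left_inv hp]
        exact I.left_inv p
      right_inv' := by
        intro p hp
        have h1 : Φ.symm p.1 ∈ B := Φ.map_target hp
        have h2 : F (Φ.symm p.1) = p.1 := Φ.right_inv hp
        rw [halfSpace_symm_of_mem ((hFmem _ h1).1 (by rw [h2]; exact p.2)), h2]
        exact I.left_inv p
      open_source := Metric.isOpen_ball.preimage I.continuous
      open_target := Φ.open_target.preimage I.continuous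
      continuousOn_toFun := I.continuous_symm.comp_continuousOn
        (hcF.comp I.continuous.continuousOn fun p hp => hp)
      continuousOn_invFun := I.continuous_symm.comp_continuousOn
        (Φ.symm.continuousOn.comp I.continuous.continuousOn fun p hp => hp) }
  have hhf : ∀ p ∈ h.source, (h p).1 = f p.1 := by
    intro p hp
    change (I.symm (F p.1)).1 = _
    rw [halfSpace_symm_of_mem ((hFmem p.1 hp).2 p.2), hFf]
  have hsubS : I.symm ⁻¹' h.source ∩ range I ⊆ S := by
    rintro y ⟨hy1, p, rfl⟩
    have : p ∈ h.source := by simpa using hy1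
    exact ⟨⟨p, rfl⟩, (hball _ this).1⟩
  refine ⟨h, ?_, Metric.mem_ball_self hδ, fun p hp => (hball _ hp).1, hhf⟩
  have hsu : UniqueDiffOn ℝ (I.symm ⁻¹' h.source ∩ range I) := by
    rw [inter_comm]; exact I.uniqueDiffOn.inter (h.open_source.preimage I.continuous_symm)
  have htu : UniqueDiffOn ℝ (I.symm ⁻¹' h.target ∩ range I) := by
    rw [inter_comm]; exact I.uniqueDiffOn.inter (h.open_target.preimage I.continuous_symm)
  have hcd : ContDiffOn ℝ ∞ (I ∘ h ∘ I.symm) (I.symm ⁻¹' h.source ∩ range I) := by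
    refine (hf.mono hsubS).congr ?_
    rintro y ⟨hy1, p, rfl⟩
    have : p ∈ h.source := by simpa using hy1
    simp only [Function.comp_apply, I.left_inv]
    exact hhf p this
  rw [contDiffGroupoid, mem_groupoid_of_pregroupoid]
  refine ⟨hcd, ?_⟩
  -- The inverse of the extension is only known to be continuous; its smoothness is recovered within
  -- the half-space.
  refine hcd.of_leftInverse hsu htu ?_ ?_ ?_ ?_
  · refine I.continuous.comp_continuousOn (h.symm.continuousOn.comp
      I.continuous_symm.continuousOn fun y hy => hy.1)
  · rintro y ⟨hy1, p, rfl⟩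
    have : p ∈ h.target := by simpa using hy1
    refine ⟨?_, ⟨_, rfl⟩⟩
    simpa using h.map_target this
  · rintro y ⟨hy1, p, rfl⟩
    have : p ∈ h.target := by simpa using hy1
    simp [h.right_inv this]
  · rintro y ⟨hy1, p, rfl⟩
    have hp : p ∈ h.source := by simpa using hy1
    have hmem : I p ∈ I.symm ⁻¹' h.source ∩ range I := ⟨by simpa using hp, p, rfl⟩
    have h4 : fderivWithin ℝ (I ∘ h ∘ I.symm) (I.symm ⁻¹' h.source ∩ range I) (I p) =
        fderivWithin ℝ f S (I p) := by
      have h5 : HasFDerivWithinAt f (fderivWithin ℝ f S (I p)) S (I p) :=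
        (hf.differentiableOn (by simp) _ (hsubS hmem)).hasFDerivWithinAt
      refine HasFDerivWithinAt.fderivWithin ((h5.mono hsubS).congr ?_ ?_) (hsu _ hmem)
      · rintro z ⟨hz1, q, rfl⟩
        have : q ∈ h.source := by simpa using hz1
        simp only [Function.comp_apply, I.left_inv]
        exact hhf q this
      · simp only [Function.comp_apply, I.left_inv]
        exact hhf p hp
    rw [h4]
    exact ((hball _ hp).2.2 ⟨p, rfl⟩).2

end HalfSpace

/-! ## Smoothness of composition operators -/

set_option synthInstance.maxHeartbeats 200000
set_option linter.unusedSectionVars false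

section Nemytskii

variable {K E F : Type*} [TopologicalSpace K] [CompactSpace K]
  [NormedAddCommGroup E] [NormedSpace ℝ E] [NormedAddCommGroup F] [NormedSpace ℝ F]

open Classical in
/-- The composition operator `γ ↦ V ∘ γ` on continuous maps. -/
noncomputable def nemytskii (V : E → F) (γ : C(K, E)) : C(K, F) :=
  -- The value `0` is a default; it is never reached for curves in a set on which `V` is continuous.
  if h : Continuous (V ∘ γ) then ⟨V ∘ γ, h⟩ else 0

theorem nemytskii_apply {V : E → F} {S : Set E} (hV : ContinuousOn V S) {γ : C(K, E)}
    (hγ : ∀ t, γ t ∈ S) (t : K) : nemytskii V γ t = V (γ t) := by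
  have h : Continuous (V ∘ γ) := hV.comp_continuous γ.continuous hγ
  simp [nemytskii, h]

noncomputable instance : NormedAddCommGroup C(K, E →L[ℝ] F) :=
  ContinuousMap.instNormedAddCommGroup

noncomputable instance : NormedSpace ℝ C(K, E →L[ℝ] F) := ContinuousMap.normedSpace

variable (K E F) in
/-- Pointwise evaluation `(A, η) ↦ (t ↦ A t (η t))` as a continuous bilinear map. -/
noncomputable def pointwiseApply : C(K, E →L[ℝ] F) →L[ℝ] C(K, E) →L[ℝ] C(K, F) :=
  LinearMap.mkContinuous₂
    (LinearMap.mk₂ ℝ (fun (A : C(K, E →L[ℝ] F)) (η : C(K, E)) =>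
      (⟨fun t => A t (η t), by fun_prop⟩ : C(K, F)))
      (by intros; ext; simp) (by intros; ext; simp) (by intros; ext; simp) (by intros; ext; simp))
    1 (by
      intro A η
      rw [one_mul, ContinuousMap.norm_le _ (by positivity)]
      intro t
      exact ((A t).le_opNorm _).trans (mul_le_mul (A.norm_coe_le_norm t) (η.norm_coe_le_norm t)
        (norm_nonneg (η t)) (norm_nonneg A)))

@[simp]
theorem pointwiseApply_apply (A : C(K, E →L[ℝ] F)) (η : C(K, E)) (t : K) :
    pointwiseApply K E F A η t = A t (η t) := rfl

/-- The image of `γ` is compact, so continuity at its points is uniform, even against neighbouring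
points of `S` off the curve. -/
theorem exists_uniform_of_continuousOn {V : E → F} {S : Set E} (hV : ContinuousOn V S)
    {γ : C(K, E)} (hγ : ∀ t, γ t ∈ S) {ε : ℝ} (hε : 0 < ε) :
    ∃ δ > 0, ∀ t, ∀ z ∈ S, dist z (γ t) < δ → ‖V z - V (γ t)‖ ≤ ε := by
  have hcomp : IsCompact (range fun t => (⟨γ t, hγ t⟩ : S)) :=
    isCompact_range (γ.continuous.subtype_mk _)
  have := hcomp.uniformContinuousAt_of_continuousAt (S.domRestrict V)
    (fun a _ => (continuousOn_iff_continuous_domRestrict.1 hV).continuousAt)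
    (Metric.dist_mem_uniformity hε)
  obtain ⟨δ, hδ, h⟩ := Metric.mem_uniformity_dist.1 this
  refine ⟨δ, hδ, fun t z hz hd => ?_⟩
  have h1 := @h ⟨γ t, hγ t⟩ ⟨z, hz⟩ (by rw [dist_comm]; exact hd) ⟨t, rfl⟩
  have h2 : dist (V (γ t)) (V z) < ε := h1
  rw [dist_comm, dist_eq_norm] at h2
  exact h2.le

/-- For each `t` the mean value inequality on `S ∩ ball (γ t) δ` bounds the linearisation error. The
radius `δ` does not depend on `t`, so the bound holds in the supremum norm. -/
theorem hasFDerivWithinAt_nemytskii {V : E → F} {S : Set E} (hS : Convex ℝ S)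
    {V' : E → E →L[ℝ] F} (hV : ∀ x ∈ S, HasFDerivWithinAt V (V' x) S x) (hV' : ContinuousOn V' S)
    {γ : C(K, E)} (hγ : ∀ t, γ t ∈ S) :
    HasFDerivWithinAt (nemytskii V) (pointwiseApply K E F (nemytskii V' γ))
      {γ : C(K, E) | ∀ t, γ t ∈ S} γ := by
  have hVc : ContinuousOn V S := fun x hx => (hV x hx).continuousWithinAt
  rw [hasFDerivWithinAt_iff_isLittleO, Asymptotics.isLittleO_iff]
  intro ε hε
  obtain ⟨δ, hδ, hd⟩ := exists_uniform_of_continuousOn hV' hγ hε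
  filter_upwards [self_mem_nhdsWithin, nhdsWithin_le_nhds (Metric.ball_mem_nhds γ hδ)] with η hη hηδ
  rw [ContinuousMap.norm_le _ (by positivity)]
  intro t
  simp only [ContinuousMap.sub_apply, pointwiseApply_apply, nemytskii_apply hVc hη,
    nemytskii_apply hVc hγ, nemytskii_apply hV' hγ]
  have hconv : Convex ℝ (S ∩ Metric.ball (γ t) δ) := hS.inter (convex_ball _ _)
  have hηt : dist (η t) (γ t) < δ := lt_of_le_of_lt (ContinuousMap.dist_apply_le_dist t) hηδ
  have h := hconv.norm_image_sub_le_of_norm_hasFDerivWithin_le' (f := V) (f' := V')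
    (φ := V' (γ t)) (C := ε) (fun z hz => (hV z hz.1).mono inter_subset_left)
    (fun z hz => hd t z hz.1 hz.2)
    (⟨hγ t, Metric.mem_ball_self hδ⟩ : γ t ∈ S ∩ Metric.ball (γ t) δ)
    (⟨hη t, hηt⟩ : η t ∈ S ∩ Metric.ball (γ t) δ)
  refine h.trans (mul_le_mul_of_nonneg_left ?_ hε.le)
  exact (η - γ).norm_coe_le_norm t

end Nemytskii

universe v in
-- The derivative is the composition operator of the derivative of `V`, followed by a continuous
-- bilinear pairing, so induction on the order applies. The target changes from `F` to `E →L[ℝ] F`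
-- in the induction; hence `F` is quantified after `k` and shares a universe with `E`.
theorem contDiffOn_nemytskii {K : Type*} [TopologicalSpace K] [CompactSpace K] {E : Type v}
    [NormedAddCommGroup E] [NormedSpace ℝ E] {S : Set E} (hS : Convex ℝ S)
    (hSu : UniqueDiffOn ℝ S) (k : ℕ) :
    ∀ {F : Type v} [NormedAddCommGroup F] [NormedSpace ℝ F] {V : E → F}, ContDiffOn ℝ ∞ V S →
      ContDiffOn ℝ k (nemytskii V : C(K, E) → C(K, F)) {γ : C(K, E) | ∀ t, γ t ∈ S} := by
  induction k with
  | zero =>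
    intro F _ _ V hV
    rw [Nat.cast_zero, contDiffOn_zero]
    intro γ hγ
    exact (hasFDerivWithinAt_nemytskii hS
      (fun x hx => (hV.differentiableOn (by simp) x hx).hasFDerivWithinAt)
      (hV.continuousOn_fderivWithin hSu (by simp)) hγ).continuousWithinAt
  | succ k ih =>
    intro F _ _ V hV
    push_cast
    rw [contDiffOn_succ_iff_hasFDerivWithinAt (by simp)]
    intro γ hγ
    refine ⟨_, by rw [insert_eq_of_mem hγ]; exact self_mem_nhdsWithin, by simp, _,
      fun η hη => hasFDerivWithinAt_nemytskii hS
        (fun x hx => (hV.differentiableOn (by simp) x hx).hasFDerivWithinAt)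
        (hV.continuousOn_fderivWithin hSu (by simp)) hη, ?_⟩
    exact (pointwiseApply K E F).contDiff.comp_contDiffOn
      (ih (hV.fderivWithin hSu (m := ∞) (by simp)))

/-! ## The primitive of a continuous map on the unit interval -/

section Primitive

variable {E : Type*} [NormedAddCommGroup E] [NormedSpace ℝ E]

variable (E) in
/-- The primitive vanishing at `0`, as a continuous linear operator. -/
noncomputable def primitiveCLM : C(unitInterval, E) →L[ℝ] C(unitInterval, E) :=
  LinearMap.mkContinuous
    { toFun := fun η => ⟨fun s => ∫ σ in (0 : ℝ)..s, IccExtend zero_le_one η σ, by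
        have : Continuous fun s : ℝ => ∫ σ in (0 : ℝ)..s, IccExtend zero_le_one η σ :=
          intervalIntegral.continuous_primitive
            (fun a b => (η.continuous.Icc_extend' (h := zero_le_one)).intervalIntegrable a b) 0
        exact this.comp continuous_subtype_val⟩
      map_add' := by
        intro η ζ
        ext s
        simp only [ContinuousMap.coe_mk, ContinuousMap.add_apply]
        rw [← intervalIntegral.integral_add
          ((η.continuous.Icc_extend' (h := zero_le_one)).intervalIntegrable _ _)
          ((ζ.continuous.Icc_extend' (h := zero_le_one)).intervalIntegrable _ _)]
        rfl
      map_smul' := by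
        intro c η
        ext s
        simp only [ContinuousMap.coe_mk, ContinuousMap.smul_apply, RingHom.id_apply]
        rw [← intervalIntegral.integral_smul]
        rfl }
    1 (by
      intro η
      rw [one_mul, ContinuousMap.norm_le _ (norm_nonneg _)]
      intro s
      have := intervalIntegral.norm_integral_le_of_norm_le_const (a := (0 : ℝ)) (b := s)
        (f := IccExtend zero_le_one η) (C := ‖η‖) (fun x _ => η.norm_coe_le_norm _)
      refine this.trans ?_
      rw [sub_zero, abs_of_nonneg s.2.1]
      exact mul_le_of_le_one_right (norm_nonneg _) s.2.2)

theorem primitiveCLM_apply (η : C(unitInterval, E)) (s : unitInterval) :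
    primitiveCLM E η s = ∫ σ in (0 : ℝ)..s, IccExtend zero_le_one η σ := rfl

theorem norm_primitiveCLM_le (η : C(unitInterval, E)) : ‖primitiveCLM E η‖ ≤ ‖η‖ := by
  have := (primitiveCLM E).le_of_opNorm_le (LinearMap.mkContinuous_norm_le _ zero_le_one _) η
  simpa using this

end Primitive

set_option synthInstance.maxHeartbeats 200000
set_option linter.unusedSectionVars false

/-! ## Smooth dependence of solutions of differential equations on initial values -/

section Flow

variable {E : Type*} [NormedAddCommGroup E] [NormedSpace ℝ E]

/-- The curve `σ ↦ (t₀ + σ (t - t₀), γ σ)`. -/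
noncomputable def rescaledGraph (t₀ : ℝ) (p : ℝ × C(unitInterval, E)) : C(unitInterval, ℝ × E) :=
  ContinuousMap.const _ (t₀, 0)
    + (p.1 - t₀) • (⟨fun σ => ((σ : ℝ), (0 : E)), by fun_prop⟩ : C(unitInterval, ℝ × E))
    + (ContinuousLinearMap.inr ℝ ℝ E).compLeftContinuous ℝ unitInterval p.2

theorem rescaledGraph_apply (t₀ : ℝ) (p : ℝ × C(unitInterval, E)) (σ : unitInterval) :
    rescaledGraph t₀ p σ = (t₀ + σ * (p.1 - t₀), p.2 σ) := by
  simp [rescaledGraph, mul_comm]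

theorem contDiff_rescaledGraph (t₀ : ℝ) : ContDiff ℝ ∞ (rescaledGraph (E := E) t₀) := by
  unfold rescaledGraph
  refine ContDiff.add (ContDiff.add contDiff_const ?_) ?_
  · exact (contDiff_fst.sub contDiff_const).smul contDiff_const
  · exact (ContinuousLinearMap.contDiff _).comp contDiff_snd

theorem rescaledTime_mem {a b t₀ t s : ℝ} (ht₀ : t₀ ∈ Icc a b) (ht : t ∈ Icc a b)
    (hs : s ∈ Icc (0 : ℝ) 1) : t₀ + s * (t - t₀) ∈ Icc a b := by
  have := (convex_Icc a b).add_smul_sub_mem ht₀ ht hs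
  simpa using this

/-- The zeros of `γ ↦ flowOperator U t₀ (t, γ) - z` are the solutions of `γ' = U(·, γ)`, with
`γ(t₀) = z`, parametrized by `[0, 1]` between `t₀` and `t`. -/
noncomputable def flowOperator (U : ℝ × E → E) (t₀ : ℝ) (p : ℝ × C(unitInterval, E)) :
    C(unitInterval, E) :=
  p.2 - (p.1 - t₀) • primitiveCLM E (nemytskii U (rescaledGraph t₀ p))

variable {a b t₀ : ℝ} {U : ℝ × E → E}

theorem rescaledGraph_mem (ht₀ : t₀ ∈ Icc a b) {p : ℝ × C(unitInterval, E)}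
    (hp : p ∈ Icc a b ×ˢ (univ : Set C(unitInterval, E))) (σ : unitInterval) :
    rescaledGraph t₀ p σ ∈ Icc a b ×ˢ (univ : Set E) := by
  rw [rescaledGraph_apply]
  exact ⟨rescaledTime_mem ht₀ hp.1 σ.2, mem_univ _⟩

theorem contDiffOn_flowOperator (hab : a < b) (ht₀ : t₀ ∈ Icc a b)
    (hU : ContDiffOn ℝ ∞ U (Icc a b ×ˢ univ)) :
    ContDiffOn ℝ ∞ (flowOperator U t₀) (Icc a b ×ˢ (univ : Set C(unitInterval, E))) := by
  rw [contDiffOn_infty]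
  intro k
  have hN := contDiffOn_nemytskii (K := unitInterval) ((convex_Icc a b).prod convex_univ)
    ((uniqueDiffOn_Icc hab).prod uniqueDiffOn_univ) k hU
  have hk : ((k : ℕ) : ℕ∞ω) ≤ ∞ := by exact_mod_cast le_top
  have hc := hN.comp ((contDiff_rescaledGraph (E := E) t₀).of_le hk).contDiffOn
    (s := Icc a b ×ˢ (univ : Set C(unitInterval, E))) (fun p hp σ => rescaledGraph_mem ht₀ hp σ)
  unfold flowOperator
  refine contDiffOn_snd.sub ?_
  exact (contDiffOn_fst.sub contDiffOn_const).smul ((primitiveCLM E).contDiff.comp_contDiffOn hc)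

variable {L : NNReal}

/-- The difference `γ - flowOperator U t₀ (t, γ)` is the Picard operator, with Lipschitz constant at
most `(b - a) L`. Being a perturbation of the identity of size `1/2` yields everything about the
operator: an inverse estimate with constant `2`, surjectivity by a fixed point, and an invertible
derivative. -/
theorem flowOperator_perturbation_le (ht₀ : t₀ ∈ Icc a b)
    (hU : ContinuousOn U (Icc a b ×ˢ univ))
    (hL : ∀ t ∈ Icc a b, LipschitzWith L fun z => U (t, z)) (hsmall : (b - a) * L ≤ 1 / 2)
    {t : ℝ} (ht : t ∈ Icc a b) (γ η : C(unitInterval, E)) :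
    ‖(γ - flowOperator U t₀ (t, γ)) - (η - flowOperator U t₀ (t, η))‖ ≤ 1 / 2 * ‖γ - η‖ := by
  have h1 : (γ - flowOperator U t₀ (t, γ)) - (η - flowOperator U t₀ (t, η)) =
      (t - t₀) • primitiveCLM E (nemytskii U (rescaledGraph t₀ (t, γ)) -
        nemytskii U (rescaledGraph t₀ (t, η))) := by
    simp only [flowOperator, map_sub, smul_sub]
    abel
  have h2 : ‖nemytskii U (rescaledGraph t₀ (t, γ)) - nemytskii U (rescaledGraph t₀ (t, η))‖
      ≤ L * ‖γ - η‖ := by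
    rw [ContinuousMap.norm_le _ (by positivity)]
    intro σ
    rw [ContinuousMap.sub_apply, nemytskii_apply hU (rescaledGraph_mem ht₀ ⟨ht, mem_univ _⟩),
      nemytskii_apply hU (rescaledGraph_mem ht₀ ⟨ht, mem_univ _⟩), rescaledGraph_apply,
      rescaledGraph_apply]
    have := (hL _ (rescaledTime_mem ht₀ ht σ.2)).dist_le_mul (γ σ) (η σ)
    rw [dist_eq_norm, dist_eq_norm] at this
    exact this.trans (mul_le_mul_of_nonneg_left ((γ - η).norm_coe_le_norm σ) L.2)
  rw [h1, norm_smul]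
  have h3 : ‖t - t₀‖ ≤ b - a := by
    rw [Real.norm_eq_abs, abs_le]
    exact ⟨by linarith [ht.1, ht₀.2], by linarith [ht.2, ht₀.1]⟩
  calc _ ≤ (b - a) * (L * ‖γ - η‖) :=
        mul_le_mul h3 ((norm_primitiveCLM_le _).trans h2) (norm_nonneg _)
          ((norm_nonneg _).trans h3)
    _ = (b - a) * L * ‖γ - η‖ := by ring
    _ ≤ _ := mul_le_mul_of_nonneg_right hsmall (norm_nonneg _)

theorem norm_sub_le_flowOperator (ht₀ : t₀ ∈ Icc a b)
    (hU : ContinuousOn U (Icc a b ×ˢ univ))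
    (hL : ∀ t ∈ Icc a b, LipschitzWith L fun z => U (t, z)) (hsmall : (b - a) * L ≤ 1 / 2)
    {t : ℝ} (ht : t ∈ Icc a b) (γ η : C(unitInterval, E)) :
    ‖γ - η‖ ≤ 2 * ‖flowOperator U t₀ (t, γ) - flowOperator U t₀ (t, η)‖ := by
  have h := flowOperator_perturbation_le ht₀ hU hL hsmall ht γ η
  have h2 : γ - η = ((γ - flowOperator U t₀ (t, γ)) - (η - flowOperator U t₀ (t, η))) +
      (flowOperator U t₀ (t, γ) - flowOperator U t₀ (t, η)) := by abel
  have h3 : ‖γ - η‖ ≤ ‖(γ - flowOperator U t₀ (t, γ)) - (η - flowOperator U t₀ (t, η))‖ +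
      ‖flowOperator U t₀ (t, γ) - flowOperator U t₀ (t, η)‖ := by
    conv_lhs => rw [h2]
    exact norm_add_le _ _
  linarith

theorem flowOperator_surjective [CompleteSpace E] (ht₀ : t₀ ∈ Icc a b)
    (hU : ContinuousOn U (Icc a b ×ˢ univ))
    (hL : ∀ t ∈ Icc a b, LipschitzWith L fun z => U (t, z)) (hsmall : (b - a) * L ≤ 1 / 2)
    {t : ℝ} (ht : t ∈ Icc a b) (ζ : C(unitInterval, E)) :
    ∃ γ, flowOperator U t₀ (t, γ) = ζ := by
  have hcon : ContractingWith (1 / 2 : NNReal)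
      (fun γ : C(unitInterval, E) => ζ + (γ - flowOperator U t₀ (t, γ))) := by
    refine ⟨by norm_num, LipschitzWith.of_dist_le_mul fun γ η => ?_⟩
    rw [dist_eq_norm, dist_eq_norm, add_sub_add_left_eq_sub]
    have := flowOperator_perturbation_le ht₀ hU hL hsmall ht γ η
    simpa using this
  refine ⟨hcon.fixedPoint, ?_⟩
  have h := hcon.fixedPoint_isFixedPt
  have h' : ζ + (hcon.fixedPoint - flowOperator U t₀ (t, hcon.fixedPoint)) = hcon.fixedPoint := h
  have h3 := sub_eq_zero.2 h'
  rw [← sub_eq_zero, ← neg_eq_zero, ← h3]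
  abel

/-- The derivative is block triangular: the identity in time, and `1 - A` with `‖A‖ ≤ 1/2` in the
curve direction, invertible by a Neumann series. Carrying time along as a variable makes the inverse
jointly smooth in time and data. -/
theorem isInvertible_fderivWithin_flowOperator [CompleteSpace E] (hab : a < b)
    (ht₀ : t₀ ∈ Icc a b) (hU : ContDiffOn ℝ ∞ U (Icc a b ×ˢ univ))
    (hL : ∀ t ∈ Icc a b, LipschitzWith L fun z => U (t, z)) (hsmall : (b - a) * L ≤ 1 / 2)
    {p : ℝ × C(unitInterval, E)} (hp : p ∈ Icc a b ×ˢ (univ : Set C(unitInterval, E))) :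
    (fderivWithin ℝ (fun q : ℝ × C(unitInterval, E) => (q.1, flowOperator U t₀ q))
      (Icc a b ×ˢ (univ : Set C(unitInterval, E))) p).IsInvertible := by
  set S := Icc a b ×ˢ (univ : Set C(unitInterval, E)) with hS
  have hSu : UniqueDiffOn ℝ S := (uniqueDiffOn_Icc hab).prod uniqueDiffOn_univ
  have hd : HasFDerivWithinAt (flowOperator U t₀) (fderivWithin ℝ (flowOperator U t₀) S p) S p :=
    ((contDiffOn_flowOperator hab ht₀ hU).differentiableOn (by simp) p hp).hasFDerivWithinAt
  set P := fderivWithin ℝ (flowOperator U t₀) S p with hP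
  have hfst : HasFDerivWithinAt (fun q : ℝ × C(unitInterval, E) => q.1)
      (ContinuousLinearMap.fst ℝ ℝ C(unitInterval, E)) S p := hasFDerivWithinAt_fst
  have hD := (hfst.prodMk hd).fderivWithin (hSu p hp)
  rw [hD]
  set A : C(unitInterval, E) →L[ℝ] C(unitInterval, E) :=
    ContinuousLinearMap.id ℝ _ - P.comp (ContinuousLinearMap.inr ℝ ℝ C(unitInterval, E)) with hA
  have hpart : HasFDerivAt (fun γ => γ - flowOperator U t₀ (p.1, γ)) A p.2 := by
    refine (hasFDerivAt_id p.2).sub ?_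
    have hin : HasFDerivAt (fun γ : C(unitInterval, E) => (p.1, γ))
        (ContinuousLinearMap.inr ℝ ℝ C(unitInterval, E)) p.2 := hasFDerivAt_prodMk_right p.1 p.2
    have := HasFDerivWithinAt.comp (t := S) (s := univ) p.2 (show HasFDerivWithinAt
      (flowOperator U t₀) P S (p.1, p.2) from hd) hin.hasFDerivWithinAt
      (fun γ _ => (⟨hp.1, mem_univ _⟩ : (p.1, γ) ∈ S))
    exact hasFDerivWithinAt_univ.1 this
  have hAn : ‖A‖ ≤ 1 / 2 := by
    have hlip : LipschitzWith (1 / 2 : NNReal)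
        (fun γ : C(unitInterval, E) => γ - flowOperator U t₀ (p.1, γ)) :=
      LipschitzWith.of_dist_le_mul fun γ η => by
        rw [dist_eq_norm, dist_eq_norm]
        simpa using flowOperator_perturbation_le ht₀ hU.continuousOn hL hsmall hp.1 γ η
    simpa using hpart.le_of_lipschitz hlip
  have hA1 : ‖A‖ < 1 := lt_of_le_of_lt hAn (by norm_num)
  set u := Units.oneSub A hA1 with hu
  have huv : ∀ η, (u : C(unitInterval, E) →L[ℝ] C(unitInterval, E)) η = P (0, η) := by
    intro η
    simp [hu, hA]
  have hdec : ∀ (τ : ℝ) (η : C(unitInterval, E)), P (τ, η) = P (τ, 0) + P (0, η) := by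
    intro τ η
    rw [← map_add]; simp
  have hinvl : ∀ η, (↑u⁻¹ : C(unitInterval, E) →L[ℝ] C(unitInterval, E)) (P (0, η)) = η := by
    intro η
    rw [← huv, ← mul_apply_eq_comp, Units.inv_mul]; rfl
  have hinvr : ∀ η, P (0, (↑u⁻¹ : C(unitInterval, E) →L[ℝ] C(unitInterval, E)) η) = η := by
    intro η
    rw [← huv, ← mul_apply_eq_comp, Units.mul_inv]; rfl
  -- Solution of the triangular system: subtract the contribution of time, then invert the curve
  -- block.
  let Q : ℝ × C(unitInterval, E) →L[ℝ] ℝ × C(unitInterval, E) :=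
    (ContinuousLinearMap.fst ℝ ℝ C(unitInterval, E)).prod
      ((↑u⁻¹ : C(unitInterval, E) →L[ℝ] C(unitInterval, E)).comp
        (ContinuousLinearMap.snd ℝ ℝ C(unitInterval, E) -
          (P.comp (ContinuousLinearMap.inl ℝ ℝ C(unitInterval, E))).comp
            (ContinuousLinearMap.fst ℝ ℝ C(unitInterval, E))))
  refine ⟨ContinuousLinearEquiv.equivOfInverse
    ((ContinuousLinearMap.fst ℝ ℝ C(unitInterval, E)).prod P) Q ?_ ?_, rfl⟩
  · rintro ⟨τ, η⟩
    simp only [Q, ContinuousLinearMap.prod_apply, ContinuousLinearMap.coe_fst',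
      ContinuousLinearMap.comp_apply, _root_.sub_apply, ContinuousLinearMap.coe_snd',
      ContinuousLinearMap.inl_apply]
    rw [hdec τ η, add_sub_cancel_left, hinvl]
  · rintro ⟨τ, η⟩
    simp only [Q, ContinuousLinearMap.prod_apply, ContinuousLinearMap.coe_fst',
      ContinuousLinearMap.comp_apply, _root_.sub_apply, ContinuousLinearMap.coe_snd',
      ContinuousLinearMap.inl_apply]
    rw [hdec τ, hinvr, add_sub_cancel]

/-- Fibrewise inverses exist by the contraction principle, `norm_sub_le_flowOperator` makes them
jointly continuous, and `ContDiffOn.of_leftInverse` raises continuity to smoothness on the slab,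
including its end times. -/
theorem exists_contDiffOn_inverse_flowOperator [CompleteSpace E] (hab : a < b)
    (ht₀ : t₀ ∈ Icc a b) (hU : ContDiffOn ℝ ∞ U (Icc a b ×ˢ univ))
    (hL : ∀ t ∈ Icc a b, LipschitzWith L fun z => U (t, z)) (hsmall : (b - a) * L ≤ 1 / 2) :
    ∃ g : ℝ × C(unitInterval, E) → C(unitInterval, E),
      ContDiffOn ℝ ∞ g (Icc a b ×ˢ (univ : Set C(unitInterval, E))) ∧
      ∀ t ∈ Icc a b, ∀ ζ, flowOperator U t₀ (t, g (t, ζ)) = ζ := by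
  have hUc := hU.continuousOn
  have hex : ∀ p : ℝ × C(unitInterval, E), ∃ γ, p.1 ∈ Icc a b →
      flowOperator U t₀ (p.1, γ) = p.2 := by
    intro p
    by_cases hp : p.1 ∈ Icc a b
    · obtain ⟨γ, hγ⟩ := flowOperator_surjective ht₀ hUc hL hsmall hp p.2
      exact ⟨γ, fun _ => hγ⟩
    · exact ⟨0, fun h => absurd h hp⟩
  choose g hg using hex
  refine ⟨g, ?_, fun t ht ζ => hg (t, ζ) ht⟩
  set S := Icc a b ×ˢ (univ : Set C(unitInterval, E)) with hS
  have hSu : UniqueDiffOn ℝ S := (uniqueDiffOn_Icc hab).prod uniqueDiffOn_univ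
  have hop := contDiffOn_flowOperator hab ht₀ hU
  have hgc : ContinuousOn g S := by
    intro p hp
    have h1 : Filter.Tendsto (fun q : ℝ × C(unitInterval, E) =>
        2 * ‖q.2 - flowOperator U t₀ (q.1, g p)‖) (𝓝[S] p) (𝓝 0) := by
      have h2 : ContinuousOn (fun q : ℝ × C(unitInterval, E) =>
          2 * ‖q.2 - flowOperator U t₀ (q.1, g p)‖) S := by
        refine continuousOn_const.mul (ContinuousOn.norm (continuousOn_snd.sub ?_))
        exact hop.continuousOn.comp (continuousOn_fst.prodMk continuousOn_const)
          (fun q hq => ⟨hq.1, mem_univ _⟩)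
      have h3 := (h2 p hp).tendsto
      rwa [hg p hp.1, sub_self, norm_zero, mul_zero] at h3
    refine tendsto_iff_norm_sub_tendsto_zero.2 (squeeze_zero' (Filter.Eventually.of_forall
      fun _ => norm_nonneg _) ?_ h1)
    filter_upwards [self_mem_nhdsWithin] with q hq
    have := norm_sub_le_flowOperator ht₀ hUc hL hsmall hq.1 (g q) (g p)
    rwa [hg q hq.1] at this
  have hall : ContDiffOn ℝ ∞ (fun q : ℝ × C(unitInterval, E) => (q.1, g q)) S := by
    refine ContDiffOn.of_leftInverse (f := fun q : ℝ × C(unitInterval, E) =>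
      (q.1, flowOperator U t₀ q)) (S := S) (contDiffOn_fst.prodMk hop) hSu hSu
      (continuousOn_fst.prodMk hgc) (fun q hq => ⟨hq.1, mem_univ _⟩) ?_ ?_
    · intro q hq
      simp only [hg q hq.1]
    · intro q hq
      exact isInvertible_fderivWithin_flowOperator hab ht₀ hU hL hsmall hq
  exact contDiff_snd.comp_contDiffOn hall

end Flow

set_option synthInstance.maxHeartbeats 200000

/-! ### Smooth flows of time-dependent fields on closed time intervals. -/

section FlowExistence

variable {E : Type*} [NormedAddCommGroup E] [NormedSpace ℝ E] [CompleteSpace E]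
  {a b t₀ : ℝ} {U : ℝ × E → E} {L : NNReal}

/-- The inverse of the flow operator at a constant curve is the trajectory reparametrised by `[0,
1]`; its end point is the flow. The initial time may be an end point of `[a, b]`, as happens for
curves issuing from the boundary of a manifold. -/
theorem exists_smooth_flow_of_lipschitz (hab : a < b)
    (ht₀ : t₀ ∈ Icc a b) (hU : ContDiffOn ℝ ∞ U (Icc a b ×ˢ univ))
    (hL : ∀ t ∈ Icc a b, LipschitzWith L fun z => U (t, z)) (hsmall : (b - a) * L ≤ 1 / 2) :
    ∃ Z : ℝ × E → E, ContDiffOn ℝ ∞ Z (Icc a b ×ˢ univ) ∧ (∀ z, Z (t₀, z) = z) ∧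
      ∀ z, ∀ t ∈ Icc a b, HasDerivWithinAt (fun t => Z (t, z)) (U (t, Z (t, z))) (Icc a b) t := by
  obtain ⟨g, hgs, hg⟩ := exists_contDiffOn_inverse_flowOperator hab ht₀ hU hL hsmall
  have hUc := hU.continuousOn
  set Z : ℝ × E → E := fun p => g (p.1, ContinuousMap.const _ p.2) 1 with hZ
  have hZs : ContDiffOn ℝ ∞ Z (Icc a b ×ˢ univ) := by
    have h1 : ContDiff ℝ ∞ fun p : ℝ × E =>
        (p.1, (ContinuousMap.const unitInterval p.2 : C(unitInterval, E))) := by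
      refine contDiff_fst.prodMk ?_
      exact ((ContinuousLinearMap.const ℝ unitInterval : E →L[ℝ] C(unitInterval, E)).contDiff).comp
        contDiff_snd
    have h2 := hgs.comp h1.contDiffOn (s := Icc a b ×ˢ (univ : Set E))
      (fun p hp => ⟨hp.1, mem_univ _⟩)
    exact (ContinuousMap.evalCLM ℝ (1 : unitInterval)).contDiff.comp_contDiffOn h2
  -- the defining integral equation
  have hint : ∀ t ∈ Icc a b, ∀ z, ∀ s : unitInterval, g (t, ContinuousMap.const _ z) s =
      z + (t - t₀) • ∫ σ in (0 : ℝ)..s, IccExtend zero_le_one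
        (nemytskii U (rescaledGraph t₀ (t, g (t, ContinuousMap.const _ z)))) σ := by
    intro t ht z s
    have h := congrArg (fun γ : C(unitInterval, E) => γ s) (hg t ht (ContinuousMap.const _ z))
    simp only [flowOperator, ContinuousMap.sub_apply, ContinuousMap.smul_apply,
      ContinuousMap.const_apply, primitiveCLM_apply] at h
    exact eq_add_of_sub_eq h
  have hext : ∀ t ∈ Icc a b, ∀ γ : C(unitInterval, E), ∀ σ (hσ : σ ∈ Icc (0 : ℝ) 1),
      IccExtend zero_le_one (nemytskii U (rescaledGraph t₀ (t, γ))) σ =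
        U (t₀ + σ * (t - t₀), γ ⟨σ, hσ⟩) := by
    intro t ht γ σ hσ
    rw [IccExtend_of_mem _ _ hσ, nemytskii_apply hUc (rescaledGraph_mem ht₀ ⟨ht, mem_univ _⟩),
      rescaledGraph_apply]
  -- By uniqueness, the trajectory computed for final time `t` and stopped at parameter `s` is the
  -- one computed for final time `t₀ + s (t - t₀)`. So end points for different times lie on one
  -- curve, which satisfies the integral equation.
  have hscale : ∀ t ∈ Icc a b, ∀ z, ∀ s : unitInterval,
      Z (t₀ + s * (t - t₀), z) = g (t, ContinuousMap.const _ z) s := by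
    intro t ht z s
    set γ := g (t, ContinuousMap.const _ z) with hγ
    have hts := rescaledTime_mem ht₀ ht s.2
    let γs : C(unitInterval, E) := ⟨fun r => γ (s * r), by fun_prop⟩
    have hγs : flowOperator U t₀ (t₀ + s * (t - t₀), γs) = ContinuousMap.const _ z := by
      ext r
      simp only [flowOperator, ContinuousMap.sub_apply, ContinuousMap.smul_apply,
        ContinuousMap.const_apply, primitiveCLM_apply]
      have hval : γs r = z + (t - t₀) • ∫ σ in (0 : ℝ)..(s * r : unitInterval),
        IccExtend zero_le_one
          (nemytskii U (rescaledGraph t₀ (t, g (t, ContinuousMap.const _ z)))) σ :=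
        hint t ht z (s * r)
      rw [hval, add_sub_cancel_left, mul_comm (s : ℝ) (t - t₀), mul_smul,
        show ((s * r : unitInterval) : ℝ) = s * r from rfl]
      rw [sub_eq_iff_eq_add, add_right_inj]
      congr 1
      rw [show (∫ σ in (0 : ℝ)..(s : ℝ) * r, IccExtend zero_le_one
          (nemytskii U (rescaledGraph t₀ (t, g (t, ContinuousMap.const _ z)))) σ) =
          (s : ℝ) • ∫ σ in (0 : ℝ)..r, IccExtend zero_le_one
          (nemytskii U (rescaledGraph t₀ (t, g (t, ContinuousMap.const _ z)))) (s * σ) by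
        rw [intervalIntegral.smul_integral_comp_mul_left, mul_zero]]
      congr 1
      apply intervalIntegral.integral_congr
      intro σ hσ
      rw [uIcc_of_le r.2.1] at hσ
      have hσ1 : σ ∈ Icc (0 : ℝ) 1 := ⟨hσ.1, hσ.2.trans r.2.2⟩
      have hsσ : (s : ℝ) * σ ∈ Icc (0 : ℝ) 1 :=
        ⟨mul_nonneg s.2.1 hσ1.1, mul_le_one₀ s.2.2 hσ1.1 hσ1.2⟩
      simp only
      rw [mul_comm (t - t₀) (s : ℝ), hext _ hts _ σ hσ1, hext t ht _ _ hsσ]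
      congr 1
      ext1
      · simp only; ring
      · rfl
    have huniq : g (t₀ + s * (t - t₀), ContinuousMap.const _ z) = γs := by
      have h := norm_sub_le_flowOperator ht₀ hUc hL hsmall hts
        (g (t₀ + s * (t - t₀), ContinuousMap.const _ z)) γs
      rw [hγs, hg _ hts, sub_self, norm_zero, mul_zero] at h
      exact sub_eq_zero.1 (norm_le_zero_iff.1 h)
    simp only [hZ, huniq, γs, ContinuousMap.coe_mk, mul_one]
  have hZt₀ : ∀ z, Z (t₀, z) = z := by
    intro z
    simp only [hZ]
    rw [hint t₀ ht₀ z 1, sub_self, zero_smul, add_zero]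
  refine ⟨Z, hZs, hZt₀, fun z t ht => ?_⟩
  -- continuous extension of the right-hand side
  have hfc : Continuous fun τ : Icc a b => U (τ, Z (τ, z)) := by
    have h1 : ContinuousOn (fun τ : ℝ => U (τ, Z (τ, z))) (Icc a b) := by
      refine hUc.comp (continuousOn_id.prodMk
        (hZs.continuousOn.comp (continuousOn_id.prodMk continuousOn_const)
          fun τ hτ => ⟨hτ, mem_univ _⟩)) fun τ hτ => ⟨hτ, mem_univ _⟩
    exact continuousOn_iff_continuous_domRestrict.1 h1
  set f : ℝ → E := IccExtend hab.le fun τ : Icc a b => U (τ, Z (τ, z)) with hf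
  have hfcont : Continuous f := hfc.Icc_extend'
  have hft : ∀ τ ∈ Icc a b, f τ = U (τ, Z (τ, z)) := fun τ hτ => IccExtend_of_mem _ _ hτ
  have hZint : ∀ τ ∈ Icc a b, Z (τ, z) = z + ∫ σ in t₀..τ, f σ := by
    intro τ hτ
    have h1 := hint τ hτ z 1
    have h2 : Z (τ, z) = g (τ, ContinuousMap.const _ z) 1 := rfl
    rw [h2, h1]
    congr 1
    have h3 : (∫ σ in (0 : ℝ)..(1 : unitInterval), IccExtend zero_le_one
        (nemytskii U (rescaledGraph t₀ (τ, g (τ, ContinuousMap.const _ z)))) σ) =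
        ∫ σ in (0 : ℝ)..1, f (t₀ + (τ - t₀) * σ) := by
      rw [Icc.coe_one]
      apply intervalIntegral.integral_congr
      intro σ hσ
      rw [uIcc_of_le zero_le_one] at hσ
      simp only
      rw [hext τ hτ _ σ hσ, ← hscale τ hτ z ⟨σ, hσ⟩, mul_comm (τ - t₀),
        hft _ (rescaledTime_mem ht₀ hτ hσ)]
    rw [h3, intervalIntegral.smul_integral_comp_add_mul]
    simp
  rw [← hft t ht]
  have hder : HasDerivAt (fun τ => z + ∫ σ in t₀..τ, f σ) (f t) t :=
    (hfcont.integral_hasStrictDerivAt t₀ t).hasDerivAt.const_add z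
  exact hder.hasDerivWithinAt.congr (fun τ hτ => hZint τ hτ) (hZint t ht)

/-- A bump function makes the field bounded and globally Lipschitz. On a short time window the
trajectories starting near `z₀` stay where the bump is `1`, hence follow the original field. -/
theorem exists_smooth_flow [FiniteDimensional ℝ E] {Ω : Set E} (hΩ : IsOpen Ω) {z₀ : E}
    (hz₀ : z₀ ∈ Ω) (hab : a < b) (ht₀ : t₀ ∈ Icc a b) (hU : ContDiffOn ℝ ∞ U (Icc a b ×ˢ Ω)) :
    ∃ δ > 0, ∃ Z : ℝ × E → E,
      ContDiffOn ℝ ∞ Z (Icc (max a (t₀ - δ)) (min b (t₀ + δ)) ×ˢ univ) ∧ (∀ z, Z (t₀, z) = z) ∧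
      ∀ z ∈ Metric.ball z₀ δ, ∀ t ∈ Icc (max a (t₀ - δ)) (min b (t₀ + δ)), Z (t, z) ∈ Ω ∧
        HasDerivWithinAt (fun t => Z (t, z)) (U (t, Z (t, z)))
          (Icc (max a (t₀ - δ)) (min b (t₀ + δ))) t := by
  obtain ⟨ε, hε, hεΩ⟩ := Metric.isOpen_iff.1 hΩ z₀ hz₀
  set r := ε / 4 with hr
  have hr0 : 0 < r := by positivity
  let χ : ContDiffBump z₀ := ⟨r, 2 * r, hr0, by linarith⟩
  set V : ℝ × E → E := fun p => χ p.2 • U p with hV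
  have hballΩ : Metric.closedBall z₀ (2 * r) ⊆ Ω :=
    (Metric.closedBall_subset_ball (by linarith)).trans hεΩ
  have hχ0 : ∀ z ∉ Metric.closedBall z₀ (2 * r), (fun z => χ z) =ᶠ[𝓝 z] 0 := by
    intro z hz
    have : z ∉ tsupport χ := by rw [χ.tsupport_eq]; exact hz
    exact notMem_tsupport_iff_eventuallyEq.1 this
  have hVs : ContDiffOn ℝ ∞ V (Icc a b ×ˢ univ) := by
    rintro ⟨t, z⟩ ⟨ht, -⟩
    by_cases hz : z ∈ Ω
    · have h1 : ContDiffWithinAt ℝ ∞ V (Icc a b ×ˢ Ω) (t, z) :=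
        ((χ.contDiff.comp contDiff_snd).contDiffWithinAt).smul (hU (t, z) ⟨ht, hz⟩)
      refine h1.mono_of_mem_nhdsWithin ?_
      have : (univ : Set ℝ) ×ˢ Ω ∈ 𝓝[Icc a b ×ˢ univ] (t, z) :=
        mem_nhdsWithin_of_mem_nhds ((isOpen_univ.prod hΩ).mem_nhds ⟨mem_univ _, hz⟩)
      filter_upwards [this, self_mem_nhdsWithin] with p hp1 hp2
      exact ⟨hp2.1, hp1.2⟩
    · have h1 := hχ0 z (fun h => hz (hballΩ h))
      refine (contDiffWithinAt_const (c := (0 : E))).congr_of_eventuallyEq ?_ ?_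
      · have h2 : ∀ᶠ p : ℝ × E in 𝓝 (t, z), χ p.2 = 0 :=
          (continuous_snd.tendsto (t, z)).eventually h1
        filter_upwards [mem_nhdsWithin_of_mem_nhds h2] with p hp
        have hp' : χ p.2 = 0 := hp
        simp [hV, hp']
      · have : χ z = 0 := h1.self_of_nhds
        simp [hV, this]
  have hSu : UniqueDiffOn ℝ (Icc a b ×ˢ (univ : Set E)) :=
    (uniqueDiffOn_Icc hab).prod uniqueDiffOn_univ
  have hcomp : IsCompact (Icc a b ×ˢ Metric.closedBall z₀ (2 * r)) :=
    isCompact_Icc.prod (isCompact_closedBall _ _)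
  have hsub : Icc a b ×ˢ Metric.closedBall z₀ (2 * r) ⊆ Icc a b ×ˢ (univ : Set E) :=
    prod_mono_right (subset_univ _)
  obtain ⟨L₀, hL₀⟩ := hcomp.exists_bound_of_continuousOn
    ((hVs.continuousOn_fderivWithin hSu (by simp)).mono hsub)
  obtain ⟨M₀, hM₀⟩ := hcomp.exists_bound_of_continuousOn (hVs.continuousOn.mono hsub)
  set L : NNReal := ⟨max L₀ 0, le_max_right _ _⟩ with hL
  set M : ℝ := max M₀ 0 with hM
  have hMb : ∀ t ∈ Icc a b, ∀ z, ‖V (t, z)‖ ≤ M := by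
    intro t ht z
    by_cases hz : z ∈ Metric.closedBall z₀ (2 * r)
    · exact (hM₀ (t, z) ⟨ht, hz⟩).trans (le_max_left _ _)
    · have : χ z = 0 := (hχ0 z hz).self_of_nhds
      simp [hV, this, hM]
  have hlip : ∀ t ∈ Icc a b, LipschitzWith L fun z => V (t, z) := by
    intro t ht
    have hder : ∀ z, HasFDerivAt (fun z => V (t, z))
        ((fderivWithin ℝ V (Icc a b ×ˢ univ) (t, z)).comp (ContinuousLinearMap.inr ℝ ℝ E)) z := by
      intro z
      have h1 := (hVs.differentiableOn (by simp) (t, z) ⟨ht, mem_univ _⟩).hasFDerivWithinAt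
      have h2 := HasFDerivWithinAt.comp (s := univ) z h1
        (hasFDerivAt_prodMk_right t z).hasFDerivWithinAt
        (fun w _ => (⟨ht, mem_univ _⟩ : (t, w) ∈ Icc a b ×ˢ univ))
      exact hasFDerivWithinAt_univ.1 h2
    refine lipschitzWith_of_nnnorm_fderiv_le (fun z => (hder z).differentiableAt) fun z => ?_
    by_cases hz : z ∈ Metric.closedBall z₀ (2 * r)
    · rw [(hder z).fderiv, ← NNReal.coe_le_coe, coe_nnnorm]
      refine le_trans ?_ ((hL₀ (t, z) ⟨ht, hz⟩).trans (le_max_left _ _))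
      refine (ContinuousLinearMap.opNorm_comp_le _ _).trans ?_
      exact mul_le_of_le_one_right (norm_nonneg _) (ContinuousLinearMap.norm_inr_le_one ℝ ℝ E)
    · have h3 : (fun z => V (t, z)) =ᶠ[𝓝 z] fun _ => 0 := by
        filter_upwards [hχ0 z hz] with w hw
        have hw' : χ w = 0 := hw
        simp [hV, hw']
      rw [h3.fderiv_eq]
      simp
  -- The three bounds keep the starting point within `r / 2` of `z₀`, give the contraction condition
  -- on a window of length at most `2 δ`, and limit the displacement to `r / 2`.
  obtain ⟨δ, hδ, hδr, hδL, hδM⟩ : ∃ δ > 0, δ < r / 2 ∧ 2 * δ * L ≤ 1 / 2 ∧ δ * M < r / 2 := by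
    refine ⟨min (r / 4) (min (1 / (4 * (L + 1))) (r / (4 * (M + 1)))), ?_, ?_, ?_, ?_⟩
    · have hM0 : 0 ≤ M := le_max_right _ _
      positivity
    · exact lt_of_le_of_lt (min_le_left _ _) (by linarith)
    · have h1 : min (r / 4) (min (1 / (4 * ((L : ℝ) + 1))) (r / (4 * (M + 1)))) ≤
        1 / (4 * ((L : ℝ) + 1)) := (min_le_right _ _).trans (min_le_left _ _)
      have hL0 : 0 ≤ (L : ℝ) := L.2
      calc _ ≤ 2 * (1 / (4 * ((L : ℝ) + 1))) * L := by gcongr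
        _ ≤ _ := by
          rw [mul_one_div, div_mul_eq_mul_div, div_le_div_iff₀ (by positivity) (by norm_num)]
          nlinarith
    · have h1 : min (r / 4) (min (1 / (4 * ((L : ℝ) + 1))) (r / (4 * (M + 1)))) ≤
        r / (4 * (M + 1)) := (min_le_right _ _).trans (min_le_right _ _)
      have hM0 : 0 ≤ M := le_max_right _ _
      calc _ ≤ r / (4 * (M + 1)) * M := by gcongr
        _ < _ := by
          rw [div_mul_eq_mul_div, div_lt_div_iff₀ (by positivity) (by norm_num)]
          nlinarith
  set a' := max a (t₀ - δ) with ha'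
  set b' := min b (t₀ + δ) with hb'
  have hab' : a' < b' := by
    rw [ha', hb', max_lt_iff, lt_min_iff, lt_min_iff]
    exact ⟨⟨hab, by linarith [ht₀.1]⟩, by linarith [ht₀.2], by linarith⟩
  have ht₀' : t₀ ∈ Icc a' b' :=
    ⟨max_le ht₀.1 (by linarith), le_min ht₀.2 (by linarith)⟩
  have hJ : Icc a' b' ⊆ Icc a b := Icc_subset_Icc (le_max_left _ _) (min_le_left _ _)
  have hsmall : (b' - a') * L ≤ 1 / 2 := by
    refine le_trans (mul_le_mul_of_nonneg_right ?_ L.2) hδL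
    linarith [min_le_right b (t₀ + δ), le_max_right a (t₀ - δ)]
  obtain ⟨Z, hZs, hZ0, hZ⟩ := exists_smooth_flow_of_lipschitz hab' ht₀'
    (hVs.mono (prod_mono_left hJ)) (fun t ht => hlip t (hJ ht)) hsmall
  refine ⟨δ, hδ, Z, hZs, hZ0, fun z hz t ht => ?_⟩
  have hdist : ‖Z (t, z) - z‖ ≤ M * ‖t - t₀‖ := by
    have := (convex_Icc a' b').norm_image_sub_le_of_norm_hasDerivWithin_le
      (f := fun t => Z (t, z)) (C := M) (fun τ hτ => hZ z τ hτ)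
      (fun τ hτ => hMb τ (hJ hτ) _) ht₀' ht
    simpa [hZ0] using this
  have htt : ‖t - t₀‖ ≤ δ := by
    rw [Real.norm_eq_abs, abs_le]
    exact ⟨by linarith [ht.1, le_max_right a (t₀ - δ)], by linarith [ht.2, min_le_right b (t₀ + δ)]⟩
  have hin : Z (t, z) ∈ Metric.ball z₀ r := by
    rw [mem_ball_iff_norm] at hz ⊢
    have h1 : M * ‖t - t₀‖ ≤ δ * M := by
      rw [mul_comm]; exact mul_le_mul_of_nonneg_right htt (le_max_right _ _)
    calc ‖Z (t, z) - z₀‖ = ‖(Z (t, z) - z) + (z - z₀)‖ := by abel_nf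
      _ ≤ ‖Z (t, z) - z‖ + ‖z - z₀‖ := norm_add_le _ _
      _ < r := by linarith
  have hχ1 : χ (Z (t, z)) = 1 := χ.one_of_mem_closedBall (Metric.ball_subset_closedBall hin)
  refine ⟨hballΩ (Metric.ball_subset_closedBall (Metric.ball_subset_ball (by linarith) hin)), ?_⟩
  have h := hZ z t ht
  simp only [hV, hχ1, one_smul] at h
  exact h

end FlowExistence

/-! ## Derivatives of charts -/

set_option linter.unusedSectionVars false

section ChartDeriv

variable {n : ℕ} {H : Type*} [TopologicalSpace H]
  {I : ModelWithCorners ℝ (EuclideanSpace ℝ (Fin n)) H}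
  {M : Type*} [TopologicalSpace M] [ChartedSpace H M]

variable (I) in
/-- The derivative of the chart `e` at `x`. -/
noncomputable def chartDeriv (e : OpenPartialHomeomorph M H) (x : M) :
    TangentSpace I x →L[ℝ] EuclideanSpace ℝ (Fin n) :=
  mvfderiv I (e.extend I) x

variable (I) in
/-- The derivative of the inverse of the chart `e`, at the point with coordinates `y`. -/
noncomputable def chartDerivSymm (e : OpenPartialHomeomorph M H) (y : EuclideanSpace ℝ (Fin n)) :
    EuclideanSpace ℝ (Fin n) →L[ℝ] TangentSpace I ((e.extend I).symm y) :=
  (mfderivWithin 𝓘(ℝ, EuclideanSpace ℝ (Fin n)) I (e.extend I).symm (range I) y).comp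
    (NormedSpace.fromTangentSpace y).symm.toContinuousLinearMap

theorem coordVector_eq (e : OpenPartialHomeomorph M H) (i : Fin n)
    (y : EuclideanSpace ℝ (Fin n)) :
    coordVector I e i y = chartDerivSymm I e y (EuclideanSpace.single i 1) := rfl

variable {e e' : OpenPartialHomeomorph M H}

theorem extend_target_mem_nhdsWithin' {y : EuclideanSpace ℝ (Fin n)}
    (hy : y ∈ (e.extend I).target) : (e.extend I).target ∈ 𝓝[range I] y := by
  have h := e.extend_target_mem_nhdsWithin (I := I) (y := (e.extend I).symm y)
    (by rw [← e.extend_source (I := I)]; exact (e.extend I).map_target hy)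
  rwa [(e.extend I).right_inv hy] at h

theorem uniqueDiffOn_extend_target : UniqueDiffOn ℝ (e.extend I).target := by
  rw [e.extend_target, inter_comm]
  exact I.uniqueDiffOn.inter (e.open_target.preimage I.continuous_symm)

theorem contMDiffOn_extend_symm_target [IsManifold I ∞ M]
    (he : e ∈ IsManifold.maximalAtlas I ∞ M) :
    ContMDiffOn 𝓘(ℝ, EuclideanSpace ℝ (Fin n)) I ∞ (e.extend I).symm (e.extend I).target := by
  rw [e.extend_target']
  exact contMDiffOn_extend_symm he

theorem contMDiffWithinAt_extend_symm [IsManifold I ∞ M]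
    (he : e ∈ IsManifold.maximalAtlas I ∞ M) {y : EuclideanSpace ℝ (Fin n)}
    (hy : y ∈ (e.extend I).target) :
    ContMDiffWithinAt 𝓘(ℝ, EuclideanSpace ℝ (Fin n)) I ∞ (e.extend I).symm (range I) y :=
  (contMDiffOn_extend_symm_target he y hy).mono_of_mem_nhdsWithin (extend_target_mem_nhdsWithin' hy)

theorem extend_symm_mem_source {y : EuclideanSpace ℝ (Fin n)} (hy : y ∈ (e.extend I).target) :
    (e.extend I).symm y ∈ e.source := by
  rw [← e.extend_source (I := I)]; exact (e.extend I).map_target hy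

theorem chartDeriv_comp_chartDerivSymm [IsManifold I ∞ M]
    (he : e ∈ IsManifold.maximalAtlas I ∞ M) {y : EuclideanSpace ℝ (Fin n)}
    (hy : y ∈ (e.extend I).target) (he' : e' ∈ IsManifold.maximalAtlas I ∞ M)
    (hy' : (e.extend I).symm y ∈ e'.source) (v : EuclideanSpace ℝ (Fin n)) :
    chartDeriv I e' ((e.extend I).symm y) (chartDerivSymm I e y v) =
      fderivWithin ℝ (fun z => e'.extend I ((e.extend I).symm z)) (range I) y v := by
  have hyr : y ∈ range I := e.extend_target_subset_range hy
  have h1 : MDifferentiableAt I 𝓘(ℝ, EuclideanSpace ℝ (Fin n)) (e'.extend I)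
      ((e.extend I).symm y) :=
    (e'.contMDiffAt_extend he' hy').mdifferentiableAt (by simp)
  have h2 : MDifferentiableWithinAt 𝓘(ℝ, EuclideanSpace ℝ (Fin n)) I (e.extend I).symm
      (range I) y := (contMDiffWithinAt_extend_symm he hy).mdifferentiableWithinAt (by simp)
  have h3 := mfderiv_comp_mfderivWithin y h1 h2 (I.uniqueMDiffOn y hyr)
  have h4 := congrArg (fun A : TangentSpace 𝓘(ℝ, EuclideanSpace ℝ (Fin n)) y →L[ℝ]
    TangentSpace 𝓘(ℝ, EuclideanSpace ℝ (Fin n)) (e'.extend I ((e.extend I).symm y)) =>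
      NormedSpace.fromTangentSpace _ (A ((NormedSpace.fromTangentSpace y).symm v))) h3
  rw [mfderivWithin_eq_fderivWithin] at h4
  exact h4.symm

theorem chartDeriv_chartDerivSymm [IsManifold I ∞ M]
    (he : e ∈ IsManifold.maximalAtlas I ∞ M) {y : EuclideanSpace ℝ (Fin n)}
    (hy : y ∈ (e.extend I).target) (v : EuclideanSpace ℝ (Fin n)) :
    chartDeriv I e ((e.extend I).symm y) (chartDerivSymm I e y v) = v := by
  have hyr : y ∈ range I := e.extend_target_subset_range hy
  rw [chartDeriv_comp_chartDerivSymm he hy he (extend_symm_mem_source hy)]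
  have h : HasFDerivWithinAt (fun z => e.extend I ((e.extend I).symm z))
      (ContinuousLinearMap.id ℝ (EuclideanSpace ℝ (Fin n))) (range I) y := by
    refine (hasFDerivWithinAt_id y _).congr_of_eventuallyEq ?_ ?_
    · filter_upwards [extend_target_mem_nhdsWithin' hy] with z hz
      exact (e.extend I).right_inv hz
    · exact (e.extend I).right_inv hy
  rw [h.fderivWithin (I.uniqueDiffOn y hyr)]
  rfl

theorem finrank_tangentSpace (x : M) : Module.finrank ℝ (TangentSpace I x) = n :=
  finrank_euclideanSpace_fin (𝕜 := ℝ)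

instance (x : M) : FiniteDimensional ℝ (TangentSpace I x) :=
  inferInstanceAs (FiniteDimensional ℝ (EuclideanSpace ℝ (Fin n)))

/-- One composite is the identity by differentiating a coordinate identity; the other follows
because the dimensions agree. -/
theorem chartDerivSymm_chartDeriv [IsManifold I ∞ M]
    (he : e ∈ IsManifold.maximalAtlas I ∞ M) {y : EuclideanSpace ℝ (Fin n)}
    (hy : y ∈ (e.extend I).target) (u : TangentSpace I ((e.extend I).symm y)) :
    chartDerivSymm I e y (chartDeriv I e ((e.extend I).symm y) u) = u := by
  have hinj : Function.Injective (chartDerivSymm I e y) :=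
    Function.LeftInverse.injective (chartDeriv_chartDerivSymm he hy)
  have hsurj : Function.Surjective (chartDerivSymm I e y) := by
    have h := LinearMap.injective_iff_surjective_of_finrank_eq_finrank
      (f := (chartDerivSymm I e y).toLinearMap)
      (by rw [finrank_tangentSpace, finrank_euclideanSpace_fin])
    exact h.1 hinj
  obtain ⟨v, rfl⟩ := hsurj u
  rw [chartDeriv_chartDerivSymm he hy]

theorem euclideanSpace_eq_sum_single (v : EuclideanSpace ℝ (Fin n)) :
    v = ∑ i, v i • EuclideanSpace.single i (1 : ℝ) := by
  ext j
  simp [Finset.sum_apply, Pi.single_apply]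

theorem eq_sum_coordVector [IsManifold I ∞ M]
    (he : e ∈ IsManifold.maximalAtlas I ∞ M) {y : EuclideanSpace ℝ (Fin n)}
    (hy : y ∈ (e.extend I).target) (u : TangentSpace I ((e.extend I).symm y)) :
    u = ∑ i, (chartDeriv I e ((e.extend I).symm y) u) i • coordVector I e i y := by
  conv_lhs => rw [← chartDerivSymm_chartDeriv he hy u,
    euclideanSpace_eq_sum_single (chartDeriv I e ((e.extend I).symm y) u), map_sum]
  simp only [map_smul, coordVector_eq]

/-! ## The metric in coordinates -/

variable [RiemannianBundle (fun x : M => TangentSpace I x)]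

theorem chartMetric_apply (e : OpenPartialHomeomorph M H) (y : EuclideanSpace ℝ (Fin n))
    (i j : Fin n) :
    chartMetric I e y i j = inner ℝ (coordVector I e i y) (coordVector I e j y) := rfl

theorem inner_eq_sum_chartMetric [IsManifold I ∞ M]
    (he : e ∈ IsManifold.maximalAtlas I ∞ M) {y : EuclideanSpace ℝ (Fin n)}
    (hy : y ∈ (e.extend I).target) (u v : TangentSpace I ((e.extend I).symm y)) :
    inner ℝ u v = ∑ i, ∑ j, chartMetric I e y i j *
      ((chartDeriv I e ((e.extend I).symm y) u) i * (chartDeriv I e ((e.extend I).symm y) v) j) := by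
  conv_lhs => rw [eq_sum_coordVector he hy u, eq_sum_coordVector he hy v]
  simp only [sum_inner, inner_sum, real_inner_smul_left, real_inner_smul_right, chartMetric_apply]
  rw [Finset.sum_comm]
  refine Finset.sum_congr rfl fun i _ => Finset.sum_congr rfl fun j _ => ?_
  ring

theorem chartMetric_symm (e : OpenPartialHomeomorph M H) (y : EuclideanSpace ℝ (Fin n))
    (i j : Fin n) : chartMetric I e y i j = chartMetric I e y j i := by
  rw [chartMetric_apply, chartMetric_apply, real_inner_comm]

theorem posDef_chartMetric [IsManifold I ∞ M]
    (he : e ∈ IsManifold.maximalAtlas I ∞ M) {y : EuclideanSpace ℝ (Fin n)}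
    (hy : y ∈ (e.extend I).target) : (chartMetric I e y).PosDef := by
  refine Matrix.PosDef.of_dotProduct_mulVec_pos ?_ ?_
  · ext i j
    simp [Matrix.conjTranspose_apply, chartMetric_symm e y i j]
  · intro v hv
    set w : EuclideanSpace ℝ (Fin n) := WithLp.toLp 2 v with hw
    have h := inner_eq_sum_chartMetric he hy (chartDerivSymm I e y w) (chartDerivSymm I e y w)
    rw [chartDeriv_chartDerivSymm he hy] at h
    have h2 : (star v ⬝ᵥ (chartMetric I e y).mulVec v) =
        inner ℝ (chartDerivSymm I e y w) (chartDerivSymm I e y w) := by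
      rw [h]
      simp only [dotProduct, Matrix.mulVec, Pi.star_apply, star_trivial, Finset.mul_sum, hw]
      refine Finset.sum_congr rfl fun i _ => Finset.sum_congr rfl fun j _ => ?_
      ring
    rw [h2]
    refine real_inner_self_pos.2 fun h0 => hv ?_
    have := chartDeriv_chartDerivSymm he hy w
    rw [h0, map_zero] at this
    ext i
    have := congrArg (fun z : EuclideanSpace ℝ (Fin n) => z i) this
    simpa [hw] using this.symm

theorem isUnit_det_chartMetric [IsManifold I ∞ M]
    (he : e ∈ IsManifold.maximalAtlas I ∞ M) {y : EuclideanSpace ℝ (Fin n)}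
    (hy : y ∈ (e.extend I).target) : IsUnit (chartMetric I e y).det :=
  (posDef_chartMetric he hy).det_pos.ne'.isUnit

/-- The coordinate fields are images of constant fields under the tangent map of the inverse chart,
hence smooth up to the boundary, and the bundle metric is smooth on smooth sections. -/
theorem contDiffOn_chartMetric [IsManifold I ∞ M]
    [IsContMDiffRiemannianBundle I ∞ (EuclideanSpace ℝ (Fin n)) (fun x : M => TangentSpace I x)]
    (he : e ∈ IsManifold.maximalAtlas I ∞ M) (i j : Fin n) :
    ContDiffOn ℝ ∞ (fun y => chartMetric I e y i j) (e.extend I).target := by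
  have hsec : ∀ i : Fin n, ContMDiffOn 𝓘(ℝ, EuclideanSpace ℝ (Fin n)) I.tangent ∞
      (fun y => (⟨(e.extend I).symm y, coordVector I e i y⟩ : TangentBundle I M))
      (e.extend I).target := by
    intro i
    have h1 := (contMDiffOn_extend_symm_target he).contMDiffOn_tangentMapWithin (m := ∞) (by simp)
      uniqueDiffOn_extend_target.uniqueMDiffOn
    have h2 : ContMDiff 𝓘(ℝ, EuclideanSpace ℝ (Fin n))
        (𝓘(ℝ, EuclideanSpace ℝ (Fin n))).tangent ∞
        (fun y : EuclideanSpace ℝ (Fin n) => (⟨y, (NormedSpace.fromTangentSpace y).symm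
          (EuclideanSpace.single i 1)⟩ :
            TangentBundle 𝓘(ℝ, EuclideanSpace ℝ (Fin n)) (EuclideanSpace ℝ (Fin n)))) := by
      intro y
      rw [contMDiffAt_totalSpace]
      refine ⟨contMDiffAt_id, ?_⟩
      have : (fun z : EuclideanSpace ℝ (Fin n) => EuclideanSpace.single i (1 : ℝ)) = fun z =>
          (trivializationAt (EuclideanSpace ℝ (Fin n)) (TangentSpace
            𝓘(ℝ, EuclideanSpace ℝ (Fin n)) (M := EuclideanSpace ℝ (Fin n))) y
            (⟨z, (NormedSpace.fromTangentSpace z).symm (EuclideanSpace.single i 1)⟩ :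
            TangentBundle 𝓘(ℝ, EuclideanSpace ℝ (Fin n)) (EuclideanSpace ℝ (Fin n)))).2 := by
        ext z
        simp
        change _ = (EuclideanSpace.single i (1 : ℝ)) _
        simp
      rw [← this]
      exact contMDiffAt_const
    have h3 := h1.comp (h2.contMDiffOn (s := (e.extend I).target)) (fun y hy => hy)
    refine h3.congr fun y hy => ?_
    simp only [Function.comp_apply, tangentMapWithin]
    have : mfderivWithin 𝓘(ℝ, EuclideanSpace ℝ (Fin n)) I (e.extend I).symm (e.extend I).target y
        = mfderivWithin 𝓘(ℝ, EuclideanSpace ℝ (Fin n)) I (e.extend I).symm (range I) y := by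
      exact mfderivWithin_subset e.extend_target_subset_range
        (uniqueDiffOn_extend_target y hy).uniqueMDiffWithinAt
        ((contMDiffWithinAt_extend_symm he hy).mdifferentiableWithinAt (by simp))
    rw [this]
    rfl
  have := ContMDiffOn.inner_bundle (F := EuclideanSpace ℝ (Fin n))
    (E := fun x : M => TangentSpace I x) (hsec i) (hsec j)
  exact this.contDiffOn

omit [ChartedSpace H M] [RiemannianBundle (fun x : M => TangentSpace I x)] in
theorem exists_extend_symm_eq {x : M} (hx : x ∈ e.source) :
    ∃ y ∈ (e.extend I).target, (e.extend I).symm y = x :=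
  ⟨e.extend I x, (e.extend I).map_source (by rwa [e.extend_source]), e.extend_left_inv hx⟩

theorem inner_eq_sum_metricComp [IsManifold I ∞ M]
    (he : e ∈ IsManifold.maximalAtlas I ∞ M) {x : M} (hx : x ∈ e.source) (u v : TangentSpace I x) :
    inner ℝ u v = ∑ i, ∑ j, chartMetric I e (e.extend I x) i j *
      ((chartDeriv I e x u) i * (chartDeriv I e x v) j) := by
  obtain ⟨y, hy, rfl⟩ := exists_extend_symm_eq (I := I) hx
  rw [inner_eq_sum_chartMetric he hy, (e.extend I).right_inv hy]

/-- Transformation of the metric under a change of coordinates. -/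
theorem chartMetric_transition [IsManifold I ∞ M]
    (he : e ∈ IsManifold.maximalAtlas I ∞ M) {y : EuclideanSpace ℝ (Fin n)}
    (hy : y ∈ (e.extend I).target) (he' : e' ∈ IsManifold.maximalAtlas I ∞ M)
    (hy' : (e.extend I).symm y ∈ e'.source) (i j : Fin n) :
    chartMetric I e y i j = ∑ a, ∑ b, chartMetric I e' (e'.extend I ((e.extend I).symm y)) a b *
      (fderivWithin ℝ (fun z => e'.extend I ((e.extend I).symm z)) (range I) y
          (EuclideanSpace.single i 1) a *
        fderivWithin ℝ (fun z => e'.extend I ((e.extend I).symm z)) (range I) y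
          (EuclideanSpace.single j 1) b) := by
  rw [chartMetric_apply, inner_eq_sum_metricComp he' hy', coordVector_eq, coordVector_eq,
    chartDeriv_comp_chartDerivSymm he hy he' hy', chartDeriv_comp_chartDerivSymm he hy he' hy']

end ChartDeriv

/-! ## Calculus of partial derivatives -/

section PartialDeriv

/-- `T` is relatively open in `s`, and derivatives within `s` behave well on `T`. -/
structure IsCoordDomain {n : ℕ} (s T : Set (EuclideanSpace ℝ (Fin n))) : Prop where
  uniqueDiffOn : UniqueDiffOn ℝ s
  subset : T ⊆ s
  mem_nhdsWithin : ∀ y ∈ T, T ∈ 𝓝[s] y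
  subset_closure : T ⊆ closure (interior s)

variable {n : ℕ} {s T : Set (EuclideanSpace ℝ (Fin n))}

theorem IsCoordDomain.nhdsWithin_eq (h : IsCoordDomain s T) {y : EuclideanSpace ℝ (Fin n)}
    (hy : y ∈ T) : 𝓝[T] y = 𝓝[s] y :=
  le_antisymm (nhdsWithin_mono _ h.subset) (nhdsWithin_le_of_mem (h.mem_nhdsWithin y hy))

theorem IsCoordDomain.uniqueDiffOn' (h : IsCoordDomain s T) : UniqueDiffOn ℝ T := fun y hy =>
  (h.uniqueDiffOn y (h.subset hy)).mono_nhds (h.nhdsWithin_eq hy).ge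

theorem IsCoordDomain.of_isOpen (hT : IsOpen T) (hs : UniqueDiffOn ℝ s) (hTs : T ⊆ s) :
    IsCoordDomain s T where
  uniqueDiffOn := hs
  subset := hTs
  mem_nhdsWithin := fun _ hy => nhdsWithin_le_nhds (hT.mem_nhds hy)
  subset_closure := fun _ hy => _root_.subset_closure (interior_maximal hTs hT hy)

theorem IsCoordDomain.mono_isOpen (h : IsCoordDomain s T) {U : Set (EuclideanSpace ℝ (Fin n))}
    (hU : IsOpen U) : IsCoordDomain s (T ∩ U) where
  uniqueDiffOn := h.uniqueDiffOn
  subset := inter_subset_left.trans h.subset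
  mem_nhdsWithin := fun y hy => Filter.inter_mem (h.mem_nhdsWithin y hy.1)
    (nhdsWithin_le_nhds (hU.mem_nhds hy.2))
  subset_closure := inter_subset_left.trans h.subset_closure

variable {f g : EuclideanSpace ℝ (Fin n) → ℝ} {y : EuclideanSpace ℝ (Fin n)}

theorem IsCoordDomain.contDiffWithinAt (h : IsCoordDomain s T) (hf : ContDiffOn ℝ ∞ f T)
    (hy : y ∈ T) : ContDiffWithinAt ℝ ∞ f s y :=
  (hf y hy).mono_of_mem_nhdsWithin (h.mem_nhdsWithin y hy)

theorem IsCoordDomain.differentiableWithinAt (h : IsCoordDomain s T) (hf : ContDiffOn ℝ ∞ f T)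
    (hy : y ∈ T) : DifferentiableWithinAt ℝ f s y :=
  (h.contDiffWithinAt hf hy).differentiableWithinAt (by simp)

theorem IsCoordDomain.partialDeriv_congr (h : IsCoordDomain s T) (hfg : EqOn f g T) (hy : y ∈ T)
    (i : Fin n) : partialDeriv s i f y = partialDeriv s i g y := by
  have : f =ᶠ[𝓝[s] y] g := by
    filter_upwards [h.mem_nhdsWithin y hy] with z hz using hfg hz
  simp only [partialDeriv, this.fderivWithin_eq (hfg hy)]

theorem IsCoordDomain.contDiffOn_partialDeriv (h : IsCoordDomain s T) (hf : ContDiffOn ℝ ∞ f T)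
    (i : Fin n) : ContDiffOn ℝ ∞ (partialDeriv s i f) T := by
  have h1 : ContDiffOn ℝ ∞ (fun y => fderivWithin ℝ f T y (EuclideanSpace.single i 1)) T :=
    (hf.fderivWithin h.uniqueDiffOn' (by simp)).clm_apply contDiffOn_const
  refine h1.congr fun y hy => ?_
  simp only [partialDeriv]
  rw [fderivWithin_congr_set' (t := T) y]
  have := h.nhdsWithin_eq hy
  exact Filter.EventuallyEq.filter_mono (nhdsWithin_eq_iff_eventuallyEq.1 this.symm)
    nhdsWithin_le_nhds

theorem IsCoordDomain.partialDeriv_add (h : IsCoordDomain s T) (hf : ContDiffOn ℝ ∞ f T)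
    (hg : ContDiffOn ℝ ∞ g T) (hy : y ∈ T) (i : Fin n) :
    partialDeriv s i (fun z => f z + g z) y = partialDeriv s i f y + partialDeriv s i g y := by
  simp only [partialDeriv]
  rw [fderivWithin_fun_add (h.uniqueDiffOn y (h.subset hy)) (h.differentiableWithinAt hf hy)
    (h.differentiableWithinAt hg hy)]
  rfl

theorem IsCoordDomain.partialDeriv_sub (h : IsCoordDomain s T) (hf : ContDiffOn ℝ ∞ f T)
    (hg : ContDiffOn ℝ ∞ g T) (hy : y ∈ T) (i : Fin n) :
    partialDeriv s i (fun z => f z - g z) y = partialDeriv s i f y - partialDeriv s i g y := by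
  simp only [partialDeriv]
  rw [fderivWithin_fun_sub (h.uniqueDiffOn y (h.subset hy)) (h.differentiableWithinAt hf hy)
    (h.differentiableWithinAt hg hy)]
  rfl

theorem IsCoordDomain.partialDeriv_mul (h : IsCoordDomain s T) (hf : ContDiffOn ℝ ∞ f T)
    (hg : ContDiffOn ℝ ∞ g T) (hy : y ∈ T) (i : Fin n) :
    partialDeriv s i (fun z => f z * g z) y =
      partialDeriv s i f y * g y + f y * partialDeriv s i g y := by
  simp only [partialDeriv]
  rw [fderivWithin_fun_mul (h.uniqueDiffOn y (h.subset hy)) (h.differentiableWithinAt hf hy)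
    (h.differentiableWithinAt hg hy)]
  simp [smul_eq_mul]
  ring

theorem partialDeriv_const (c : ℝ) (i : Fin n) :
    partialDeriv s i (fun _ => c) y = 0 := by
  simp only [partialDeriv]
  rw [fderivWithin_fun_const]
  rfl

theorem IsCoordDomain.partialDeriv_const_mul (h : IsCoordDomain s T) (hf : ContDiffOn ℝ ∞ f T)
    (hy : y ∈ T) (c : ℝ) (i : Fin n) :
    partialDeriv s i (fun z => c * f z) y = c * partialDeriv s i f y := by
  rw [h.partialDeriv_mul contDiffOn_const hf hy, _root_.partialDeriv_const]
  ring

theorem IsCoordDomain.partialDeriv_sum (h : IsCoordDomain s T) {ι : Type*} [Fintype ι]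
    {f : ι → EuclideanSpace ℝ (Fin n) → ℝ}
    (hf : ∀ a, ContDiffOn ℝ ∞ (f a) T) (hy : y ∈ T) (i : Fin n) :
    partialDeriv s i (fun z => ∑ a, f a z) y = ∑ a, partialDeriv s i (f a) y := by
  simp only [partialDeriv]
  rw [fderivWithin_fun_sum (h.uniqueDiffOn y (h.subset hy))
    (fun a _ => h.differentiableWithinAt (hf a) hy)]
  simp

/-- Symmetry of second derivatives extends from the interior of `s` to its closure. This covers
boundary points and is the purpose of the field `subset_closure`. -/
theorem IsCoordDomain.partialDeriv_comm (h : IsCoordDomain s T) (hf : ContDiffOn ℝ ∞ f T)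
    (hy : y ∈ T) (i j : Fin n) :
    partialDeriv s i (partialDeriv s j f) y = partialDeriv s j (partialDeriv s i f) y := by
  have hsymm : IsSymmSndFDerivWithinAt ℝ f s y :=
    (h.contDiffWithinAt hf hy).isSymmSndFDerivWithinAt (by simpa using WithTop.coe_le_coe.2 (le_top : (2 : ℕ∞) ≤ ⊤)) h.uniqueDiffOn
      (h.subset_closure hy) (h.subset hy)
  have key : ∀ a b : Fin n, partialDeriv s a (partialDeriv s b f) y =
      fderivWithin ℝ (fderivWithin ℝ f s) s y (EuclideanSpace.single a 1)
        (EuclideanSpace.single b 1) := by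
    intro a b
    have hd : DifferentiableWithinAt ℝ (fderivWithin ℝ f s) s y := by
      have h1 := (h.contDiffWithinAt hf hy).fderivWithin_right (m := ∞) h.uniqueDiffOn (by simp)
        (h.subset hy)
      exact h1.differentiableWithinAt (by simp)
    have h2 := hd.hasFDerivWithinAt.clm_apply
      (hasFDerivWithinAt_const (EuclideanSpace.single b (1 : ℝ)) y s)
    have h3 := h2.fderivWithin (h.uniqueDiffOn y (h.subset hy))
    have h4 : partialDeriv s a (partialDeriv s b f) y = fderivWithin ℝ
      (fun z => fderivWithin ℝ f s z (EuclideanSpace.single b (1 : ℝ))) s y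
        (EuclideanSpace.single a 1) := rfl
    rw [h4, h3]
    simp
  rw [key, key, hsymm.eq]

end PartialDeriv

/-! ## Riemannian metrics in coordinates -/

section CoordMetric

/-- `G` is a smooth (pseudo-)Riemannian metric on `T`. -/
structure IsCoordMetric {n : ℕ} (s T : Set (EuclideanSpace ℝ (Fin n)))
    (G : EuclideanSpace ℝ (Fin n) → Matrix (Fin n) (Fin n) ℝ) : Prop
    extends IsCoordDomain s T where
  smooth : ∀ i j, ContDiffOn ℝ ∞ (fun y => G y i j) T
  symm : ∀ y ∈ T, ∀ i j, G y i j = G y j i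
  isUnit_det : ∀ y ∈ T, IsUnit (G y).det

theorem contDiffOn_matrix_det {E : Type*} [NormedAddCommGroup E] [NormedSpace ℝ E] {T : Set E}
    {n : ℕ} {G : E → Matrix (Fin n) (Fin n) ℝ}
    (hG : ∀ i j, ContDiffOn ℝ ∞ (fun y => G y i j) T) :
    ContDiffOn ℝ ∞ (fun y => (G y).det) T := by
  simp only [Matrix.det_apply]
  exact ContDiffOn.sum fun σ _ => (contDiffOn_prod fun i _ => hG _ _).const_smul _

theorem contDiffOn_matrix_inv {E : Type*} [NormedAddCommGroup E] [NormedSpace ℝ E] {T : Set E}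
    {n : ℕ} {G : E → Matrix (Fin n) (Fin n) ℝ}
    (hG : ∀ i j, ContDiffOn ℝ ∞ (fun y => G y i j) T) (hdet : ∀ y ∈ T, IsUnit (G y).det)
    (i j : Fin n) : ContDiffOn ℝ ∞ (fun y => (G y)⁻¹ i j) T := by
  simp only [Matrix.inv_def, Matrix.smul_apply, smul_eq_mul, Ring.inverse_eq_inv']
  refine ((contDiffOn_matrix_det hG).inv fun y hy => (hdet y hy).ne_zero).mul ?_
  simp only [Matrix.adjugate_apply]
  refine contDiffOn_matrix_det fun a b => ?_
  simp only [Matrix.updateRow_apply]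
  split_ifs
  · exact contDiffOn_const
  · exact hG a b

variable {n : ℕ} {s T : Set (EuclideanSpace ℝ (Fin n))}
  {G : EuclideanSpace ℝ (Fin n) → Matrix (Fin n) (Fin n) ℝ} {p : EuclideanSpace ℝ (Fin n)}

theorem IsCoordMetric.contDiffOn_inv (h : IsCoordMetric s T G) (i j : Fin n) :
    ContDiffOn ℝ ∞ (fun y => (G y)⁻¹ i j) T :=
  contDiffOn_matrix_inv h.smooth h.isUnit_det i j

/-- Twice the Christoffel symbols with lowered index. -/
noncomputable def loweredChristoffel (s : Set (EuclideanSpace ℝ (Fin n)))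
    (G : EuclideanSpace ℝ (Fin n) → Matrix (Fin n) (Fin n) ℝ) (l i j : Fin n)
    (y : EuclideanSpace ℝ (Fin n)) : ℝ :=
  partialDeriv s i (fun z => G z j l) y + partialDeriv s j (fun z => G z i l) y
    - partialDeriv s l (fun z => G z i j) y

theorem christoffel_eq (k i j : Fin n) : christoffel s G k i j = fun y =>
    (1 / 2 : ℝ) * ∑ l, (G y)⁻¹ k l * loweredChristoffel s G l i j y := rfl

theorem IsCoordMetric.contDiffOn_loweredChristoffel (h : IsCoordMetric s T G) (l i j : Fin n) :
    ContDiffOn ℝ ∞ (loweredChristoffel s G l i j) T :=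
  ((h.contDiffOn_partialDeriv (h.smooth _ _) _).add
    (h.contDiffOn_partialDeriv (h.smooth _ _) _)).sub (h.contDiffOn_partialDeriv (h.smooth _ _) _)

theorem IsCoordMetric.contDiffOn_christoffel (h : IsCoordMetric s T G) (k i j : Fin n) :
    ContDiffOn ℝ ∞ (christoffel s G k i j) T := by
  rw [christoffel_eq]
  exact contDiffOn_const.mul (ContDiffOn.sum fun l _ =>
    (h.contDiffOn_inv _ _).mul (h.contDiffOn_loweredChristoffel _ _ _))

theorem IsCoordMetric.christoffel_symm (h : IsCoordMetric s T G) {y : EuclideanSpace ℝ (Fin n)}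
    (hy : y ∈ T) (k i j : Fin n) : christoffel s G k i j y = christoffel s G k j i y := by
  simp only [christoffel_eq, loweredChristoffel]
  congr 1
  refine Finset.sum_congr rfl fun l _ => ?_
  rw [h.partialDeriv_congr (fun z hz => h.symm z hz i j) hy l]
  ring

theorem IsCoordMetric.contDiffOn_coordRicci (h : IsCoordMetric s T G) (i j : Fin n) :
    ContDiffOn ℝ ∞ (coordRicci s G i j) T := by
  have hΓ := h.contDiffOn_christoffel
  exact (ContDiffOn.sum fun k _ => (h.contDiffOn_partialDeriv (hΓ _ _ _) _).sub
    (h.contDiffOn_partialDeriv (hΓ _ _ _) _)).add (ContDiffOn.sum fun k _ =>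
      ContDiffOn.sum fun l _ => ((hΓ _ _ _).mul (hΓ _ _ _)).sub ((hΓ _ _ _).mul (hΓ _ _ _)))

/-- Lowering the index of the Christoffel symbols. -/
theorem IsCoordMetric.sum_christoffel_mul (h : IsCoordMetric s T G) {y : EuclideanSpace ℝ (Fin n)}
    (hy : y ∈ T) (a i j : Fin n) :
    ∑ k, G y a k * christoffel s G k i j y = (1 / 2) * loweredChristoffel s G a i j y := by
  have h1 : G y * (G y)⁻¹ = 1 := Matrix.mul_nonsing_inv _ (h.isUnit_det y hy)
  calc ∑ k, G y a k * christoffel s G k i j y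
      = (1 / 2) * ∑ l, (∑ k, G y a k * (G y)⁻¹ k l) * loweredChristoffel s G l i j y := by
        simp only [christoffel_eq, Finset.mul_sum, Finset.sum_mul]
        rw [Finset.sum_comm]
        refine Finset.sum_congr rfl fun l _ => Finset.sum_congr rfl fun k _ => ?_
        ring
    _ = (1 / 2) * loweredChristoffel s G a i j y := by
        simp only [← Matrix.mul_apply, h1, Matrix.one_apply, ite_mul, one_mul, zero_mul,
          Finset.sum_ite_eq, Finset.mem_univ, if_true]

/-- `G` is in normal form at `p`: the coordinates are normal to first order there. -/
structure IsNormalAt (s T : Set (EuclideanSpace ℝ (Fin n)))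
    (G : EuclideanSpace ℝ (Fin n) → Matrix (Fin n) (Fin n) ℝ) (p : EuclideanSpace ℝ (Fin n)) : Prop
    extends IsCoordMetric s T G where
  mem : p ∈ T
  eq_one : G p = 1
  deriv_eq_zero : ∀ k i j, partialDeriv s k (fun z => G z i j) p = 0

theorem IsNormalAt.inv_eq_one (h : IsNormalAt s T G p) : (G p)⁻¹ = 1 := by
  rw [h.eq_one, inv_one]

/-- The product rule for `G⁻¹ G = 1`, recorded at every point of `T` so that it can be
differentiated again. -/
theorem IsCoordMetric.sum_partialDeriv_inv (h : IsCoordMetric s T G)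
    {y : EuclideanSpace ℝ (Fin n)} (hy : y ∈ T) (b i l : Fin n) :
    ∑ j, (partialDeriv s b (fun z => (G z)⁻¹ i j) y * G y j l +
      (G y)⁻¹ i j * partialDeriv s b (fun z => G z j l) y) = 0 := by
  have h1 : EqOn (fun z => ∑ j, (G z)⁻¹ i j * G z j l)
      (fun _ => (1 : Matrix (Fin n) (Fin n) ℝ) i l) T := by
    intro z hz
    have := Matrix.nonsing_inv_mul _ (h.isUnit_det z hz)
    simp only [← Matrix.mul_apply, this]
  have h2 := h.partialDeriv_congr h1 hy b
  rw [partialDeriv_const, h.partialDeriv_sum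
    (fun j => (h.contDiffOn_inv i j).mul (h.smooth j l)) hy] at h2
  rw [← h2]
  exact Finset.sum_congr rfl fun j _ =>
    (h.partialDeriv_mul (h.contDiffOn_inv i j) (h.smooth j l) hy b).symm

theorem IsNormalAt.partialDeriv_inv (h : IsNormalAt s T G p) (b i l : Fin n) :
    partialDeriv s b (fun z => (G z)⁻¹ i l) p = 0 := by
  have := h.sum_partialDeriv_inv h.mem b i l
  simpa [h.eq_one, h.deriv_eq_zero, Matrix.one_apply] using this

/-- Second differentiation of `G⁻¹ G = 1`; the cross terms contain first derivatives, which vanish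
at `p`. -/
theorem IsNormalAt.partialDeriv_partialDeriv_inv (h : IsNormalAt s T G p) (a b i l : Fin n) :
    partialDeriv s a (partialDeriv s b (fun z => (G z)⁻¹ i l)) p =
      -partialDeriv s a (partialDeriv s b (fun z => G z i l)) p := by
  have h1 : EqOn (fun y => ∑ j, (partialDeriv s b (fun z => (G z)⁻¹ i j) y * G y j l +
      (G y)⁻¹ i j * partialDeriv s b (fun z => G z j l) y)) (fun _ => 0) T :=
    fun y hy => h.sum_partialDeriv_inv hy b i l
  have h2 := h.partialDeriv_congr h1 h.mem a
  have hK := h.contDiffOn_inv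
  have hdK := fun i j => h.contDiffOn_partialDeriv (hK i j) b
  have hdG := fun i j => h.contDiffOn_partialDeriv (h.smooth i j) b
  rw [partialDeriv_const, h.partialDeriv_sum
    (fun j => ((hdK i j).mul (h.smooth j l)).add ((hK i j).mul (hdG j l))) h.mem] at h2
  have h3 : ∀ j, partialDeriv s a (fun y => partialDeriv s b (fun z => (G z)⁻¹ i j) y * G y j l +
      (G y)⁻¹ i j * partialDeriv s b (fun z => G z j l) y) p =
      partialDeriv s a (partialDeriv s b (fun z => (G z)⁻¹ i j)) p *
          (1 : Matrix (Fin n) (Fin n) ℝ) j l +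
        (1 : Matrix (Fin n) (Fin n) ℝ) i j *
          partialDeriv s a (partialDeriv s b (fun z => G z j l)) p := by
    intro j
    rw [h.partialDeriv_add ((hdK i j).mul (h.smooth j l)) ((hK i j).mul (hdG j l)) h.mem,
      h.partialDeriv_mul (hdK i j) (h.smooth j l) h.mem,
      h.partialDeriv_mul (hK i j) (hdG j l) h.mem, h.partialDeriv_inv, h.partialDeriv_inv,
      h.eq_one, inv_one]
    ring
  simp only [h3, Finset.sum_add_distrib, Matrix.one_apply] at h2
  simp at h2
  linarith

theorem IsNormalAt.loweredChristoffel_eq_zero (h : IsNormalAt s T G p) (l i j : Fin n) :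
    loweredChristoffel s G l i j p = 0 := by
  simp [loweredChristoffel, h.deriv_eq_zero]

theorem IsNormalAt.christoffel_eq_zero (h : IsNormalAt s T G p) (k i j : Fin n) :
    christoffel s G k i j p = 0 := by
  simp [christoffel_eq, h.loweredChristoffel_eq_zero]

theorem IsCoordMetric.partialDeriv_christoffel (h : IsCoordMetric s T G)
    {y : EuclideanSpace ℝ (Fin n)} (hy : y ∈ T) (a k i j : Fin n) :
    partialDeriv s a (christoffel s G k i j) y = (1 / 2) * ∑ l,
      (partialDeriv s a (fun z => (G z)⁻¹ k l) y * loweredChristoffel s G l i j y +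
        (G y)⁻¹ k l * partialDeriv s a (loweredChristoffel s G l i j) y) := by
  have hB := h.contDiffOn_loweredChristoffel
  rw [christoffel_eq, h.partialDeriv_const_mul (ContDiffOn.sum fun l _ =>
    (h.contDiffOn_inv _ _).mul (hB l i j)) hy,
    h.partialDeriv_sum (fun l => (h.contDiffOn_inv _ _).mul (hB l i j)) hy]
  congr 1
  exact Finset.sum_congr rfl fun l _ => h.partialDeriv_mul (h.contDiffOn_inv _ _) (hB l i j) hy a

theorem IsNormalAt.partialDeriv_christoffel_eq (h : IsNormalAt s T G p) (a k i j : Fin n) :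
    partialDeriv s a (christoffel s G k i j) p =
      (1 / 2) * partialDeriv s a (loweredChristoffel s G k i j) p := by
  rw [h.partialDeriv_christoffel h.mem]
  simp [h.loweredChristoffel_eq_zero, h.inv_eq_one, Matrix.one_apply]

theorem IsNormalAt.partialDeriv_partialDeriv_christoffel (h : IsNormalAt s T G p)
    (b a k i j : Fin n) :
    partialDeriv s b (partialDeriv s a (christoffel s G k i j)) p =
      (1 / 2) * partialDeriv s b (partialDeriv s a (loweredChristoffel s G k i j)) p := by
  have hK := h.contDiffOn_inv
  have hB := h.contDiffOn_loweredChristoffel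
  have hdK := fun i j => h.contDiffOn_partialDeriv (hK i j) a
  have hdB := fun l i j => h.contDiffOn_partialDeriv (hB l i j) a
  rw [h.partialDeriv_congr (fun y hy => h.partialDeriv_christoffel hy a k i j) h.mem,
    h.partialDeriv_const_mul (ContDiffOn.sum fun l _ => ((hdK k l).mul (hB l i j)).add
      ((hK k l).mul (hdB l i j))) h.mem,
    h.partialDeriv_sum (fun l => ((hdK k l).mul (hB l i j)).add
      ((hK k l).mul (hdB l i j))) h.mem]
  congr 1
  have h3 : ∀ l, partialDeriv s b (fun y =>
      partialDeriv s a (fun z => (G z)⁻¹ k l) y * loweredChristoffel s G l i j y +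
        (G y)⁻¹ k l * partialDeriv s a (loweredChristoffel s G l i j) y) p =
      (1 : Matrix (Fin n) (Fin n) ℝ) k l *
        partialDeriv s b (partialDeriv s a (loweredChristoffel s G l i j)) p := by
    intro l
    rw [h.partialDeriv_add ((hdK k l).mul (hB l i j)) ((hK k l).mul (hdB l i j)) h.mem,
      h.partialDeriv_mul (hdK k l) (hB l i j) h.mem,
      h.partialDeriv_mul (hK k l) (hdB l i j) h.mem, h.partialDeriv_inv, h.partialDeriv_inv,
      h.loweredChristoffel_eq_zero, h.inv_eq_one]
    ring
  simp [h3, Matrix.one_apply]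

theorem IsCoordMetric.partialDeriv_loweredChristoffel (h : IsCoordMetric s T G)
    {y : EuclideanSpace ℝ (Fin n)} (hy : y ∈ T) (a l i j : Fin n) :
    partialDeriv s a (loweredChristoffel s G l i j) y =
      partialDeriv s a (partialDeriv s i (fun z => G z j l)) y +
      partialDeriv s a (partialDeriv s j (fun z => G z i l)) y -
      partialDeriv s a (partialDeriv s l (fun z => G z i j)) y := by
  have hd := fun k i j => h.contDiffOn_partialDeriv (h.smooth i j) k
  have : loweredChristoffel s G l i j = fun y => (partialDeriv s i (fun z => G z j l) y +
    partialDeriv s j (fun z => G z i l) y) - partialDeriv s l (fun z => G z i j) y := rfl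
  rw [this, h.partialDeriv_sub ((hd _ _ _).add (hd _ _ _)) (hd _ _ _) hy,
    h.partialDeriv_add (hd _ _ _) (hd _ _ _) hy]

theorem IsCoordMetric.partialDeriv_partialDeriv_loweredChristoffel (h : IsCoordMetric s T G)
    {y : EuclideanSpace ℝ (Fin n)} (hy : y ∈ T) (b a l i j : Fin n) :
    partialDeriv s b (partialDeriv s a (loweredChristoffel s G l i j)) y =
      partialDeriv s b (partialDeriv s a (partialDeriv s i (fun z => G z j l))) y +
      partialDeriv s b (partialDeriv s a (partialDeriv s j (fun z => G z i l))) y -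
      partialDeriv s b (partialDeriv s a (partialDeriv s l (fun z => G z i j))) y := by
  have hd := fun a k i j => h.contDiffOn_partialDeriv
    (h.contDiffOn_partialDeriv (h.smooth i j) k) a
  rw [h.partialDeriv_congr (fun y hy => h.partialDeriv_loweredChristoffel hy a l i j) hy,
    h.partialDeriv_sub ((hd _ _ _ _).add (hd _ _ _ _)) (hd _ _ _ _) hy,
    h.partialDeriv_add (hd _ _ _ _) (hd _ _ _ _) hy]

theorem IsNormalAt.coordRicci_eq (h : IsNormalAt s T G p) (i j : Fin n) :
    coordRicci s G i j p = ∑ k, (partialDeriv s k (christoffel s G k i j) p -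
      partialDeriv s j (christoffel s G k i k) p) := by
  simp [coordRicci, h.christoffel_eq_zero]

/-- The quadratic terms are products of two Christoffel symbols, both zero at `p`, so they still
vanish after one differentiation. -/
theorem IsNormalAt.partialDeriv_coordRicci (h : IsNormalAt s T G p) (a i j : Fin n) :
    partialDeriv s a (coordRicci s G i j) p =
      ∑ k, (partialDeriv s a (partialDeriv s k (christoffel s G k i j)) p -
        partialDeriv s a (partialDeriv s j (christoffel s G k i k)) p) := by
  have hΓ := h.contDiffOn_christoffel
  have hd := fun a k i j => h.contDiffOn_partialDeriv (hΓ k i j) a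
  have hq := fun k l => ((hΓ k k l).mul (hΓ l i j)).sub ((hΓ k j l).mul (hΓ l i k))
  have h0 : coordRicci s G i j = fun y => ∑ k, (partialDeriv s k (christoffel s G k i j) y -
      partialDeriv s j (christoffel s G k i k) y) + ∑ k, ∑ l, (christoffel s G k k l y *
        christoffel s G l i j y - christoffel s G k j l y * christoffel s G l i k y) := rfl
  rw [h0, h.partialDeriv_add (ContDiffOn.sum fun k _ => (hd _ _ _ _).sub (hd _ _ _ _))
    (ContDiffOn.sum fun k _ => ContDiffOn.sum fun l _ => hq k l) h.mem,
    h.partialDeriv_sum (fun k => (hd _ _ _ _).sub (hd _ _ _ _)) h.mem,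
    h.partialDeriv_sum (fun k => ContDiffOn.sum fun l _ => hq k l) h.mem]
  have h1 : ∀ k, partialDeriv s a (fun y => ∑ l, (christoffel s G k k l y *
        christoffel s G l i j y - christoffel s G k j l y * christoffel s G l i k y)) p = 0 := by
    intro k
    rw [h.partialDeriv_sum (fun l => hq k l) h.mem]
    refine Finset.sum_eq_zero fun l _ => ?_
    rw [h.partialDeriv_sub ((hΓ k k l).mul (hΓ l i j)) ((hΓ k j l).mul (hΓ l i k)) h.mem,
      h.partialDeriv_mul (hΓ k k l) (hΓ l i j) h.mem,
      h.partialDeriv_mul (hΓ k j l) (hΓ l i k) h.mem]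
    simp [h.christoffel_eq_zero]
  simp only [h1, Finset.sum_const_zero, add_zero]
  exact Finset.sum_congr rfl fun k _ => h.partialDeriv_sub (hd _ _ _ _) (hd _ _ _ _) h.mem a

/-- The contracted second Bianchi identity. -/
theorem IsNormalAt.bianchi (h : IsNormalAt s T G p) (i : Fin n) :
    ∑ j, partialDeriv s j (coordRicci s G i j) p =
      (1 / 2) * ∑ j, partialDeriv s i (coordRicci s G j j) p := by
  have hd := fun k i j => h.contDiffOn_partialDeriv (h.smooth i j) k
  -- At `p` both sides reduce to third partial derivatives of the metric. Their symmetry in the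
  -- three derivative indices and in the two metric indices turns the identity into a relabelling of
  -- sums.
  set D : Fin n → Fin n → Fin n → Fin n → Fin n → ℝ := fun a b c i j =>
    partialDeriv s a (partialDeriv s b (partialDeriv s c (fun z => G z i j))) p with hD
  have h12 : ∀ a b c i j, D a b c i j = D b a c i j := fun a b c i j =>
    h.partialDeriv_comm (hd c i j) h.mem a b
  have h23 : ∀ a b c i j, D a b c i j = D a c b i j := fun a b c i j =>
    h.partialDeriv_congr (fun y hy => h.partialDeriv_comm (h.smooth i j) hy b c) h.mem a
  have hs : ∀ a b c i j, D a b c i j = D a b c j i := by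
    intro a b c i j
    refine h.partialDeriv_congr (fun y hy => h.partialDeriv_congr (fun y hy =>
      h.partialDeriv_congr (fun y hy => h.symm y hy i j) hy c) hy b) h.mem a
  have hR : ∀ a i j, partialDeriv s a (coordRicci s G i j) p =
      (1 / 2) * ∑ k, (D a k i j k + D a k j i k - D a k k i j - D a j i k k) := by
    intro a i j
    rw [h.partialDeriv_coordRicci, Finset.mul_sum]
    refine Finset.sum_congr rfl fun k _ => ?_
    rw [h.partialDeriv_partialDeriv_christoffel, h.partialDeriv_partialDeriv_christoffel,
      h.partialDeriv_partialDeriv_loweredChristoffel h.mem,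
      h.partialDeriv_partialDeriv_loweredChristoffel h.mem]
    simp only [hD]
    ring
  have hX : ∑ j, ∑ k, D j k j i k = ∑ j, ∑ k, D j k k i j := by
    rw [Finset.sum_comm]
    refine Finset.sum_congr rfl fun k _ => Finset.sum_congr rfl fun j _ => ?_
    rw [h12]
  have hY : ∑ j, ∑ k, D i k k j j = ∑ j, ∑ k, D i j j k k := Finset.sum_comm
  simp only [hR, ← Finset.mul_sum]
  have e1 : ∑ j, ∑ k, (D j k i j k + D j k j i k - D j k k i j - D j j i k k) =
      ∑ j, ∑ k, D i j k j k - ∑ j, ∑ k, D i j j k k := by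
    simp only [Finset.sum_add_distrib, Finset.sum_sub_distrib, hX]
    rw [add_sub_cancel_right]
    congr 1
    · refine Finset.sum_congr rfl fun j _ => Finset.sum_congr rfl fun k _ => ?_
      rw [h23 j k i, h12 j i k]
    · refine Finset.sum_congr rfl fun j _ => Finset.sum_congr rfl fun k _ => ?_
      rw [h23 j j i, h12 j i j]
  have e2 : ∑ j, ∑ k, (D i k j j k + D i k j j k - D i k k j j - D i j j k k) =
      2 * (∑ j, ∑ k, D i j k j k - ∑ j, ∑ k, D i j j k k) := by
    simp only [Finset.sum_add_distrib, Finset.sum_sub_distrib, hY]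
    have : ∑ j, ∑ k, D i k j j k = ∑ j, ∑ k, D i j k j k :=
      Finset.sum_congr rfl fun j _ => Finset.sum_congr rfl fun k _ => h23 i k j j k
    rw [this]
    ring
  rw [e1, e2]
  ring

end CoordMetric

/-! ## The quasi-Einstein equation in normal coordinates -/

section QuasiEinstein

/-- The squared length of the gradient of `f`. -/
noncomputable def coordGradSq {n : ℕ} (s : Set (EuclideanSpace ℝ (Fin n)))
    (G : EuclideanSpace ℝ (Fin n) → Matrix (Fin n) (Fin n) ℝ)
    (f : EuclideanSpace ℝ (Fin n) → ℝ) (y : EuclideanSpace ℝ (Fin n)) : ℝ :=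
  ∑ i, ∑ j, (G y)⁻¹ i j * (partialDeriv s i f y * partialDeriv s j f y)

variable {n : ℕ} {s T : Set (EuclideanSpace ℝ (Fin n))}
  {G : EuclideanSpace ℝ (Fin n) → Matrix (Fin n) (Fin n) ℝ} {p : EuclideanSpace ℝ (Fin n)}
  {w : EuclideanSpace ℝ (Fin n) → ℝ} {m c : ℝ}

theorem IsCoordMetric.contDiffOn_coordGradSq (h : IsCoordMetric s T G) (hw : ContDiffOn ℝ ∞ w T) :
    ContDiffOn ℝ ∞ (coordGradSq s G w) T :=
  ContDiffOn.sum fun i _ => ContDiffOn.sum fun j _ => (h.contDiffOn_inv i j).mul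
    ((h.contDiffOn_partialDeriv hw i).mul (h.contDiffOn_partialDeriv hw j))

theorem IsNormalAt.coordHess_eq (h : IsNormalAt s T G p) (i j : Fin n) :
    coordHess s G w i j p = partialDeriv s i (partialDeriv s j w) p := by
  simp [coordHess, h.christoffel_eq_zero]

theorem IsNormalAt.partialDeriv_coordHess (h : IsNormalAt s T G p) (hw : ContDiffOn ℝ ∞ w T)
    (a i j : Fin n) : partialDeriv s a (coordHess s G w i j) p =
      partialDeriv s a (partialDeriv s i (partialDeriv s j w)) p -
        ∑ l, partialDeriv s a (christoffel s G l i j) p * partialDeriv s l w p := by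
  have hd := fun i => h.contDiffOn_partialDeriv hw i
  have hd2 := fun i j => h.contDiffOn_partialDeriv (hd j) i
  have hΓ := fun k => h.contDiffOn_christoffel k i j
  have h0 : coordHess s G w i j = fun y => partialDeriv s i (partialDeriv s j w) y -
    ∑ k, christoffel s G k i j y * partialDeriv s k w y := rfl
  rw [h0, h.partialDeriv_sub (hd2 i j) (ContDiffOn.sum fun k _ => (hΓ k).mul (hd k)) h.mem,
    h.partialDeriv_sum (fun k => (hΓ k).mul (hd k)) h.mem]
  congr 1
  refine Finset.sum_congr rfl fun k _ => ?_
  rw [h.partialDeriv_mul (hΓ k) (hd k) h.mem, h.christoffel_eq_zero]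
  ring

theorem IsNormalAt.partialDeriv_christoffel_eq' (h : IsNormalAt s T G p) (a k i j : Fin n) :
    partialDeriv s a (christoffel s G k i j) p = (1 / 2) *
      (partialDeriv s a (partialDeriv s i (fun z => G z j k)) p +
      partialDeriv s a (partialDeriv s j (fun z => G z i k)) p -
      partialDeriv s a (partialDeriv s k (fun z => G z i j)) p) := by
  rw [h.partialDeriv_christoffel_eq, h.partialDeriv_loweredChristoffel h.mem]

theorem IsCoordMetric.partialDeriv_partialDeriv_symm (h : IsCoordMetric s T G)
    {y : EuclideanSpace ℝ (Fin n)} (hy : y ∈ T) (a b i j : Fin n) :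
    partialDeriv s a (partialDeriv s b (fun z => G z i j)) y =
      partialDeriv s a (partialDeriv s b (fun z => G z j i)) y :=
  h.partialDeriv_congr (fun _ hy => h.partialDeriv_congr (fun y hy => h.symm y hy i j) hy b) hy a

/-- The Ricci tensor as the other contraction of the curvature tensor. -/
theorem IsNormalAt.coordRicci_eq' (h : IsNormalAt s T G p) (k l : Fin n) :
    coordRicci s G k l p = ∑ i, (partialDeriv s k (christoffel s G l i i) p -
      partialDeriv s i (christoffel s G l k i) p) := by
  rw [h.coordRicci_eq]
  refine Finset.sum_congr rfl fun i _ => ?_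
  have hc := fun a b i j => h.partialDeriv_comm (h.smooth i j) h.mem a b
  have hs := fun a b i j => h.partialDeriv_partialDeriv_symm h.mem a b i j
  simp only [h.partialDeriv_christoffel_eq']
  rw [hc i k l i, hs k i l i, hc l k i i, hc l i k i]
  linarith [hc i k i l]

variable (hm : m ≠ 0)

section

variable (hw : ContDiffOn ℝ ∞ w T)
  (hH : ∀ y ∈ T, ∀ i j, coordHess s G w i j y = w y / m * coordRicci s G i j y)
  (hS : ∀ y ∈ T, ∑ i, ∑ j, (G y)⁻¹ i j * coordRicci s G i j y = c)

include hS in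
theorem IsNormalAt.sum_coordRicci (h : IsNormalAt s T G p) : ∑ i, coordRicci s G i i p = c := by
  rw [← hS p h.mem]
  simp [h.inv_eq_one, Matrix.one_apply]

include hS in
-- The trace is constant, and the inverse metric in it has zero derivative at `p`.
theorem IsNormalAt.sum_partialDeriv_coordRicci (h : IsNormalAt s T G p) (a : Fin n) :
    ∑ i, partialDeriv s a (coordRicci s G i i) p = 0 := by
  have h1 := h.partialDeriv_congr (f := fun y => ∑ i, ∑ j, (G y)⁻¹ i j * coordRicci s G i j y)
    (g := fun _ => c) hS h.mem a
  have hR := h.contDiffOn_coordRicci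
  have hK := h.contDiffOn_inv
  rw [partialDeriv_const, h.partialDeriv_sum (fun i => ContDiffOn.sum fun j _ =>
    (hK i j).mul (hR i j)) h.mem] at h1
  rw [← h1]
  refine Finset.sum_congr rfl fun i _ => ?_
  rw [h.partialDeriv_sum (fun j => (hK i j).mul (hR i j)) h.mem]
  have : ∀ j, partialDeriv s a (fun y => (G y)⁻¹ i j * coordRicci s G i j y) p =
      (1 : Matrix (Fin n) (Fin n) ℝ) i j * partialDeriv s a (coordRicci s G i j) p := by
    intro j
    rw [h.partialDeriv_mul (hK i j) (hR i j) h.mem, h.partialDeriv_inv, h.inv_eq_one]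
    ring
  simp [this, Matrix.one_apply]

include hS in
-- The divergence of the Ricci tensor is half the differential of the scalar curvature.
theorem IsNormalAt.sum_partialDeriv_coordRicci' (h : IsNormalAt s T G p) (i : Fin n) :
    ∑ j, partialDeriv s j (coordRicci s G i j) p = 0 := by
  rw [h.bianchi, h.sum_partialDeriv_coordRicci hS, mul_zero]

include hw hH in
theorem IsNormalAt.partialDeriv_coordHess_eq (h : IsNormalAt s T G p) (a i j : Fin n) :
    partialDeriv s a (coordHess s G w i j) p = (partialDeriv s a w p * coordRicci s G i j p +
      w p * partialDeriv s a (coordRicci s G i j) p) / m := by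
  rw [h.partialDeriv_congr (g := fun y => m⁻¹ * (w y * coordRicci s G i j y))
    (fun y hy => by simp only [hH y hy]; ring) h.mem,
    h.partialDeriv_const_mul (hw.mul (h.contDiffOn_coordRicci i j)) h.mem,
    h.partialDeriv_mul hw (h.contDiffOn_coordRicci i j) h.mem]
  ring

include hm hw hH hS in
/-- The gradient of `w` is an eigenvector of the Ricci tensor. -/
theorem IsNormalAt.sum_coordRicci_mul_partialDeriv (h : IsNormalAt s T G p) (k : Fin n) :
    (m - 1) * ∑ l, coordRicci s G k l p * partialDeriv s l w p = -c * partialDeriv s k w p := by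
  have hd := fun i => h.contDiffOn_partialDeriv hw i
  -- The quantity `∇Δw - div Hess w` is computed twice. Commutation of derivatives gives `-Ric(∇w)`;
  -- the equation for `Hess w`, with constant trace and divergence-free Ricci tensor, gives `(c ∇w -
  -- Ric(∇w)) / m`.
  have h1 : ∑ i, (partialDeriv s k (coordHess s G w i i) p -
      partialDeriv s i (coordHess s G w k i) p) =
      -∑ l, coordRicci s G k l p * partialDeriv s l w p := by
    simp only [h.coordRicci_eq', Finset.sum_mul]
    rw [Finset.sum_comm, ← Finset.sum_neg_distrib]
    refine Finset.sum_congr rfl fun i _ => ?_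
    rw [h.partialDeriv_coordHess hw, h.partialDeriv_coordHess hw,
      h.partialDeriv_comm (hd i) h.mem i k]
    simp only [sub_mul, Finset.sum_sub_distrib]
    ring
  have h2 : ∑ i, (partialDeriv s k (coordHess s G w i i) p -
      partialDeriv s i (coordHess s G w k i) p) =
      (partialDeriv s k w p * c - ∑ l, coordRicci s G k l p * partialDeriv s l w p) / m := by
    simp only [h.partialDeriv_coordHess_eq hw hH, Finset.sum_sub_distrib, ← Finset.sum_div,
      Finset.sum_add_distrib, ← Finset.mul_sum, h.sum_coordRicci hS,
      h.sum_partialDeriv_coordRicci hS, h.sum_partialDeriv_coordRicci' hS]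
    rw [← sub_div]
    congr 1
    have : ∑ i, partialDeriv s i w p * coordRicci s G k i p =
      ∑ l, coordRicci s G k l p * partialDeriv s l w p :=
        Finset.sum_congr rfl fun i _ => mul_comm _ _
    rw [this]
    ring
  rw [h1, eq_div_iff hm] at h2
  linarith

include hw in
theorem IsNormalAt.partialDeriv_coordGradSq (h : IsNormalAt s T G p) (k : Fin n) :
    partialDeriv s k (coordGradSq s G w) p =
      2 * ∑ i, coordHess s G w k i p * partialDeriv s i w p := by
  have hd := fun i => h.contDiffOn_partialDeriv hw i
  have hK := h.contDiffOn_inv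
  have h0 : coordGradSq s G w = fun y => ∑ i, ∑ j, (G y)⁻¹ i j *
    (partialDeriv s i w y * partialDeriv s j w y) := rfl
  rw [h0, h.partialDeriv_sum (fun i => ContDiffOn.sum fun j _ => (hK i j).mul
    ((hd i).mul (hd j))) h.mem, Finset.mul_sum]
  refine Finset.sum_congr rfl fun i _ => ?_
  rw [h.partialDeriv_sum (fun j => (hK i j).mul ((hd i).mul (hd j))) h.mem]
  have : ∀ j, partialDeriv s k (fun y => (G y)⁻¹ i j *
      (partialDeriv s i w y * partialDeriv s j w y)) p =
      (1 : Matrix (Fin n) (Fin n) ℝ) i j *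
        (coordHess s G w k i p * partialDeriv s j w p +
          partialDeriv s i w p * coordHess s G w k j p) := by
    intro j
    rw [h.partialDeriv_mul (hK i j) ((hd i).mul (hd j)) h.mem,
      h.partialDeriv_mul (hd i) (hd j) h.mem, h.partialDeriv_inv, h.inv_eq_one,
      h.coordHess_eq, h.coordHess_eq]
    ring
  simp only [this, Matrix.one_apply, ite_mul, one_mul, zero_mul, Finset.sum_ite_eq,
    Finset.mem_univ, if_true]
  ring

include hm hw hH hS in
-- A first integral: `∇|∇w|² = 2 Hess w(∇w) = (2w/m) Ric(∇w) = -2c w ∇w / (m(m-1))`. The eigenvector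
-- property can be solved for `Ric(∇w)` only if `m ≠ 1`.
theorem IsNormalAt.partialDeriv_coordGradSq_add (h : IsNormalAt s T G p) (hm1 : m ≠ 1)
    (k : Fin n) : partialDeriv s k
      (fun y => coordGradSq s G w y + c / (m * (m - 1)) * (w y * w y)) p = 0 := by
  have h1 := h.sum_coordRicci_mul_partialDeriv hm hw hH hS k
  have hm2 : m - 1 ≠ 0 := sub_ne_zero.2 hm1
  rw [h.partialDeriv_add (h.contDiffOn_coordGradSq hw) (contDiffOn_const.mul (hw.mul hw)) h.mem,
    h.partialDeriv_coordGradSq hw, h.partialDeriv_const_mul (hw.mul hw) h.mem,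
    h.partialDeriv_mul hw hw h.mem]
  simp only [hH p h.mem, mul_assoc, ← Finset.mul_sum]
  have h2 : ∑ l, coordRicci s G k l p * partialDeriv s l w p =
      -c * partialDeriv s k w p / (m - 1) := by
    rw [eq_div_iff hm2, mul_comm, h1]
  rw [h2]
  field_simp
  ring

include hw in
-- Bochner's formula before taking the trace. In the chosen coordinates curvature enters only
-- through second derivatives of the inverse metric, which are minus those of the metric.
theorem IsNormalAt.partialDeriv_partialDeriv_coordGradSq (h : IsNormalAt s T G p) (k : Fin n) :
    partialDeriv s k (partialDeriv s k (coordGradSq s G w)) p =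
      ∑ i, (2 * (partialDeriv s k (partialDeriv s k (partialDeriv s i w)) p * partialDeriv s i w p +
          coordHess s G w k i p ^ 2) -
        ∑ j, partialDeriv s k (partialDeriv s k (fun z => G z i j)) p *
          (partialDeriv s i w p * partialDeriv s j w p)) := by
  have hd := fun i => h.contDiffOn_partialDeriv hw i
  have hd2 := fun i => h.contDiffOn_partialDeriv (hd i) k
  have hK := h.contDiffOn_inv
  have hdK := fun i j => h.contDiffOn_partialDeriv (hK i j) k
  have hA := fun i j => ((hdK i j).mul ((hd i).mul (hd j))).add
    ((hK i j).mul (((hd2 i).mul (hd j)).add ((hd i).mul (hd2 j))))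
  have h1 : EqOn (partialDeriv s k (coordGradSq s G w)) (fun y => ∑ i, ∑ j,
      (partialDeriv s k (fun z => (G z)⁻¹ i j) y * (partialDeriv s i w y * partialDeriv s j w y) +
      (G y)⁻¹ i j * (partialDeriv s k (partialDeriv s i w) y * partialDeriv s j w y +
        partialDeriv s i w y * partialDeriv s k (partialDeriv s j w) y))) T := by
    intro y hy
    have h0 : coordGradSq s G w = fun y => ∑ i, ∑ j, (G y)⁻¹ i j *
      (partialDeriv s i w y * partialDeriv s j w y) := rfl
    rw [h0, h.partialDeriv_sum (fun i => ContDiffOn.sum fun j _ => (hK i j).mul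
      ((hd i).mul (hd j))) hy]
    refine Finset.sum_congr rfl fun i _ => ?_
    rw [h.partialDeriv_sum (fun j => (hK i j).mul ((hd i).mul (hd j))) hy]
    refine Finset.sum_congr rfl fun j _ => ?_
    rw [h.partialDeriv_mul (hK i j) ((hd i).mul (hd j)) hy, h.partialDeriv_mul (hd i) (hd j) hy]
  rw [h.partialDeriv_congr h1 h.mem, h.partialDeriv_sum (fun i => ContDiffOn.sum fun j _ => hA i j)
    h.mem]
  refine Finset.sum_congr rfl fun i _ => ?_
  rw [h.partialDeriv_sum (fun j => hA i j) h.mem]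
  have h2 : ∀ j, partialDeriv s k (fun y =>
      (partialDeriv s k (fun z => (G z)⁻¹ i j) y * (partialDeriv s i w y * partialDeriv s j w y) +
      (G y)⁻¹ i j * (partialDeriv s k (partialDeriv s i w) y * partialDeriv s j w y +
        partialDeriv s i w y * partialDeriv s k (partialDeriv s j w) y))) p =
      -(partialDeriv s k (partialDeriv s k (fun z => G z i j)) p *
          (partialDeriv s i w p * partialDeriv s j w p)) +
      (1 : Matrix (Fin n) (Fin n) ℝ) i j * (
        (partialDeriv s k (partialDeriv s k (partialDeriv s i w)) p * partialDeriv s j w p +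
          coordHess s G w k i p * coordHess s G w k j p) +
        (coordHess s G w k i p * coordHess s G w k j p + partialDeriv s i w p *
          partialDeriv s k (partialDeriv s k (partialDeriv s j w)) p)) := by
    intro j
    rw [h.partialDeriv_add ((hdK i j).mul ((hd i).mul (hd j)))
      ((hK i j).mul (((hd2 i).mul (hd j)).add ((hd i).mul (hd2 j)))) h.mem,
      h.partialDeriv_mul (hdK i j) ((hd i).mul (hd j)) h.mem,
      h.partialDeriv_mul (hK i j) (((hd2 i).mul (hd j)).add ((hd i).mul (hd2 j))) h.mem,
      h.partialDeriv_add ((hd2 i).mul (hd j)) ((hd i).mul (hd2 j)) h.mem,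
      h.partialDeriv_mul (hd2 i) (hd j) h.mem, h.partialDeriv_mul (hd i) (hd2 j) h.mem,
      h.partialDeriv_inv, h.partialDeriv_partialDeriv_inv, h.inv_eq_one,
      h.coordHess_eq, h.coordHess_eq]
    ring
  simp only [h2, Finset.sum_add_distrib, Matrix.one_apply, ite_mul, one_mul, zero_mul,
    Finset.sum_ite_eq, Finset.mem_univ, if_true, Finset.sum_neg_distrib]
  ring

include hm hw hH hS in
-- The Laplacian of the first integral at `p`. The derivatives of the Ricci tensor drop out since it
-- is divergence-free, and by the eigenvector property the term `Ric(∇w, ∇w)` cancels the term `c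
-- |∇w|²`. What remains is `|Hess w|² = (w/m)² |Ric|²` against a multiple of `c² w²`, and `w²` can
-- be cancelled.
theorem IsNormalAt.sum_coordRicci_sq (h : IsNormalAt s T G p) (hm1 : m ≠ 1) (hwp : w p ≠ 0)
    (hF : ∀ y ∈ T, ∀ k, partialDeriv s k
      (fun y => coordGradSq s G w y + c / (m * (m - 1)) * (w y * w y)) y = 0) :
    (m - 1) * ∑ k, ∑ i, coordRicci s G k i p ^ 2 = - c ^ 2 := by
  have hd := fun i => h.contDiffOn_partialDeriv hw i
  have hm2 : m - 1 ≠ 0 := sub_ne_zero.2 hm1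
  have hgs := h.contDiffOn_coordGradSq hw
  set κ := c / (m * (m - 1)) with hκ
  set D : Fin n → ℝ := fun i => partialDeriv s i w p with hD
  set R : Fin n → Fin n → ℝ := fun i j => coordRicci s G i j p with hR
  set S : Fin n → Fin n → Fin n → Fin n → ℝ := fun a b i j =>
    partialDeriv s a (partialDeriv s b (fun z => G z i j)) p with hSd
  -- The third derivative is reordered so that it can be read off from the derivative of the
  -- Hessian, which the equation expresses through the Ricci tensor.
  have h3 : ∀ k i, partialDeriv s k (partialDeriv s k (partialDeriv s i w)) p =
      (D k * R i k + w p * partialDeriv s k (coordRicci s G i k) p) / m +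
        (1 / 2) * ∑ l, (S k i k l + S k k i l - S k l i k) * D l := by
    intro k i
    have e1 := h.partialDeriv_coordHess hw k i k
    rw [h.partialDeriv_coordHess_eq hw hH] at e1
    have e2 : partialDeriv s k (partialDeriv s k (partialDeriv s i w)) p =
        partialDeriv s k (partialDeriv s i (partialDeriv s k w)) p :=
      h.partialDeriv_congr (fun y hy => h.partialDeriv_comm hw hy k i) h.mem k
    simp only [h.partialDeriv_christoffel_eq', mul_assoc, ← Finset.mul_sum] at e1
    rw [e2]
    linarith
  have h4 : ∀ k, partialDeriv s k (partialDeriv s k (coordGradSq s G w)) p +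
      κ * (2 * (D k * D k + w p * (w p / m * R k k))) = 0 := by
    intro k
    have e1 := h.partialDeriv_congr (f := partialDeriv s k
      (fun y => coordGradSq s G w y + κ * (w y * w y))) (g := fun _ => 0)
      (fun y hy => hF y hy k) h.mem k
    have e2 : EqOn (partialDeriv s k (fun y => coordGradSq s G w y + κ * (w y * w y)))
        (fun y => partialDeriv s k (coordGradSq s G w) y +
          κ * (partialDeriv s k w y * w y + w y * partialDeriv s k w y)) T := by
      intro y hy
      rw [h.partialDeriv_add hgs (contDiffOn_const.mul (hw.mul hw)) hy,
        h.partialDeriv_const_mul (hw.mul hw) hy, h.partialDeriv_mul hw hw hy]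
    rw [partialDeriv_const, h.partialDeriv_congr e2 h.mem,
      h.partialDeriv_add (h.contDiffOn_partialDeriv hgs k)
        (contDiffOn_const.mul (((hd k).mul hw).add (hw.mul (hd k)))) h.mem,
      h.partialDeriv_const_mul (((hd k).mul hw).add (hw.mul (hd k))) h.mem,
      h.partialDeriv_add ((hd k).mul hw) (hw.mul (hd k)) h.mem,
      h.partialDeriv_mul (hd k) hw h.mem, h.partialDeriv_mul hw (hd k) h.mem,
      ← h.coordHess_eq (w := w), hH p h.mem] at e1
    rw [← e1]
    simp only [hD, hR]
    ring
  have h5 : ∑ k, ∑ i, (2 * (((D k * R i k + w p * partialDeriv s k (coordRicci s G i k) p) / m +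
        (1 / 2) * ∑ l, (S k i k l + S k k i l - S k l i k) * D l) * D i +
        (w p / m * R k i) ^ 2) - ∑ j, S k k i j * (D i * D j)) +
      ∑ k, κ * (2 * (D k * D k + w p * (w p / m * R k k))) = 0 := by
    rw [← Finset.sum_add_distrib]
    refine Finset.sum_eq_zero fun k _ => ?_
    rw [← h4 k, h.partialDeriv_partialDeriv_coordGradSq hw]
    simp only [h3, hH p h.mem]
    rfl
  have e1 : ∀ k i, (2 * (((D k * R i k + w p * partialDeriv s k (coordRicci s G i k) p) / m +
        (1 / 2) * ∑ l, (S k i k l + S k k i l - S k l i k) * D l) * D i +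
        (w p / m * R k i) ^ 2) - ∑ j, S k k i j * (D i * D j)) =
      2 / m * (R i k * D k * D i) +
      2 * w p / m * (partialDeriv s k (coordRicci s G i k) p * D i) +
      2 * (w p / m) ^ 2 * R k i ^ 2 +
      (∑ l, S k i k l * (D l * D i) - ∑ l, S k l i k * (D l * D i)) := by
    intro k i
    have : ∑ l, (S k i k l + S k k i l - S k l i k) * D l * D i = ∑ l, S k i k l * (D l * D i) -
        ∑ l, S k l i k * (D l * D i) + ∑ j, S k k i j * (D i * D j) := by
      rw [← Finset.sum_sub_distrib, ← Finset.sum_add_distrib]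
      exact Finset.sum_congr rfl fun l _ => by ring
    rw [← Finset.sum_mul] at this
    linear_combination this
  -- The leftover second derivatives of the metric cancel in pairs when `i` and `l` are exchanged.
  have e2 : ∀ k, ∑ i, (∑ l, S k i k l * (D l * D i) - ∑ l, S k l i k * (D l * D i)) = 0 := by
    intro k
    rw [Finset.sum_sub_distrib, sub_eq_zero, Finset.sum_comm]
    refine Finset.sum_congr rfl fun i _ => Finset.sum_congr rfl fun l _ => ?_
    have : S k l k i = S k l i k := h.partialDeriv_partialDeriv_symm h.mem k l k i
    rw [this]
    ring
  have e3 : ∑ k, ∑ i, R i k * D k * D i = -c / (m - 1) * ∑ i, D i * D i := by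
    rw [Finset.sum_comm, Finset.mul_sum]
    refine Finset.sum_congr rfl fun i _ => ?_
    have := h.sum_coordRicci_mul_partialDeriv hm hw hH hS i
    rw [← Finset.sum_mul]
    have h6 : ∑ l, R i l * D l = -c / (m - 1) * D i := by
      rw [div_mul_eq_mul_div, eq_div_iff hm2, mul_comm, this]
    rw [h6]
    ring
  have e4 : ∑ k, ∑ i, partialDeriv s k (coordRicci s G i k) p * D i = 0 := by
    rw [Finset.sum_comm]
    refine Finset.sum_eq_zero fun i _ => ?_
    rw [← Finset.sum_mul, h.sum_partialDeriv_coordRicci' hS, zero_mul]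
  have e5 : ∑ k, κ * (2 * (D k * D k + w p * (w p / m * R k k))) =
      κ * (2 * (∑ k, D k * D k + w p ^ 2 / m * c)) := by
    rw [← h.sum_coordRicci hS, ← Finset.mul_sum, ← Finset.mul_sum, Finset.sum_add_distrib,
      Finset.mul_sum]
    congr 3
    exact Finset.sum_congr rfl fun k _ => by ring
  simp only [e1, Finset.sum_add_distrib, ← Finset.mul_sum, e2, e3, e4, e5,
    Finset.sum_const_zero] at h5
  rw [hκ] at h5
  have hw2 : w p ^ 2 ≠ 0 := pow_ne_zero _ hwp
  field_simp at h5
  have h6 : w p ^ 2 * ((m - 1) * ∑ k, ∑ i, R k i ^ 2 + c ^ 2) = 0 := by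
    linear_combination h5 / 2
  rcases mul_eq_zero.1 h6 with h7 | h7
  · exact absurd h7 hw2
  · linarith

include hm hw hH hS in
-- Cauchy–Schwarz for `Ric(∇w)`: `c²|∇w|² = (m-1)²|Ric(∇w)|² ≤ (m-1)²|Ric|²|∇w|² = -(m-1)c²|∇w|²`.
-- Dividing by `|∇w|²` leaves `m c² ≤ 0`; here the positivity of `m` is decisive.
theorem IsNormalAt.scalar_eq_zero (h : IsNormalAt s T G p) (hm0 : 0 < m) (hm1 : m ≠ 1)
    (hwp : w p ≠ 0) (hF : ∀ y ∈ T, ∀ k, partialDeriv s k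
      (fun y => coordGradSq s G w y + c / (m * (m - 1)) * (w y * w y)) y = 0)
    {k : Fin n} (hk : partialDeriv s k w p ≠ 0) : c = 0 := by
  have h1 := h.sum_coordRicci_sq hm hw hH hS hm1 hwp hF
  have h2 := h.sum_coordRicci_mul_partialDeriv hm hw hH hS
  set D : Fin n → ℝ := fun i => partialDeriv s i w p with hD
  set R : Fin n → Fin n → ℝ := fun i j => coordRicci s G i j p with hR
  have hDpos : 0 < ∑ i, D i ^ 2 :=
    Finset.sum_pos' (fun i _ => sq_nonneg _) ⟨k, Finset.mem_univ _, by positivity⟩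
  have h3 : c ^ 2 * ∑ i, D i ^ 2 ≤ (m - 1) ^ 2 * ((∑ k, ∑ i, R k i ^ 2) * ∑ i, D i ^ 2) := by
    rw [Finset.sum_mul, Finset.mul_sum, Finset.mul_sum]
    refine Finset.sum_le_sum fun i _ => ?_
    have e1 := Finset.sum_mul_sq_le_sq_mul_sq Finset.univ (R i) D
    have e2 : c ^ 2 * D i ^ 2 = (m - 1) ^ 2 * (∑ l, R i l * D l) ^ 2 := by
      rw [← mul_pow, ← mul_pow]
      have := h2 i
      change (m - 1) * ∑ l, R i l * D l = -c * D i at this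
      rw [this]
      ring
    rw [e2]
    exact mul_le_mul_of_nonneg_left e1 (sq_nonneg _)
  have h4 : (m - 1) ^ 2 * ((∑ k, ∑ i, R k i ^ 2) * ∑ i, D i ^ 2) =
      -(m - 1) * c ^ 2 * ∑ i, D i ^ 2 := by
    have : (m - 1) * ∑ k, ∑ i, R k i ^ 2 = - c ^ 2 := h1
    linear_combination (m - 1) * (∑ i, D i ^ 2) * this
  rw [h4] at h3
  have h5 : c ^ 2 ≤ -(m - 1) * c ^ 2 := le_of_mul_le_mul_right h3 hDpos
  by_contra hc
  have : 0 < m * c ^ 2 := by positivity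
  nlinarith

include hm hw hH hS in
-- For `c = 0` the identity of `IsNormalAt.sum_coordRicci_sq` says that a sum of squares vanishes.
theorem IsNormalAt.coordRicci_eq_zero (h : IsNormalAt s T G p) (hm1 : m ≠ 1)
    (hwp : w p ≠ 0) (hc : c = 0) (hF : ∀ y ∈ T, ∀ k, partialDeriv s k
      (fun y => coordGradSq s G w y + c / (m * (m - 1)) * (w y * w y)) y = 0) (i j : Fin n) :
    coordRicci s G i j p = 0 := by
  have h1 := h.sum_coordRicci_sq hm hw hH hS hm1 hwp hF
  have hm2 : m - 1 ≠ 0 := sub_ne_zero.2 hm1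
  rw [hc] at h1
  have h2 : ∑ k, ∑ i, coordRicci s G k i p ^ 2 = 0 := by
    have : (m - 1) * ∑ k, ∑ i, coordRicci s G k i p ^ 2 = 0 := by simpa using h1
    exact (mul_eq_zero.1 this).resolve_left hm2
  rw [Finset.sum_eq_zero_iff_of_nonneg (fun _ _ => Finset.sum_nonneg fun _ _ => sq_nonneg _)] at h2
  have h3 := h2 i (Finset.mem_univ _)
  rw [Finset.sum_eq_zero_iff_of_nonneg (fun _ _ => sq_nonneg _)] at h3
  exact pow_eq_zero_iff (by norm_num) |>.1 (h3 j (Finset.mem_univ _))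

end

end QuasiEinstein

/-! ## Coordinate changes -/

section CoordChange

set_option linter.unusedSectionVars false

theorem ContinuousLinearMap.isInvertible_of_isUnit_det {n : ℕ}
    {A : EuclideanSpace ℝ (Fin n) →L[ℝ] EuclideanSpace ℝ (Fin n)}
    (hA : IsUnit (Matrix.of fun a i => A (EuclideanSpace.single i 1) a).det) :
    A.IsInvertible := by
  set J : Matrix (Fin n) (Fin n) ℝ := Matrix.of fun a i => A (EuclideanSpace.single i 1) a with hJ
  have hJv : ∀ v : EuclideanSpace ℝ (Fin n), (A v).ofLp = J.mulVec v.ofLp := by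
    intro v
    conv_lhs => rw [euclideanSpace_eq_sum_single v, map_sum]
    ext a
    simp [Matrix.mulVec, dotProduct, hJ, mul_comm]
  have hinj : Function.Injective A.toLinearMap := by
    intro v w hvw
    have h1 : J.mulVec v.ofLp = J.mulVec w.ofLp := by
      rw [← hJv, ← hJv]
      exact congrArg _ hvw
    have h2 := congrArg (J⁻¹).mulVec h1
    rw [Matrix.mulVec_mulVec, Matrix.mulVec_mulVec, Matrix.nonsing_inv_mul _ hA,
      Matrix.one_mulVec, Matrix.one_mulVec] at h2
    exact (WithLp.equiv 2 (Fin n → ℝ)).injective h2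
  exact ⟨(LinearEquiv.ofInjectiveEndo A.toLinearMap hinj).toContinuousLinearEquiv, by
    ext v; rfl⟩

/-- The chain rule for partial derivatives. -/
theorem IsCoordDomain.partialDeriv_comp {n k : ℕ} {s T : Set (EuclideanSpace ℝ (Fin n))}
    {s' T' : Set (EuclideanSpace ℝ (Fin k))} (h : IsCoordDomain s T) (h' : IsCoordDomain s' T')
    {f : EuclideanSpace ℝ (Fin n) → EuclideanSpace ℝ (Fin k)} (hf : ContDiffOn ℝ ∞ f T)
    (hmaps : MapsTo f T T') {u : EuclideanSpace ℝ (Fin k) → ℝ} (hu : ContDiffOn ℝ ∞ u T')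
    {y : EuclideanSpace ℝ (Fin n)} (hy : y ∈ T) (i : Fin n) :
    partialDeriv s i (fun z => u (f z)) y =
      ∑ a, partialDeriv s' a u (f y) * partialDeriv s i (fun z => f z a) y := by
  have hfd : HasFDerivWithinAt f (fderivWithin ℝ f T y) T y :=
    (hf.differentiableOn (by simp) y hy).hasFDerivWithinAt
  have hud : HasFDerivWithinAt u (fderivWithin ℝ u s' (f y)) T' (f y) :=
    (h'.differentiableWithinAt hu (hmaps hy)).hasFDerivWithinAt.mono h'.subset
  have hc : HasFDerivWithinAt (fun z => u (f z))
      ((fderivWithin ℝ u s' (f y)).comp (fderivWithin ℝ f T y)) s y :=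
    (hud.comp y hfd hmaps).mono_of_mem_nhdsWithin (h.mem_nhdsWithin y hy)
  have hfa : ∀ a, partialDeriv s i (fun z => f z a) y =
      fderivWithin ℝ f T y (EuclideanSpace.single i 1) a := by
    intro a
    have h1 : HasFDerivWithinAt (fun z => f z a)
        ((EuclideanSpace.proj a : EuclideanSpace ℝ (Fin k) →L[ℝ] ℝ).comp (fderivWithin ℝ f T y))
        s y := ((EuclideanSpace.proj a : EuclideanSpace ℝ (Fin k) →L[ℝ] ℝ).hasFDerivAt.comp_hasFDerivWithinAt
          y hfd).mono_of_mem_nhdsWithin (h.mem_nhdsWithin y hy)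
    rw [partialDeriv, h1.fderivWithin (h.uniqueDiffOn y (h.subset hy))]
    rfl
  rw [partialDeriv, hc.fderivWithin (h.uniqueDiffOn y (h.subset hy)),
    ContinuousLinearMap.comp_apply]
  conv_lhs => rw [euclideanSpace_eq_sum_single (fderivWithin ℝ f T y (EuclideanSpace.single i 1)),
    map_sum]
  refine Finset.sum_congr rfl fun a _ => ?_
  rw [map_smul, hfa, smul_eq_mul, mul_comm]
  rfl

theorem IsCoordDomain.partialDeriv_apply {n k : ℕ} {s T : Set (EuclideanSpace ℝ (Fin n))}
    (h : IsCoordDomain s T)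
    {f : EuclideanSpace ℝ (Fin n) → EuclideanSpace ℝ (Fin k)} (hf : ContDiffOn ℝ ∞ f T)
    {y : EuclideanSpace ℝ (Fin n)} (hy : y ∈ T) (i : Fin n) (a : Fin k) :
    partialDeriv s i (fun z => f z a) y = fderivWithin ℝ f s y (EuclideanSpace.single i 1) a := by
  have hd : HasFDerivWithinAt f (fderivWithin ℝ f s y) s y :=
    (((hf y hy).mono_of_mem_nhdsWithin (h.mem_nhdsWithin y hy)).differentiableWithinAt
      (by simp)).hasFDerivWithinAt
  have h1 := (EuclideanSpace.proj a : EuclideanSpace ℝ (Fin k) →L[ℝ] ℝ).hasFDerivAt.comp_hasFDerivWithinAt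
          y hd
  rw [partialDeriv]
  have := h1.fderivWithin (h.uniqueDiffOn y (h.subset hy))
  exact congrArg (fun A : EuclideanSpace ℝ (Fin n) →L[ℝ] ℝ => A (EuclideanSpace.single i 1)) this

variable {n : ℕ} {H : Type*} [TopologicalSpace H]
  {I : ModelWithCorners ℝ (EuclideanSpace ℝ (Fin n)) H}
  {M : Type*} [TopologicalSpace M] [ChartedSpace H M] [IsManifold I ∞ M]
  {e e' : OpenPartialHomeomorph M H}

theorem OpenPartialHomeomorph.trans_mem_maximalAtlas (he : e ∈ IsManifold.maximalAtlas I ∞ M)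
    {h : OpenPartialHomeomorph H H} (hh : h ∈ contDiffGroupoid ∞ I) :
    e ≫ₕ h ∈ IsManifold.maximalAtlas I ∞ M := by
  rw [IsManifold.mem_maximalAtlas_iff, mem_maximalAtlas_iff]
  intro e₀ he₀
  have h1 := mem_maximalAtlas_iff.1 (IsManifold.mem_maximalAtlas_iff.1 he) e₀ he₀
  constructor
  · rw [OpenPartialHomeomorph.trans_symm_eq_symm_trans_symm, OpenPartialHomeomorph.trans_assoc]
    exact (contDiffGroupoid ∞ I).trans ((contDiffGroupoid ∞ I).symm hh) h1.1
  · rw [← OpenPartialHomeomorph.trans_assoc]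
    exact (contDiffGroupoid ∞ I).trans h1.2 hh

theorem isCoordDomain_extend_target (e : OpenPartialHomeomorph M H) :
    IsCoordDomain (range I) (e.extend I).target where
  uniqueDiffOn := I.uniqueDiffOn
  subset := e.extend_target_subset_range
  mem_nhdsWithin := fun _ hy => extend_target_mem_nhdsWithin' hy
  subset_closure := fun _ hy => I.range_subset_closure_interior (e.extend_target_subset_range hy)

variable (I) in
/-- The domain of the coordinate change from `e` to `e'`. -/
noncomputable def overlap (e e' : OpenPartialHomeomorph M H) : Set (EuclideanSpace ℝ (Fin n)) :=
  (e.extend I).target ∩ (e.extend I).symm ⁻¹' e'.source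

variable (I) in
/-- The coordinate change from `e` to `e'`. -/
noncomputable def coordChange (e e' : OpenPartialHomeomorph M H) (y : EuclideanSpace ℝ (Fin n)) :
    EuclideanSpace ℝ (Fin n) :=
  e'.extend I ((e.extend I).symm y)

theorem isCoordDomain_overlap (e e' : OpenPartialHomeomorph M H) :
    IsCoordDomain (range I) (overlap I e e') where
  uniqueDiffOn := I.uniqueDiffOn
  subset := inter_subset_left.trans e.extend_target_subset_range
  mem_nhdsWithin := fun y hy => by
    have h1 : (e.extend I).target ∈ 𝓝[range I] y := extend_target_mem_nhdsWithin' hy.1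
    have h2 : ContinuousWithinAt (e.extend I).symm (e.extend I).target y :=
      (e.continuousOn_extend_symm (I := I)) y hy.1
    have h3 := (h2.mono_of_mem_nhdsWithin h1).preimage_mem_nhdsWithin (e'.open_source.mem_nhds hy.2)
    exact Filter.inter_mem h1 h3
  subset_closure := fun _ hy => (isCoordDomain_extend_target e).subset_closure hy.1

theorem mapsTo_coordChange (e e' : OpenPartialHomeomorph M H) :
    MapsTo (coordChange I e e') (overlap I e e') (e'.extend I).target := fun y hy =>
  (e'.extend I).map_source (by rw [e'.extend_source]; exact hy.2)

theorem contDiffOn_coordChange (he : e ∈ IsManifold.maximalAtlas I ∞ M)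
    (he' : e' ∈ IsManifold.maximalAtlas I ∞ M) :
    ContDiffOn ℝ ∞ (coordChange I e e') (overlap I e e') := by
  have h1 := (contMDiffOn_extend_symm_target he).mono
    (inter_subset_left : overlap I e e' ⊆ (e.extend I).target)
  have h2 : ContMDiffOn I 𝓘(ℝ, EuclideanSpace ℝ (Fin n)) ∞ (e'.extend I) e'.source :=
    fun x hx => (e'.contMDiffAt_extend he' hx).contMDiffWithinAt
  exact (h2.comp h1 fun y hy => hy.2).contDiffOn

theorem extend_mem_overlap {x : M} (hx : x ∈ e.source) (hx' : x ∈ e'.source) :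
    e.extend I x ∈ overlap I e e' :=
  ⟨(e.extend I).map_source (by rwa [e.extend_source]), by
    rw [mem_preimage, e.extend_left_inv hx]; exact hx'⟩

theorem coordChange_extend {x : M} (hx : x ∈ e.source) :
    coordChange I e e' (e.extend I x) = e'.extend I x := by
  rw [coordChange, e.extend_left_inv hx]

theorem inChart_coordChange (f : M → ℝ) {y : EuclideanSpace ℝ (Fin n)} (hy : y ∈ overlap I e e') :
    inChart I e' f (coordChange I e e' y) = inChart I e f y := by
  rw [inChart, inChart, coordChange, e'.extend_left_inv hy.2]

theorem contDiffOn_inChart {f : M → ℝ} (hf : ContMDiff I 𝓘(ℝ, ℝ) ∞ f)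
    (he : e ∈ IsManifold.maximalAtlas I ∞ M) :
    ContDiffOn ℝ ∞ (inChart I e f) (e.extend I).target :=
  (hf.comp_contMDiffOn (contMDiffOn_extend_symm_target he)).contDiffOn

theorem partialDeriv_inChart {f : M → ℝ} (he : e ∈ IsManifold.maximalAtlas I ∞ M)
    (he' : e' ∈ IsManifold.maximalAtlas I ∞ M)
    (hf : ContDiffOn ℝ ∞ (inChart I e' f) (e'.extend I).target)
    {y : EuclideanSpace ℝ (Fin n)} (hy : y ∈ overlap I e e') (i : Fin n) :
    partialDeriv (range I) i (inChart I e f) y =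
      ∑ a, partialDeriv (range I) a (inChart I e' f) (coordChange I e e' y) *
        partialDeriv (range I) i (fun z => coordChange I e e' z a) y := by
  rw [(isCoordDomain_overlap e e').partialDeriv_congr
    (fun z hz => (inChart_coordChange f hz).symm) hy]
  exact (isCoordDomain_overlap e e').partialDeriv_comp (isCoordDomain_extend_target e')
    (contDiffOn_coordChange he he') (mapsTo_coordChange e e') hf hy i

variable [RiemannianBundle (fun x : M => TangentSpace I x)]
  [IsContMDiffRiemannianBundle I ∞ (EuclideanSpace ℝ (Fin n)) (fun x : M => TangentSpace I x)]

theorem isCoordMetric_chartMetric (he : e ∈ IsManifold.maximalAtlas I ∞ M) :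
    IsCoordMetric (range I) (e.extend I).target (chartMetric I e) where
  toIsCoordDomain := isCoordDomain_extend_target e
  smooth := contDiffOn_chartMetric he
  symm := fun y _ i j => chartMetric_symm e y i j
  isUnit_det := fun _ hy => isUnit_det_chartMetric he hy

theorem chartMetric_coordChange (he : e ∈ IsManifold.maximalAtlas I ∞ M)
    (he' : e' ∈ IsManifold.maximalAtlas I ∞ M) {y : EuclideanSpace ℝ (Fin n)}
    (hy : y ∈ overlap I e e') (i j : Fin n) :
    chartMetric I e y i j = ∑ a, ∑ b, chartMetric I e' (coordChange I e e' y) a b *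
      (partialDeriv (range I) i (fun z => coordChange I e e' z a) y *
        partialDeriv (range I) j (fun z => coordChange I e e' z b) y) := by
  rw [chartMetric_transition he hy.1 he' hy.2]
  simp only [(isCoordDomain_overlap e e').partialDeriv_apply (contDiffOn_coordChange he he') hy]
  rfl

/-- The squared length of the gradient does not depend on the chart. -/
theorem coordGradSq_coordChange {f : M → ℝ} (he : e ∈ IsManifold.maximalAtlas I ∞ M)
    (he' : e' ∈ IsManifold.maximalAtlas I ∞ M)
    (hf : ContDiffOn ℝ ∞ (inChart I e' f) (e'.extend I).target)
    {y : EuclideanSpace ℝ (Fin n)} (hy : y ∈ overlap I e e') :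
    coordGradSq (range I) (chartMetric I e) (inChart I e f) y =
      coordGradSq (range I) (chartMetric I e') (inChart I e' f) (coordChange I e e' y) := by
  -- With the Jacobian `J`, differentials change by `Jᵀ` and metrics by `B ↦ Jᵀ B J`, so the
  -- quadratic form of the inverse metric on differentials is unchanged.
  set J : Matrix (Fin n) (Fin n) ℝ := Matrix.of fun a i =>
    partialDeriv (range I) i (fun z => coordChange I e e' z a) y with hJ
  set A := chartMetric I e y with hA
  set B := chartMetric I e' (coordChange I e e' y) with hB
  set d : Fin n → ℝ := fun i => partialDeriv (range I) i (inChart I e f) y with hd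
  set d' : Fin n → ℝ := fun a =>
    partialDeriv (range I) a (inChart I e' f) (coordChange I e e' y) with hd'
  have hdd : d = J.transpose.mulVec d' := by
    ext i
    simp only [hd, partialDeriv_inChart he he' hf hy, Matrix.mulVec, dotProduct, hd', hJ,
      Matrix.transpose_apply, Matrix.of_apply]
    exact Finset.sum_congr rfl fun a _ => mul_comm _ _
  have hAB : A = J.transpose * B * J := by
    ext i j
    rw [hA, chartMetric_coordChange he he' hy, Matrix.mul_assoc, Matrix.mul_apply]
    refine Finset.sum_congr rfl fun a _ => ?_
    rw [Matrix.mul_apply, Finset.mul_sum]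
    refine Finset.sum_congr rfl fun b _ => ?_
    simp only [hJ, hB, Matrix.transpose_apply, Matrix.of_apply]
    ring
  have hJdet : IsUnit J.det := by
    have h1 := isUnit_det_chartMetric he hy.1
    rw [← hA, hAB, Matrix.det_mul, Matrix.det_mul] at h1
    exact isUnit_of_mul_isUnit_right h1
  have hJt : IsUnit J.transpose.det := by rwa [Matrix.det_transpose]
  have hq : ∀ (K : Matrix (Fin n) (Fin n) ℝ) (v : Fin n → ℝ),
      ∑ i, ∑ j, K i j * (v i * v j) = v ⬝ᵥ K.mulVec v := by
    intro K v
    simp only [dotProduct, Matrix.mulVec, Finset.mul_sum]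
    exact Finset.sum_congr rfl fun i _ => Finset.sum_congr rfl fun j _ => by ring
  have h1 : coordGradSq (range I) (chartMetric I e) (inChart I e f) y = d ⬝ᵥ (A⁻¹).mulVec d :=
    hq _ _
  have h2 : coordGradSq (range I) (chartMetric I e') (inChart I e' f) (coordChange I e e' y) =
      d' ⬝ᵥ (B⁻¹).mulVec d' := hq _ _
  rw [h1, h2, hdd, hAB, Matrix.mul_inv_rev, Matrix.mul_inv_rev, Matrix.mulVec_mulVec,
    Matrix.mul_assoc, Matrix.mul_assoc, Matrix.nonsing_inv_mul _ hJt, Matrix.mul_one,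
    Matrix.mulVec_transpose, ← Matrix.dotProduct_mulVec, Matrix.mulVec_mulVec,
    ← Matrix.mul_assoc, Matrix.mul_nonsing_inv _ hJdet, Matrix.one_mul]

end CoordChange

/-! ## Charts with values in the half-space -/

section HalfSpaceCharts

set_option linter.unusedSectionVars false

variable {n : ℕ} [NeZero n] {M : Type*} [TopologicalSpace M]
  [ChartedSpace (EuclideanHalfSpace n) M] [IsManifold (𝓡∂ n) ∞ M]
  {e : OpenPartialHomeomorph M (EuclideanHalfSpace n)}

/-- Interior points are defined through the preferred charts. Enlarging the atlas to the maximal one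
while keeping these charts does not alter the notion, and it makes `e` a member of the atlas. -/
theorem isInteriorPoint_iff_of_mem_maximalAtlas {k : ℕ} {H : Type*} [TopologicalSpace H]
    {I : ModelWithCorners ℝ (EuclideanSpace ℝ (Fin k)) H} {N : Type*} [TopologicalSpace N]
    [cs : ChartedSpace H N] [IsManifold I ∞ N] {e : OpenPartialHomeomorph N H}
    (he : e ∈ IsManifold.maximalAtlas I ∞ N) {x : N} (hx : x ∈ e.source) :
    I.IsInteriorPoint x ↔ e.extend I x ∈ interior (e.extend I).target := by
  have hc : ∀ {h h' : OpenPartialHomeomorph N H}, h ∈ IsManifold.maximalAtlas I ∞ N →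
      h' ∈ IsManifold.maximalAtlas I ∞ N → h.symm ≫ₕ h' ∈ contDiffGroupoid ∞ I :=
    fun h h' => IsManifold.compatible_of_mem_maximalAtlas h h'
  have hx0 : ∀ x : N, chartAt H x ∈ IsManifold.maximalAtlas I ∞ N :=
    fun x => IsManifold.chart_mem_maximalAtlas x
  let cs' : ChartedSpace H N :=
    { atlas := IsManifold.maximalAtlas I ∞ N
      chartAt := chartAt H
      mem_chart_source := mem_chart_source H
      chart_mem_atlas := hx0 }
  have hm : @IsManifold ℝ _ _ _ _ H _ I ∞ N _ cs' :=
    @IsManifold.mk ℝ _ _ _ _ H _ I ∞ N _ cs'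
      (@HasGroupoid.mk H _ N _ cs' _ hc)
  exact @ModelWithCorners.isInteriorPoint_iff_of_mem_atlas ℝ _ _ _ _ H _ I N _ cs' ∞ hm e x
    (by simp) he hx

theorem mem_interior_iff_coord_pos (he : e ∈ IsManifold.maximalAtlas (𝓡∂ n) ∞ M) {x : M}
    (hx : x ∈ e.source) : x ∈ (𝓡∂ n).interior M ↔ 0 < e.extend (𝓡∂ n) x 0 := by
  have h1 : x ∈ (𝓡∂ n).interior M ↔ (𝓡∂ n).IsInteriorPoint x := Iff.rfl
  rw [h1, isInteriorPoint_iff_of_mem_maximalAtlas he hx]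
  have h2 : interior (range (𝓡∂ n)) = {y | 0 < y 0} := interior_range_modelWithCornersEuclideanHalfSpace n
  constructor
  · intro h
    have := OpenPartialHomeomorph.interior_extend_target_subset_interior_range _ h
    rwa [h2] at this
  · intro h
    refine e.mem_interior_extend_target (e.map_source hx) ?_
    rw [h2]
    exact h

theorem extend_coord_nonneg (e : OpenPartialHomeomorph M (EuclideanHalfSpace n)) (x : M) :
    0 ≤ e.extend (𝓡∂ n) x 0 :=
  (e x).2

theorem mem_boundary_iff_coord_eq_zero (he : e ∈ IsManifold.maximalAtlas (𝓡∂ n) ∞ M) {x : M}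
    (hx : x ∈ e.source) : x ∈ (𝓡∂ n).boundary M ↔ e.extend (𝓡∂ n) x 0 = 0 := by
  rw [← ModelWithCorners.compl_interior, mem_compl_iff, mem_interior_iff_coord_pos he hx, not_lt]
  exact ⟨fun h => le_antisymm h (extend_coord_nonneg e x), fun h => h.le⟩

/-- Changing a chart by a map with invertible derivative. -/
theorem exists_chart_change (he : e ∈ IsManifold.maximalAtlas (𝓡∂ n) ∞ M) {q : M}
    (hq : q ∈ e.source) {f : EuclideanSpace ℝ (Fin n) → EuclideanSpace ℝ (Fin n)}
    {U : Set (EuclideanSpace ℝ (Fin n))} (hU : IsOpen U) (hqU : e.extend (𝓡∂ n) q ∈ U)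
    (hf : ContDiffOn ℝ ∞ f (range (𝓡∂ n) ∩ U))
    (hmaps : MapsTo f (range (𝓡∂ n) ∩ U) (range (𝓡∂ n)))
    (hbd : ∀ y ∈ U, y 0 = 0 → f y 0 = 0)
    (hinv : (fderivWithin ℝ f (range (𝓡∂ n)) (e.extend (𝓡∂ n) q)).IsInvertible) :
    ∃ e' ∈ IsManifold.maximalAtlas (𝓡∂ n) ∞ M, q ∈ e'.source ∧ e'.source ⊆ e.source ∧
      ∀ x ∈ e'.source, e.extend (𝓡∂ n) x ∈ U ∧ e'.extend (𝓡∂ n) x = f (e.extend (𝓡∂ n) x) := by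
  obtain ⟨h, hh, hqh, hhU, hhf⟩ := exists_halfSpace_localDiffeo (p₀ := e q) hU hqU hf hmaps hbd hinv
  refine ⟨e ≫ₕ h, e.trans_mem_maximalAtlas he hh, ?_, ?_, ?_⟩
  · rw [OpenPartialHomeomorph.trans_source]
    exact ⟨hq, hqh⟩
  · rw [OpenPartialHomeomorph.trans_source]
    exact inter_subset_left
  · intro x hx
    rw [OpenPartialHomeomorph.trans_source] at hx
    exact ⟨hhU _ hx.2, hhf _ hx.2⟩

/-- The part of the target of a chart that corresponds to interior points. -/
theorem isCoordDomain_interior_target (e : OpenPartialHomeomorph M (EuclideanHalfSpace n)) :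
    IsCoordDomain (range (𝓡∂ n)) ((e.extend (𝓡∂ n)).target ∩ {y | 0 < y 0}) :=
  (isCoordDomain_extend_target e).mono_isOpen isOpen_coord_zero_pos

end HalfSpaceCharts

/-! ## Normal charts -/

section NormalCharts

set_option linter.unusedSectionVars false

variable {n : ℕ}

theorem IsCoordDomain.partialDeriv_coord {s T : Set (EuclideanSpace ℝ (Fin n))}
    (h : IsCoordDomain s T) {y : EuclideanSpace ℝ (Fin n)} (hy : y ∈ T) (i k : Fin n) :
    partialDeriv s i (fun z => z k) y = if k = i then 1 else 0 := by
  have h1 : HasFDerivWithinAt (fun z : EuclideanSpace ℝ (Fin n) => z k)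
      (EuclideanSpace.proj k : EuclideanSpace ℝ (Fin n) →L[ℝ] ℝ) s y :=
    (EuclideanSpace.proj k : EuclideanSpace ℝ (Fin n) →L[ℝ] ℝ).hasFDerivWithinAt
  rw [partialDeriv, h1.fderivWithin (h.uniqueDiffOn y (h.subset hy))]
  simp

theorem contDiff_coord (k : Fin n) : ContDiff ℝ ∞ (fun z : EuclideanSpace ℝ (Fin n) => z k) :=
  (EuclideanSpace.proj k : EuclideanSpace ℝ (Fin n) →L[ℝ] ℝ).contDiff

/-- The quadratic change of coordinates with linear part `L` and quadratic part `L * Γ / 2`. -/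
noncomputable def quadChange (L : Matrix (Fin n) (Fin n) ℝ) (Γ : Fin n → Fin n → Fin n → ℝ)
    (v₀ y₀ y : EuclideanSpace ℝ (Fin n)) : EuclideanSpace ℝ (Fin n) :=
  WithLp.toLp 2 fun a => v₀ a + ∑ k, L a k * ((y k - y₀ k) +
    (1 / 2) * ∑ i, ∑ j, Γ k i j * ((y i - y₀ i) * (y j - y₀ j)))

variable {L : Matrix (Fin n) (Fin n) ℝ} {Γ : Fin n → Fin n → Fin n → ℝ}
  {v₀ y₀ y : EuclideanSpace ℝ (Fin n)}

theorem contDiff_quadChange_apply (a : Fin n) :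
    ContDiff ℝ ∞ (fun y => quadChange L Γ v₀ y₀ y a) := by
  have hc := fun k => (contDiff_coord (n := n) k).sub (contDiff_const (c := y₀ k))
  exact contDiff_const.add (ContDiff.sum fun k _ => contDiff_const.mul ((hc k).add
    (contDiff_const.mul (ContDiff.sum fun i _ => ContDiff.sum fun j _ =>
      contDiff_const.mul ((hc i).mul (hc j))))))

theorem contDiff_quadChange : ContDiff ℝ ∞ (quadChange L Γ v₀ y₀) :=
  contDiff_euclidean.2 contDiff_quadChange_apply

theorem quadChange_self : quadChange L Γ v₀ y₀ y₀ = v₀ := by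
  ext a
  simp [quadChange]

variable {s T : Set (EuclideanSpace ℝ (Fin n))}

theorem IsCoordDomain.partialDeriv_coord_sub (h : IsCoordDomain s T) (hy : y ∈ T) (i k : Fin n) :
    partialDeriv s i (fun z => z k - y₀ k) y = if k = i then 1 else 0 := by
  rw [h.partialDeriv_sub (contDiff_coord k).contDiffOn contDiffOn_const hy, partialDeriv_const,
    sub_zero, h.partialDeriv_coord hy]

theorem IsCoordDomain.partialDeriv_quadChange (h : IsCoordDomain s T) (hy : y ∈ T)
    (hΓ : ∀ k i j, Γ k i j = Γ k j i) (i a : Fin n) :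
    partialDeriv s i (fun z => quadChange L Γ v₀ y₀ z a) y =
      L a i + ∑ k, L a k * ∑ j, Γ k i j * (y j - y₀ j) := by
  have hc : ∀ k, ContDiffOn ℝ ∞ (fun z : EuclideanSpace ℝ (Fin n) => z k - y₀ k) T := fun k =>
    ((contDiff_coord (n := n) k).sub (contDiff_const (c := y₀ k))).contDiffOn
  have hq : ∀ k p q, ContDiffOn ℝ ∞ (fun z : EuclideanSpace ℝ (Fin n) =>
      Γ k p q * ((z p - y₀ p) * (z q - y₀ q))) T :=
    fun k p q => contDiffOn_const.mul ((hc p).mul (hc q))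
  have hs : ∀ k, ContDiffOn ℝ ∞ (fun z : EuclideanSpace ℝ (Fin n) =>
      (1 / 2 : ℝ) * ∑ p, ∑ q, Γ k p q * ((z p - y₀ p) * (z q - y₀ q))) T := fun k =>
    contDiffOn_const.mul (ContDiffOn.sum fun p _ => ContDiffOn.sum fun q _ => hq k p q)
  have h0 : (fun z => quadChange L Γ v₀ y₀ z a) = fun z => v₀ a + ∑ k, L a k * ((z k - y₀ k) +
    (1 / 2) * ∑ p, ∑ q, Γ k p q * ((z p - y₀ p) * (z q - y₀ q))) := rfl
  rw [h0, h.partialDeriv_add contDiffOn_const (ContDiffOn.sum fun k _ =>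
    contDiffOn_const.mul ((hc k).add (hs k))) hy, partialDeriv_const, zero_add,
    h.partialDeriv_sum (fun k => contDiffOn_const.mul ((hc k).add (hs k))) hy]
  have h1 : ∀ k, partialDeriv s i (fun z => L a k * ((z k - y₀ k) +
      (1 / 2) * ∑ p, ∑ q, Γ k p q * ((z p - y₀ p) * (z q - y₀ q)))) y =
      L a k * (if k = i then 1 else 0) + L a k * ∑ j, Γ k i j * (y j - y₀ j) := by
    intro k
    rw [h.partialDeriv_const_mul ((hc k).add (hs k)) hy, h.partialDeriv_add (hc k) (hs k) hy,
      h.partialDeriv_coord_sub hy, h.partialDeriv_const_mul (ContDiffOn.sum fun p _ =>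
        ContDiffOn.sum fun q _ => hq k p q) hy,
      h.partialDeriv_sum (fun p => ContDiffOn.sum fun q _ => hq k p q) hy, mul_add]
    congr 2
    have h2 : ∀ p, partialDeriv s i (fun z => ∑ q, Γ k p q * ((z p - y₀ p) * (z q - y₀ q))) y =
        ∑ q, ((if p = i then Γ k p q * (y q - y₀ q) else 0) +
          (if q = i then Γ k p q * (y p - y₀ p) else 0)) := by
      intro p
      rw [h.partialDeriv_sum (fun q => hq k p q) hy]
      refine Finset.sum_congr rfl fun q _ => ?_
      rw [h.partialDeriv_const_mul ((hc p).mul (hc q)) hy, h.partialDeriv_mul (hc p) (hc q) hy,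
        h.partialDeriv_coord_sub hy, h.partialDeriv_coord_sub hy]
      split_ifs <;> ring
    have h3 : ∀ p, ∑ q, (if p = i then Γ k p q * (y q - y₀ q) else 0) =
        if p = i then ∑ q, Γ k p q * (y q - y₀ q) else 0 := by
      intro p
      split_ifs <;> simp
    simp only [h2, Finset.sum_add_distrib, h3, Finset.sum_ite_eq', Finset.mem_univ, if_true]
    have h4 : ∑ p, Γ k p i * (y p - y₀ p) = ∑ q, Γ k i q * (y q - y₀ q) :=
      Finset.sum_congr rfl fun p _ => by rw [hΓ]
    rw [h4]
    ring
  simp only [h1, Finset.sum_add_distrib, mul_ite, mul_one, mul_zero, Finset.sum_ite_eq',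
    Finset.mem_univ, if_true]

theorem IsCoordDomain.partialDeriv_partialDeriv_quadChange (h : IsCoordDomain s T) (hy : y ∈ T)
    (hΓ : ∀ k i j, Γ k i j = Γ k j i) (i j a : Fin n) :
    partialDeriv s i (partialDeriv s j (fun z => quadChange L Γ v₀ y₀ z a)) y =
      ∑ k, L a k * Γ k i j := by
  have hc : ∀ k, ContDiffOn ℝ ∞ (fun z : EuclideanSpace ℝ (Fin n) => z k - y₀ k) T := fun k =>
    ((contDiff_coord (n := n) k).sub (contDiff_const (c := y₀ k))).contDiffOn
  have h1 : ∀ k, ContDiffOn ℝ ∞ (fun z : EuclideanSpace ℝ (Fin n) =>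
      ∑ l, Γ k j l * (z l - y₀ l)) T := fun k =>
    ContDiffOn.sum fun l _ => contDiffOn_const.mul (hc l)
  rw [h.partialDeriv_congr (fun z hz => h.partialDeriv_quadChange hz hΓ j a) hy,
    h.partialDeriv_add contDiffOn_const (ContDiffOn.sum fun k _ => contDiffOn_const.mul (h1 k)) hy,
    partialDeriv_const, zero_add, h.partialDeriv_sum (fun k => contDiffOn_const.mul (h1 k)) hy]
  refine Finset.sum_congr rfl fun k _ => ?_
  rw [h.partialDeriv_const_mul (h1 k) hy, h.partialDeriv_sum (fun l => contDiffOn_const.mul (hc l))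
    hy]
  congr 1
  have h2 : ∀ l, partialDeriv s i (fun z => Γ k j l * (z l - y₀ l)) y =
      if l = i then Γ k j l else 0 := by
    intro l
    rw [h.partialDeriv_const_mul (hc l) hy, h.partialDeriv_coord_sub hy]
    split_ifs <;> simp
  simp only [h2, Finset.sum_ite_eq', Finset.mem_univ, if_true]
  exact hΓ _ _ _

open scoped MatrixOrder ComplexOrder in
theorem Matrix.PosDef.exists_eq_transpose_mul_self {A : Matrix (Fin n) (Fin n) ℝ}
    (hA : A.PosDef) : ∃ L : Matrix (Fin n) (Fin n) ℝ, A = L.transpose * L := by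
  obtain ⟨B, rfl⟩ := CStarAlgebra.nonneg_iff_eq_star_mul_self.mp hA.posSemidef.nonneg
  exact ⟨B, by rw [Matrix.star_eq_conjTranspose, Matrix.conjTranspose_eq_transpose_of_trivial]⟩

variable [NeZero n] {M : Type*} [TopologicalSpace M]
  [ChartedSpace (EuclideanHalfSpace n) M] [IsManifold (𝓡∂ n) ∞ M]
  [RiemannianBundle (fun x : M => TangentSpace (𝓡∂ n) x)]
  [IsContMDiffRiemannianBundle (𝓡∂ n) ∞ (EuclideanSpace ℝ (Fin n))
    (fun x : M => TangentSpace (𝓡∂ n) x)]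
  {e : OpenPartialHomeomorph M (EuclideanHalfSpace n)}

/-- Around each interior point there is a chart which is normal to first order. -/
theorem exists_normal_chart (he : e ∈ IsManifold.maximalAtlas (𝓡∂ n) ∞ M) {q : M}
    (hq : q ∈ e.source) (hqi : q ∈ (𝓡∂ n).interior M) :
    ∃ e' ∈ IsManifold.maximalAtlas (𝓡∂ n) ∞ M, q ∈ e'.source ∧
      IsNormalAt (range (𝓡∂ n)) ((e'.extend (𝓡∂ n)).target ∩ {y | 0 < y 0})
        (chartMetric (𝓡∂ n) e') (e'.extend (𝓡∂ n) q) ∧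
      ∀ u : M → ℝ, ContMDiff (𝓡∂ n) 𝓘(ℝ, ℝ) ∞ u →
        (∀ a b, hessComp (𝓡∂ n) e' u q a b = 0) → ∀ i j, hessComp (𝓡∂ n) e u q i j = 0 := by
  set y₀ := e.extend (𝓡∂ n) q with hy₀
  set s := range (𝓡∂ n) with hs
  have hy₀t : y₀ ∈ (e.extend (𝓡∂ n)).target := (e.extend (𝓡∂ n)).map_source (by rwa [e.extend_source])
  have hdom : IsCoordDomain s (e.extend (𝓡∂ n)).target := isCoordDomain_extend_target e
  have hG := isCoordMetric_chartMetric he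
  set Γ : Fin n → Fin n → Fin n → ℝ := fun k i j => christoffel s (chartMetric (𝓡∂ n) e) k i j y₀ with hΓd
  have hΓ : ∀ k i j, Γ k i j = Γ k j i := fun k i j => hG.christoffel_symm hy₀t k i j
  -- The linear part `L` of the new coordinates turns the metric at `y₀` into the identity; the
  -- Christoffel symbols in the quadratic part will remove its first derivatives.
  obtain ⟨L, hL⟩ := (posDef_chartMetric he hy₀t).exists_eq_transpose_mul_self
  have hLdet : IsUnit L.det := by
    have h1 := isUnit_det_chartMetric he hy₀t
    rw [hL, Matrix.det_mul] at h1
    exact isUnit_of_mul_isUnit_right h1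
  have hGL : ∀ i j, chartMetric (𝓡∂ n) e y₀ i j = ∑ a, L a i * L a j := by
    intro i j
    rw [hL, Matrix.mul_apply]
    rfl
  have hker : ∀ v : Fin n → ℝ, (∀ i, ∑ a, v a * L a i = 0) → ∀ a, v a = 0 := by
    intro v hv a
    exact congrFun (Matrix.eq_zero_of_vecMul_eq_zero hLdet.ne_zero (funext hv)) a
  -- The base value has first coordinate `1`, so both `q` and its new image lie off the boundary
  -- hyperplane. After restriction to `U` the boundary conditions on the change of coordinates are
  -- vacuous.
  set f := quadChange L Γ (EuclideanSpace.single 0 1) y₀ with hf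
  have hfs : ContDiff ℝ ∞ f := contDiff_quadChange
  set U : Set (EuclideanSpace ℝ (Fin n)) := {y | 0 < y 0} ∩ f ⁻¹' {y | 0 < y 0} with hU
  have hUo : IsOpen U := isOpen_coord_zero_pos.inter (isOpen_coord_zero_pos.preimage hfs.continuous)
  have hy₀U : y₀ ∈ U := by
    refine ⟨(mem_interior_iff_coord_pos he hq).1 hqi, ?_⟩
    rw [mem_preimage, hf, quadChange_self]
    simp
  obtain ⟨e', he', hq', hsub, hee'⟩ := exists_chart_change he hq hUo hy₀U hfs.contDiffOn
    (fun y hy => mem_range_halfSpace.2 (le_of_lt hy.2.2))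
    (fun y hy h0 => absurd h0 (ne_of_gt hy.1)) (by
      refine ContinuousLinearMap.isInvertible_of_isUnit_det ?_
      have : (Matrix.of fun a i => fderivWithin ℝ f s y₀ (EuclideanSpace.single i 1) a) = L := by
        ext a i
        rw [Matrix.of_apply, ← hdom.partialDeriv_apply hfs.contDiffOn hy₀t,
          hdom.partialDeriv_quadChange hy₀t hΓ]
        simp
      rw [this]
      exact hLdet)
  have hdO : IsCoordDomain s (overlap (𝓡∂ n) e e') := isCoordDomain_overlap e e'
  have hO : y₀ ∈ overlap (𝓡∂ n) e e' := extend_mem_overlap hq hq'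
  have hτf : EqOn (coordChange (𝓡∂ n) e e') f (overlap (𝓡∂ n) e e') := by
    intro y hy
    rw [coordChange, (hee' _ hy.2).2, (e.extend (𝓡∂ n)).right_inv hy.1]
  have hz₀ : coordChange (𝓡∂ n) e e' y₀ = e'.extend (𝓡∂ n) q := coordChange_extend hq
  set z₀ := e'.extend (𝓡∂ n) q with hz₀d
  set J : Fin n → Fin n → EuclideanSpace ℝ (Fin n) → ℝ := fun a i =>
    partialDeriv s i (fun z => coordChange (𝓡∂ n) e e' z a) with hJ
  have hτs := contDiffOn_coordChange he he'
  have hτa : ∀ a, ContDiffOn ℝ ∞ (fun z => coordChange (𝓡∂ n) e e' z a) (overlap (𝓡∂ n) e e') := fun a =>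
    (contDiff_coord a).comp_contDiffOn hτs
  have hJs : ∀ a i, ContDiffOn ℝ ∞ (J a i) (overlap (𝓡∂ n) e e') := fun a i =>
    hdO.contDiffOn_partialDeriv (hτa a) i
  have hJf : ∀ a i, EqOn (J a i) (partialDeriv s i (fun z => f z a)) (overlap (𝓡∂ n) e e') :=
    fun a i y hy => hdO.partialDeriv_congr (fun z hz => by
      change coordChange (𝓡∂ n) e e' z a = f z a
      rw [hτf hz]) hy i
  have hJ₀ : ∀ a i, J a i y₀ = L a i := by
    intro a i
    rw [hJf a i hO, hdO.partialDeriv_quadChange hO hΓ]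
    simp
  have hQ : ∀ a k i, partialDeriv s k (J a i) y₀ = ∑ l, L a l * Γ l k i := by
    intro a k i
    rw [hdO.partialDeriv_congr (hJf a i) hO, hdO.partialDeriv_partialDeriv_quadChange hO hΓ]
  have hG' := isCoordMetric_chartMetric he'
  have hz₀t : z₀ ∈ (e'.extend (𝓡∂ n)).target := (e'.extend (𝓡∂ n)).map_source (by rwa [e'.extend_source])
  have hG'one : chartMetric (𝓡∂ n) e' z₀ = 1 := by
    have h1 : L.transpose * L = L.transpose * chartMetric (𝓡∂ n) e' z₀ * L := by
      rw [← hL]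
      ext i j
      rw [chartMetric_coordChange he he' hO, Matrix.mul_assoc, Matrix.mul_apply, hz₀]
      refine Finset.sum_congr rfl fun a _ => ?_
      rw [Matrix.mul_apply, Finset.mul_sum]
      refine Finset.sum_congr rfl fun b _ => ?_
      rw [Matrix.transpose_apply, ← hJ₀ a i, ← hJ₀ b j]
      ring
    have h2 := congrArg (fun A => (L.transpose)⁻¹ * A * L⁻¹) h1
    have hLt : IsUnit L.transpose.det := by rwa [Matrix.det_transpose]
    simp only [Matrix.mul_assoc, Matrix.mul_nonsing_inv _ hLdet, Matrix.mul_one] at h2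
    rw [Matrix.nonsing_inv_mul _ hLt, ← Matrix.mul_assoc, Matrix.nonsing_inv_mul _ hLt,
      Matrix.one_mul] at h2
    exact h2.symm
  have hcomp : ∀ (u : EuclideanSpace ℝ (Fin n) → ℝ), ContDiffOn ℝ ∞ u (e'.extend (𝓡∂ n)).target →
      ∀ k, partialDeriv s k (fun z => u (coordChange (𝓡∂ n) e e' z)) y₀ =
        ∑ c, partialDeriv s c u z₀ * L c k := by
    intro u hu k
    rw [hdO.partialDeriv_comp (isCoordDomain_extend_target e') hτs (mapsTo_coordChange e e') hu hO,
      hz₀]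
    exact Finset.sum_congr rfl fun c _ => by rw [← hJ₀ c k]
  have hG's : ∀ a b, ContDiffOn ℝ ∞ (fun z => chartMetric (𝓡∂ n) e' (coordChange (𝓡∂ n) e e' z) a b)
      (overlap (𝓡∂ n) e e') := fun a b => (hG'.smooth a b).comp hτs (mapsTo_coordChange e e')
  -- Differentiate `G = Jᵀ G' J` at `y₀`. The second derivatives of the coordinate change contribute
  -- two lowered Christoffel symbols, whose sum is exactly the derivative of `G`. So the derivative
  -- of `G'`, contracted with `L` in all three slots, is zero, and `L` is invertible.
  have hdG' : ∀ c a b, partialDeriv s c (fun z => chartMetric (𝓡∂ n) e' z a b) z₀ = 0 := by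
    have h1 : ∀ k i j, ∑ a, ∑ b, ((∑ c, partialDeriv s c (fun z => chartMetric (𝓡∂ n) e' z a b) z₀ *
        L c k) * (L a i * L b j)) = 0 := by
      intro k i j
      have e1 := hdO.partialDeriv_congr (fun y hy => chartMetric_coordChange he he' hy i j) hO k
      have hterm := fun a b => (hG's a b).mul ((hJs a i).mul (hJs b j))
      rw [hdO.partialDeriv_sum (fun a => ContDiffOn.sum fun b _ => hterm a b) hO] at e1
      have e2 : ∀ a, partialDeriv s k (fun y => ∑ b, chartMetric (𝓡∂ n) e' (coordChange (𝓡∂ n) e e' y) a b *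
          (J a i y * J b j y)) y₀ =
          ∑ b, (∑ c, partialDeriv s c (fun z => chartMetric (𝓡∂ n) e' z a b) z₀ *
            L c k) * (L a i * L b j) +
          ((∑ l, L a l * Γ l k i) * L a j + L a i * ∑ l, L a l * Γ l k j) := by
        intro a
        have e3 : ∀ b, partialDeriv s k (fun y => chartMetric (𝓡∂ n) e' (coordChange (𝓡∂ n) e e' y) a b *
          (J a i y * J b j y)) y₀ = (∑ c, partialDeriv s c (fun z => chartMetric (𝓡∂ n) e' z a b) z₀ *
            L c k) * (L a i * L b j) + if a = b then
              ((∑ l, L a l * Γ l k i) * L b j + L a i * ∑ l, L b l * Γ l k j) else 0 := by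
          intro b
          rw [hdO.partialDeriv_mul (hG's a b) ((hJs a i).mul (hJs b j)) hO,
            hdO.partialDeriv_mul (hJs a i) (hJs b j) hO,
            hcomp (fun z => chartMetric (𝓡∂ n) e' z a b) (hG'.smooth a b), hQ, hQ, hJ₀, hJ₀, hz₀,
            hG'one, Matrix.one_apply]
          split_ifs <;> ring
        rw [hdO.partialDeriv_sum (fun b => hterm a b) hO, Finset.sum_congr rfl fun b _ => e3 b,
          Finset.sum_add_distrib]
        congr 1
        simp
      have e4 : partialDeriv s k (fun y => chartMetric (𝓡∂ n) e y i j) y₀ =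
          ∑ a, (∑ b, (∑ c, partialDeriv s c (fun z => chartMetric (𝓡∂ n) e' z a b) z₀ *
            L c k) * (L a i * L b j) +
          ((∑ l, L a l * Γ l k i) * L a j + L a i * ∑ l, L a l * Γ l k j)) := by
        rw [← Finset.sum_congr rfl fun a _ => e2 a]
        exact e1
      have e5 : ∀ i j, ∑ a, (∑ l, L a l * Γ l k i) * L a j =
          (1 / 2) * loweredChristoffel s (chartMetric (𝓡∂ n) e) j k i y₀ := by
        intro i j
        rw [← hG.sum_christoffel_mul hy₀t j k i]
        simp only [hGL, Finset.sum_mul]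
        rw [Finset.sum_comm]
        refine Finset.sum_congr rfl fun l _ => Finset.sum_congr rfl fun a _ => ?_
        simp only [hΓd]
        ring
      have e6 : ∑ a, L a i * ∑ l, L a l * Γ l k j = ∑ a, (∑ l, L a l * Γ l k j) * L a i :=
        Finset.sum_congr rfl fun a _ => mul_comm _ _
      have e7 : ∀ c a b, partialDeriv s c (fun y => chartMetric (𝓡∂ n) e y a b) y₀ =
          partialDeriv s c (fun y => chartMetric (𝓡∂ n) e y b a) y₀ := fun c a b =>
        hdom.partialDeriv_congr (fun y hy => hG.symm y hy a b) hy₀t c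
      rw [Finset.sum_add_distrib, Finset.sum_add_distrib, e6, e5, e5] at e4
      simp only [loweredChristoffel] at e4
      rw [e7 k j i] at e4
      linarith
    intro c a b
    have h2 : ∀ k i b, ∑ a, (∑ c, partialDeriv s c (fun z => chartMetric (𝓡∂ n) e' z a b) z₀ *
        L c k) * L a i = 0 := by
      intro k i
      refine hker (fun b => ∑ a, (∑ c, partialDeriv s c (fun z => chartMetric (𝓡∂ n) e' z a b) z₀ *
        L c k) * L a i) fun j => ?_
      rw [← h1 k i j, Finset.sum_comm]
      refine Finset.sum_congr rfl fun b _ => ?_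
      rw [Finset.sum_mul]
      exact Finset.sum_congr rfl fun a _ => by ring
    have h3 : ∀ k b a, ∑ c, partialDeriv s c (fun z => chartMetric (𝓡∂ n) e' z a b) z₀ * L c k = 0 :=
      fun k b => hker (fun a => ∑ c, partialDeriv s c (fun z => chartMetric (𝓡∂ n) e' z a b) z₀ * L c k)
        fun i => h2 k i b
    exact hker (fun c => partialDeriv s c (fun z => chartMetric (𝓡∂ n) e' z a b) z₀)
      (fun k => h3 k b a) c
  have hnormal : IsNormalAt s ((e'.extend (𝓡∂ n)).target ∩ {y | 0 < y 0}) (chartMetric (𝓡∂ n) e') z₀ :=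
    { toIsCoordDomain := isCoordDomain_interior_target e'
      smooth := fun i j => (hG'.smooth i j).mono inter_subset_left
      symm := fun y hy => hG'.symm y hy.1
      isUnit_det := fun y hy => hG'.isUnit_det y hy.1
      mem := ⟨hz₀t, (mem_interior_iff_coord_pos he' hq').1 hqi⟩
      eq_one := hG'one
      deriv_eq_zero := hdG' }
  refine ⟨e', he', hq', hnormal, fun u hu hH i j => ?_⟩
  have hu' := contDiffOn_inChart hu he'
  have hdu' := fun a => (isCoordDomain_extend_target e').contDiffOn_partialDeriv hu' a
  have hH' : ∀ a b, partialDeriv s a (partialDeriv s b (inChart (𝓡∂ n) e' u)) z₀ = 0 := by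
    intro a b
    rw [← hnormal.coordHess_eq (w := inChart (𝓡∂ n) e' u)]
    exact hH a b
  have h1 : ∀ j, EqOn (partialDeriv s j (inChart (𝓡∂ n) e u)) (fun y => ∑ a,
      partialDeriv s a (inChart (𝓡∂ n) e' u) (coordChange (𝓡∂ n) e e' y) * J a j y) (overlap (𝓡∂ n) e e') :=
    fun j y hy => partialDeriv_inChart he he' hu' hy j
  have hcs : ∀ a, ContDiffOn ℝ ∞ (fun y => partialDeriv s a (inChart (𝓡∂ n) e' u)
      (coordChange (𝓡∂ n) e e' y)) (overlap (𝓡∂ n) e e') :=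
    fun a => (hdu' a).comp hτs (mapsTo_coordChange e e')
  -- Since the second derivatives of `u` vanish in the new chart, only its first derivatives times
  -- those of the coordinate change survive. This is the Christoffel term that the Hessian in `e`
  -- subtracts.
  have h2 : partialDeriv s i (partialDeriv s j (inChart (𝓡∂ n) e u)) y₀ =
      ∑ a, partialDeriv s a (inChart (𝓡∂ n) e' u) z₀ * ∑ l, L a l * Γ l i j := by
    rw [hdO.partialDeriv_congr (h1 j) hO, hdO.partialDeriv_sum (fun a => (hcs a).mul (hJs a j)) hO]
    refine Finset.sum_congr rfl fun a _ => ?_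
    rw [hdO.partialDeriv_mul (hcs a) (hJs a j) hO, hcomp _ (hdu' a), hQ, hz₀]
    have h0 : ∑ c, partialDeriv s c (partialDeriv s a (inChart (𝓡∂ n) e' u)) z₀ * L c i = 0 :=
      Finset.sum_eq_zero fun c _ => by rw [hH', zero_mul]
    rw [h0]
    ring
  have h3 : ∀ l, partialDeriv s l (inChart (𝓡∂ n) e u) y₀ =
      ∑ a, partialDeriv s a (inChart (𝓡∂ n) e' u) z₀ * L a l := by
    intro l
    refine (h1 l hO).trans (Finset.sum_congr rfl fun a _ => ?_)
    rw [hz₀, hJ₀]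
  rw [hessComp, coordHess, h2, sub_eq_zero]
  simp only [← hy₀, ← hs, h3, Finset.mul_sum]
  rw [Finset.sum_comm]
  refine Finset.sum_congr rfl fun l _ => Finset.sum_congr rfl fun a _ => ?_
  simp only [hΓd]
  ring

end NormalCharts

/-! ## Quasi-Einstein manifolds of constant scalar curvature -/

section ConstantScalar

set_option linter.unusedSectionVars false

variable {n : ℕ} [NeZero n]

theorem IsCoordDomain.subset_closure_inter_pos {T : Set (EuclideanSpace ℝ (Fin n))}
    (h : IsCoordDomain (range (𝓡∂ n)) T) : T ⊆ closure (T ∩ {y | 0 < y 0}) := by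
  intro y hy
  rw [mem_closure_iff_nhds]
  intro V hV
  have h1 := h.mem_nhdsWithin y hy
  rw [mem_nhdsWithin_iff_exists_mem_nhds_inter] at h1
  obtain ⟨W, hW, hWT⟩ := h1
  have h2 := h.subset_closure hy
  rw [mem_closure_iff_nhds] at h2
  obtain ⟨z, hz, hzi⟩ := h2 _ (Filter.inter_mem hV hW)
  have h3 : interior (range (𝓡∂ n)) = {y | 0 < y 0} :=
    interior_range_modelWithCornersEuclideanHalfSpace n
  exact ⟨z, hz.1, hWT ⟨hz.2, interior_subset hzi⟩, by rwa [h3] at hzi⟩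

/-- Interior points are dense in the range of a chart, so identities obtained where `w > 0` reach
the boundary by continuity. -/
theorem IsCoordDomain.eq_zero_of_forall_pos {T : Set (EuclideanSpace ℝ (Fin n))}
    (h : IsCoordDomain (range (𝓡∂ n)) T) {g : EuclideanSpace ℝ (Fin n) → ℝ}
    (hg : ContinuousOn g T) (h0 : ∀ y ∈ T, 0 < y 0 → g y = 0) : ∀ y ∈ T, g y = 0 := by
  intro y hy
  have h1 : g y ∈ closure (g '' (T ∩ {y | 0 < y 0})) :=
    ((hg y hy).mono inter_subset_left).mem_closure_image (h.subset_closure_inter_pos hy)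
  have h2 : g '' (T ∩ {y | 0 < y 0}) ⊆ {0} := by
    rintro _ ⟨z, hz, rfl⟩
    exact h0 z hz.1 hz.2
  simpa using closure_mono h2 h1

variable {M : Type*} [TopologicalSpace M]
  [ChartedSpace (EuclideanHalfSpace n) M] [IsManifold (𝓡∂ n) ∞ M]

theorem nonempty_interior_of_halfSpace [Nonempty M] : ((𝓡∂ n).interior M).Nonempty := by
  obtain ⟨x⟩ := ‹Nonempty M›
  set e := chartAt (EuclideanHalfSpace n) x with hedef
  have he : e ∈ IsManifold.maximalAtlas (𝓡∂ n) ∞ M := IsManifold.chart_mem_maximalAtlas x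
  have hx : e.extend (𝓡∂ n) x ∈ (e.extend (𝓡∂ n)).target :=
    (e.extend (𝓡∂ n)).map_source (by rw [e.extend_source]; exact mem_chart_source _ x)
  have h1 := (isCoordDomain_extend_target e).subset_closure_inter_pos hx
  obtain ⟨z, hz, hz0⟩ := closure_nonempty_iff.1 ⟨_, h1⟩
  refine ⟨(e.extend (𝓡∂ n)).symm z, (mem_interior_iff_coord_pos he
    (extend_symm_mem_source hz)).2 ?_⟩
  rwa [(e.extend (𝓡∂ n)).right_inv hz]

variable [RiemannianBundle (fun x : M => TangentSpace (𝓡∂ n) x)]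
  [IsContMDiffRiemannianBundle (𝓡∂ n) ∞ (EuclideanSpace ℝ (Fin n))
    (fun x : M => TangentSpace (𝓡∂ n) x)]
  {e : OpenPartialHomeomorph M (EuclideanHalfSpace n)} {m c : ℝ} {w : M → ℝ}

theorem WarpedEinstein.IsQuasiEinstein.coordHess_eq (hw : IsQuasiEinstein (𝓡∂ n) 0 m w)
    (he : e ∈ IsManifold.maximalAtlas (𝓡∂ n) ∞ M) {y : EuclideanSpace ℝ (Fin n)}
    (hy : y ∈ (e.extend (𝓡∂ n)).target) (i j : Fin n) :
    coordHess (range (𝓡∂ n)) (chartMetric (𝓡∂ n) e) (inChart (𝓡∂ n) e w) i j y =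
      inChart (𝓡∂ n) e w y / m * coordRicci (range (𝓡∂ n)) (chartMetric (𝓡∂ n) e) i j y := by
  have h := hw.hess_eq e he _ (extend_symm_mem_source hy) i j
  rw [hessComp, ricciComp, (e.extend (𝓡∂ n)).right_inv hy, zero_mul, sub_zero] at h
  exact h

theorem sum_coordRicci_eq_of_scalarCurvature
    (hc : ∀ e ∈ IsManifold.maximalAtlas (𝓡∂ n) ∞ M, ∀ x ∈ e.source,
      scalarCurvature (𝓡∂ n) e x = c)
    (he : e ∈ IsManifold.maximalAtlas (𝓡∂ n) ∞ M) {y : EuclideanSpace ℝ (Fin n)}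
    (hy : y ∈ (e.extend (𝓡∂ n)).target) :
    ∑ i, ∑ j, (chartMetric (𝓡∂ n) e y)⁻¹ i j *
      coordRicci (range (𝓡∂ n)) (chartMetric (𝓡∂ n) e) i j y = c := by
  have h := hc e he _ (extend_symm_mem_source hy)
  simp only [scalarCurvature, invMetricComp, ricciComp, (e.extend (𝓡∂ n)).right_inv hy] at h
  exact h

theorem WarpedEinstein.IsQuasiEinstein.inChart_pos (hw : IsQuasiEinstein (𝓡∂ n) 0 m w)
    (he : e ∈ IsManifold.maximalAtlas (𝓡∂ n) ∞ M) {y : EuclideanSpace ℝ (Fin n)}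
    (hy : y ∈ (e.extend (𝓡∂ n)).target) (hy0 : 0 < y 0) : 0 < inChart (𝓡∂ n) e w y := by
  refine hw.pos _ ((mem_interior_iff_coord_pos he (extend_symm_mem_source hy)).2 ?_)
  rwa [(e.extend (𝓡∂ n)).right_inv hy]

variable (hm : 0 < m) (hm1 : m ≠ 1) (hw : IsQuasiEinstein (𝓡∂ n) 0 m w)
  (hc : ∀ e ∈ IsManifold.maximalAtlas (𝓡∂ n) ∞ M, ∀ x ∈ e.source,
    scalarCurvature (𝓡∂ n) e x = c)

include hm hm1 hw hc in
-- The first integral is a function on the manifold, so the vanishing of its differential at the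
-- centre of a normal chart passes to any chart. Having it on an open set matters:
-- `IsNormalAt.sum_coordRicci_sq` differentiates it once more.
theorem partialDeriv_coordGradSq_add_eq_zero (he : e ∈ IsManifold.maximalAtlas (𝓡∂ n) ∞ M)
    {y : EuclideanSpace ℝ (Fin n)} (hy : y ∈ (e.extend (𝓡∂ n)).target) (hy0 : 0 < y 0)
    (k : Fin n) : partialDeriv (range (𝓡∂ n)) k (fun y =>
      coordGradSq (range (𝓡∂ n)) (chartMetric (𝓡∂ n) e) (inChart (𝓡∂ n) e w) y +
      c / (m * (m - 1)) * (inChart (𝓡∂ n) e w y * inChart (𝓡∂ n) e w y)) y = 0 := by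
  have hq := extend_symm_mem_source hy
  have hqy := (e.extend (𝓡∂ n)).right_inv hy
  obtain ⟨e', he', hq', hnormal, -⟩ := exists_normal_chart he hq
    ((mem_interior_iff_coord_pos he hq).2 (by rwa [hqy]))
  have hw' := contDiffOn_inChart hw.smooth he'
  have hO : y ∈ overlap (𝓡∂ n) e e' := ⟨hy, hq'⟩
  have h0 : ∀ a, partialDeriv (range (𝓡∂ n)) a (fun y =>
      coordGradSq (range (𝓡∂ n)) (chartMetric (𝓡∂ n) e') (inChart (𝓡∂ n) e' w) y +
      c / (m * (m - 1)) * (inChart (𝓡∂ n) e' w y * inChart (𝓡∂ n) e' w y))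
        (coordChange (𝓡∂ n) e e' y) = 0 := fun a =>
    hnormal.partialDeriv_coordGradSq_add hm.ne' (hw'.mono inter_subset_left)
      (fun z hz => hw.coordHess_eq he' hz.1)
      (fun z hz => sum_coordRicci_eq_of_scalarCurvature hc he' hz.1) hm1 a
  have hs := ((isCoordMetric_chartMetric he').contDiffOn_coordGradSq hw').add
    ((contDiffOn_const (c := c / (m * (m - 1)))).mul (hw'.mul hw'))
  rw [(isCoordDomain_overlap e e').partialDeriv_congr (g := fun z => (fun y =>
      coordGradSq (range (𝓡∂ n)) (chartMetric (𝓡∂ n) e') (inChart (𝓡∂ n) e' w) y +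
      c / (m * (m - 1)) * (inChart (𝓡∂ n) e' w y * inChart (𝓡∂ n) e' w y))
        (coordChange (𝓡∂ n) e e' z)) ?_ hO,
    (isCoordDomain_overlap e e').partialDeriv_comp (isCoordDomain_extend_target e')
      (contDiffOn_coordChange he he') (mapsTo_coordChange e e') hs hO]
  · exact Finset.sum_eq_zero fun a _ => by rw [h0, zero_mul]
  · intro z hz
    simp only
    rw [coordGradSq_coordChange he he' hw' hz, inChart_coordChange w hz]

include hm hm1 hw hc in
-- If `c ≠ 0`, then `IsNormalAt.scalar_eq_zero` forces `∇w = 0` throughout the interior. The Hessian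
-- vanishes there, and dividing the equation by `w > 0` shows that the Ricci tensor has trace zero
-- after all.
theorem scalarCurvature_eq_zero [Nonempty M] : c = 0 := by
  by_contra hc0
  have hzero : ∀ e ∈ IsManifold.maximalAtlas (𝓡∂ n) ∞ M, ∀ y ∈ (e.extend (𝓡∂ n)).target,
      0 < y 0 → ∀ k, partialDeriv (range (𝓡∂ n)) k (inChart (𝓡∂ n) e w) y = 0 := by
    intro e he y hy hy0 k
    have hq := extend_symm_mem_source hy
    have hqy := (e.extend (𝓡∂ n)).right_inv hy
    obtain ⟨e', he', hq', hnormal, -⟩ := exists_normal_chart he hq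
      ((mem_interior_iff_coord_pos he hq).2 (by rwa [hqy]))
    have hw' := contDiffOn_inChart hw.smooth he'
    have h1 : ∀ a, partialDeriv (range (𝓡∂ n)) a (inChart (𝓡∂ n) e' w)
        (coordChange (𝓡∂ n) e e' y) = 0 := by
      intro a
      by_contra ha
      exact hc0 (hnormal.scalar_eq_zero hm.ne' (hw'.mono inter_subset_left)
        (fun z hz => hw.coordHess_eq he' hz.1)
        (fun z hz => sum_coordRicci_eq_of_scalarCurvature hc he' hz.1) hm hm1
        (hw.inChart_pos he' hnormal.mem.1 hnormal.mem.2).ne'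
        (fun z hz => partialDeriv_coordGradSq_add_eq_zero hm hm1 hw hc he' hz.1 hz.2) ha)
    rw [partialDeriv_inChart he he' hw' ⟨hy, hq'⟩]
    exact Finset.sum_eq_zero fun a _ => by rw [h1, zero_mul]
  obtain ⟨q, hq⟩ := nonempty_interior_of_halfSpace (n := n) (M := M)
  obtain ⟨e, he, hqe, hnormal, -⟩ := exists_normal_chart
    (IsManifold.chart_mem_maximalAtlas (I := 𝓡∂ n) (n := ∞) q) (mem_chart_source _ q) hq
  refine hc0 ?_
  rw [← hnormal.sum_coordRicci
    (fun z hz => sum_coordRicci_eq_of_scalarCurvature hc he hz.1)]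
  refine Finset.sum_eq_zero fun i _ => ?_
  have h1 := hw.coordHess_eq he hnormal.mem.1 i i
  rw [hnormal.coordHess_eq, hnormal.partialDeriv_congr
    (fun z hz => hzero e he z hz.1 hz.2 i) hnormal.mem, partialDeriv_const] at h1
  have h2 : inChart (𝓡∂ n) e w (e.extend (𝓡∂ n) q) / m ≠ 0 :=
    div_ne_zero (hw.inChart_pos he hnormal.mem.1 hnormal.mem.2).ne' hm.ne'
  exact (mul_eq_zero.1 h1.symm).resolve_left h2

include hm hm1 hw hc in
/-- The Hessian of `w` vanishes. -/
theorem coordHess_eq_zero_of_scalarCurvature [Nonempty M]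
    (he : e ∈ IsManifold.maximalAtlas (𝓡∂ n) ∞ M)
    {y : EuclideanSpace ℝ (Fin n)} (hy : y ∈ (e.extend (𝓡∂ n)).target) (i j : Fin n) :
    coordHess (range (𝓡∂ n)) (chartMetric (𝓡∂ n) e) (inChart (𝓡∂ n) e w) i j y = 0 := by
  have hq := extend_symm_mem_source hy
  have hqy := (e.extend (𝓡∂ n)).right_inv hy
  -- Normal charts exist around interior points only; at boundary points the equation itself gives
  -- the claim, because `w = 0`.
  rcases (𝓡∂ n).isInteriorPoint_or_isBoundaryPoint ((e.extend (𝓡∂ n)).symm y) with hi | hb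
  · obtain ⟨e', he', hq', hnormal, hH⟩ := exists_normal_chart he hq hi
    have hw' := contDiffOn_inChart hw.smooth he'
    have h1 : ∀ a b, hessComp (𝓡∂ n) e' w ((e.extend (𝓡∂ n)).symm y) a b = 0 := by
      intro a b
      rw [hw.hess_eq e' he' _ hq', ricciComp, hnormal.coordRicci_eq_zero hm.ne'
        (hw'.mono inter_subset_left) (fun z hz => hw.coordHess_eq he' hz.1)
        (fun z hz => sum_coordRicci_eq_of_scalarCurvature hc he' hz.1) hm1
        (hw.inChart_pos he' hnormal.mem.1 hnormal.mem.2).ne'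
        (scalarCurvature_eq_zero hm hm1 hw hc)
        (fun z hz => partialDeriv_coordGradSq_add_eq_zero hm hm1 hw hc he' hz.1 hz.2)]
      simp
    have h2 := hH w hw.smooth h1 i j
    rwa [hessComp, hqy] at h2
  · rw [hw.coordHess_eq he hy, inChart, hw.zero _ hb]
    simp

include hm hm1 hw hc in
-- In each chart the Ricci tensor is recovered from the vanishing Hessian by dividing the equation
-- by `w`. This makes the transformation law of the Ricci tensor unnecessary.
theorem coordRicci_eq_zero_of_scalarCurvature [Nonempty M]
    (he : e ∈ IsManifold.maximalAtlas (𝓡∂ n) ∞ M)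
    {y : EuclideanSpace ℝ (Fin n)} (hy : y ∈ (e.extend (𝓡∂ n)).target) (i j : Fin n) :
    coordRicci (range (𝓡∂ n)) (chartMetric (𝓡∂ n) e) i j y = 0 := by
  refine (isCoordDomain_extend_target e).eq_zero_of_forall_pos
    ((isCoordMetric_chartMetric he).contDiffOn_coordRicci i j).continuousOn (fun z hz hz0 => ?_) y hy
  have h1 := coordHess_eq_zero_of_scalarCurvature hm hm1 hw hc he hz i j
  rw [hw.coordHess_eq he hz] at h1
  exact (mul_eq_zero.1 h1).resolve_left (div_ne_zero (hw.inChart_pos he hz hz0).ne' hm.ne')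

include hm hm1 hw hc in
theorem partialDeriv_coordGradSq_eq_zero [Nonempty M]
    (he : e ∈ IsManifold.maximalAtlas (𝓡∂ n) ∞ M)
    {y : EuclideanSpace ℝ (Fin n)} (hy : y ∈ (e.extend (𝓡∂ n)).target) (k : Fin n) :
    partialDeriv (range (𝓡∂ n)) k
      (coordGradSq (range (𝓡∂ n)) (chartMetric (𝓡∂ n) e) (inChart (𝓡∂ n) e w)) y = 0 := by
  have hs := (isCoordMetric_chartMetric he).contDiffOn_coordGradSq (contDiffOn_inChart hw.smooth he)
  refine (isCoordDomain_extend_target e).eq_zero_of_forall_pos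
    ((isCoordDomain_extend_target e).contDiffOn_partialDeriv hs k).continuousOn
    (fun z hz hz0 => ?_) y hy
  have h1 := partialDeriv_coordGradSq_add_eq_zero hm hm1 hw hc he hz hz0 k
  simpa [scalarCurvature_eq_zero hm hm1 hw hc] using h1

end ConstantScalar

open scoped NNReal

/-! ## Gluing vertical lines -/

section Gluing

/-- A family of flow boxes for the height function `r`: in each box a point is given by its height
and its horizontal position, and vertical lines in different boxes fit together. -/
structure IsFlowBoxFamily {M V : Type*} [PseudoEMetricSpace M] [TopologicalSpace V] (r : M → ℝ≥0)
    (B : Set (OpenPartialHomeomorph M (ℝ≥0 × V))) : Prop where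
  continuous : Continuous r
  exists_mem : ∀ x, ∃ e ∈ B, x ∈ e.source
  fst_eq : ∀ e ∈ B, ∀ x ∈ e.source, (e x).1 = r x
  target_eq : ∀ e ∈ B, ∃ (J : Set ℝ≥0) (W : Set V), IsOpen J ∧ IsPreconnected J ∧ e.target = J ×ˢ W
  compat : ∀ e ∈ B, ∀ e' ∈ B, ∀ p ∈ e.source, p ∈ e'.source →
    ∀ᶠ u in 𝓝 (r p), e.symm (u, (e p).2) = e'.symm (u, (e' p).2)
  edist_le : ∀ e ∈ B, ∀ u v z, u ≤ v → (u, z) ∈ e.target → (v, z) ∈ e.target →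
    edist (e.symm (u, z)) (e.symm (v, z)) ≤ ((v - u : ℝ≥0) : ENNReal)

/-- `γ` is a vertical line over `J`. -/
def IsLine {M V : Type*} [TopologicalSpace M] [TopologicalSpace V] (r : M → ℝ≥0)
    (B : Set (OpenPartialHomeomorph M (ℝ≥0 × V))) (γ : ℝ≥0 → M) (J : Set ℝ≥0) : Prop :=
  ∀ u ∈ J, r (γ u) = u ∧ ∃ e ∈ B, γ u ∈ e.source ∧ ∀ᶠ v in 𝓝 u, γ v = e.symm (v, (e (γ u)).2)

variable {M V : Type*} [EMetricSpace M] [TopologicalSpace V] {r : M → ℝ≥0}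
  {B : Set (OpenPartialHomeomorph M (ℝ≥0 × V))} {γ γ' : ℝ≥0 → M} {J J' : Set ℝ≥0}
  {e : OpenPartialHomeomorph M (ℝ≥0 × V)}

theorem IsLine.mono (h : IsLine r B γ J) (hJ : J' ⊆ J) : IsLine r B γ J' := fun u hu => h u (hJ hu)

theorem IsFlowBoxFamily.apply_eq (h : IsFlowBoxFamily r B) (he : e ∈ B) {x : M}
    (hx : x ∈ e.source) : e x = (r x, (e x).2) := by
  rw [← h.fst_eq e he x hx]

theorem IsLine.eventually_eq (h : IsFlowBoxFamily r B) (hγ : IsLine r B γ J) {u : ℝ≥0}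
    (hu : u ∈ J) (he : e ∈ B) (hue : γ u ∈ e.source) :
    ∀ᶠ v in 𝓝 u, γ v = e.symm (v, (e (γ u)).2) := by
  obtain ⟨h1, e', he', hue', h2⟩ := hγ u hu
  have h3 := h.compat e' he' e he (γ u) hue' hue
  rw [h1] at h3
  filter_upwards [h2, h3] with v hv hv'
  rw [hv, hv']

theorem IsFlowBoxFamily.continuousAt_symm (h : IsFlowBoxFamily r B) (he : e ∈ B) {x : M}
    (hx : x ∈ e.source) : ContinuousAt (fun v => e.symm (v, (e x).2)) (r x) := by
  have h1 : ContinuousAt e.symm (r x, (e x).2) := by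
    rw [← h.apply_eq he hx]
    exact e.continuousAt_symm (e.map_source hx)
  exact ContinuousAt.comp (f := fun v => (v, (e x).2)) h1 (by fun_prop)

theorem IsLine.continuousAt (h : IsFlowBoxFamily r B) (hγ : IsLine r B γ J) {u : ℝ≥0}
    (hu : u ∈ J) : ContinuousAt γ u := by
  obtain ⟨h1, e, he, hue, h2⟩ := hγ u hu
  refine ContinuousAt.congr ?_ (h2.mono fun v hv => hv.symm)
  have := h.continuousAt_symm he hue
  rwa [h1] at this

/-- The set of agreement is open because both lines follow the same box, its complement is open
because `M` is Hausdorff, and `J` is connected. -/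
theorem IsLine.eqOn (h : IsFlowBoxFamily r B) (hγ : IsLine r B γ J) (hγ' : IsLine r B γ' J)
    (hJ : IsPreconnected J) {u : ℝ≥0} (hu : u ∈ J) (heq : γ u = γ' u) : EqOn γ γ' J := by
  have hopen : ∀ v ∈ J, γ v = γ' v → ∀ᶠ w in 𝓝 v, γ w = γ' w := by
    intro v hv hvv
    obtain ⟨h1, e, he, hue, h2⟩ := hγ v hv
    have h3 := hγ'.eventually_eq h hv he (hvv ▸ hue)
    rw [← hvv] at h3
    filter_upwards [h2, h3] with w hw hw'
    rw [hw, hw']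
  have hne : ∀ v ∈ J, γ v ≠ γ' v → ∀ᶠ w in 𝓝 v, γ w ≠ γ' w := by
    intro v hv hvv
    exact ((hγ.continuousAt h hv).prodMk (hγ'.continuousAt h hv)).eventually
      ((isClosed_diagonal (X := M)).isOpen_compl.mem_nhds (fun hd => hvv hd))
  intro v hv
  by_contra hvv
  have hA := isOpen_interior (s := {w | γ w = γ' w})
  have hB := isOpen_interior (s := {w | γ w ≠ γ' w})
  obtain ⟨w, -, hw1, hw2⟩ := hJ _ _ hA hB (fun w hw => by
    by_cases hww : γ w = γ' w
    · exact Or.inl (mem_interior_iff_mem_nhds.2 (hopen w hw hww))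
    · exact Or.inr (mem_interior_iff_mem_nhds.2 (hne w hw hww)))
    ⟨u, hu, mem_interior_iff_mem_nhds.2 (hopen u hu heq)⟩
    ⟨v, hv, mem_interior_iff_mem_nhds.2 (hne v hv hvv)⟩
  have h1 : γ w = γ' w := (interior_subset hw1 : w ∈ {w | γ w = γ' w})
  have h2 : γ w ≠ γ' w := (interior_subset hw2 : w ∈ {w | γ w ≠ γ' w})
  exact h2 h1

/-- The vertical line through `x` in a box. -/
theorem IsFlowBoxFamily.isLine_symm (h : IsFlowBoxFamily r B) (he : e ∈ B) {z : V} :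
    IsLine r B (fun v => e.symm (v, z)) {v | (v, z) ∈ e.target} := by
  intro u hu
  have h1 : e.symm (u, z) ∈ e.source := e.map_target hu
  have h2 : e (e.symm (u, z)) = (u, z) := e.right_inv hu
  refine ⟨?_, e, he, h1, ?_⟩
  · rw [← h.fst_eq e he _ h1, h2]
  · rw [h2]
    exact Filter.Eventually.of_forall fun v => rfl

/-- Continuous induction along `[u, v]`: the heights satisfying the bound form a closed set, and the
box estimate with the triangle inequality pushes it to the right. -/
theorem IsLine.edist_le (h : IsFlowBoxFamily r B) (hγ : IsLine r B γ J)
    (hJ : IsPreconnected J) {u v : ℝ≥0} (hu : u ∈ J) (hv : v ∈ J) (huv : u ≤ v) :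
    edist (γ u) (γ v) ≤ ((v - u : ℝ≥0) : ENNReal) := by
  have hIcc : Icc u v ⊆ J := hJ.ordConnected.out hu hv
  have hcont : ContinuousOn γ (Icc u v) := fun w hw =>
    (hγ.continuousAt h (hIcc hw)).continuousWithinAt
  have hcl : IsClosed ({w | edist (γ u) (γ w) ≤ ((w - u : ℝ≥0) : ENNReal)} ∩ Icc u v) := by
    have h1 : ContinuousOn (fun w => edist (γ u) (γ w)) (Icc u v) :=
      continuous_edist.comp_continuousOn (continuousOn_const.prodMk hcont)
    have h2 : ContinuousOn (fun w : ℝ≥0 => ((w - u : ℝ≥0) : ENNReal)) (Icc u v) :=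
      (ENNReal.continuous_coe.comp (continuous_id.sub continuous_const)).continuousOn
    have := isClosed_Icc.isClosed_le h1 h2
    convert this using 1
    ext w
    simp [and_comm]
  refine hcl.Icc_subset_of_forall_exists_gt ?_ ?_ (right_mem_Icc.2 huv)
  · simp
  · rintro w ⟨hw, hw1, hw2⟩ b hb
    have hwJ : w ∈ J := hIcc ⟨hw1, hw2.le⟩
    obtain ⟨h1, e, he, hwe, h2⟩ := hγ w hwJ
    have h4 : ∀ᶠ b' in 𝓝 w, (b', (e (γ w)).2) ∈ e.target := by
      have : (w, (e (γ w)).2) ∈ e.target := by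
        have := e.map_source hwe
        rwa [h.apply_eq he hwe, h1] at this
      exact (Continuous.prodMk_left (e (γ w)).2).continuousAt.eventually (e.open_target.mem_nhds this)
    have h5 : ∀ᶠ b' in 𝓝[>] w, b' ∈ Ioc w b := Ioc_mem_nhdsGT hb
    obtain ⟨b', hb1, hb2, hb3⟩ := ((h2.filter_mono nhdsWithin_le_nhds).and
      ((h4.filter_mono nhdsWithin_le_nhds).and h5)).exists
    refine ⟨b', ?_, hb3⟩
    have h6 : (w, (e (γ w)).2) ∈ e.target := h4.self_of_nhds
    have h7 := h.edist_le e he w b' _ hb3.1.le h6 hb2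
    have h8 : e.symm (w, (e (γ w)).2) = γ w := h2.self_of_nhds.symm
    rw [h8, ← hb1] at h7
    calc edist (γ u) (γ b') ≤ edist (γ u) (γ w) + edist (γ w) (γ b') := edist_triangle _ _ _
      _ ≤ ((w - u : ℝ≥0) : ENNReal) + ((b' - w : ℝ≥0) : ENNReal) := add_le_add hw h7
      _ = ((b' - u : ℝ≥0) : ENNReal) := by
        rw [← ENNReal.coe_add]
        congr 1
        rw [add_comm, tsub_add_tsub_cancel hb3.1.le hw1]

/-- Through each point there is a line over a neighbourhood of its height. -/
theorem IsFlowBoxFamily.exists_isLine (h : IsFlowBoxFamily r B) (x : M) :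
    ∃ (γ : ℝ≥0 → M) (J : Set ℝ≥0), IsOpen J ∧ IsPreconnected J ∧ r x ∈ J ∧ IsLine r B γ J ∧
      γ (r x) = x := by
  obtain ⟨e, he, hx⟩ := h.exists_mem x
  obtain ⟨J, W, hJo, hJ, ht⟩ := h.target_eq e he
  have h1 := e.map_source hx
  rw [h.apply_eq he hx, ht] at h1
  refine ⟨fun v => e.symm (v, (e x).2), J, hJo, hJ, h1.1, (h.isLine_symm he).mono fun v hv => ?_, ?_⟩
  · change (v, (e x).2) ∈ e.target
    rw [ht]
    exact ⟨hv, h1.2⟩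
  · simp only
    rw [← h.apply_eq he hx, e.left_inv hx]

/-- Two lines which agree at a point can be glued. -/
theorem IsLine.union (h : IsFlowBoxFamily r B) (hγ : IsLine r B γ J) (hγ' : IsLine r B γ' J')
    (hJo : IsOpen J) (hJo' : IsOpen J') (hJ : IsPreconnected J) (hJ' : IsPreconnected J') {u : ℝ≥0}
    (hu : u ∈ J) (hu' : u ∈ J') (heq : γ u = γ' u) :
    ∃ γ'', IsLine r B γ'' (J ∪ J') ∧ EqOn γ'' γ J ∧ EqOn γ'' γ' J' := by
  classical
  have hJJ : IsPreconnected (J ∩ J') :=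
    (hJ.ordConnected.inter hJ'.ordConnected).isPreconnected
  have hE := (hγ.mono inter_subset_left).eqOn h (hγ'.mono inter_subset_right) hJJ ⟨hu, hu'⟩ heq
  have h1 : EqOn (J.piecewise γ γ') γ J := fun v hv => piecewise_eq_of_mem _ _ _ hv
  have h2 : EqOn (J.piecewise γ γ') γ' J' := by
    intro v hv
    by_cases hvJ : v ∈ J
    · rw [piecewise_eq_of_mem _ _ _ hvJ, hE ⟨hvJ, hv⟩]
    · rw [piecewise_eq_of_notMem _ _ _ hvJ]
  refine ⟨J.piecewise γ γ', ?_, h1, h2⟩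
  rintro v (hv | hv)
  · obtain ⟨h3, e, he, hve, h4⟩ := hγ v hv
    rw [h1 hv]
    refine ⟨h3, e, he, hve, ?_⟩
    filter_upwards [h4, hJo.mem_nhds hv] with w hw hwJ
    rw [h1 hwJ, hw]
  · obtain ⟨h3, e, he, hve, h4⟩ := hγ' v hv
    rw [h2 hv]
    refine ⟨h3, e, he, hve, ?_⟩
    filter_upwards [h4, hJo'.mem_nhds hv] with w hw hwJ
    rw [h2 hwJ, hw]

/-- Vertical lines extend to all heights, by completeness. -/
theorem IsFlowBoxFamily.exists_isLine_univ [CompleteSpace M] (h : IsFlowBoxFamily r B) (x : M) :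
    ∃ γ : ℝ≥0 → M, IsLine r B γ univ ∧ γ (r x) = x := by
  classical
  set P : (ℝ≥0 → M) → Set ℝ≥0 → Prop := fun γ J => IsOpen J ∧ IsPreconnected J ∧ r x ∈ J ∧
    IsLine r B γ J ∧ γ (r x) = x with hP
  -- All heights reached by some line through `x` over an open interval. By uniqueness the partial
  -- lines agree where they overlap, so they define a single maximal line over `D`.
  set D : Set ℝ≥0 := {u | ∃ γ J, P γ J ∧ u ∈ J} with hD
  have hP' : ∀ u, ∃ γ : ℝ≥0 → M, u ∈ D → ∃ J, P γ J ∧ u ∈ J := by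
    intro u
    by_cases hu : u ∈ D
    · obtain ⟨γ, J, h1⟩ := hu
      exact ⟨γ, fun _ => ⟨J, h1⟩⟩
    · exact ⟨fun _ => x, fun h => absurd h hu⟩
  choose Γ hΓ using hP'
  set γ : ℝ≥0 → M := fun u => Γ u u with hγd
  have hagree : ∀ γ₁ J₁, P γ₁ J₁ → EqOn γ γ₁ J₁ := by
    rintro γ₁ J₁ ⟨ho, hc, hx, hl, hlx⟩ u hu
    obtain ⟨J₂, ⟨ho', hc', hx', hl', hlx'⟩, hu2⟩ := hΓ u ⟨γ₁, J₁, ⟨ho, hc, hx, hl, hlx⟩, hu⟩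
    exact (hl'.mono inter_subset_left).eqOn h (hl.mono inter_subset_right)
      (hc'.ordConnected.inter hc.ordConnected).isPreconnected ⟨hx', hx⟩ (hlx'.trans hlx.symm)
      ⟨hu2, hu⟩
  have hDo : IsOpen D := by
    rw [isOpen_iff_mem_nhds]
    rintro u ⟨γ₁, J₁, h1, hu⟩
    exact Filter.mem_of_superset (h1.1.mem_nhds hu) fun v hv => ⟨γ₁, J₁, h1, hv⟩
  have hDc : IsPreconnected D := by
    have : D = ⋃₀ {J | ∃ γ, P γ J} := by
      ext u
      simp only [hD, mem_ofPred_eq, mem_sUnion]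
      exact ⟨fun ⟨γ, J, h1, h2⟩ => ⟨J, ⟨γ, h1⟩, h2⟩, fun ⟨J, ⟨γ, h1⟩, h2⟩ => ⟨γ, J, h1, h2⟩⟩
    rw [this]
    exact isPreconnected_sUnion (r x) _ (fun J ⟨γ, h1⟩ => h1.2.2.1) (fun J ⟨γ, h1⟩ => h1.2.1)
  obtain ⟨γ₀, J₀, h₀⟩ := h.exists_isLine x
  have hxD : r x ∈ D := ⟨γ₀, J₀, h₀, h₀.2.2.1⟩
  have hγx : γ (r x) = x := by
    rw [hagree γ₀ J₀ h₀ h₀.2.2.1]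
    exact h₀.2.2.2.2
  have hγ : IsLine r B γ D := by
    rintro u ⟨γ₁, J₁, h1, hu⟩
    obtain ⟨h3, e, he, hue, h4⟩ := h1.2.2.2.1 u hu
    rw [hagree γ₁ J₁ h1 hu]
    refine ⟨h3, e, he, hue, ?_⟩
    filter_upwards [h4, h1.1.mem_nhds hu] with v hv hvJ
    rw [hagree γ₁ J₁ h1 hvJ, hv]
  -- At a limit height `b` the length bound makes the points on the line a Cauchy sequence.
  -- Completeness yields a limit point at height `b`, and a flow box around it continues the line
  -- through `b`.
  have hDcl : IsClosed D := by
    refine isClosed_of_closure_subset fun b hb => ?_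
    obtain ⟨u, huD, hub⟩ := mem_closure_iff_seq_limit.1 hb
    have hle : ∀ i j, edist (γ (u i)) (γ (u j)) ≤ edist (u i) (u j) := by
      have key : ∀ s ∈ D, ∀ t ∈ D, s ≤ t → edist (γ s) (γ t) ≤ edist s t := by
        intro s hs t ht hst
        refine (hγ.edist_le h hDc hs ht hst).trans (le_of_eq ?_)
        rw [edist_comm, edist_nndist, NNReal.nndist_eq, tsub_eq_zero_of_le hst, max_eq_left zero_le]
      intro i j
      rcases le_total (u i) (u j) with hij | hij
      · exact key _ (huD i) _ (huD j) hij
      · rw [edist_comm, edist_comm (u i)]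
        exact key _ (huD j) _ (huD i) hij
    have hcau : CauchySeq fun i => γ (u i) := by
      rw [EMetric.cauchySeq_iff]
      intro ε hε
      obtain ⟨N, hN⟩ := EMetric.cauchySeq_iff.1 hub.cauchySeq ε hε
      exact ⟨N, fun m hm k hk => (hle m k).trans_lt (hN m hm k hk)⟩
    obtain ⟨p, hp⟩ := cauchySeq_tendsto_of_complete hcau
    have hrp : r p = b := by
      refine tendsto_nhds_unique ((h.continuous.tendsto p).comp hp) ?_
      refine hub.congr fun i => ?_
      exact (hγ (u i) (huD i)).1.symm
    obtain ⟨e, he, hpe⟩ := h.exists_mem p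
    obtain ⟨J, W, hJo, hJ, ht⟩ := h.target_eq e he
    have hpt := e.map_source hpe
    rw [h.apply_eq he hpe, ht, hrp] at hpt
    obtain ⟨i, hi1, hi2⟩ := ((hp.eventually (e.open_source.mem_nhds hpe)).and
      (hub.eventually (hJo.mem_nhds hpt.1))).exists
    have hit := e.map_source hi1
    have hri : r (γ (u i)) = u i := (hγ (u i) (huD i)).1
    rw [h.apply_eq he hi1, ht, hri] at hit
    have hl : IsLine r B (fun v => e.symm (v, (e (γ (u i))).2)) J :=
      (h.isLine_symm he).mono fun v hv => by
        change (v, _) ∈ e.target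
        rw [ht]
        exact ⟨hv, hit.2⟩
    obtain ⟨γ₂, hγ₂, h2, h3⟩ := hγ.union h hl hDo hJo hDc hJ (huD i) hi2 (by
      have := h.apply_eq he hi1
      rw [hri] at this
      rw [← this, e.left_inv hi1])
    exact ⟨γ₂, D ∪ J, ⟨hDo.union hJo, hDc.union (u i) (huD i) hi2 hJ, Or.inl hxD, hγ₂, by
      rw [h2 hxD, hγx]⟩, Or.inr hpt.1⟩
  have hDu : D = univ := IsClopen.eq_univ ⟨hDcl, hDo⟩ ⟨_, hxD⟩
  exact ⟨γ, hDu ▸ hγ, hγx⟩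

/-- The point at height `u` on the vertical line through `x`. -/
noncomputable def IsFlowBoxFamily.transport [CompleteSpace M] (h : IsFlowBoxFamily r B) (x : M)
    (u : ℝ≥0) : M :=
  (h.exists_isLine_univ x).choose u

variable [CompleteSpace M]

theorem IsFlowBoxFamily.isLine_transport (h : IsFlowBoxFamily r B) (x : M) :
    IsLine r B (h.transport x) univ := (h.exists_isLine_univ x).choose_spec.1

theorem IsFlowBoxFamily.transport_self (h : IsFlowBoxFamily r B) (x : M) :
    h.transport x (r x) = x := (h.exists_isLine_univ x).choose_spec.2

theorem IsFlowBoxFamily.height_transport (h : IsFlowBoxFamily r B) (x : M) (u : ℝ≥0) :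
    r (h.transport x u) = u := (h.isLine_transport x u (mem_univ u)).1

/-- Both are complete vertical lines through the same point at height `u`. -/
theorem IsFlowBoxFamily.transport_transport (h : IsFlowBoxFamily r B) (x : M) (u v : ℝ≥0) :
    h.transport (h.transport x u) v = h.transport x v := by
  refine (h.isLine_transport (h.transport x u)).eqOn h (h.isLine_transport x) isPreconnected_univ
    (mem_univ u) ?_ (mem_univ v)
  have := h.transport_self (h.transport x u)
  rwa [h.height_transport] at this

theorem IsFlowBoxFamily.transport_eq (h : IsFlowBoxFamily r B) (he : e ∈ B) {x : M}
    (hx : x ∈ e.source) {u : ℝ≥0} (hu : (u, (e x).2) ∈ e.target) :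
    h.transport x u = e.symm (u, (e x).2) := by
  obtain ⟨J, W, hJo, hJ, ht⟩ := h.target_eq e he
  have h1 := e.map_source hx
  rw [h.apply_eq he hx, ht] at h1
  rw [ht] at hu
  refine ((h.isLine_transport x).mono (subset_univ J)).eqOn h ((h.isLine_symm he).mono
    fun v hv => ?_) hJ h1.1 ?_ hu.1
  · change (v, (e x).2) ∈ e.target
    rw [ht]
    exact ⟨hv, h1.2⟩
  · simp only
    rw [h.transport_self, ← h.apply_eq he hx, e.left_inv hx]

end Gluing

/-! ## Height functions -/

section Height

set_option linter.unusedSectionVars false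

theorem fderivWithin_eq_zero_of_partialDeriv {n : ℕ} {s : Set (EuclideanSpace ℝ (Fin n))}
    {f : EuclideanSpace ℝ (Fin n) → ℝ} {y : EuclideanSpace ℝ (Fin n)}
    (h0 : ∀ k, partialDeriv s k f y = 0) : fderivWithin ℝ f s y = 0 := by
  ext v
  rw [euclideanSpace_eq_sum_single v, map_sum]
  refine Finset.sum_eq_zero fun i _ => ?_
  rw [map_smul]
  have : fderivWithin ℝ f s y (EuclideanSpace.single i 1) = 0 := h0 i
  rw [this, smul_zero]

variable {n : ℕ} [NeZero n] {M : Type*} [TopologicalSpace M]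
  [ChartedSpace (EuclideanHalfSpace n) M] [IsManifold (𝓡∂ n) ∞ M]

theorem exists_ball_inter_range_subset_target
    {e : OpenPartialHomeomorph M (EuclideanHalfSpace n)} {y : EuclideanSpace ℝ (Fin n)}
    (hy : y ∈ (e.extend (𝓡∂ n)).target) :
    ∃ ε > 0, Metric.ball y ε ∩ range (𝓡∂ n) ⊆ (e.extend (𝓡∂ n)).target :=
  Metric.mem_nhdsWithin_iff.1 (extend_target_mem_nhdsWithin' hy)

/-- Intersections of balls with the half-space are convex, so `f` is constant on small chart
neighbourhoods, including those of boundary points; connectedness does the rest. -/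
theorem eq_of_partialDeriv_eq_zero [ConnectedSpace M] {f : M → ℝ}
    (hs : ∀ e ∈ IsManifold.maximalAtlas (𝓡∂ n) ∞ M,
      ContDiffOn ℝ ∞ (inChart (𝓡∂ n) e f) (e.extend (𝓡∂ n)).target)
    (h0 : ∀ e ∈ IsManifold.maximalAtlas (𝓡∂ n) ∞ M, ∀ y ∈ (e.extend (𝓡∂ n)).target, ∀ k,
      partialDeriv (range (𝓡∂ n)) k (inChart (𝓡∂ n) e f) y = 0) (x x' : M) : f x = f x' := by
  have hl : IsLocallyConstant f := by
    rw [IsLocallyConstant.iff_eventually_eq]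
    intro x
    set e := chartAt (EuclideanHalfSpace n) x with hedef
    have he : e ∈ IsManifold.maximalAtlas (𝓡∂ n) ∞ M := IsManifold.chart_mem_maximalAtlas x
    have hxs : x ∈ e.source := mem_chart_source _ x
    have hx : e.extend (𝓡∂ n) x ∈ (e.extend (𝓡∂ n)).target :=
      (e.extend (𝓡∂ n)).map_source (by rwa [e.extend_source])
    obtain ⟨ε, hε, hsub⟩ := exists_ball_inter_range_subset_target hx
    set C := Metric.ball (e.extend (𝓡∂ n) x) ε ∩ range (𝓡∂ n) with hC
    have hconv : Convex ℝ C := (convex_ball _ _).inter convex_range_halfSpace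
    have hT := isCoordDomain_extend_target (I := 𝓡∂ n) e
    have hud : UniqueDiffOn ℝ C := by
      rw [hC, inter_comm]
      exact (𝓡∂ n).uniqueDiffOn.inter Metric.isOpen_ball
    have hder : ∀ z ∈ C, HasFDerivWithinAt (inChart (𝓡∂ n) e f)
        (0 : EuclideanSpace ℝ (Fin n) →L[ℝ] ℝ) C z := by
      intro z hz
      have h1 := (hT.differentiableWithinAt (hs e he) (hsub hz)).hasFDerivWithinAt
      rw [fderivWithin_eq_zero_of_partialDeriv (h0 e he z (hsub hz))] at h1
      exact h1.mono inter_subset_right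
    have hconst : ∀ z ∈ C, inChart (𝓡∂ n) e f z = inChart (𝓡∂ n) e f (e.extend (𝓡∂ n) x) :=
      fun z hz => hconv.is_const_of_fderivWithin_eq_zero
        (fun z hz => (hder z hz).differentiableWithinAt)
        (fun z hz => (hder z hz).fderivWithin (hud z hz)) hz
        ⟨Metric.mem_ball_self hε, hT.subset hx⟩
    filter_upwards [e.open_source.mem_nhds hxs,
      (e.continuousAt_extend (I := 𝓡∂ n) hxs).eventually (Metric.ball_mem_nhds _ hε)] with z hz hz'
    have h2 := hconst _ ⟨hz', hT.subset ((e.extend (𝓡∂ n)).map_source (by rwa [e.extend_source]))⟩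
    rwa [inChart, inChart, e.extend_left_inv hz, e.extend_left_inv hxs] at h2
  exact hl.apply_eq_of_preconnectedSpace x x'

variable [RiemannianBundle (fun x : M => TangentSpace (𝓡∂ n) x)]
  [IsContMDiffRiemannianBundle (𝓡∂ n) ∞ (EuclideanSpace ℝ (Fin n))
    (fun x : M => TangentSpace (𝓡∂ n) x)]

/-- `r` is a height function: its gradient has length one, its Hessian vanishes, and its zeros form
the boundary of `M`. -/
structure IsHeight (r : M → ℝ) : Prop where
  smooth : ContMDiff (𝓡∂ n) 𝓘(ℝ, ℝ) ∞ r
  hess : ∀ e ∈ IsManifold.maximalAtlas (𝓡∂ n) ∞ M, ∀ y ∈ (e.extend (𝓡∂ n)).target, ∀ i j,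
    coordHess (range (𝓡∂ n)) (chartMetric (𝓡∂ n) e) (inChart (𝓡∂ n) e r) i j y = 0
  grad : ∀ e ∈ IsManifold.maximalAtlas (𝓡∂ n) ∞ M, ∀ y ∈ (e.extend (𝓡∂ n)).target,
    coordGradSq (range (𝓡∂ n)) (chartMetric (𝓡∂ n) e) (inChart (𝓡∂ n) e r) y = 1
  pos : ∀ x ∈ (𝓡∂ n).interior M, 0 < r x
  zero : ∀ x ∈ (𝓡∂ n).boundary M, r x = 0

variable {e : OpenPartialHomeomorph M (EuclideanHalfSpace n)} {r : M → ℝ}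

theorem IsHeight.nonneg (hr : IsHeight (n := n) r) (x : M) : 0 ≤ r x := by
  rcases (𝓡∂ n).isInteriorPoint_or_isBoundaryPoint x with h | h
  · exact (hr.pos x h).le
  · exact (hr.zero x h).ge

theorem IsHeight.inChart_nonneg (hr : IsHeight (n := n) r) (y : EuclideanSpace ℝ (Fin n)) :
    0 ≤ inChart (𝓡∂ n) e r y := hr.nonneg _

theorem IsHeight.inChart_eq_zero (hr : IsHeight (n := n) r)
    (he : e ∈ IsManifold.maximalAtlas (𝓡∂ n) ∞ M) {y : EuclideanSpace ℝ (Fin n)}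
    (hy : y ∈ (e.extend (𝓡∂ n)).target) (hy0 : y 0 = 0) : inChart (𝓡∂ n) e r y = 0 := by
  refine hr.zero _ ((mem_boundary_iff_coord_eq_zero he (extend_symm_mem_source hy)).2 ?_)
  rwa [(e.extend (𝓡∂ n)).right_inv hy]

theorem coordGradSq_pos (he : e ∈ IsManifold.maximalAtlas (𝓡∂ n) ∞ M)
    {y : EuclideanSpace ℝ (Fin n)} (hy : y ∈ (e.extend (𝓡∂ n)).target)
    {u : EuclideanSpace ℝ (Fin n) → ℝ} {k : Fin n}
    (hk : partialDeriv (range (𝓡∂ n)) k u y ≠ 0) :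
    0 < coordGradSq (range (𝓡∂ n)) (chartMetric (𝓡∂ n) e) u y := by
  have h1 := (posDef_chartMetric he hy).inv
  have h2 := h1.dotProduct_mulVec_pos (x := fun i => partialDeriv (range (𝓡∂ n)) i u y)
    (fun h => hk (congrFun h k))
  refine h2.trans_eq ?_
  simp only [coordGradSq, dotProduct, Matrix.mulVec, Finset.mul_sum, Pi.star_apply, star_trivial]
  exact Finset.sum_congr rfl fun i _ => Finset.sum_congr rfl fun j _ => by ring

/-- If the boundary is nonempty, `w` is a multiple of a height function. -/
theorem exists_isHeight [ConnectedSpace M] {m c : ℝ} {w : M → ℝ} (hm : 0 < m) (hm1 : m ≠ 1)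
    (hw : IsQuasiEinstein (𝓡∂ n) 0 m w)
    (hc : ∀ e ∈ IsManifold.maximalAtlas (𝓡∂ n) ∞ M, ∀ x ∈ e.source,
      scalarCurvature (𝓡∂ n) e x = c)
    (hb : ((𝓡∂ n).boundary M).Nonempty) :
    ∃ (a : ℝ) (r : M → ℝ), 0 < a ∧ IsHeight (n := n) r ∧ ∀ x, w x = a * r x := by
  -- The function `|∇w|²` on `M`, read in preferred charts; its value does not depend on this
  -- choice.
  set g : M → ℝ := fun x => coordGradSq (range (𝓡∂ n))
    (chartMetric (𝓡∂ n) (chartAt (EuclideanHalfSpace n) x))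
    (inChart (𝓡∂ n) (chartAt (EuclideanHalfSpace n) x) w)
    ((chartAt (EuclideanHalfSpace n) x).extend (𝓡∂ n) x) with hg
  have hws := fun (e : OpenPartialHomeomorph M (EuclideanHalfSpace n))
    (he : e ∈ IsManifold.maximalAtlas (𝓡∂ n) ∞ M) => contDiffOn_inChart hw.smooth he
  have hge : ∀ e ∈ IsManifold.maximalAtlas (𝓡∂ n) ∞ M, EqOn (inChart (𝓡∂ n) e g)
      (coordGradSq (range (𝓡∂ n)) (chartMetric (𝓡∂ n) e) (inChart (𝓡∂ n) e w))
      (e.extend (𝓡∂ n)).target := by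
    intro e he y hy
    have he' : chartAt (EuclideanHalfSpace n) ((e.extend (𝓡∂ n)).symm y) ∈
      IsManifold.maximalAtlas (𝓡∂ n) ∞ M := IsManifold.chart_mem_maximalAtlas _
    rw [coordGradSq_coordChange he he' (hws _ he') ⟨hy, mem_chart_source _ _⟩]
    rfl
  have hgc := fun x x' => eq_of_partialDeriv_eq_zero (n := n) (f := g)
    (fun e he => ((isCoordMetric_chartMetric he).contDiffOn_coordGradSq (hws e he)).congr (hge e he))
    (fun e he y hy k => by
      rw [(isCoordDomain_extend_target e).partialDeriv_congr (hge e he) hy]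
      exact partialDeriv_coordGradSq_eq_zero hm hm1 hw hc he hy k) x x'
  obtain ⟨b, hbb⟩ := hb
  have hgb : ∀ e ∈ IsManifold.maximalAtlas (𝓡∂ n) ∞ M, ∀ y ∈ (e.extend (𝓡∂ n)).target,
      coordGradSq (range (𝓡∂ n)) (chartMetric (𝓡∂ n) e) (inChart (𝓡∂ n) e w) y = g b := by
    intro e he y hy
    rw [← hge e he hy]
    exact hgc _ _
  -- If the gradient vanished identically, `w` would be constant, zero at the boundary point `b` yet
  -- positive inside.
  have hA : 0 < g b := by
    by_contra hA
    have hwc := fun x x' => eq_of_partialDeriv_eq_zero (n := n) (f := w) hws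
      (fun e he y hy k => by
        by_contra hk
        exact hA ((coordGradSq_pos he hy hk).trans_eq (hgb e he y hy))) x x'
    obtain ⟨q, hq⟩ := nonempty_interior_of_halfSpace (n := n) (M := M)
    have := hw.pos q hq
    rw [hwc q b, hw.zero b hbb] at this
    exact lt_irrefl _ this
  set a := Real.sqrt (g b) with ha
  have ha0 : 0 < a := Real.sqrt_pos.2 hA
  have haa : a * a = g b := Real.mul_self_sqrt hA.le
  refine ⟨a, fun x => a⁻¹ * w x, ha0, ?_, fun x => by field_simp⟩
  have hin : ∀ e : OpenPartialHomeomorph M (EuclideanHalfSpace n),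
      inChart (𝓡∂ n) e (fun x => a⁻¹ * w x) = fun y => a⁻¹ * inChart (𝓡∂ n) e w y := fun e => rfl
  have hpd : ∀ e ∈ IsManifold.maximalAtlas (𝓡∂ n) ∞ M, ∀ k, EqOn
      (partialDeriv (range (𝓡∂ n)) k (inChart (𝓡∂ n) e (fun x => a⁻¹ * w x)))
      (fun y => a⁻¹ * partialDeriv (range (𝓡∂ n)) k (inChart (𝓡∂ n) e w) y)
      (e.extend (𝓡∂ n)).target := by
    intro e he k y hy
    rw [hin]
    exact (isCoordDomain_extend_target e).partialDeriv_const_mul (hws e he) hy _ _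
  refine ⟨contMDiff_const.mul hw.smooth, fun e he y hy i j => ?_, fun e he y hy => ?_,
    fun x hx => mul_pos (inv_pos.2 ha0) (hw.pos x hx), fun x hx => by rw [hw.zero x hx, mul_zero]⟩
  · have hT := isCoordDomain_extend_target (I := 𝓡∂ n) e
    have h1 := coordHess_eq_zero_of_scalarCurvature hm hm1 hw hc he hy i j
    simp only [coordHess] at h1 ⊢
    rw [hT.partialDeriv_congr (hpd e he j) hy,
      hT.partialDeriv_const_mul (hT.contDiffOn_partialDeriv (hws e he) j) hy]
    have h2 : ∀ k, christoffel (range (𝓡∂ n)) (chartMetric (𝓡∂ n) e) k i j y *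
        partialDeriv (range (𝓡∂ n)) k (inChart (𝓡∂ n) e (fun x => a⁻¹ * w x)) y =
        a⁻¹ * (christoffel (range (𝓡∂ n)) (chartMetric (𝓡∂ n) e) k i j y *
          partialDeriv (range (𝓡∂ n)) k (inChart (𝓡∂ n) e w) y) := by
      intro k
      rw [hpd e he k hy]
      ring
    simp only [h2, ← Finset.mul_sum]
    rw [← mul_sub, h1, mul_zero]
  · have h1 := hgb e he y hy
    simp only [coordGradSq] at h1 ⊢
    have h2 : ∀ i j, (chartMetric (𝓡∂ n) e y)⁻¹ i j *
        (partialDeriv (range (𝓡∂ n)) i (inChart (𝓡∂ n) e (fun x => a⁻¹ * w x)) y *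
          partialDeriv (range (𝓡∂ n)) j (inChart (𝓡∂ n) e (fun x => a⁻¹ * w x)) y) =
        (a * a)⁻¹ * ((chartMetric (𝓡∂ n) e y)⁻¹ i j *
          (partialDeriv (range (𝓡∂ n)) i (inChart (𝓡∂ n) e w) y *
            partialDeriv (range (𝓡∂ n)) j (inChart (𝓡∂ n) e w) y)) := by
      intro i j
      rw [hpd e he i hy, hpd e he j hy, mul_inv]
      ring
    simp only [h2, ← Finset.mul_sum]
    rw [h1, haa, inv_mul_cancel₀ hA.ne']

theorem IsHeight.exists_partialDeriv_ne_zero (hr : IsHeight (n := n) r)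
    (he : e ∈ IsManifold.maximalAtlas (𝓡∂ n) ∞ M) {y : EuclideanSpace ℝ (Fin n)}
    (hy : y ∈ (e.extend (𝓡∂ n)).target) :
    ∃ k, partialDeriv (range (𝓡∂ n)) k (inChart (𝓡∂ n) e r) y ≠ 0 := by
  by_contra! h
  have h1 := hr.grad e he y hy
  simp only [coordGradSq, h, mul_zero, Finset.sum_const_zero] at h1
  exact zero_ne_one h1

theorem ContinuousLinearMap.isInvertible_of_ker {n : ℕ}
    {A : EuclideanSpace ℝ (Fin n) →L[ℝ] EuclideanSpace ℝ (Fin n)}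
    (hA : ∀ v, A v = 0 → v = 0) : A.IsInvertible := by
  have hinj : Function.Injective A.toLinearMap := (injective_iff_map_eq_zero A).2 hA
  exact ⟨(LinearEquiv.ofInjectiveEndo A.toLinearMap hinj).toContinuousLinearEquiv, by
    ext v; rfl⟩

/-- Around each point there is a chart whose first coordinate is the height. -/
theorem IsHeight.exists_height_chart (hr : IsHeight (n := n) r) (q : M) :
    ∃ e ∈ IsManifold.maximalAtlas (𝓡∂ n) ∞ M, q ∈ e.source ∧
      ∀ x ∈ e.source, e.extend (𝓡∂ n) x 0 = r x := by
  set e := chartAt (EuclideanHalfSpace n) q with hedef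
  have he : e ∈ IsManifold.maximalAtlas (𝓡∂ n) ∞ M := IsManifold.chart_mem_maximalAtlas q
  have hq : q ∈ e.source := mem_chart_source _ q
  set y₀ := e.extend (𝓡∂ n) q with hy₀
  have hy₀t : y₀ ∈ (e.extend (𝓡∂ n)).target :=
    (e.extend (𝓡∂ n)).map_source (by rwa [e.extend_source])
  have hT := isCoordDomain_extend_target (I := 𝓡∂ n) e
  have hrs := contDiffOn_inChart hr.smooth he
  obtain ⟨k, hk⟩ := hr.exists_partialDeriv_ne_zero he hy₀t
  -- The height becomes the first coordinate, and the old first coordinate moves to the slot `k`,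
  -- along which the height has nonzero derivative. Since `r ≥ 0`, with `r = 0` on the boundary, the
  -- change respects the half-space.
  set σ := Equiv.swap 0 k with hσ
  set f : EuclideanSpace ℝ (Fin n) → EuclideanSpace ℝ (Fin n) := fun y =>
    WithLp.toLp 2 fun i => if i = 0 then inChart (𝓡∂ n) e r y else y (σ i) with hf
  have hf0 : ∀ y, f y 0 = inChart (𝓡∂ n) e r y := fun y => by simp [hf]
  have hfi : ∀ y, ∀ i ≠ 0, f y i = y (σ i) := fun y i hi => by simp [hf, hi]
  have hfs : ContDiffOn ℝ ∞ f (e.extend (𝓡∂ n)).target := by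
    rw [contDiffOn_euclidean]
    intro i
    by_cases hi : i = 0
    · subst hi
      exact hrs.congr fun y _ => hf0 y
    · exact (contDiff_coord (σ i)).contDiffOn.congr fun y _ => hfi y i hi
  obtain ⟨ε, hε, hsub⟩ := exists_ball_inter_range_subset_target hy₀t
  have hsub' : range (𝓡∂ n) ∩ Metric.ball y₀ ε ⊆ (e.extend (𝓡∂ n)).target := by
    rwa [inter_comm]
  obtain ⟨e', he', hq', hs', hee'⟩ := exists_chart_change he hq Metric.isOpen_ball
    (Metric.mem_ball_self hε) (hfs.mono hsub')
    (fun y hy => mem_range_halfSpace.2 (by rw [hf0]; exact hr.inChart_nonneg y))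
    (fun y hy h0 => by
      rw [hf0]
      exact hr.inChart_eq_zero he (hsub' ⟨mem_range_halfSpace.2 h0.ge, hy⟩) h0)
    (by
      refine ContinuousLinearMap.isInvertible_of_ker fun v hv => ?_
      have hcomp : ∀ i, (∑ j, v j * partialDeriv (range (𝓡∂ n)) j (fun z => f z i) y₀) = 0 := by
        intro i
        have h1 := congrArg (fun u : EuclideanSpace ℝ (Fin n) => u i) hv
        rw [euclideanSpace_eq_sum_single v, map_sum] at h1
        simp only [map_smul] at h1
        simp only [hT.partialDeriv_apply hfs hy₀t]
        rw [WithLp.ofLp_sum, Finset.sum_apply] at h1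
        exact h1
      have hvi : ∀ i ≠ k, v i = 0 := by
        intro i hi
        have hσi : σ i ≠ 0 := fun h => hi (by rw [← σ.symm_apply_apply i, h]; simp [hσ])
        have h1 := hcomp (σ i)
        have h2 : (fun z => f z (σ i)) = fun z => z i := by
          funext z
          rw [hfi z _ hσi]
          simp [hσ]
        simp only [h2, hT.partialDeriv_coord hy₀t] at h1
        simpa using h1
      have hvk : v k = 0 := by
        have h1 := hcomp 0
        have h2 : (fun z => f z 0) = inChart (𝓡∂ n) e r := funext hf0
        rw [Finset.sum_eq_single k (fun i _ hi => by rw [hvi i hi, zero_mul])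
          (fun h => absurd (Finset.mem_univ k) h)] at h1
        exact (mul_eq_zero.1 h1).resolve_right (by rwa [h2])
      ext i
      by_cases hi : i = k
      · rw [hi, hvk]; rfl
      · rw [hvi i hi]; rfl)
  refine ⟨e', he', hq', fun x hx => ?_⟩
  rw [(hee' x hx).2, hf0, inChart, e.extend_left_inv (hs' hx)]

end Height

/-! ## Box charts -/

section BoxCharts

set_option linter.unusedSectionVars false

variable {n : ℕ} [NeZero n]

/-- The point `z` with its first coordinate replaced by `t`. -/
noncomputable def setHeight (t : ℝ) (z : EuclideanSpace ℝ (Fin n)) : EuclideanSpace ℝ (Fin n) :=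
  z + (t - z 0) • EuclideanSpace.single 0 (1 : ℝ)

theorem setHeight_zero (t : ℝ) (z : EuclideanSpace ℝ (Fin n)) : setHeight t z 0 = t := by
  simp [setHeight]

theorem setHeight_ne (t : ℝ) (z : EuclideanSpace ℝ (Fin n)) {i : Fin n} (hi : i ≠ 0) :
    setHeight t z i = z i := by
  simp [setHeight, hi]

theorem setHeight_self (z : EuclideanSpace ℝ (Fin n)) : setHeight (z 0) z = z := by
  simp [setHeight]

theorem setHeight_setHeight (s t : ℝ) (z : EuclideanSpace ℝ (Fin n)) :
    setHeight s (setHeight t z) = setHeight s z := by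
  ext i
  by_cases hi : i = 0
  · subst hi; rw [setHeight_zero, setHeight_zero]
  · rw [setHeight_ne _ _ hi, setHeight_ne _ _ hi, setHeight_ne _ _ hi]

theorem contDiff_setHeight :
    ContDiff ℝ ∞ (fun p : ℝ × EuclideanSpace ℝ (Fin n) => setHeight p.1 p.2) := by
  unfold setHeight
  exact contDiff_snd.add ((contDiff_fst.sub ((contDiff_coord 0).comp contDiff_snd)).smul
    contDiff_const)

theorem setHeight_mem_range {t : ℝ} (ht : 0 ≤ t) (z : EuclideanSpace ℝ (Fin n)) :
    setHeight t z ∈ range (𝓡∂ n) := mem_range_halfSpace.2 (by rwa [setHeight_zero])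

theorem hasDerivAt_setHeight (z : EuclideanSpace ℝ (Fin n)) (t : ℝ) :
    HasDerivAt (fun s => setHeight s z) (EuclideanSpace.single 0 (1 : ℝ)) t := by
  have := (((hasDerivAt_id t).sub_const (z 0)).smul_const
    (EuclideanSpace.single (0 : Fin n) (1 : ℝ))).const_add z
  rwa [one_smul] at this

theorem abs_coord_le_norm (z : EuclideanSpace ℝ (Fin n)) (i : Fin n) : |z i| ≤ ‖z‖ := by
  simpa using PiLp.norm_apply_le z i

theorem norm_setHeight_sub_le (t : ℝ) (z y : EuclideanSpace ℝ (Fin n)) :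
    ‖setHeight t z - y‖ ≤ 2 * ‖z - y‖ + |t - y 0| := by
  have h1 : setHeight t z - y = (z - y) + ((t - y 0) - (z - y) 0) • EuclideanSpace.single 0 (1 : ℝ) := by
    simp only [setHeight, PiLp.sub_apply]
    module
  rw [h1]
  refine (norm_add_le _ _).trans ?_
  rw [norm_smul]
  have h2 : ‖EuclideanSpace.single (0 : Fin n) (1 : ℝ)‖ = 1 := by simp
  have h3 := abs_sub (t - y 0) ((z - y) 0)
  have h4 := abs_coord_le_norm (z - y) 0
  rw [h2, mul_one, Real.norm_eq_abs]
  linarith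

theorem norm_setHeight_sub_le' (z y : EuclideanSpace ℝ (Fin n)) :
    ‖setHeight (y 0) z - y‖ ≤ ‖z - y‖ := by
  rw [EuclideanSpace.norm_eq, EuclideanSpace.norm_eq]
  refine Real.sqrt_le_sqrt (Finset.sum_le_sum fun i _ => ?_)
  by_cases hi : i = 0
  · subst hi
    rw [PiLp.sub_apply, setHeight_zero, sub_self, norm_zero, zero_pow two_ne_zero]
    positivity
  · simp [setHeight_ne _ _ hi]

variable {M : Type*} [TopologicalSpace M]
  [ChartedSpace (EuclideanHalfSpace n) M] [IsManifold (𝓡∂ n) ∞ M]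
  [RiemannianBundle (fun x : M => TangentSpace (𝓡∂ n) x)]
  [IsContMDiffRiemannianBundle (𝓡∂ n) ∞ (EuclideanSpace ℝ (Fin n))
    (fun x : M => TangentSpace (𝓡∂ n) x)]

/-- A chart whose first coordinate is the height and in which the metric has the form
`dr² + g'`. -/
structure IsBoxChart (r : M → ℝ) (e : OpenPartialHomeomorph M (EuclideanHalfSpace n)) : Prop where
  mem : e ∈ IsManifold.maximalAtlas (𝓡∂ n) ∞ M
  coord : ∀ x ∈ e.source, e.extend (𝓡∂ n) x 0 = r x
  metric : ∀ y ∈ (e.extend (𝓡∂ n)).target, ∀ j,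
    chartMetric (𝓡∂ n) e y 0 j = (1 : Matrix (Fin n) (Fin n) ℝ) 0 j

variable {e : OpenPartialHomeomorph M (EuclideanHalfSpace n)} {r : M → ℝ}

theorem inChart_eq_coord (hc : ∀ x ∈ e.source, e.extend (𝓡∂ n) x 0 = r x)
    {y : EuclideanSpace ℝ (Fin n)} (hy : y ∈ (e.extend (𝓡∂ n)).target) :
    inChart (𝓡∂ n) e r y = y 0 := by
  rw [inChart, ← hc _ (extend_symm_mem_source hy), (e.extend (𝓡∂ n)).right_inv hy]

theorem partialDeriv_inChart_of_coord (hc : ∀ x ∈ e.source, e.extend (𝓡∂ n) x 0 = r x)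
    {y : EuclideanSpace ℝ (Fin n)} (hy : y ∈ (e.extend (𝓡∂ n)).target) (k : Fin n) :
    partialDeriv (range (𝓡∂ n)) k (inChart (𝓡∂ n) e r) y = if 0 = k then 1 else 0 := by
  have hT := isCoordDomain_extend_target (I := 𝓡∂ n) e
  rw [hT.partialDeriv_congr (fun z hz => inChart_eq_coord hc hz) hy, hT.partialDeriv_coord hy]

/-- The components of the metric of a box chart do not depend on the height. -/
theorem IsBoxChart.partialDeriv_zero_chartMetric (hr : IsHeight (n := n) r) (he : IsBoxChart r e)
    {y : EuclideanSpace ℝ (Fin n)} (hy : y ∈ (e.extend (𝓡∂ n)).target) (i j : Fin n) :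
    partialDeriv (range (𝓡∂ n)) 0 (fun z => chartMetric (𝓡∂ n) e z i j) y = 0 := by
  have hT := isCoordDomain_extend_target (I := 𝓡∂ n) e
  have hG := isCoordMetric_chartMetric he.mem
  -- When the height is a coordinate, its vanishing Hessian says that all `Γ⁰_ij` are zero. The row
  -- `g_0j` is constant, so lowering the index leaves only the height derivative of `g_ij`.
  have h1 := hr.hess e he.mem y hy i j
  simp only [coordHess] at h1
  rw [hT.partialDeriv_congr (fun z hz => partialDeriv_inChart_of_coord he.coord hz j) hy,
    partialDeriv_const, zero_sub, neg_eq_zero] at h1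
  simp only [partialDeriv_inChart_of_coord he.coord hy, mul_ite, mul_one, mul_zero,
    Finset.sum_ite_eq, Finset.mem_univ, if_true] at h1
  have h2 := hG.sum_christoffel_mul hy 0 i j
  simp only [he.metric y hy, Matrix.one_apply, ite_mul, one_mul, zero_mul, Finset.sum_ite_eq,
    Finset.mem_univ, if_true, h1] at h2
  have h3 : ∀ a b, partialDeriv (range (𝓡∂ n)) a (fun z => chartMetric (𝓡∂ n) e z b 0) y = 0 := by
    intro a b
    rw [hT.partialDeriv_congr (g := fun _ => (1 : Matrix (Fin n) (Fin n) ℝ) 0 b)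
      (fun z hz => by simp only; rw [chartMetric_symm, he.metric z hz]) hy, partialDeriv_const]
  simp only [loweredChristoffel, h3] at h2
  linarith

/-- Here `f` expresses the old coordinates through the new ones. It fixes the coordinates of `q`, so
that `q` lies in the domain of the inverse change. -/
theorem exists_chart_change_symm (he : e ∈ IsManifold.maximalAtlas (𝓡∂ n) ∞ M) {q : M}
    (hq : q ∈ e.source) {f : EuclideanSpace ℝ (Fin n) → EuclideanSpace ℝ (Fin n)}
    {U : Set (EuclideanSpace ℝ (Fin n))} (hU : IsOpen U) (hqU : e.extend (𝓡∂ n) q ∈ U)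
    (hfq : f (e.extend (𝓡∂ n) q) = e.extend (𝓡∂ n) q)
    (hf : ContDiffOn ℝ ∞ f (range (𝓡∂ n) ∩ U))
    (hmaps : MapsTo f (range (𝓡∂ n) ∩ U) (range (𝓡∂ n)))
    (hbd : ∀ y ∈ U, y 0 = 0 → f y 0 = 0)
    (hinv : (fderivWithin ℝ f (range (𝓡∂ n)) (e.extend (𝓡∂ n) q)).IsInvertible) :
    ∃ e' ∈ IsManifold.maximalAtlas (𝓡∂ n) ∞ M, q ∈ e'.source ∧ e'.source ⊆ e.source ∧
      ∀ x ∈ e'.source, e'.extend (𝓡∂ n) x ∈ U ∧ f (e'.extend (𝓡∂ n) x) = e.extend (𝓡∂ n) x := by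
  obtain ⟨h, hh, hqh, hhU, hhf⟩ := exists_halfSpace_localDiffeo (p₀ := e q) hU hqU hf hmaps hbd hinv
  have hhq : h (e q) = e q := Subtype.ext ((hhf _ hqh).trans hfq)
  refine ⟨e ≫ₕ h.symm, e.trans_mem_maximalAtlas he ((contDiffGroupoid ∞ (𝓡∂ n)).symm hh), ?_, ?_, ?_⟩
  · rw [OpenPartialHomeomorph.trans_source]
    refine ⟨hq, ?_⟩
    have := h.map_source hqh
    rw [hhq] at this
    exact this
  · rw [OpenPartialHomeomorph.trans_source]
    exact inter_subset_left
  · intro x hx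
    rw [OpenPartialHomeomorph.trans_source] at hx
    have h1 : h.symm (e x) ∈ h.source := h.map_target hx.2
    refine ⟨hhU _ h1, ?_⟩
    have h2 := hhf _ h1
    rw [h.right_inv hx.2] at h2
    exact h2.symm

/-- Around each point there is a box chart. -/
theorem IsHeight.exists_boxChart (hr : IsHeight (n := n) r) (q : M) :
    ∃ e, IsBoxChart (n := n) r e ∧ q ∈ e.source := by
  obtain ⟨e, he, hq, hc⟩ := hr.exists_height_chart q
  set y₀ := e.extend (𝓡∂ n) q with hy₀
  have hy₀t : y₀ ∈ (e.extend (𝓡∂ n)).target :=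
    (e.extend (𝓡∂ n)).map_source (by rwa [e.extend_source])
  have hT := isCoordDomain_extend_target (I := 𝓡∂ n) e
  have hG := isCoordMetric_chartMetric he
  -- The components of `∇r`. Because `|∇r| = 1`, the height component is `1`, so height can serve as
  -- time along the flow.
  set K : EuclideanSpace ℝ (Fin n) → Fin n → ℝ := fun y a => (chartMetric (𝓡∂ n) e y)⁻¹ 0 a with hK
  have hK0 : ∀ y ∈ (e.extend (𝓡∂ n)).target, K y 0 = 1 := by
    intro y hy
    rw [← hr.grad e he y hy, coordGradSq]
    simp only [partialDeriv_inChart_of_coord hc hy, mul_ite, mul_one, mul_zero,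
      Finset.sum_ite_eq, Finset.mem_univ, if_true]
    rfl
  obtain ⟨ε, hε, hsub⟩ := exists_ball_inter_range_subset_target hy₀t
  set t₀ := y₀ 0 with ht₀
  have ht₀0 : 0 ≤ t₀ := extend_coord_nonneg e q
  -- The window of heights is cut off at zero; when `q` is a boundary point the flow is one-sided,
  -- starting at the end of the interval.
  set a := max 0 (t₀ - ε / 4) with ha
  set b := t₀ + ε / 4 with hb
  have hab : a < b := max_lt (by linarith) (by linarith)
  have ht₀ab : t₀ ∈ Icc a b := ⟨max_le ht₀0 (by linarith), by linarith⟩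
  set Ω := Metric.ball y₀ (ε / 4) with hΩ
  have hmem : ∀ t ∈ Icc a b, ∀ z ∈ Ω, setHeight t z ∈ (e.extend (𝓡∂ n)).target := by
    intro t ht z hz
    refine hsub ⟨?_, setHeight_mem_range ((le_max_left _ _).trans ht.1) z⟩
    rw [mem_ball_iff_norm]
    have h1 := norm_setHeight_sub_le t z y₀
    have h2 : ‖z - y₀‖ < ε / 4 := mem_ball_iff_norm.1 hz
    have h3 : |t - y₀ 0| ≤ ε / 4 := by
      rw [abs_le]
      have := (le_max_right 0 (t₀ - ε / 4)).trans ht.1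
      have := ht.2
      constructor <;> linarith
    linarith
  -- The gradient field at the point whose height is the current time. The first coordinate of the
  -- moving point is overwritten, so time and height coincide by construction.
  set U : ℝ × EuclideanSpace ℝ (Fin n) → EuclideanSpace ℝ (Fin n) := fun p =>
    WithLp.toLp 2 (K (setHeight p.1 p.2)) with hU
  have hUs : ContDiffOn ℝ ∞ U (Icc a b ×ˢ Ω) := by
    rw [contDiffOn_euclidean]
    intro i
    exact (hG.contDiffOn_inv 0 i).comp contDiff_setHeight.contDiffOn fun p hp => hmem _ hp.1 _ hp.2
  obtain ⟨δ, hδ, Z, hZs, hZ0, hZ⟩ := exists_smooth_flow Metric.isOpen_ball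
    (Metric.mem_ball_self (by positivity) : y₀ ∈ Ω) hab ht₀ab hUs
  set J := Icc (max a (t₀ - δ)) (min b (t₀ + δ)) with hJ
  have hJlt : max a (t₀ - δ) < min b (t₀ + δ) := by
    refine max_lt (lt_min hab ?_) (lt_min ?_ ?_)
    · exact lt_of_le_of_lt ht₀ab.1 (by linarith)
    · exact lt_of_lt_of_le (by linarith : t₀ - δ < t₀) ht₀ab.2
    · linarith
  have hJu : UniqueDiffOn ℝ J := uniqueDiffOn_Icc hJlt
  have hJab : ∀ t ∈ J, t ∈ Icc a b := fun t ht =>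
    ⟨(le_max_left _ _).trans ht.1, ht.2.trans (min_le_left _ _)⟩
  have hJ0 : ∀ t ∈ J, 0 ≤ t := fun t ht => (le_max_left _ _).trans (hJab t ht).1
  set δ' := min δ (ε / 4) with hδ'
  have hδ'0 : 0 < δ' := lt_min hδ (by positivity)
  -- From new to old coordinates: the horizontal coordinates of `y` mark a point at height `t₀`,
  -- which is moved along the flow to the height of `y`.
  set Ξ : EuclideanSpace ℝ (Fin n) → EuclideanSpace ℝ (Fin n) := fun y =>
    setHeight (y 0) (Z (y 0, setHeight t₀ y)) with hΞ
  have hyJ : ∀ y ∈ range (𝓡∂ n) ∩ Metric.ball y₀ δ', y 0 ∈ J := by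
    rintro y ⟨hyr, hyb⟩
    have h1 : 0 ≤ y 0 := mem_range_halfSpace.1 hyr
    have h2 := abs_coord_le_norm (y - y₀) 0
    have h3 : ‖y - y₀‖ < δ' := mem_ball_iff_norm.1 hyb
    have h4 : |y 0 - t₀| < δ' := lt_of_le_of_lt h2 h3
    rw [abs_lt] at h4
    have h5 : δ' ≤ δ := min_le_left _ _
    have h6 : δ' ≤ ε / 4 := min_le_right _ _
    exact ⟨max_le (max_le h1 (by linarith)) (by linarith), le_min (by linarith) (by linarith)⟩
  have hyb : ∀ y ∈ Metric.ball y₀ δ', setHeight t₀ y ∈ Metric.ball y₀ δ := by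
    intro y hy
    rw [mem_ball_iff_norm] at hy ⊢
    exact lt_of_le_of_lt (norm_setHeight_sub_le' y y₀) (hy.trans_le (min_le_left _ _))
  have hΞs : ContDiffOn ℝ ∞ Ξ (range (𝓡∂ n) ∩ Metric.ball y₀ δ') := by
    have h1 : ContDiffOn ℝ ∞ (fun y : EuclideanSpace ℝ (Fin n) => Z (y 0, setHeight t₀ y))
        (range (𝓡∂ n) ∩ Metric.ball y₀ δ') := by
      refine hZs.comp (ContDiff.contDiffOn ?_) fun y hy => ⟨hyJ y hy, mem_univ _⟩
      exact (contDiff_coord 0).prodMk (contDiff_setHeight.comp (contDiff_const.prodMk contDiff_id))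
    exact contDiff_setHeight.comp_contDiffOn ((contDiff_coord 0).contDiffOn.prodMk h1)
  have hΞ0 : ∀ y, Ξ y 0 = y 0 := fun y => setHeight_zero _ _
  have hΞt : ∀ y : EuclideanSpace ℝ (Fin n), y 0 = t₀ → Ξ y = y := by
    intro y hy
    simp only [hΞ, hy, hZ0, setHeight_setHeight]
    rw [← hy, setHeight_self]
  have hy₀r : y₀ ∈ range (𝓡∂ n) := hT.subset hy₀t
  have hΞd : ∀ y ∈ range (𝓡∂ n) ∩ Metric.ball y₀ δ',
      HasFDerivWithinAt Ξ (fderivWithin ℝ Ξ (range (𝓡∂ n)) y) (range (𝓡∂ n)) y := by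
    intro y hy
    refine DifferentiableWithinAt.hasFDerivWithinAt ?_
    exact ((hΞs y hy).mono_of_mem_nhdsWithin (Filter.inter_mem self_mem_nhdsWithin
      (nhdsWithin_le_nhds (Metric.isOpen_ball.mem_nhds hy.2)))).differentiableWithinAt (by simp)
  obtain ⟨e', he', hq', hs', hee'⟩ := exists_chart_change_symm he hq Metric.isOpen_ball
    (Metric.mem_ball_self hδ'0) (hΞt y₀ rfl) hΞs
    (fun y hy => mem_range_halfSpace.2 (by rw [hΞ0]; exact mem_range_halfSpace.1 hy.1))
    (fun y _ h0 => by rw [hΞ0, h0])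
    (by
      -- A kernel vector has zero height component because `Ξ` preserves heights; in the remaining
      -- directions `Ξ` is the identity at height `t₀`.
      have hd := hΞd y₀ ⟨hy₀r, Metric.mem_ball_self hδ'0⟩
      refine ContinuousLinearMap.isInvertible_of_ker fun v hv => ?_
      have hv0 : v 0 = 0 := by
        have h1 : HasFDerivWithinAt (fun y : EuclideanSpace ℝ (Fin n) => y 0)
            ((EuclideanSpace.proj 0 : EuclideanSpace ℝ (Fin n) →L[ℝ] ℝ).comp
              (fderivWithin ℝ Ξ (range (𝓡∂ n)) y₀)) (range (𝓡∂ n)) y₀ :=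
          ((EuclideanSpace.proj 0 : EuclideanSpace ℝ (Fin n) →L[ℝ] ℝ).hasFDerivAt.comp_hasFDerivWithinAt
            y₀ hd).congr_of_eventuallyEq (Filter.Eventually.of_forall fun y => (hΞ0 y).symm)
              (hΞ0 y₀).symm
        have h2 := (𝓡∂ n).uniqueDiffOn.eq hy₀r h1
          ((EuclideanSpace.proj 0 : EuclideanSpace ℝ (Fin n) →L[ℝ] ℝ).hasFDerivWithinAt)
        have h3 := congrArg (fun A : EuclideanSpace ℝ (Fin n) →L[ℝ] ℝ => A v) h2
        simp only [ContinuousLinearMap.comp_apply] at h3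
        rw [hv, map_zero] at h3
        exact h3.symm
      have hℓd : HasDerivAt (fun t : ℝ => y₀ + t • v) v 0 := by
        have := ((hasDerivAt_id (0 : ℝ)).smul_const v).const_add y₀
        rwa [one_smul] at this
      have hℓ0 : ∀ t : ℝ, (y₀ + t • v) 0 = t₀ := fun t => by simp [hv0, ht₀]
      have hd' : HasFDerivWithinAt Ξ (fderivWithin ℝ Ξ (range (𝓡∂ n)) y₀) (range (𝓡∂ n))
          (y₀ + (0 : ℝ) • v) := by simpa using hd
      have h1 := hd'.comp_hasDerivWithinAt (s := univ) 0 hℓd.hasDerivWithinAt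
        (fun t _ => mem_range_halfSpace.2 (by rw [hℓ0]; exact ht₀0))
      rw [hasDerivWithinAt_univ, hv] at h1
      have h2 : HasDerivAt (Ξ ∘ fun t : ℝ => y₀ + t • v) v 0 :=
        hℓd.congr_of_eventuallyEq (Filter.Eventually.of_forall fun t => hΞt _ (hℓ0 t))
      exact h2.unique h1)
  have hT' := isCoordDomain_extend_target (I := 𝓡∂ n) e'
  have hcoord : ∀ x ∈ e'.source, e'.extend (𝓡∂ n) x 0 = r x := fun x hx => by
    rw [← hΞ0, (hee' x hx).2, hc x (hs' hx)]
  have hO : ∀ y ∈ (e'.extend (𝓡∂ n)).target, y ∈ overlap (𝓡∂ n) e' e := fun y hy =>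
    ⟨hy, hs' (extend_symm_mem_source hy)⟩
  have hcc : ∀ y ∈ (e'.extend (𝓡∂ n)).target, y ∈ Metric.ball y₀ δ' ∧
      coordChange (𝓡∂ n) e' e y = Ξ y := by
    intro y hy
    have h1 := hee' _ (extend_symm_mem_source hy)
    rw [(e'.extend (𝓡∂ n)).right_inv hy] at h1
    exact ⟨h1.1, h1.2.symm⟩
  have hpd : ∀ y ∈ (e'.extend (𝓡∂ n)).target, ∀ i a,
      partialDeriv (range (𝓡∂ n)) i (fun z => coordChange (𝓡∂ n) e' e z a) y =
        fderivWithin ℝ Ξ (range (𝓡∂ n)) y (EuclideanSpace.single i 1) a := by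
    intro y hy i a
    have hΞs' : ContDiffOn ℝ ∞ Ξ (e'.extend (𝓡∂ n)).target :=
      hΞs.mono fun z hz => ⟨hT'.subset hz, (hcc z hz).1⟩
    rw [← hT'.partialDeriv_apply hΞs' hy]
    exact hT'.partialDeriv_congr (fun z hz => by simp only; rw [(hcc z hz).2]) hy i
  -- The vertical coordinate field of the new chart is `∇r`.
  have hpd0 : ∀ y ∈ (e'.extend (𝓡∂ n)).target, ∀ a,
      partialDeriv (range (𝓡∂ n)) 0 (fun z => coordChange (𝓡∂ n) e' e z a) y =
        K (coordChange (𝓡∂ n) e' e y) a := by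
    intro y hy a
    have hyb' := (hcc y hy).1
    have hyr := hT'.subset hy
    have hyJ' := hyJ y ⟨hyr, hyb'⟩
    rw [hpd y hy]
    by_cases ha0 : a = 0
    · subst ha0
      rw [hK0 _ (mapsTo_coordChange e' e (hO y hy)), ← hpd y hy]
      have h1 : EqOn (fun z => coordChange (𝓡∂ n) e' e z 0) (fun z => z 0)
          (e'.extend (𝓡∂ n)).target := fun z hz => by
        simp only
        rw [(hcc z hz).2, hΞ0]
      rw [hT'.partialDeriv_congr h1 hy, hT'.partialDeriv_coord hy, if_pos rfl]
    · have hd := hΞd y ⟨hyr, hyb'⟩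
      rw [← setHeight_self y] at hd
      have h1 := hd.comp_hasDerivWithinAt (s := J) (y 0)
        (hasDerivAt_setHeight y (y 0)).hasDerivWithinAt
        (fun t ht => setHeight_mem_range (hJ0 t ht) y)
      rw [setHeight_self] at h1
      have h2 := ((EuclideanSpace.proj a : EuclideanSpace ℝ (Fin n) →L[ℝ] ℝ).hasFDerivAt
        (x := Ξ (setHeight (y 0) y))).comp_hasDerivWithinAt (y 0) h1
      have h3 := (hZ (setHeight t₀ y) (hyb y hyb') (y 0) hyJ').2
      have h4 := ((EuclideanSpace.proj a : EuclideanSpace ℝ (Fin n) →L[ℝ] ℝ).hasFDerivAt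
        (x := Z (y 0, setHeight t₀ y))).comp_hasDerivWithinAt (y 0) h3
      have h5 : ∀ t, ((EuclideanSpace.proj a : EuclideanSpace ℝ (Fin n) →L[ℝ] ℝ) ∘
          Ξ ∘ fun s => setHeight s y) t =
          ((EuclideanSpace.proj a : EuclideanSpace ℝ (Fin n) →L[ℝ] ℝ) ∘
            fun t => Z (t, setHeight t₀ y)) t := by
        intro t
        change Ξ (setHeight t y) a = Z (t, setHeight t₀ y) a
        simp only [hΞ, setHeight_zero, setHeight_setHeight]
        rw [setHeight_ne _ _ ha0]
      have h6 := h4.congr (fun t _ => h5 t) (h5 (y 0))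
      have h7 := (hJu (y 0) hyJ').eq_deriv _ h2 h6
      have h8 : (EuclideanSpace.proj a : EuclideanSpace ℝ (Fin n) →L[ℝ] ℝ)
          (U (y 0, Z (y 0, setHeight t₀ y))) = K (coordChange (𝓡∂ n) e' e y) a := by
        rw [(hcc y hy).2]
        rfl
      rw [← h8, ← h7]
      rfl
  refine ⟨e', ⟨he', hcoord, fun y hy j => ?_⟩, hq'⟩
  rw [chartMetric_coordChange he' he (hO y hy)]
  simp only [hpd0 y hy]
  have hz := mapsTo_coordChange e' e (hO y hy)
  set z := coordChange (𝓡∂ n) e' e y with hzd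
  have h1 : ∀ b, ∑ a, K z a * chartMetric (𝓡∂ n) e z a b = (1 : Matrix (Fin n) (Fin n) ℝ) 0 b := by
    intro b
    rw [← Matrix.nonsing_inv_mul _ (hG.isUnit_det z hz), Matrix.mul_apply]
  -- This is `g(∇r, ∂_j) = dr(∂_j)`, which is `1` for the height coordinate and `0` otherwise.
  calc ∑ a, ∑ b, chartMetric (𝓡∂ n) e z a b *
        (K z a * partialDeriv (range (𝓡∂ n)) j (fun z => coordChange (𝓡∂ n) e' e z b) y)
      = ∑ b, (∑ a, K z a * chartMetric (𝓡∂ n) e z a b) *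
          partialDeriv (range (𝓡∂ n)) j (fun z => coordChange (𝓡∂ n) e' e z b) y := by
        rw [Finset.sum_comm]
        refine Finset.sum_congr rfl fun b _ => ?_
        rw [Finset.sum_mul]
        exact Finset.sum_congr rfl fun a _ => by ring
    _ = partialDeriv (range (𝓡∂ n)) j (fun z => coordChange (𝓡∂ n) e' e z 0) y := by
        simp only [h1, Matrix.one_apply, ite_mul, one_mul, zero_mul, Finset.sum_ite_eq,
          Finset.mem_univ, if_true]
    _ = (1 : Matrix (Fin n) (Fin n) ℝ) 0 j := by
        have h2 : EqOn (fun z => coordChange (𝓡∂ n) e' e z 0) (fun z => z 0)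
            (e'.extend (𝓡∂ n)).target := fun z hz => by
          simp only
          rw [(hcc z hz).2, hΞ0]
        rw [hT'.partialDeriv_congr h2 hy, hT'.partialDeriv_coord hy, Matrix.one_apply]

end BoxCharts

/-! ## Flow boxes -/

section SplitHeight

variable {k : ℕ}

/-- The last coordinates of a point. -/
noncomputable def tailL (k : ℕ) : EuclideanSpace ℝ (Fin (k + 1)) →L[ℝ] EuclideanSpace ℝ (Fin k) :=
  (PiLp.continuousLinearEquiv 2 ℝ (fun _ : Fin k => ℝ)).symm.toContinuousLinearMap.comp
    (ContinuousLinearMap.pi fun i => EuclideanSpace.proj i.succ)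

/-- The point with first coordinate `t` and last coordinates `z`. -/
noncomputable def consE (t : ℝ) (z : EuclideanSpace ℝ (Fin k)) : EuclideanSpace ℝ (Fin (k + 1)) :=
  WithLp.toLp 2 (Fin.cons t z)

@[simp] theorem tailL_apply (y : EuclideanSpace ℝ (Fin (k + 1))) (i : Fin k) :
    tailL k y i = y i.succ := rfl

@[simp] theorem consE_zero (t : ℝ) (z : EuclideanSpace ℝ (Fin k)) : consE t z 0 = t := rfl

@[simp] theorem consE_succ (t : ℝ) (z : EuclideanSpace ℝ (Fin k)) (i : Fin k) :
    consE t z i.succ = z i := rfl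

@[simp] theorem tailL_consE (t : ℝ) (z : EuclideanSpace ℝ (Fin k)) : tailL k (consE t z) = z := rfl

@[simp] theorem consE_tailL (y : EuclideanSpace ℝ (Fin (k + 1))) : consE (y 0) (tailL k y) = y := by
  ext i
  refine Fin.cases rfl (fun i => rfl) i

theorem consE_tailL_eq_setHeight (t : ℝ) (y : EuclideanSpace ℝ (Fin (k + 1))) :
    consE t (tailL k y) = setHeight t y := by
  ext i
  refine Fin.cases (setHeight_zero t y).symm (fun i => ?_) i
  rw [setHeight_ne _ _ (Fin.succ_ne_zero i)]
  rfl

theorem setHeight_consE (t u : ℝ) (z : EuclideanSpace ℝ (Fin k)) :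
    setHeight t (consE u z) = consE t z := by
  rw [← consE_tailL_eq_setHeight, tailL_consE]

theorem contDiff_consE :
    ContDiff ℝ ∞ (fun p : ℝ × EuclideanSpace ℝ (Fin k) => consE p.1 p.2) := by
  rw [contDiff_euclidean]
  intro i
  refine Fin.cases contDiff_fst (fun i => ?_) i
  exact (contDiff_coord i).comp contDiff_snd

/-- The half space as a product. -/
noncomputable def halfSpaceSplit (k : ℕ) :
    EuclideanHalfSpace (k + 1) ≃ₜ NNReal × EuclideanSpace ℝ (Fin k) where
  toFun x := (⟨x.1 0, x.2⟩, tailL k x.1)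
  invFun p := ⟨consE p.1 p.2, p.1.2⟩
  left_inv x := Subtype.ext (consE_tailL x.1)
  right_inv p := rfl
  continuous_toFun := by
    refine Continuous.prodMk ?_ ((tailL k).continuous.comp continuous_subtype_val)
    exact ((contDiff_coord (0 : Fin (k + 1))).continuous.comp continuous_subtype_val).subtype_mk _
  continuous_invFun := by
    refine Continuous.subtype_mk ?_ _
    exact contDiff_consE.continuous.comp (NNReal.continuous_coe.prodMap continuous_id)

variable {M : Type*} [TopologicalSpace M]

/-- A chart with values in the half space, seen as a chart with values in the product. -/
noncomputable def splitChart (e : OpenPartialHomeomorph M (EuclideanHalfSpace (k + 1))) :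
    OpenPartialHomeomorph M (NNReal × EuclideanSpace ℝ (Fin k)) :=
  e.transHomeomorph (halfSpaceSplit k)

variable {e : OpenPartialHomeomorph M (EuclideanHalfSpace (k + 1))}

theorem splitChart_snd (x : M) : (splitChart e x).2 = tailL k (e.extend (𝓡∂ (k + 1)) x) := rfl

theorem halfSpace_symm_eq {y : EuclideanSpace ℝ (Fin (k + 1))} (hy : 0 ≤ y 0) :
    (𝓡∂ (k + 1)).symm y = (⟨y, hy⟩ : EuclideanHalfSpace (k + 1)) := by
  have : (𝓡∂ (k + 1)) (⟨y, hy⟩ : EuclideanHalfSpace (k + 1)) = y := rfl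
  conv_lhs => rw [← this]
  exact (𝓡∂ (k + 1)).left_inv _

theorem splitChart_symm (u : NNReal) (z : EuclideanSpace ℝ (Fin k)) :
    (splitChart e).symm (u, z) = (e.extend (𝓡∂ (k + 1))).symm (consE u z) := by
  rw [e.extend_coe_symm, Function.comp_apply, halfSpace_symm_eq (y := consE u z) u.2]
  rfl

theorem mem_splitChart_target {u : NNReal} {z : EuclideanSpace ℝ (Fin k)} :
    (u, z) ∈ (splitChart e).target ↔ consE u z ∈ (e.extend (𝓡∂ (k + 1))).target := by
  rw [e.extend_target, mem_inter_iff, mem_preimage, halfSpace_symm_eq (y := consE u z) u.2]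
  exact ⟨fun h => ⟨h, mem_range_halfSpace.2 u.2⟩, fun h => h.1⟩

end SplitHeight

/-! ### Agreement of vertical lines in different box charts. -/

section FlowBoxes

set_option linter.unusedSectionVars false

variable {n : ℕ} [NeZero n] {M : Type*} [TopologicalSpace M]
  [ChartedSpace (EuclideanHalfSpace n) M] [IsManifold (𝓡∂ n) ∞ M]
  [RiemannianBundle (fun x : M => TangentSpace (𝓡∂ n) x)]
  [IsContMDiffRiemannianBundle (𝓡∂ n) ∞ (EuclideanSpace ℝ (Fin n))
    (fun x : M => TangentSpace (𝓡∂ n) x)]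
  {r : M → ℝ} {e e' : OpenPartialHomeomorph M (EuclideanHalfSpace n)}

theorem IsBoxChart.coordChange_zero (he : IsBoxChart r e) (he' : IsBoxChart r e')
    {y : EuclideanSpace ℝ (Fin n)} (hy : y ∈ overlap (𝓡∂ n) e e') :
    coordChange (𝓡∂ n) e e' y 0 = y 0 := by
  rw [coordChange, he'.coord _ hy.2, ← he.coord _ (extend_symm_mem_source hy.1),
    (e.extend (𝓡∂ n)).right_inv hy.1]

/-- The vertical coordinate field does not depend on the box chart. -/
theorem IsBoxChart.partialDeriv_zero_coordChange (he : IsBoxChart r e) (he' : IsBoxChart r e')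
    {y : EuclideanSpace ℝ (Fin n)} (hy : y ∈ overlap (𝓡∂ n) e e') (a : Fin n) :
    partialDeriv (range (𝓡∂ n)) 0 (fun z => coordChange (𝓡∂ n) e e' z a) y =
      if a = 0 then 1 else 0 := by
  have hO := isCoordDomain_overlap (I := 𝓡∂ n) e e'
  have hy' := mapsTo_coordChange e e' hy
  set d : Fin n → ℝ := fun a =>
    partialDeriv (range (𝓡∂ n)) 0 (fun z => coordChange (𝓡∂ n) e e' z a) y with hd
  set G := chartMetric (𝓡∂ n) e' (coordChange (𝓡∂ n) e e' y) with hG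
  have h0 : d 0 = 1 := by
    rw [hd]
    simp only
    rw [hO.partialDeriv_congr (fun z hz => he.coordChange_zero he' hz) hy, hO.partialDeriv_coord hy,
      if_pos rfl]
  have h1 : ∑ a, ∑ b, G a b * (d a * d b) = 1 := by
    rw [← chartMetric_coordChange he.mem he'.mem hy, he.metric y hy.1, Matrix.one_apply_eq]
  have h2 : ∀ j, G 0 j = (1 : Matrix (Fin n) (Fin n) ℝ) 0 j := he'.metric _ hy'
  have h3 : ∀ j, G j 0 = (1 : Matrix (Fin n) (Fin n) ℝ) 0 j := fun j => by
    rw [← h2, hG, chartMetric_symm]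
  -- Let `d` be the image of the vertical field. It has length one and height component one, and the
  -- vertical field of the second chart is a unit vector orthogonal to the other coordinate fields.
  -- So the squared length of the difference is `1 - 2 + 1 = 0`.
  set v : Fin n → ℝ := fun a => d a - if a = 0 then 1 else 0 with hv
  have hv0 : v = 0 := by
    by_contra hne
    have h4 := (posDef_chartMetric he'.mem hy').dotProduct_mulVec_pos hne
    have h5 : star v ⬝ᵥ G.mulVec v = 0 := by
      have h6 : star v ⬝ᵥ G.mulVec v = ∑ a, ∑ b, G a b * (v a * v b) := by
        simp only [dotProduct, Matrix.mulVec, Finset.mul_sum, Pi.star_apply, star_trivial]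
        exact Finset.sum_congr rfl fun i _ => Finset.sum_congr rfl fun j _ => by ring
      rw [h6]
      have h7 : ∀ a b, G a b * (v a * v b) = G a b * (d a * d b)
          - (if a = 0 then G a b * d b else 0) - (if b = 0 then G a b * d a else 0)
          + (if a = 0 then (if b = 0 then G a b else 0) else 0) := by
        intro a b
        simp only [hv]
        split_ifs <;> ring
      simp only [h7, Finset.sum_add_distrib, Finset.sum_sub_distrib, h1, Finset.sum_ite_eq',
        Finset.mem_univ, if_true]
      rw [Finset.sum_comm]
      simp only [Finset.sum_ite_eq', Finset.mem_univ, if_true, h2, h3, Matrix.one_apply, ite_mul,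
        one_mul, zero_mul, Finset.sum_ite_eq, h0]
      norm_num
      rw [h2 0, Matrix.one_apply_eq, neg_add_cancel]
    rw [h5] at h4
    exact lt_irrefl _ h4
  have := congrFun hv0 a
  exact sub_eq_zero.1 this

/-- Vertical lines do not depend on the box chart. -/
theorem IsBoxChart.eventually_coordChange (he : IsBoxChart r e) (he' : IsBoxChart r e')
    {y : EuclideanSpace ℝ (Fin n)} (hy : y ∈ overlap (𝓡∂ n) e e') :
    ∀ᶠ u in 𝓝[Ici 0] (y 0), setHeight u y ∈ overlap (𝓡∂ n) e e' ∧
      coordChange (𝓡∂ n) e e' (setHeight u y) = setHeight u (coordChange (𝓡∂ n) e e' y) := by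
  have hO := isCoordDomain_overlap (I := 𝓡∂ n) e e'
  have hcc := contDiffOn_coordChange he.mem he'.mem
  obtain ⟨ε, hε, hsub⟩ := Metric.mem_nhdsWithin_iff.1 (hO.mem_nhdsWithin y hy)
  set S : Set ℝ := Metric.ball (y 0) ε ∩ Ici 0 with hS
  have hSc : Convex ℝ S := (convex_ball _ _).inter (convex_Ici 0)
  have hmem : ∀ u ∈ S, setHeight u y ∈ overlap (𝓡∂ n) e e' := by
    rintro u ⟨hu, hu0⟩
    refine hsub ⟨?_, setHeight_mem_range hu0 y⟩
    rw [mem_ball_iff_norm] at hu ⊢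
    have h1 := norm_setHeight_sub_le u y y
    rw [sub_self, norm_zero, mul_zero, zero_add] at h1
    exact h1.trans_lt hu
  have hy0 : y 0 ∈ S := ⟨Metric.mem_ball_self hε, mem_range_halfSpace.1 (hO.subset hy)⟩
  -- Along a vertical segment the coordinate change has constant derivative, the vertical unit
  -- vector, so only the height varies.
  have key : ∀ u ∈ S, ∀ a, coordChange (𝓡∂ n) e e' (setHeight u y) a =
      coordChange (𝓡∂ n) e e' y a + if a = 0 then u - y 0 else 0 := by
    intro u hu a
    have hder : ∀ t ∈ S, HasDerivWithinAt
        (fun t => coordChange (𝓡∂ n) e e' (setHeight t y) a - if a = 0 then t - y 0 else 0)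
        0 S t := by
      intro t ht
      have h1 := (hO.differentiableWithinAt (f := fun z => coordChange (𝓡∂ n) e e' z a)
        ((contDiff_coord a).comp_contDiffOn hcc) (hmem t ht)).hasFDerivWithinAt
      have h2 := h1.comp_hasDerivWithinAt (s := S) t (hasDerivAt_setHeight y t).hasDerivWithinAt
        (fun s hs => setHeight_mem_range hs.2 y)
      have h3 := he.partialDeriv_zero_coordChange he' (hmem t ht) a
      rw [partialDeriv] at h3
      rw [h3] at h2
      have h4 : HasDerivWithinAt (fun t : ℝ => if a = 0 then t - y 0 else 0)
          (if a = 0 then 1 else 0) S t := by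
        split_ifs
        · exact (hasDerivWithinAt_id t S).sub_const _
        · exact hasDerivWithinAt_const _ _ _
      have h5 := h2.sub h4
      rw [sub_self] at h5
      exact h5
    have h1 := hSc.norm_image_sub_le_of_norm_hasDerivWithin_le (C := 0) hder
      (fun t _ => by simp) hy0 hu
    rw [zero_mul, norm_le_zero_iff, sub_eq_zero, setHeight_self, sub_self, ite_self, sub_zero] at h1
    linarith
  have hSn : S ∈ 𝓝[Ici 0] (y 0) := Filter.inter_mem
    (nhdsWithin_le_nhds (Metric.ball_mem_nhds _ hε)) self_mem_nhdsWithin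
  filter_upwards [hSn] with u hu
  refine ⟨hmem u hu, ?_⟩
  ext a
  rw [key u hu a]
  by_cases ha : a = 0
  · subst ha
    rw [setHeight_zero, if_pos rfl, he.coordChange_zero he' hy]
    ring
  · rw [setHeight_ne _ _ ha, if_neg ha, add_zero]

end FlowBoxes

/-! ### Length of vertical segments. -/

section FlowBoxLength

set_option linter.unusedSectionVars false

variable {n : ℕ} [NeZero n] {M : Type*} [EMetricSpace M]
  [ChartedSpace (EuclideanHalfSpace n) M] [IsManifold (𝓡∂ n) ∞ M]
  [RiemannianBundle (fun x : M => TangentSpace (𝓡∂ n) x)]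
  [IsContMDiffRiemannianBundle (𝓡∂ n) ∞ (EuclideanSpace ℝ (Fin n))
    (fun x : M => TangentSpace (𝓡∂ n) x)] [IsRiemannianManifold (𝓡∂ n) M]
  {r : M → ℝ} {e e' : OpenPartialHomeomorph M (EuclideanHalfSpace n)}

theorem IsBoxChart.enorm_coordVector (he : IsBoxChart r e) {y : EuclideanSpace ℝ (Fin n)}
    (hy : y ∈ (e.extend (𝓡∂ n)).target) : ‖coordVector (𝓡∂ n) e 0 y‖ₑ = 1 := by
  have h1 := he.metric y hy 0
  rw [chartMetric_apply, real_inner_self_eq_norm_sq, Matrix.one_apply_eq] at h1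
  have h2 : ‖coordVector (𝓡∂ n) e 0 y‖ = 1 :=
    (pow_eq_one_iff_of_nonneg (norm_nonneg _) two_ne_zero).1 h1
  rw [← ofReal_norm, h2, ENNReal.ofReal_one]

/-- The vertical segment has unit speed because `g_00 = 1`; its length bounds the Riemannian
distance of its end points. -/
theorem IsBoxChart.edist_le (he : IsBoxChart r e) {y : EuclideanSpace ℝ (Fin n)} {u v : ℝ}
    (huv : u ≤ v) (h : ∀ t ∈ Icc u v, setHeight t y ∈ (e.extend (𝓡∂ n)).target) :
    edist ((e.extend (𝓡∂ n)).symm (setHeight u y)) ((e.extend (𝓡∂ n)).symm (setHeight v y)) ≤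
      ENNReal.ofReal (v - u) := by
  rw [IsRiemannianManifold.out (I := 𝓡∂ n)]
  have hs : ContDiff ℝ ∞ (fun t : ℝ => setHeight t y) :=
    contDiff_setHeight.comp (contDiff_id.prodMk contDiff_const)
  have hγ : ContMDiffOn 𝓘(ℝ, ℝ) (𝓡∂ n) 1 (fun t : ℝ => (e.extend (𝓡∂ n)).symm (setHeight t y))
      (Icc u v) :=
    ((contMDiffOn_extend_symm_target he.mem).comp hs.contMDiff.contMDiffOn h).of_le (by simp)
  refine (riemannianEDist_le_pathELength hγ rfl rfl huv).trans ?_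
  rw [pathELength_eq_lintegral_mfderiv_Ioo]
  have hspeed : ∀ t ∈ Ioo u v, ‖mfderiv 𝓘(ℝ, ℝ) (𝓡∂ n)
      (fun t : ℝ => (e.extend (𝓡∂ n)).symm (setHeight t y)) t 1‖ₑ = 1 := by
    intro t ht
    have hty := h t ⟨ht.1.le, ht.2.le⟩
    have h1 := ((contMDiffWithinAt_extend_symm he.mem hty).mdifferentiableWithinAt
      (by simp)).hasMFDerivWithinAt
    have h2 := (hasDerivAt_setHeight y t).hasFDerivAt.hasMFDerivAt
    have h3 := (h1.mono (isCoordDomain_extend_target e).subset).comp t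
      (h2.hasMFDerivWithinAt (s := Ioo u v)) (fun s hs => h s ⟨hs.1.le, hs.2.le⟩)
    have h4 := h3.hasMFDerivAt (isOpen_Ioo.mem_nhds ht)
    have h5 := h4.mfderiv
    rw [← he.enorm_coordVector hty]
    congr 1
    refine (congrArg (fun A => A (1 : ℝ)) h5).trans ?_
    change mfderivWithin 𝓘(ℝ, EuclideanSpace ℝ (Fin n)) (𝓡∂ n) (e.extend (𝓡∂ n)).symm
      (range (𝓡∂ n)) (setHeight t y) ((1 : ℝ) • EuclideanSpace.single 0 (1 : ℝ)) = _
    rw [one_smul]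
    rfl
  rw [MeasureTheory.setLIntegral_congr_fun measurableSet_Ioo hspeed]
  simp

end FlowBoxLength

/-! ### The flow boxes of a height function. -/

section FlowBoxFamily

set_option linter.unusedSectionVars false

variable {k : ℕ} {M : Type*} [EMetricSpace M]
  [ChartedSpace (EuclideanHalfSpace (k + 1)) M] [IsManifold (𝓡∂ (k + 1)) ∞ M]
  [RiemannianBundle (fun x : M => TangentSpace (𝓡∂ (k + 1)) x)]
  [IsContMDiffRiemannianBundle (𝓡∂ (k + 1)) ∞ (EuclideanSpace ℝ (Fin (k + 1)))
    (fun x : M => TangentSpace (𝓡∂ (k + 1)) x)] [IsRiemannianManifold (𝓡∂ (k + 1)) M]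
  {r : M → ℝ}

/-- The height, as a nonnegative number. -/
noncomputable def IsHeight.toNNReal (hr : IsHeight (n := k + 1) r) (x : M) : NNReal :=
  ⟨r x, hr.nonneg x⟩

/-- The box charts, restricted to boxes. -/
def flowBoxes (r : M → ℝ) : Set (OpenPartialHomeomorph M (NNReal × EuclideanSpace ℝ (Fin k))) :=
  {f | ∃ e : OpenPartialHomeomorph M (EuclideanHalfSpace (k + 1)), IsBoxChart r e ∧
    ∃ (J : Set NNReal) (W : Set (EuclideanSpace ℝ (Fin k))) (hJ : IsOpen J) (hW : IsOpen W),
      IsPreconnected J ∧ J ×ˢ W ⊆ (splitChart e).target ∧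
      f = ((splitChart e).symm.restrOpen (J ×ˢ W) (hJ.prod hW)).symm}

theorem IsHeight.isFlowBoxFamily (hr : IsHeight (n := k + 1) r) :
    IsFlowBoxFamily hr.toNNReal (flowBoxes (k := k) r) where
  continuous := hr.smooth.continuous.subtype_mk _
  exists_mem x := by
    obtain ⟨e, he, hx⟩ := hr.exists_boxChart x
    have hx' : x ∈ (splitChart e).source := hx
    obtain ⟨J, W, hJ, hW, hxJ, hxW, hsub⟩ := isOpen_prod_iff.1 (splitChart e).open_target
      (splitChart e x).1 (splitChart e x).2 ((splitChart e).map_source hx')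
    obtain ⟨ε, hε, hball⟩ := Metric.isOpen_iff.1 hJ _ hxJ
    have hc : IsPreconnected (Metric.ball (splitChart e x).1 ε) := by
      have : Metric.ball (splitChart e x).1 ε =
          ((↑) : NNReal → ℝ) ⁻¹' Metric.ball ((splitChart e x).1 : ℝ) ε := rfl
      rw [this, Real.ball_eq_Ioo]
      exact (ordConnected_Ioo.preimage_mono NNReal.coe_mono).isPreconnected
    refine ⟨_, ⟨e, he, _, W, Metric.isOpen_ball, hW, hc,
      (prod_mono hball le_rfl).trans hsub, rfl⟩, ?_⟩
    exact ⟨hx', Metric.mem_ball_self hε, hxW⟩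
  fst_eq f hf x hx := by
    obtain ⟨e, he, J, W, hJ, hW, hc, hsub, rfl⟩ := hf
    have hx' : x ∈ e.source := hx.1
    refine Subtype.ext ?_
    exact he.coord x hx'
  target_eq f hf := by
    obtain ⟨e, he, J, W, hJ, hW, hc, hsub, rfl⟩ := hf
    exact ⟨J, W, hJ, hc, inter_eq_right.2 hsub⟩
  compat f hf f' hf' p hp hp' := by
    obtain ⟨e, he, J, W, hJ, hW, hc, hsub, rfl⟩ := hf
    obtain ⟨e', he', J', W', hJ', hW', hc', hsub', rfl⟩ := hf'
    have hx : p ∈ e.source := hp.1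
    have hx' : p ∈ e'.source := hp'.1
    have h1 := he.eventually_coordChange he' (extend_mem_overlap (I := 𝓡∂ (k + 1)) hx hx')
    rw [he.coord p hx, coordChange_extend hx] at h1
    have h2 : Filter.Tendsto ((↑) : NNReal → ℝ) (𝓝 (hr.toNNReal p)) (𝓝[Ici 0] (r p)) :=
      tendsto_nhdsWithin_iff.2 ⟨NNReal.continuous_coe.continuousAt, Filter.Eventually.of_forall
        fun u => u.2⟩
    filter_upwards [h2.eventually h1] with u hu
    change (splitChart e).symm (u, (splitChart e p).2) =
      (splitChart e').symm (u, (splitChart e' p).2)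
    rw [splitChart_symm, splitChart_symm, splitChart_snd, splitChart_snd,
      consE_tailL_eq_setHeight, consE_tailL_eq_setHeight, ← hu.2, coordChange,
      e'.extend_left_inv hu.1.2]
  edist_le f hf u v z huv hu hv := by
    obtain ⟨e, he, J, W, hJ, hW, hc, hsub, rfl⟩ := hf
    have hu' : (u, z) ∈ J ×ˢ W := hu.2
    have hv' : (v, z) ∈ J ×ˢ W := hv.2
    change edist ((splitChart e).symm (u, z)) ((splitChart e).symm (v, z)) ≤ _
    rw [splitChart_symm, splitChart_symm]
    have h1 := he.edist_le (y := consE 0 z) (u := u) (v := v) huv fun t ht => by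
      have h0 : 0 ≤ t := u.2.trans ht.1
      rw [setHeight_consE]
      exact mem_splitChart_target (u := ⟨t, h0⟩).1
        (hsub ⟨hc.ordConnected.out hu'.1 hv'.1 ⟨ht.1, ht.2⟩, hu'.2⟩)
    rw [setHeight_consE, setHeight_consE] at h1
    refine h1.trans (le_of_eq ?_)
    rw [← NNReal.coe_sub huv, ENNReal.ofReal_coe_nnreal]

end FlowBoxFamily

/-! ## Transport along vertical lines -/

section VectorDeriv

variable {E : Type*} [NormedAddCommGroup E] [NormedSpace ℝ E] {H : Type*} [TopologicalSpace H]
  {I : ModelWithCorners ℝ E H} {M : Type*} [TopologicalSpace M] [ChartedSpace H M]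
  {V V' : Type*} [NormedAddCommGroup V] [NormedSpace ℝ V] [NormedAddCommGroup V']
  [NormedSpace ℝ V']

theorem mvfderiv_comp_left {f : M → V} {x : M} {g : V → V'} {g' : V →L[ℝ] V'}
    (hg : HasFDerivAt g g' (f x)) (hf : MDifferentiableAt I 𝓘(ℝ, V) f x) (u : TangentSpace I x) :
    mvfderiv I (fun y => g (f y)) x u = g' (mvfderiv I f x u) := by
  have h := ((hg.hasMFDerivAt).comp x hf.hasMFDerivAt).mfderiv
  exact congrArg (fun A => NormedSpace.fromTangentSpace (g (f x)) (A u)) h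

theorem mvfderiv_comp_mfderiv {E' : Type*} [NormedAddCommGroup E'] [NormedSpace ℝ E'] {H' : Type*}
    [TopologicalSpace H'] {I' : ModelWithCorners ℝ E' H'} {M' : Type*} [TopologicalSpace M']
    [ChartedSpace H' M'] {f : M → M'} {g : M' → V} (x : M)
    (hg : MDifferentiableAt I' 𝓘(ℝ, V) g (f x)) (hf : MDifferentiableAt I I' f x)
    (u : TangentSpace I x) :
    mvfderiv I (fun y => g (f y)) x u = mvfderiv I' g (f x) (mfderiv I I' f x u) := by
  have h := mfderiv_comp x hg hf
  exact congrArg (fun A => NormedSpace.fromTangentSpace (g (f x)) (A u)) h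

theorem Filter.EventuallyEq.mvfderiv_apply {f g : M → V} {x : M} (h : f =ᶠ[𝓝 x] g)
    (u : TangentSpace I x) : mvfderiv I f x u = mvfderiv I g x u := by
  exact congrArg (fun A : TangentSpace I x →L[ℝ] V => A u) h.mfderiv_eq

end VectorDeriv

theorem contMDiffAt_extend_symm_comp {n : ℕ} {H : Type*} [TopologicalSpace H]
    {I : ModelWithCorners ℝ (EuclideanSpace ℝ (Fin n)) H}
    {M : Type*} [TopologicalSpace M] [ChartedSpace H M] [IsManifold I ∞ M]
    {EN : Type*} [NormedAddCommGroup EN] [NormedSpace ℝ EN] {HN : Type*} [TopologicalSpace HN]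
    {IN : ModelWithCorners ℝ EN HN} {N : Type*} [TopologicalSpace N] [ChartedSpace HN N]
    {e : OpenPartialHomeomorph M H} (he : e ∈ IsManifold.maximalAtlas I ∞ M)
    {f : N → EuclideanSpace ℝ (Fin n)} {p : N}
    (hf : ContMDiffAt IN 𝓘(ℝ, EuclideanSpace ℝ (Fin n)) ∞ f p)
    (hm : ∀ᶠ q in 𝓝 p, f q ∈ (e.extend I).target) :
    ContMDiffAt IN I ∞ (fun q => (e.extend I).symm (f q)) p :=
  (ContMDiffWithinAt.comp' (s := univ) p (contMDiffOn_extend_symm_target he _ hm.self_of_nhds)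
    (contMDiffWithinAt_univ.2 hf)).contMDiffAt (Filter.inter_mem Filter.univ_mem hm)

/-- The truth value of `A` is locally constant on the connected space of heights. This carries a
property along a vertical line from one box to the next. -/
theorem NNReal.forall_of_eventually_iff {A : NNReal → Prop}
    (h : ∀ t, ∃ J : Set NNReal, IsOpen J ∧ t ∈ J ∧ ∀ u ∈ J, ∀ v ∈ J, A u → A v)
    {t₀ : NNReal} (h₀ : A t₀) (t : NNReal) : A t := by
  have hA : IsLocallyConstant A := by
    rw [IsLocallyConstant.iff_eventually_eq]
    intro t
    obtain ⟨J, hJ, ht, hJA⟩ := h t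
    filter_upwards [hJ.mem_nhds ht] with u hu
    exact propext ⟨hJA u hu t ht, hJA t ht u hu⟩
  rw [hA.apply_eq_of_preconnectedSpace t t₀]
  exact h₀

section Box

set_option linter.unusedSectionVars false

variable {n : ℕ} [NeZero n] {M : Type*} [TopologicalSpace M]
  [ChartedSpace (EuclideanHalfSpace n) M] [IsManifold (𝓡∂ n) ∞ M]
  [RiemannianBundle (fun x : M => TangentSpace (𝓡∂ n) x)]
  [IsContMDiffRiemannianBundle (𝓡∂ n) ∞ (EuclideanSpace ℝ (Fin n))
    (fun x : M => TangentSpace (𝓡∂ n) x)]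
  {r : M → ℝ} {e : OpenPartialHomeomorph M (EuclideanHalfSpace n)}

/-- Integration of `IsBoxChart.partialDeriv_zero_chartMetric` along a vertical segment. -/
theorem IsBoxChart.chartMetric_setHeight (hr : IsHeight (n := n) r) (he : IsBoxChart r e)
    {y : EuclideanSpace ℝ (Fin n)} {J : Set ℝ} (hJ : Convex ℝ J)
    (h : ∀ t ∈ J, setHeight t y ∈ (e.extend (𝓡∂ n)).target) {a b : ℝ} (ha : a ∈ J) (hb : b ∈ J)
    (i j : Fin n) :
    chartMetric (𝓡∂ n) e (setHeight a y) i j = chartMetric (𝓡∂ n) e (setHeight b y) i j := by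
  have hT := isCoordDomain_extend_target (I := 𝓡∂ n) e
  have hG := isCoordMetric_chartMetric he.mem
  have hder : ∀ t ∈ J, HasDerivWithinAt
      (fun t => chartMetric (𝓡∂ n) e (setHeight t y) i j) 0 J t := by
    intro t ht
    have h1 := (hT.differentiableWithinAt (hG.smooth i j) (h t ht)).hasFDerivWithinAt
    have h2 := h1.comp_hasDerivWithinAt (s := J) t (hasDerivAt_setHeight y t).hasDerivWithinAt
      (fun s hs => hT.subset (h s hs))
    have h3 := he.partialDeriv_zero_chartMetric hr (h t ht) i j
    rw [partialDeriv] at h3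
    rw [h3] at h2
    exact h2
  have h1 := hJ.norm_image_sub_le_of_norm_hasDerivWithin_le (C := 0) hder
    (fun t _ => by simp) hb ha
  rw [zero_mul, norm_le_zero_iff, sub_eq_zero] at h1
  exact h1

theorem IsBoxChart.chartDeriv_zero (he : IsBoxChart r e) {x : M} (hx : x ∈ e.source)
    (u : TangentSpace (𝓡∂ n) x) : chartDeriv (𝓡∂ n) e x u 0 = mvfderiv (𝓡∂ n) r x u := by
  have h1 : MDifferentiableAt (𝓡∂ n) 𝓘(ℝ, EuclideanSpace ℝ (Fin n)) (e.extend (𝓡∂ n)) x :=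
    (e.contMDiffAt_extend he.mem hx).mdifferentiableAt (by simp)
  have h2 := mvfderiv_comp_left (I := 𝓡∂ n)
    ((EuclideanSpace.proj 0 : EuclideanSpace ℝ (Fin n) →L[ℝ] ℝ).hasFDerivAt) h1 u
  refine h2.symm.trans (Filter.EventuallyEq.mvfderiv_apply ?_ u)
  filter_upwards [e.open_source.mem_nhds hx] with z hz
  exact he.coord z hz

end Box

/-! ### Smoothness and differential of the transport. -/

section Transport

set_option linter.unusedSectionVars false

variable {k : ℕ} {M : Type*} [EMetricSpace M] [CompleteSpace M]
  [ChartedSpace (EuclideanHalfSpace (k + 1)) M] [IsManifold (𝓡∂ (k + 1)) ∞ M]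
  [RiemannianBundle (fun x : M => TangentSpace (𝓡∂ (k + 1)) x)]
  [IsContMDiffRiemannianBundle (𝓡∂ (k + 1)) ∞ (EuclideanSpace ℝ (Fin (k + 1)))
    (fun x : M => TangentSpace (𝓡∂ (k + 1)) x)] [IsRiemannianManifold (𝓡∂ (k + 1)) M]
  {r : M → ℝ}

/-- The point at height `t` on the vertical line through `x`. -/
noncomputable def IsHeight.transport (hr : IsHeight (n := k + 1) r) (x : M) (t : NNReal) : M :=
  hr.isFlowBoxFamily.transport x t

theorem IsHeight.transport_self (hr : IsHeight (n := k + 1) r) (x : M) :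
    hr.transport x (hr.toNNReal x) = x := hr.isFlowBoxFamily.transport_self x

theorem IsHeight.toNNReal_transport (hr : IsHeight (n := k + 1) r) (x : M) (t : NNReal) :
    hr.toNNReal (hr.transport x t) = t := hr.isFlowBoxFamily.height_transport x t

theorem IsHeight.apply_transport (hr : IsHeight (n := k + 1) r) (x : M) (t : NNReal) :
    r (hr.transport x t) = t := congrArg NNReal.toReal (hr.toNNReal_transport x t)

theorem IsHeight.transport_transport (hr : IsHeight (n := k + 1) r) (x : M) (s t : NNReal) :
    hr.transport (hr.transport x s) t = hr.transport x t :=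
  hr.isFlowBoxFamily.transport_transport x s t

/-- `U` is the product of the interval `J` with a horizontal set, in the box chart `e`. -/
structure IsHeight.IsBox (hr : IsHeight (n := k + 1) r)
    (e : OpenPartialHomeomorph M (EuclideanHalfSpace (k + 1))) (J : Set NNReal) (U : Set M) :
    Prop where
  chart : IsBoxChart r e
  isOpen_interval : IsOpen J
  isPreconnected : IsPreconnected J
  isOpen : IsOpen U
  subset : U ⊆ e.source
  height_mem : ∀ x ∈ U, hr.toNNReal x ∈ J
  setHeight_mem : ∀ x ∈ U, ∀ t ∈ J,
    setHeight t (e.extend (𝓡∂ (k + 1)) x) ∈ (e.extend (𝓡∂ (k + 1))).target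
  transport_eq : ∀ x ∈ U, ∀ t ∈ J, hr.transport x t =
    (e.extend (𝓡∂ (k + 1))).symm (setHeight t (e.extend (𝓡∂ (k + 1)) x))
  transport_mem : ∀ x ∈ U, ∀ t ∈ J, hr.transport x t ∈ U

theorem IsHeight.exists_isBox (hr : IsHeight (n := k + 1) r) (x : M) :
    ∃ e J U, hr.IsBox e J U ∧ x ∈ U := by
  obtain ⟨f, hf, hx⟩ := hr.isFlowBoxFamily.exists_mem x
  have hf' := hf
  obtain ⟨e, he, J, W, hJ, hW, hc, hsub, rfl⟩ := hf'
  set f := ((splitChart e).symm.restrOpen (J ×ˢ W) (hJ.prod hW)).symm with hfdef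
  have hmem : ∀ x ∈ f.source, ∀ t ∈ J, (t, (f x).2) ∈ J ×ˢ W := fun x hx t ht => ⟨ht, hx.2.2⟩
  have hmem' : ∀ x ∈ f.source, ∀ t ∈ J, (t, (f x).2) ∈ f.target := fun x hx t ht =>
    ⟨hsub (hmem x hx t ht), hmem x hx t ht⟩
  have heq : ∀ x ∈ f.source, ∀ t ∈ J, hr.transport x t = f.symm (t, (f x).2) := fun x hx t ht =>
    hr.isFlowBoxFamily.transport_eq hf hx (hmem' x hx t ht)
  refine ⟨e, J, f.source, ⟨he, hJ, hc, f.open_source, fun x hx => hx.1, fun x hx => ?_,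
    fun x hx t ht => ?_, fun x hx t ht => ?_, fun x hx t ht => ?_⟩, hx⟩
  · rw [← hr.isFlowBoxFamily.fst_eq f hf x hx]
    exact hx.2.1
  · rw [← consE_tailL_eq_setHeight]
    exact mem_splitChart_target.1 (hsub (hmem x hx t ht))
  · rw [heq x hx t ht, ← consE_tailL_eq_setHeight, ← splitChart_symm]
    rfl
  · rw [heq x hx t ht]
    exact f.map_target (hmem' x hx t ht)

variable {e : OpenPartialHomeomorph M (EuclideanHalfSpace (k + 1))} {J : Set NNReal} {U : Set M}
  {EN : Type*} [NormedAddCommGroup EN] [NormedSpace ℝ EN] {HN : Type*} [TopologicalSpace HN]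
  {IN : ModelWithCorners ℝ EN HN} {N : Type*} [TopologicalSpace N] [ChartedSpace HN N]

theorem IsHeight.IsBox.contMDiffAt_transport {hr : IsHeight (n := k + 1) r}
    (h : hr.IsBox e J U) {f : N → M} {s : N → NNReal} {p : N}
    (hf : ContMDiffAt IN (𝓡∂ (k + 1)) ∞ f p)
    (hs : ContMDiffAt IN 𝓘(ℝ, ℝ) ∞ (fun q => (s q : ℝ)) p) (hp : f p ∈ U) (hsp : s p ∈ J) :
    ContMDiffAt IN (𝓡∂ (k + 1)) ∞ (fun q => hr.transport (f q) (s q)) p := by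
  have hsc : ContinuousAt s p := Topology.IsEmbedding.subtypeVal.continuousAt_iff.2 hs.continuousAt
  have hev : ∀ᶠ q in 𝓝 p, f q ∈ U ∧ s q ∈ J :=
    (hf.continuousAt.eventually (h.isOpen.mem_nhds hp)).and
      (hsc.eventually (h.isOpen_interval.mem_nhds hsp))
  have h1 : ContMDiffAt IN 𝓘(ℝ, EuclideanSpace ℝ (Fin (k + 1))) ∞
      (fun q => e.extend (𝓡∂ (k + 1)) (f q)) p :=
    (e.contMDiffAt_extend h.chart.mem (h.subset hp)).comp p hf
  have h2 : ContMDiffAt IN 𝓘(ℝ, EuclideanSpace ℝ (Fin (k + 1))) ∞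
      (fun q => setHeight (s q) (e.extend (𝓡∂ (k + 1)) (f q))) p :=
    contDiff_setHeight.contDiffAt.comp_contMDiffAt (hs.prodMk_space h1)
  refine (contMDiffAt_extend_symm_comp h.chart.mem h2 ?_).congr_of_eventuallyEq ?_
  · filter_upwards [hev] with q hq
    exact h.setHeight_mem _ hq.1 _ hq.2
  filter_upwards [hev] with q hq
  exact h.transport_eq _ hq.1 _ hq.2

theorem IsHeight.IsBox.mem_of_transport_mem {hr : IsHeight (n := k + 1) r} (h : hr.IsBox e J U)
    {x : M} {s t : NNReal} (hx : hr.transport x s ∈ U) (ht : t ∈ J) : hr.transport x t ∈ U := by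
  rw [← hr.transport_transport x s t]
  exact h.transport_mem _ hx t ht

/-- Transport to height `v` is transport to a nearby height `u` followed by motion inside one box,
where it is smooth by its coordinate formula. Smoothness thus spreads from the height of `x` to all
heights. -/
theorem IsHeight.contMDiffAt_transport_const (hr : IsHeight (n := k + 1) r) (x : M) (t : NNReal) :
    ContMDiffAt (𝓡∂ (k + 1)) (𝓡∂ (k + 1)) ∞ (fun y => hr.transport y t) x := by
  refine NNReal.forall_of_eventually_iff (t₀ := hr.toNNReal x)
    (A := fun t => ContMDiffAt (𝓡∂ (k + 1)) (𝓡∂ (k + 1)) ∞ (fun y => hr.transport y t) x)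
    (fun t => ?_) ?_ t
  · obtain ⟨e, J, U, h, hq⟩ := hr.exists_isBox (hr.transport x t)
    refine ⟨J, h.isOpen_interval, ?_, fun u hu v hv hs => ?_⟩
    · rw [← hr.toNNReal_transport x t]
      exact h.height_mem _ hq
    · have := h.contMDiffAt_transport hs (s := fun _ => v) contMDiffAt_const
        (h.mem_of_transport_mem hq hu) hv
      simp only [hr.transport_transport] at this
      exact this
  · obtain ⟨e, J, U, h, hx⟩ := hr.exists_isBox x
    exact h.contMDiffAt_transport contMDiffAt_id contMDiffAt_const hx (h.height_mem _ hx)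

/-- The transport is smooth. -/
theorem IsHeight.contMDiffAt_transport (hr : IsHeight (n := k + 1) r) {f : N → M} {s : N → NNReal}
    {p : N} (hf : ContMDiffAt IN (𝓡∂ (k + 1)) ∞ f p)
    (hs : ContMDiffAt IN 𝓘(ℝ, ℝ) ∞ (fun q => (s q : ℝ)) p) :
    ContMDiffAt IN (𝓡∂ (k + 1)) ∞ (fun q => hr.transport (f q) (s q)) p := by
  obtain ⟨e, J, U, h, hq⟩ := hr.exists_isBox (hr.transport (f p) (s p))
  -- The variable target height is handled by going first to the fixed height `s p`, then moving
  -- within a box around the image point.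
  have h1 : ContMDiffAt IN (𝓡∂ (k + 1)) ∞ (fun q => hr.transport (f q) (s p)) p :=
    (hr.contMDiffAt_transport_const (f p) (s p)).comp p hf
  have h2 := h.contMDiffAt_transport h1 hs hq (by
    rw [← hr.toNNReal_transport (f p) (s p)]
    exact h.height_mem _ hq)
  simp only [hr.transport_transport] at h2
  exact h2

/-- In the box chart the differential erases the first component of a vector. The metric there is
`dr² + g'` with `g'` independent of height, so only the product of the height components is lost. -/
theorem IsHeight.IsBox.inner_mfderiv_transport {hr : IsHeight (n := k + 1) r}
    (h : hr.IsBox e J U) {x : M} (hx : x ∈ U) {t : NNReal} (ht : t ∈ J)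
    (u v : TangentSpace (𝓡∂ (k + 1)) x) :
    inner ℝ (mfderiv (𝓡∂ (k + 1)) (𝓡∂ (k + 1)) (fun y => hr.transport y t) x u)
      (mfderiv (𝓡∂ (k + 1)) (𝓡∂ (k + 1)) (fun y => hr.transport y t) x v) =
    inner ℝ u v - mvfderiv (𝓡∂ (k + 1)) r x u * mvfderiv (𝓡∂ (k + 1)) r x v := by
  have hxs := h.subset hx
  have hts := h.subset (h.transport_mem x hx t ht)
  have hed : ∀ z ∈ e.source, MDifferentiableAt (𝓡∂ (k + 1)) 𝓘(ℝ, EuclideanSpace ℝ (Fin (k + 1)))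
      (e.extend (𝓡∂ (k + 1))) z := fun z hz =>
    (e.contMDiffAt_extend h.chart.mem hz).mdifferentiableAt (by simp)
  have hmap : (fun y => e.extend (𝓡∂ (k + 1)) (hr.transport y t)) =ᶠ[𝓝 x]
      fun y => setHeight t (e.extend (𝓡∂ (k + 1)) y) := by
    filter_upwards [h.isOpen.mem_nhds hx] with y hy
    rw [h.transport_eq y hy t ht]
    exact (e.extend (𝓡∂ (k + 1))).right_inv (h.setHeight_mem y hy t ht)
  have hcomp : ∀ (w : TangentSpace (𝓡∂ (k + 1)) x) (i : Fin (k + 1)),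
      chartDeriv (𝓡∂ (k + 1)) e (hr.transport x t)
        (mfderiv (𝓡∂ (k + 1)) (𝓡∂ (k + 1)) (fun y => hr.transport y t) x w) i =
      chartDeriv (𝓡∂ (k + 1)) e x w i -
        if i = 0 then chartDeriv (𝓡∂ (k + 1)) e x w 0 else 0 := by
    intro w i
    have h1 := mvfderiv_comp_mfderiv (f := fun y => hr.transport y t) x (hed _ hts)
      ((hr.contMDiffAt_transport_const x t).mdifferentiableAt (by simp)) w
    have h2 := Filter.EventuallyEq.mvfderiv_apply (I := 𝓡∂ (k + 1)) hmap w
    have h3 : HasFDerivAt (fun z : EuclideanSpace ℝ (Fin (k + 1)) => setHeight t z)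
        (ContinuousLinearMap.id ℝ _ + (-(EuclideanSpace.proj 0 :
          EuclideanSpace ℝ (Fin (k + 1)) →L[ℝ] ℝ)).smulRight (EuclideanSpace.single 0 (1 : ℝ)))
        (e.extend (𝓡∂ (k + 1)) x) :=
      (hasFDerivAt_id (𝕜 := ℝ) (e.extend (𝓡∂ (k + 1)) x)).add
        ((((EuclideanSpace.proj 0 : EuclideanSpace ℝ (Fin (k + 1)) →L[ℝ] ℝ).hasFDerivAt
          (x := e.extend (𝓡∂ (k + 1)) x)).const_sub (t : ℝ)).smul_const
            (EuclideanSpace.single (0 : Fin (k + 1)) (1 : ℝ)))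
    have h4 := mvfderiv_comp_left (I := 𝓡∂ (k + 1)) h3 (hed x hxs) w
    have h5 := congrArg (fun z : EuclideanSpace ℝ (Fin (k + 1)) => z i)
      (h1.symm.trans (h2.trans h4))
    refine h5.trans ?_
    change (chartDeriv (𝓡∂ (k + 1)) e x w + (-chartDeriv (𝓡∂ (k + 1)) e x w 0) •
      EuclideanSpace.single 0 (1 : ℝ) : EuclideanSpace ℝ (Fin (k + 1))) i = _
    by_cases hi : i = 0 <;> simp [hi]
  have hy : e.extend (𝓡∂ (k + 1)) x ∈ (e.extend (𝓡∂ (k + 1))).target :=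
    (e.extend (𝓡∂ (k + 1))).map_source (by rwa [e.extend_source])
  have hG : ∀ i j, chartMetric (𝓡∂ (k + 1)) e (e.extend (𝓡∂ (k + 1)) (hr.transport x t)) i j =
      chartMetric (𝓡∂ (k + 1)) e (e.extend (𝓡∂ (k + 1)) x) i j := by
    intro i j
    have hm : e.extend (𝓡∂ (k + 1)) (hr.transport x t) =
      setHeight t (e.extend (𝓡∂ (k + 1)) x) := hmap.self_of_nhds
    rw [hm]
    have hJc : Convex ℝ ((↑) '' J : Set ℝ) :=
      (h.isPreconnected.image _ NNReal.continuous_coe.continuousOn).ordConnected.convex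
    have h1 := h.chart.chartMetric_setHeight hr hJc (y := e.extend (𝓡∂ (k + 1)) x)
      (by rintro _ ⟨s, hs, rfl⟩; exact h.setHeight_mem x hx s hs) ⟨t, ht, rfl⟩
      ⟨_, h.height_mem x hx, rfl⟩ i j
    rw [h1]
    have h2 : ((hr.toNNReal x : NNReal) : ℝ) = e.extend (𝓡∂ (k + 1)) x 0 := (h.chart.coord x hxs).symm
    rw [h2, setHeight_self]
  rw [inner_eq_sum_metricComp h.chart.mem hts, inner_eq_sum_metricComp h.chart.mem hxs,
    ← h.chart.chartDeriv_zero hxs, ← h.chart.chartDeriv_zero hxs]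
  simp only [hcomp, hG]
  set a := chartDeriv (𝓡∂ (k + 1)) e x u
  set b := chartDeriv (𝓡∂ (k + 1)) e x v
  set G := chartMetric (𝓡∂ (k + 1)) e (e.extend (𝓡∂ (k + 1)) x) with hGdef
  have h2 : ∀ j, G 0 j = (1 : Matrix (Fin (k + 1)) (Fin (k + 1)) ℝ) 0 j := h.chart.metric _ hy
  have h3 : ∀ j, G j 0 = (1 : Matrix (Fin (k + 1)) (Fin (k + 1)) ℝ) 0 j := fun j => by
    rw [← h2, hGdef, chartMetric_symm]
  simp only [Fin.sum_univ_succ, h2, h3, Matrix.one_apply_eq, Fin.succ_ne_zero, if_true, if_false,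
    Matrix.one_apply_ne (Fin.succ_ne_zero _).symm]
  simp

/-- The differential of the transport annihilates the vertical part of tangent vectors and
preserves the length of the horizontal part. -/
theorem IsHeight.inner_mfderiv_transport (hr : IsHeight (n := k + 1) r) (x : M) (t : NNReal)
    (u v : TangentSpace (𝓡∂ (k + 1)) x) :
    inner ℝ (mfderiv (𝓡∂ (k + 1)) (𝓡∂ (k + 1)) (fun y => hr.transport y t) x u)
      (mfderiv (𝓡∂ (k + 1)) (𝓡∂ (k + 1)) (fun y => hr.transport y t) x v) =
    inner ℝ u v - mvfderiv (𝓡∂ (k + 1)) r x u * mvfderiv (𝓡∂ (k + 1)) r x v := by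
  have hd := fun t y => (hr.contMDiffAt_transport_const y t).mdifferentiableAt (by simp)
  -- Vectors in the image of the differential are horizontal, because the transported points all
  -- have the same height. The correction term therefore disappears in every later box, and inner
  -- products are preserved from there on.
  have hdr : ∀ s, ∀ w : TangentSpace (𝓡∂ (k + 1)) x, mvfderiv (𝓡∂ (k + 1)) r (hr.transport x s)
      (mfderiv (𝓡∂ (k + 1)) (𝓡∂ (k + 1)) (fun y => hr.transport y s) x w) = 0 := by
    intro s w
    rw [← mvfderiv_comp_mfderiv (f := fun y => hr.transport y s) x
      ((hr.smooth _).mdifferentiableAt (by simp)) (hd s x) w]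
    have h1 : (fun y => r (hr.transport y s)) = fun _ => (s : ℝ) :=
      funext fun y => hr.apply_transport y s
    rw [h1, mvfderiv_const]
    rfl
  refine NNReal.forall_of_eventually_iff (t₀ := hr.toNNReal x) (A := fun t =>
    inner ℝ (mfderiv (𝓡∂ (k + 1)) (𝓡∂ (k + 1)) (fun y => hr.transport y t) x u)
      (mfderiv (𝓡∂ (k + 1)) (𝓡∂ (k + 1)) (fun y => hr.transport y t) x v) =
    inner ℝ u v - mvfderiv (𝓡∂ (k + 1)) r x u * mvfderiv (𝓡∂ (k + 1)) r x v)
    (fun t => ?_) ?_ t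
  · obtain ⟨e, J, U, h, hq⟩ := hr.exists_isBox (hr.transport x t)
    refine ⟨J, h.isOpen_interval, ?_, fun s hs s' hs' hA => ?_⟩
    · rw [← hr.toNNReal_transport x t]
      exact h.height_mem _ hq
    · have h1 := h.inner_mfderiv_transport (h.mem_of_transport_mem hq hs) hs'
        (mfderiv (𝓡∂ (k + 1)) (𝓡∂ (k + 1)) (fun y => hr.transport y s) x u)
        (mfderiv (𝓡∂ (k + 1)) (𝓡∂ (k + 1)) (fun y => hr.transport y s) x v)
      rw [hdr, hdr, mul_zero, sub_zero, hA] at h1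
      have h2 : ((fun y => hr.transport y s') ∘ fun y => hr.transport y s) =
          fun y => hr.transport y s' := funext fun y => hr.transport_transport y s s'
      have h3 := mfderiv_comp x (hd s' (hr.transport x s)) (hd s x)
      have h4 := congrArg (fun f : M → M => (inner ℝ (mfderiv (𝓡∂ (k + 1)) (𝓡∂ (k + 1)) f x u)
        (mfderiv (𝓡∂ (k + 1)) (𝓡∂ (k + 1)) f x v) : ℝ)) h2
      refine h4.symm.trans (Eq.trans ?_ h1)
      rw [h3]
      rfl
  · obtain ⟨e, J, U, h, hx⟩ := hr.exists_isBox x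
    exact h.inner_mfderiv_transport hx (h.height_mem _ hx) u v

end Transport

/-! ## The slice of height zero -/

section Slice

set_option linter.unusedSectionVars false

variable {k : ℕ} {M : Type*} [EMetricSpace M] [CompleteSpace M]
  [ChartedSpace (EuclideanHalfSpace (k + 1)) M] [IsManifold (𝓡∂ (k + 1)) ∞ M]
  [RiemannianBundle (fun x : M => TangentSpace (𝓡∂ (k + 1)) x)]
  [IsContMDiffRiemannianBundle (𝓡∂ (k + 1)) ∞ (EuclideanSpace ℝ (Fin (k + 1)))
    (fun x : M => TangentSpace (𝓡∂ (k + 1)) x)] [IsRiemannianManifold (𝓡∂ (k + 1)) M]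
  {r : M → ℝ}

/-- The points of height zero. -/
def IsHeight.Slice (_ : IsHeight (n := k + 1) r) : Type _ := {x : M // r x = 0}

namespace IsHeight

variable {hr : IsHeight (n := k + 1) r}

instance : TopologicalSpace hr.Slice := inferInstanceAs (TopologicalSpace {x : M // r x = 0})

instance : T2Space hr.Slice := inferInstanceAs (T2Space {x : M // r x = 0})

instance [SecondCountableTopology M] : SecondCountableTopology hr.Slice :=
  inferInstanceAs (SecondCountableTopology {x : M // r x = 0})

/-- The inclusion of the slice of height zero. -/
def incl (hr : IsHeight (n := k + 1) r) (p : hr.Slice) : M := p.1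

theorem apply_incl (hr : IsHeight (n := k + 1) r) (p : hr.Slice) : r (hr.incl p) = 0 := p.2

theorem toNNReal_incl (p : hr.Slice) : hr.toNNReal (hr.incl p) = 0 := NNReal.eq p.2

theorem isEmbedding_incl : IsEmbedding hr.incl := IsEmbedding.subtypeVal

/-- The projection to the slice of height zero. -/
noncomputable def proj (hr : IsHeight (n := k + 1) r) (x : M) : hr.Slice :=
  ⟨hr.transport x 0, hr.apply_transport x 0⟩

theorem proj_incl (p : hr.Slice) : hr.proj (hr.incl p) = p := by
  refine Subtype.ext ?_
  have := hr.transport_self (hr.incl p)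
  rwa [toNNReal_incl] at this

theorem incl_proj_of_eq_zero {x : M} (hx : r x = 0) : hr.incl (hr.proj x) = x :=
  congrArg hr.incl (proj_incl (⟨x, hx⟩ : hr.Slice))

theorem continuous_proj : Continuous hr.proj :=
  isEmbedding_incl.continuous_iff.2 (continuous_iff_continuousAt.2 fun x =>
    (hr.contMDiffAt_transport_const x 0).continuousAt)

end IsHeight

variable {hr : IsHeight (n := k + 1) r} {e e' : OpenPartialHomeomorph M (EuclideanHalfSpace (k + 1))}

theorem IsBoxChart.extend_incl (he : IsBoxChart r e) {p : hr.Slice} (hp : hr.incl p ∈ e.source) :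
    consE 0 (tailL k (e.extend (𝓡∂ (k + 1)) (hr.incl p))) = e.extend (𝓡∂ (k + 1)) (hr.incl p) := by
  have h : e.extend (𝓡∂ (k + 1)) (hr.incl p) 0 = 0 := by rw [he.coord _ hp, hr.apply_incl]
  conv_rhs => rw [← consE_tailL (e.extend (𝓡∂ (k + 1)) (hr.incl p)), h]

theorem IsBoxChart.height_symm (he : IsBoxChart r e) {y : EuclideanSpace ℝ (Fin (k + 1))}
    (hy : y ∈ (e.extend (𝓡∂ (k + 1))).target) : r ((e.extend (𝓡∂ (k + 1))).symm y) = y 0 := by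
  rw [← he.coord _ (extend_symm_mem_source hy), (e.extend (𝓡∂ (k + 1))).right_inv hy]

theorem IsBoxChart.incl_proj_symm (hr : IsHeight (n := k + 1) r) (he : IsBoxChart r e)
    {z : EuclideanSpace ℝ (Fin k)} (hz : consE 0 z ∈ (e.extend (𝓡∂ (k + 1))).target) :
    hr.incl (hr.proj ((e.extend (𝓡∂ (k + 1))).symm (consE 0 z))) =
      (e.extend (𝓡∂ (k + 1))).symm (consE 0 z) :=
  IsHeight.incl_proj_of_eq_zero (by rw [he.height_symm hz, consE_zero])

theorem continuous_consE_zero : Continuous (consE 0 : EuclideanSpace ℝ (Fin k) → _) :=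
  contDiff_consE.continuous.comp (continuous_const.prodMk continuous_id)

theorem contDiff_consE_zero : ContDiff ℝ ∞ (consE 0 : EuclideanSpace ℝ (Fin k) → _) :=
  contDiff_consE.comp (contDiff_const.prodMk contDiff_id)

/-- The chart of the slice of height zero that comes from a box chart. -/
noncomputable def IsHeight.sliceChart (hr : IsHeight (n := k + 1) r) (he : IsBoxChart r e) :
    OpenPartialHomeomorph hr.Slice (EuclideanSpace ℝ (Fin k)) where
  toFun p := tailL k (e.extend (𝓡∂ (k + 1)) (hr.incl p))
  invFun z := hr.proj ((e.extend (𝓡∂ (k + 1))).symm (consE 0 z))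
  source := {p | hr.incl p ∈ e.source}
  target := {z | consE 0 z ∈ (e.extend (𝓡∂ (k + 1))).target}
  map_source' p hp := by
    change consE 0 (tailL k (e.extend (𝓡∂ (k + 1)) (hr.incl p))) ∈
      (e.extend (𝓡∂ (k + 1))).target
    rw [he.extend_incl hp]
    exact (e.extend (𝓡∂ (k + 1))).map_source (by rwa [e.extend_source])
  map_target' z hz := by
    change hr.incl _ ∈ e.source
    rw [he.incl_proj_symm hr hz]
    exact extend_symm_mem_source hz
  left_inv' p hp := by
    rw [he.extend_incl hp, e.extend_left_inv hp, IsHeight.proj_incl]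
  right_inv' z hz := by
    rw [he.incl_proj_symm hr hz, (e.extend (𝓡∂ (k + 1))).right_inv hz, tailL_consE]
  open_source := e.open_source.preimage IsHeight.isEmbedding_incl.continuous
  open_target := by
    have h1 : {z | consE 0 z ∈ (e.extend (𝓡∂ (k + 1))).target} =
        (fun z => ((0 : NNReal), z)) ⁻¹' (splitChart e).target := by
      ext z
      exact (mem_splitChart_target (e := e) (u := 0) (z := z)).symm
    rw [h1]
    exact (splitChart e).open_target.preimage (Continuous.prodMk_right 0)
  continuousOn_toFun := (tailL k).continuous.comp_continuousOn
    ((e.continuousOn_extend (I := 𝓡∂ (k + 1))).comp IsHeight.isEmbedding_incl.continuous.continuousOn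
      fun p hp => by rw [e.extend_source]; exact hp)
  continuousOn_invFun := IsHeight.continuous_proj.comp_continuousOn
    ((e.continuousOn_extend_symm (I := 𝓡∂ (k + 1))).comp continuous_consE_zero.continuousOn
      fun z hz => hz)

theorem IsHeight.incl_sliceChart_symm (he : IsBoxChart r e) {z : EuclideanSpace ℝ (Fin k)}
    (hz : z ∈ (hr.sliceChart he).target) :
    hr.incl ((hr.sliceChart he).symm z) = (e.extend (𝓡∂ (k + 1))).symm (consE 0 z) :=
  he.incl_proj_symm hr hz

noncomputable instance : ChartedSpace (EuclideanSpace ℝ (Fin k)) hr.Slice where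
  atlas := {f | ∃ (e : OpenPartialHomeomorph M (EuclideanHalfSpace (k + 1))) (he : IsBoxChart r e),
    f = hr.sliceChart he}
  chartAt p := hr.sliceChart (hr.exists_boxChart (hr.incl p)).choose_spec.1
  mem_chart_source p := (hr.exists_boxChart (hr.incl p)).choose_spec.2
  chart_mem_atlas _ := ⟨_, _, rfl⟩

/-- Transition maps of the slice are transition maps of box charts restricted to the hyperplane of
height zero, with the first coordinate dropped. -/
instance : IsManifold (𝓡 k) ∞ hr.Slice := by
  refine isManifold_of_contDiffOn _ _ _ ?_
  rintro _ _ ⟨e, he, rfl⟩ ⟨e', he', rfl⟩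
  have hsub : ∀ z ∈ ((hr.sliceChart he).symm ≫ₕ hr.sliceChart he').source,
      consE 0 z ∈ overlap (𝓡∂ (k + 1)) e e' := by
    intro z hz
    rw [OpenPartialHomeomorph.trans_source] at hz
    refine ⟨hz.1, ?_⟩
    have h1 : hr.incl ((hr.sliceChart he).symm z) ∈ e'.source := hz.2
    rwa [IsHeight.incl_sliceChart_symm he hz.1] at h1
  have h2 : ContDiffOn ℝ ∞ (fun z => tailL k (coordChange (𝓡∂ (k + 1)) e e' (consE 0 z)))
      ((hr.sliceChart he).symm ≫ₕ hr.sliceChart he').source :=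
    (tailL k).contDiff.comp_contDiffOn ((contDiffOn_coordChange he.mem he'.mem).comp
      contDiff_consE_zero.contDiffOn hsub)
  simp only [modelWithCornersSelf_coe, modelWithCornersSelf_coe_symm, Function.id_comp,
    Function.comp_id, preimage_id, range_id, inter_univ]
  refine h2.congr fun z hz => ?_
  rw [OpenPartialHomeomorph.trans_source] at hz
  change tailL k (e'.extend (𝓡∂ (k + 1)) (hr.incl ((hr.sliceChart he).symm z))) = _
  rw [IsHeight.incl_sliceChart_symm he hz.1]
  rfl

theorem IsHeight.sliceChart_mem_maximalAtlas (he : IsBoxChart r e) :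
    hr.sliceChart he ∈ IsManifold.maximalAtlas (𝓡 k) ∞ hr.Slice :=
  IsManifold.subset_maximalAtlas ⟨e, he, rfl⟩

theorem IsHeight.contMDiff_incl : ContMDiff (𝓡 k) (𝓡∂ (k + 1)) ∞ hr.incl := by
  intro p
  obtain ⟨e, he, hp⟩ := hr.exists_boxChart (hr.incl p)
  have hp' : p ∈ (hr.sliceChart he).source := hp
  have h1 : ContMDiffAt (𝓡 k) 𝓘(ℝ, EuclideanSpace ℝ (Fin (k + 1))) ∞
      (fun q => consE 0 (hr.sliceChart he q)) p :=
    contDiff_consE_zero.contDiffAt.comp_contMDiffAt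
      (contMDiffAt_of_mem_maximalAtlas (sliceChart_mem_maximalAtlas he) hp')
  have hev : ∀ᶠ q in 𝓝 p, q ∈ (hr.sliceChart he).source :=
    (hr.sliceChart he).open_source.mem_nhds hp'
  refine (contMDiffAt_extend_symm_comp he.mem h1 ?_).congr_of_eventuallyEq ?_
  · filter_upwards [hev] with q hq
    exact (hr.sliceChart he).map_source hq
  · filter_upwards [hev] with q hq
    change _ = (e.extend (𝓡∂ (k + 1))).symm (consE 0 (tailL k (e.extend (𝓡∂ (k + 1)) (hr.incl q))))
    rw [he.extend_incl hq, e.extend_left_inv hq]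

theorem IsHeight.contMDiff_proj : ContMDiff (𝓡∂ (k + 1)) (𝓡 k) ∞ hr.proj := by
  intro x
  obtain ⟨e, he, hp⟩ := hr.exists_boxChart (hr.incl (hr.proj x))
  have hp' : hr.proj x ∈ (hr.sliceChart he).source := hp
  have h1 : ContMDiffAt (𝓡∂ (k + 1)) 𝓘(ℝ, EuclideanSpace ℝ (Fin (k + 1))) ∞
      (fun y => e.extend (𝓡∂ (k + 1)) (hr.transport y 0)) x :=
    (e.contMDiffAt_extend he.mem hp).comp x (hr.contMDiffAt_transport_const x 0)
  have h2 : ContMDiffAt (𝓡∂ (k + 1)) (𝓡 k) ∞ (fun y => hr.sliceChart he (hr.proj y)) x :=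
    (tailL k).contDiff.contDiffAt.comp_contMDiffAt h1
  have h3 := contMDiffOn_symm_of_mem_maximalAtlas (sliceChart_mem_maximalAtlas he)
    _ ((hr.sliceChart he).map_source hp')
  have h4 := h3.contMDiffAt ((hr.sliceChart he).open_target.mem_nhds
    ((hr.sliceChart he).map_source hp'))
  refine (h4.comp x h2).congr_of_eventuallyEq ?_
  filter_upwards [continuous_proj.continuousAt.eventually
    ((hr.sliceChart he).open_source.mem_nhds hp')] with y hy
  exact ((hr.sliceChart he).left_inv hy).symm

/-- The chain rule for `proj ∘ incl = id`. It shows that the inclusion is an immersion, which makes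
the pulled-back metric positive definite. -/
theorem IsHeight.mfderiv_proj_mfderiv_incl (p : hr.Slice) (u : TangentSpace (𝓡 k) p) :
    mfderiv (𝓡∂ (k + 1)) (𝓡 k) hr.proj (hr.incl p)
      (mfderiv (𝓡 k) (𝓡∂ (k + 1)) hr.incl p u) = u := by
  have h1 := mfderiv_comp p ((contMDiff_proj (hr := hr) _).mdifferentiableAt (by simp))
    ((contMDiff_incl (hr := hr) p).mdifferentiableAt (by simp))
  have h2 : hr.proj ∘ hr.incl = id := funext proj_incl
  rw [h2, mfderiv_id] at h1
  exact (congrArg (fun A => A u) h1).symm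

end Slice

/-! ## The metric of the slice -/

section PullbackMetric

/-- A family of bilinear forms on the tangent spaces is smooth if its values on smooth sections
are. -/
theorem contMDiff_bilinear_of_sections {k : ℕ} {F : Type*} [TopologicalSpace F]
    [ChartedSpace (EuclideanSpace ℝ (Fin k)) F] [IsManifold (𝓡 k) ∞ F]
    (g : ∀ p : F, TangentSpace (𝓡 k) p →L[ℝ] TangentSpace (𝓡 k) p →L[ℝ] ℝ)
    (hg : ∀ (p : F) (s s' : ∀ q : F, TangentSpace (𝓡 k) q),
      ContMDiffAt (𝓡 k) (𝓡 k).tangent ∞ (fun q => (⟨q, s q⟩ : TangentBundle (𝓡 k) F)) p →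
      ContMDiffAt (𝓡 k) (𝓡 k).tangent ∞ (fun q => (⟨q, s' q⟩ : TangentBundle (𝓡 k) F)) p →
      ContMDiffAt (𝓡 k) 𝓘(ℝ, ℝ) ∞ (fun q => g q (s q) (s' q)) p) :
    ContMDiff (𝓡 k) ((𝓡 k).prod 𝓘(ℝ, EuclideanSpace ℝ (Fin k) →L[ℝ]
      EuclideanSpace ℝ (Fin k) →L[ℝ] ℝ)) ∞
      (fun p => TotalSpace.mk' (EuclideanSpace ℝ (Fin k) →L[ℝ] EuclideanSpace ℝ (Fin k) →L[ℝ] ℝ)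
        (E := fun p : F => TangentSpace (𝓡 k) p →L[ℝ] TangentSpace (𝓡 k) p →L[ℝ] ℝ) p (g p)) := by
  intro p
  rw [contMDiffAt_hom_bundle]
  refine ⟨contMDiffAt_id, ?_⟩
  set b := (EuclideanSpace.basisFun (Fin k) ℝ).toBasis with hb
  set t := trivializationAt (EuclideanSpace ℝ (Fin k)) (TangentSpace (𝓡 k) (M := F)) p with ht
  have hpt : p ∈ t.baseSet := FiberBundle.mem_baseSet_trivializationAt' p
  have hs := fun i => contMDiffAt_localFrame_of_mem (I := 𝓡 k) ∞ t b i hpt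
  -- The elementary bilinear forms. In the trivialisation the given form is their combination with
  -- coefficients its values on a smooth local frame.
  set P : Fin k → Fin k → (EuclideanSpace ℝ (Fin k) →L[ℝ] EuclideanSpace ℝ (Fin k) →L[ℝ] ℝ) :=
    fun i j => (EuclideanSpace.proj i : EuclideanSpace ℝ (Fin k) →L[ℝ] ℝ).smulRight
      (EuclideanSpace.proj j : EuclideanSpace ℝ (Fin k) →L[ℝ] ℝ) with hP
  have h1 : ContMDiffAt (𝓡 k) 𝓘(ℝ, EuclideanSpace ℝ (Fin k) →L[ℝ]
      EuclideanSpace ℝ (Fin k) →L[ℝ] ℝ) ∞ (fun q => ∑ i, ∑ j,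
        (g q (t.localFrame b i q) (t.localFrame b j q)) • P i j) p := by
    refine contMDiffAt_finsetSum fun i _ => contMDiffAt_finsetSum fun j _ => ?_
    exact (hg p _ _ (hs i) (hs j)).smul contMDiffAt_const
  refine h1.congr_of_eventuallyEq ?_
  filter_upwards [t.open_baseSet.mem_nhds hpt] with q hq
  refine ContinuousLinearMap.ext fun v => ContinuousLinearMap.ext fun w => ?_
  rw [inCoordinates_apply_eq₂ hq hq (by simp)]
  have hL : ∀ v : EuclideanSpace ℝ (Fin k), t.symm q v = ∑ i, v i • t.localFrame b i q := by
    intro v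
    have h2 : t.symm q v = (t.linearEquivAt ℝ q hq).symm v := rfl
    rw [h2]
    conv_lhs => rw [euclideanSpace_eq_sum_single v, map_sum]
    refine Finset.sum_congr rfl fun i _ => ?_
    rw [map_smul, t.localFrame_apply_of_mem_baseSet b hq, Trivialization.basisAt,
      Module.Basis.map_apply]
    simp [hb]
  rw [hL, hL]
  simp only [map_sum, map_smul, sum_apply, smul_apply, hP, ContinuousLinearMap.smulRight_apply,
    smul_eq_mul, Finset.mul_sum]
  rw [Finset.sum_comm]
  refine Finset.sum_congr rfl fun i _ => Finset.sum_congr rfl fun j _ => ?_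
  have h3 : ∀ c : ℝ, (trivializationAt ℝ (fun _ : F => ℝ) p).linearMapAt ℝ q c = c := fun c => by
    simp only [Trivial.fiberBundle_trivializationAt', Trivial.linearMapAt_trivialization,
      LinearMap.id_coe, id_eq]
  rw [h3]
  change w j * (v i * _) = _ * (v i * w j)
  ring

end PullbackMetric

/-! ### The induced metric. -/

section SliceMetric

set_option linter.unusedSectionVars false

variable {k : ℕ} {M : Type*} [EMetricSpace M] [CompleteSpace M]
  [ChartedSpace (EuclideanHalfSpace (k + 1)) M] [IsManifold (𝓡∂ (k + 1)) ∞ M]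
  [RiemannianBundle (fun x : M => TangentSpace (𝓡∂ (k + 1)) x)]
  [IsContMDiffRiemannianBundle (𝓡∂ (k + 1)) ∞ (EuclideanSpace ℝ (Fin (k + 1)))
    (fun x : M => TangentSpace (𝓡∂ (k + 1)) x)] [IsRiemannianManifold (𝓡∂ (k + 1)) M]
  {r : M → ℝ} {hr : IsHeight (n := k + 1) r}

/-- The metric of the slice, as a family of bilinear forms. -/
noncomputable def IsHeight.sliceForm (hr : IsHeight (n := k + 1) r) (p : hr.Slice) :
    TangentSpace (𝓡 k) p →L[ℝ] TangentSpace (𝓡 k) p →L[ℝ] ℝ :=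
  (ContinuousLinearMap.precomp ℝ (mfderiv (𝓡 k) (𝓡∂ (k + 1)) hr.incl p)).comp
    ((innerSL ℝ : TangentSpace (𝓡∂ (k + 1)) (hr.incl p) →L[ℝ]
      TangentSpace (𝓡∂ (k + 1)) (hr.incl p) →L[ℝ] ℝ).comp
        (mfderiv (𝓡 k) (𝓡∂ (k + 1)) hr.incl p))

theorem IsHeight.sliceForm_apply (p : hr.Slice) (u v : TangentSpace (𝓡 k) p) :
    hr.sliceForm p u v = inner ℝ (mfderiv (𝓡 k) (𝓡∂ (k + 1)) hr.incl p u)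
      (mfderiv (𝓡 k) (𝓡∂ (k + 1)) hr.incl p v) := rfl

/-- The metric of the slice. -/
noncomputable def IsHeight.sliceMetric (hr : IsHeight (n := k + 1) r) :
    ContMDiffRiemannianMetric (𝓡 k) ∞ (EuclideanSpace ℝ (Fin k))
      (fun p : hr.Slice => TangentSpace (𝓡 k) p) where
  inner := hr.sliceForm
  symm p u v := by rw [sliceForm_apply, sliceForm_apply, real_inner_comm]
  pos p u hu := by
    rw [sliceForm_apply]
    refine real_inner_self_pos.2 fun h => hu ?_
    rw [← mfderiv_proj_mfderiv_incl p u, h, map_zero]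
    rfl
  -- The unit ball of the pulled-back form lies in the image, under the differential of the
  -- projection, of a unit ball in a tangent space of `M`.
  isVonNBounded p := by
    have h1 := (NormedSpace.isVonNBounded_ball ℝ (TangentSpace (𝓡∂ (k + 1)) (hr.incl p)) 1).image
      (mfderiv (𝓡∂ (k + 1)) (𝓡 k) hr.proj (hr.incl p))
    refine h1.subset ?_
    intro (u : TangentSpace (𝓡 k) p) hu
    refine ⟨mfderiv (𝓡 k) (𝓡∂ (k + 1)) hr.incl p u, ?_, mfderiv_proj_mfderiv_incl p u⟩
    have h2 : inner ℝ (mfderiv (𝓡 k) (𝓡∂ (k + 1)) hr.incl p u)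
      (mfderiv (𝓡 k) (𝓡∂ (k + 1)) hr.incl p u) < 1 := hu
    rw [real_inner_self_eq_norm_sq] at h2
    rw [mem_ball_zero_iff]
    nlinarith [norm_nonneg (mfderiv (𝓡 k) (𝓡∂ (k + 1)) hr.incl p u)]
  contMDiff := by
    refine contMDiff_bilinear_of_sections hr.sliceForm fun p s s' hs hs' => ?_
    have h1 : ∀ s : ∀ q : hr.Slice, TangentSpace (𝓡 k) q,
        ContMDiffAt (𝓡 k) (𝓡 k).tangent ∞ (fun q => (⟨q, s q⟩ : TangentBundle (𝓡 k) hr.Slice)) p →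
        ContMDiffAt (𝓡 k) (𝓡∂ (k + 1)).tangent ∞ (fun q => (⟨hr.incl q,
          mfderiv (𝓡 k) (𝓡∂ (k + 1)) hr.incl q (s q)⟩ : TangentBundle (𝓡∂ (k + 1)) M)) p := by
      intro s hs
      exact ((contMDiff_incl (hr := hr)).contMDiff_tangentMap (m := ∞) (by simp)).contMDiffAt.comp p hs
    exact ContMDiffAt.inner_bundle (F := EuclideanSpace ℝ (Fin (k + 1)))
      (E := fun x : M => TangentSpace (𝓡∂ (k + 1)) x) (h1 s hs) (h1 s' hs')

noncomputable instance : RiemannianBundle (fun p : hr.Slice => TangentSpace (𝓡 k) p) :=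
  ⟨hr.sliceMetric.toRiemannianMetric⟩

instance : IsContMDiffRiemannianBundle (𝓡 k) ∞ (EuclideanSpace ℝ (Fin k))
    (fun p : hr.Slice => TangentSpace (𝓡 k) p) :=
  ⟨hr.sliceMetric.inner, hr.sliceMetric.contMDiff, fun _ _ _ => rfl⟩

theorem IsHeight.inner_slice (p : hr.Slice) (u v : TangentSpace (𝓡 k) p) :
    inner ℝ u v = inner ℝ (mfderiv (𝓡 k) (𝓡∂ (k + 1)) hr.incl p u)
      (mfderiv (𝓡 k) (𝓡∂ (k + 1)) hr.incl p v) := rfl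

end SliceMetric

/-! ## The Ricci tensor of a slice -/

section SliceCoordinates

variable {k : ℕ} {s T : Set (EuclideanSpace ℝ (Fin k))} {s' T' : Set (EuclideanSpace ℝ (Fin (k + 1)))}
  {G : EuclideanSpace ℝ (Fin k) → Matrix (Fin k) (Fin k) ℝ}
  {G' : EuclideanSpace ℝ (Fin (k + 1)) → Matrix (Fin (k + 1)) (Fin (k + 1)) ℝ}

theorem IsCoordDomain.partialDeriv_comp_consE (h : IsCoordDomain s T) (h' : IsCoordDomain s' T')
    (hmaps : MapsTo (consE 0) T T') {u : EuclideanSpace ℝ (Fin (k + 1)) → ℝ}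
    (hu : ContDiffOn ℝ ∞ u T') {z : EuclideanSpace ℝ (Fin k)} (hz : z ∈ T) (i : Fin k) :
    partialDeriv s i (fun z => u (consE 0 z)) z = partialDeriv s' i.succ u (consE 0 z) := by
  rw [h.partialDeriv_comp h' contDiff_consE_zero.contDiffOn hmaps hu hz, Fin.sum_univ_succ]
  simp only [consE_zero, consE_succ, partialDeriv_const, mul_zero, zero_add,
    h.partialDeriv_coord hz, mul_ite, mul_one, Finset.sum_ite_eq', Finset.mem_univ, if_true]

/-- A metric of the form `dr² + g'` with `g'` independent of `r`. -/
structure IsSplitMetric (s' T' : Set (EuclideanSpace ℝ (Fin (k + 1))))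
    (G' : EuclideanSpace ℝ (Fin (k + 1)) → Matrix (Fin (k + 1)) (Fin (k + 1)) ℝ) : Prop
    extends IsCoordMetric s' T' G' where
  apply_zero : ∀ y ∈ T', ∀ j, G' y 0 j = (1 : Matrix (Fin (k + 1)) (Fin (k + 1)) ℝ) 0 j
  partialDeriv_zero : ∀ y ∈ T', ∀ i j, partialDeriv s' 0 (fun z => G' z i j) y = 0

theorem IsSplitMetric.partialDeriv_apply_zero (h : IsSplitMetric s' T' G')
    {y : EuclideanSpace ℝ (Fin (k + 1))} (hy : y ∈ T') (i j : Fin (k + 1)) :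
    partialDeriv s' i (fun z => G' z 0 j) y = 0 := by
  rw [h.partialDeriv_congr (fun z hz => h.apply_zero z hz j) hy, partialDeriv_const]

theorem IsSplitMetric.partialDeriv_apply_zero_right (h : IsSplitMetric s' T' G')
    {y : EuclideanSpace ℝ (Fin (k + 1))} (hy : y ∈ T') (i j : Fin (k + 1)) :
    partialDeriv s' i (fun z => G' z j 0) y = 0 := by
  rw [h.partialDeriv_congr (fun z hz => h.symm z hz j 0) hy, h.partialDeriv_apply_zero hy]

theorem IsSplitMetric.christoffel_zero_upper (h : IsSplitMetric s' T' G')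
    {y : EuclideanSpace ℝ (Fin (k + 1))} (hy : y ∈ T') (i j : Fin (k + 1)) :
    christoffel s' G' 0 i j y = 0 := by
  have h1 := h.sum_christoffel_mul hy 0 i j
  simp only [h.apply_zero y hy, Matrix.one_apply, ite_mul, one_mul, zero_mul, Finset.sum_ite_eq,
    Finset.mem_univ, if_true, loweredChristoffel, h.partialDeriv_apply_zero_right hy,
    h.partialDeriv_zero y hy] at h1
  rw [h1]
  norm_num

theorem IsSplitMetric.christoffel_zero_right (h : IsSplitMetric s' T' G')
    {y : EuclideanSpace ℝ (Fin (k + 1))} (hy : y ∈ T') (a i : Fin (k + 1)) :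
    christoffel s' G' a i 0 y = 0 := by
  simp only [christoffel, h.partialDeriv_apply_zero_right hy, h.partialDeriv_apply_zero hy,
    h.partialDeriv_zero y hy]
  simp

variable (h' : IsSplitMetric s' T' G') (h : IsCoordMetric s T G) (hmaps : MapsTo (consE 0) T T')
  (hG : ∀ z ∈ T, ∀ i j, G z i j = G' (consE 0 z) i.succ j.succ)
include h' h hmaps hG

/-- The comparison is made with the index lowered, where only derivatives of the metric occur. The
symbol with upper index zero drops out, and `G` is invertible. -/
theorem IsSplitMetric.christoffel_slice {z : EuclideanSpace ℝ (Fin k)} (hz : z ∈ T)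
    (a i j : Fin k) :
    christoffel s G a i j z = christoffel s' G' a.succ i.succ j.succ (consE 0 z) := by
  have hd : ∀ l i j, partialDeriv s l (fun z => G z i j) z =
      partialDeriv s' l.succ (fun z => G' z i.succ j.succ) (consE 0 z) := by
    intro l i j
    rw [h.partialDeriv_congr (fun z hz => hG z hz i j) hz]
    exact h.partialDeriv_comp_consE h'.toIsCoordDomain hmaps (h'.smooth _ _) hz l
  have h1 : (G z).mulVec (fun a => christoffel s G a i j z) =
      (G z).mulVec (fun a => christoffel s' G' a.succ i.succ j.succ (consE 0 z)) := by
    funext a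
    have e1 := h.sum_christoffel_mul hz a i j
    have e2 := h'.sum_christoffel_mul (hmaps hz) a.succ i.succ j.succ
    rw [Fin.sum_univ_succ, h'.christoffel_zero_upper (hmaps hz), mul_zero, zero_add] at e2
    simp only [← hG z hz] at e2
    simp only [loweredChristoffel, ← hd] at e1 e2
    exact e1.trans e2.symm
  exact congrFun (Matrix.mulVec_injective_of_isUnit
    ((Matrix.isUnit_iff_isUnit_det _).2 (h.isUnit_det z hz)) h1) a

/-- The Ricci tensor of `dr² + g'` restricts to the Ricci tensor of `g'`. -/
theorem IsSplitMetric.coordRicci_slice {z : EuclideanSpace ℝ (Fin k)} (hz : z ∈ T)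
    (i j : Fin k) :
    coordRicci s G i j z = coordRicci s' G' i.succ j.succ (consE 0 z) := by
  have hy := hmaps hz
  have hd : ∀ l a i j, partialDeriv s l (christoffel s G a i j) z =
      partialDeriv s' l.succ (christoffel s' G' a.succ i.succ j.succ) (consE 0 z) := by
    intro l a i j
    rw [h.partialDeriv_congr (fun z hz => h'.christoffel_slice h hmaps hG hz a i j) hz]
    exact h.partialDeriv_comp_consE h'.toIsCoordDomain hmaps
      (h'.contDiffOn_christoffel _ _ _) hz l
  have h1 : ∀ l i j, partialDeriv s' l (christoffel s' G' 0 i j) (consE 0 z) = 0 := by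
    intro l i j
    rw [h'.partialDeriv_congr (g := fun _ => 0)
      (fun y hy => h'.christoffel_zero_upper hy i j) hy, partialDeriv_const]
  simp only [coordRicci, Fin.sum_univ_succ (n := k), h1, h'.christoffel_zero_upper hy,
    h'.christoffel_zero_right hy, hd,
    h'.christoffel_slice h hmaps hG hz]
  simp

end SliceCoordinates

/-- The inclusion of the coordinate hyperplane. -/
noncomputable def consL (k : ℕ) : EuclideanSpace ℝ (Fin k) →L[ℝ] EuclideanSpace ℝ (Fin (k + 1)) :=
  LinearMap.toContinuousLinearMap
    { toFun := consE 0
      map_add' := fun y z => by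
        ext a
        refine Fin.cases (by simp) (fun a => by simp) a
      map_smul' := fun c z => by
        ext a
        refine Fin.cases (by simp) (fun a => by simp) a }

/-! ### From charts of the slice to box charts of the manifold. -/

section SliceRicci

set_option linter.unusedSectionVars false

variable {k : ℕ} {M : Type*} [EMetricSpace M] [CompleteSpace M]
  [ChartedSpace (EuclideanHalfSpace (k + 1)) M] [IsManifold (𝓡∂ (k + 1)) ∞ M]
  [RiemannianBundle (fun x : M => TangentSpace (𝓡∂ (k + 1)) x)]
  [IsContMDiffRiemannianBundle (𝓡∂ (k + 1)) ∞ (EuclideanSpace ℝ (Fin (k + 1)))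
    (fun x : M => TangentSpace (𝓡∂ (k + 1)) x)] [IsRiemannianManifold (𝓡∂ (k + 1)) M]
  {r : M → ℝ} {hr : IsHeight (n := k + 1) r} {e : OpenPartialHomeomorph M (EuclideanHalfSpace (k + 1))}

theorem IsBoxChart.isSplitMetric (hr : IsHeight (n := k + 1) r) (he : IsBoxChart r e) :
    IsSplitMetric (range (𝓡∂ (k + 1))) (e.extend (𝓡∂ (k + 1))).target
      (chartMetric (𝓡∂ (k + 1)) e) where
  toIsCoordMetric := isCoordMetric_chartMetric he.mem
  apply_zero := he.metric
  partialDeriv_zero _ hy := he.partialDeriv_zero_chartMetric hr hy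

/-- The metric of the slice in the coordinates of a box chart. -/
theorem IsBoxChart.chartMetric_slice (he : IsBoxChart r e)
    {f : OpenPartialHomeomorph hr.Slice (EuclideanSpace ℝ (Fin k))}
    (hf : f ∈ IsManifold.maximalAtlas (𝓡 k) ∞ hr.Slice) {p : hr.Slice} (hp : p ∈ f.source)
    (hpe : hr.incl p ∈ e.source)
    (hev : ∀ᶠ q in 𝓝 p, e.extend (𝓡∂ (k + 1)) (hr.incl q) = consE 0 (f q)) (i j : Fin k) :
    chartMetric (𝓡 k) f (f.extend (𝓡 k) p) i j =
      chartMetric (𝓡∂ (k + 1)) e (e.extend (𝓡∂ (k + 1)) (hr.incl p)) i.succ j.succ := by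
  obtain ⟨z, hz, rfl⟩ := exists_extend_symm_eq (I := 𝓡 k) hp
  rw [(f.extend (𝓡 k)).right_inv hz, chartMetric_apply, IsHeight.inner_slice,
    inner_eq_sum_metricComp he.mem hpe]
  set p := (f.extend (𝓡 k)).symm z with hpz
  have hpf : p ∈ f.source := hp
  have h1 : ∀ u : TangentSpace (𝓡 k) p, chartDeriv (𝓡∂ (k + 1)) e (hr.incl p)
      (mfderiv (𝓡 k) (𝓡∂ (k + 1)) hr.incl p u) =
      consE 0 (chartDeriv (𝓡 k) f p u) := by
    intro u
    have hes := (e.contMDiffAt_extend he.mem hpe).mdifferentiableAt (by simp)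
    have hfs := (f.contMDiffAt_extend hf hpf).mdifferentiableAt (by simp)
    have his := (IsHeight.contMDiff_incl (hr := hr) p).mdifferentiableAt (by simp)
    have h2 : chartDeriv (𝓡∂ (k + 1)) e (hr.incl p)
        (mfderiv (𝓡 k) (𝓡∂ (k + 1)) hr.incl p u) =
        mvfderiv (𝓡 k) (fun q => e.extend (𝓡∂ (k + 1)) (hr.incl q)) p u :=
      (mvfderiv_comp_mfderiv p hes his u).symm
    have h3 : mvfderiv (𝓡 k) (fun q => e.extend (𝓡∂ (k + 1)) (hr.incl q)) p u =
        mvfderiv (𝓡 k) (fun q => consE 0 (f.extend (𝓡 k) q)) p u :=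
      Filter.EventuallyEq.mvfderiv_apply hev u
    have h4 := mvfderiv_comp_left (I := 𝓡 k) (consL k).hasFDerivAt hfs u
    rw [h2, h3]
    exact h4
  have h2 : ∀ i, consE 0 (chartDeriv (𝓡 k) f p (coordVector (𝓡 k) f i z)) =
      EuclideanSpace.single i.succ (1 : ℝ) := by
    intro i
    rw [coordVector_eq, chartDeriv_chartDerivSymm hf hz]
    ext a
    refine Fin.cases ?_ (fun a => ?_) a
    · simp [(Fin.succ_ne_zero i).symm]
    · simp [Fin.succ_inj, PiLp.single_apply]
  simp only [h1, h2]
  simp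
/-- A chart of the slice extends to a box chart. -/
theorem IsBoxChart.exists_of_sliceChart {f : OpenPartialHomeomorph hr.Slice (EuclideanSpace ℝ (Fin k))}
    (hf : f ∈ IsManifold.maximalAtlas (𝓡 k) ∞ hr.Slice) {p : hr.Slice} (hp : p ∈ f.source) :
    ∃ e, IsBoxChart (n := k + 1) r e ∧ hr.incl p ∈ e.source ∧
      ∀ᶠ q in 𝓝 p, e.extend (𝓡∂ (k + 1)) (hr.incl q) = consE 0 (f q) := by
  obtain ⟨b, hb, hpb⟩ := hr.exists_boxChart (hr.incl p)
  have hbs := hr.sliceChart_mem_maximalAtlas hb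
  set ψ := (hr.sliceChart hb).symm ≫ₕ f with hψ
  have hpψ : hr.sliceChart hb p ∈ ψ.source := by
    rw [hψ, OpenPartialHomeomorph.trans_source]
    refine ⟨(hr.sliceChart hb).map_source hpb, ?_⟩
    rw [mem_preimage, (hr.sliceChart hb).left_inv hpb]
    exact hp
  have hψg : ψ ∈ contDiffGroupoid ∞ (𝓡 k) :=
    (contDiffGroupoid ∞ (𝓡 k)).compatible_of_mem_maximalAtlas hbs hf
  rw [contDiffGroupoid, mem_groupoid_of_pregroupoid] at hψg
  have hψs : ContDiffOn ℝ ∞ ψ ψ.source := by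
    have := hψg.1
    simp only [contDiffPregroupoid, modelWithCornersSelf_coe, modelWithCornersSelf_coe_symm,
      Function.id_comp, Function.comp_id, preimage_id, range_id, inter_univ] at this
    exact this
  have hψs' : ContDiffOn ℝ ∞ ψ.symm ψ.target := by
    have := hψg.2
    simp only [contDiffPregroupoid, modelWithCornersSelf_coe, modelWithCornersSelf_coe_symm,
      Function.id_comp, Function.comp_id, preimage_id, range_id, inter_univ] at this
    exact this
  have hlift : ∀ (φ : OpenPartialHomeomorph (EuclideanSpace ℝ (Fin k)) (EuclideanSpace ℝ (Fin k))),
      ContDiffOn ℝ ∞ φ φ.source → ContDiffOn ℝ ∞ (fun y => consE (y 0) (φ (tailL k y)))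
        (tailL k ⁻¹' φ.source) := fun φ hφ =>
    contDiff_consE.comp_contDiffOn ((contDiff_coord 0).contDiffOn.prodMk
      (hφ.comp (tailL k).contDiff.contDiffOn fun y hy => hy))
  -- A change of slice coordinates is extended by leaving the height alone. It then preserves the
  -- vertical field and the form `dr² + g'`. The general `f` is needed because Ricci flatness refers
  -- to all charts of the maximal atlas.
  set F : EuclideanSpace ℝ (Fin (k + 1)) → EuclideanSpace ℝ (Fin (k + 1)) := fun y =>
    consE (y 0) (ψ (tailL k y)) with hF
  set F' : EuclideanSpace ℝ (Fin (k + 1)) → EuclideanSpace ℝ (Fin (k + 1)) := fun y =>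
    consE (y 0) (ψ.symm (tailL k y)) with hF'
  have hU : IsOpen (tailL k ⁻¹' ψ.source) := ψ.open_source.preimage (tailL k).continuous
  have hU' : IsOpen (tailL k ⁻¹' ψ.target) := ψ.open_target.preimage (tailL k).continuous
  have hFs : ContDiffOn ℝ ∞ F (tailL k ⁻¹' ψ.source) := hlift ψ hψs
  have hFs' : ContDiffOn ℝ ∞ F' (tailL k ⁻¹' ψ.target) := hlift ψ.symm hψs'
  have hF'F : ∀ y ∈ tailL k ⁻¹' ψ.source, F' (F y) = y := by
    intro y hy
    simp only [hF, hF', tailL_consE, consE_zero]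
    rw [ψ.left_inv hy, consE_tailL]
  set y₀ := b.extend (𝓡∂ (k + 1)) (hr.incl p) with hy₀
  have hy₀U : y₀ ∈ tailL k ⁻¹' ψ.source := hpψ
  have hy₀U' : F y₀ ∈ tailL k ⁻¹' ψ.target := ψ.map_source hy₀U
  have hy₀r : y₀ ∈ range (𝓡∂ (k + 1)) := mem_range_self _
  obtain ⟨e, he, hpe, hes, hee⟩ := exists_chart_change hb.mem hpb hU hy₀U
    (hFs.mono inter_subset_right)
    (fun y hy => mem_range_halfSpace.2 (mem_range_halfSpace.1 hy.1 : 0 ≤ y 0)) (fun y _ h0 => h0)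
    (by
      have h1 := (hFs.contDiffAt (hU.mem_nhds hy₀U)).differentiableAt (by simp)
      have h2 := (hFs'.contDiffAt (hU'.mem_nhds hy₀U')).differentiableAt (by simp)
      have h3 := h2.hasFDerivAt.comp y₀ h1.hasFDerivAt
      have h4 : HasFDerivAt (F' ∘ F) (ContinuousLinearMap.id ℝ _) y₀ := by
        refine (hasFDerivAt_id y₀).congr_of_eventuallyEq ?_
        filter_upwards [hU.mem_nhds hy₀U] with y hy using hF'F y hy
      have h5 := h3.unique h4
      rw [h1.fderivWithin ((𝓡∂ (k + 1)).uniqueDiffOn y₀ hy₀r)]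
      refine ContinuousLinearMap.isInvertible_of_ker fun v hv => ?_
      have h6 := congrArg (fun A => A v) h5
      rw [ContinuousLinearMap.comp_apply, hv, map_zero] at h6
      exact h6.symm)
  have hcoord : ∀ x ∈ e.source, e.extend (𝓡∂ (k + 1)) x 0 = r x := fun x hx => by
    rw [(hee x hx).2, ← hb.coord x (hes hx)]
    rfl
  have hT := isCoordDomain_extend_target (I := 𝓡∂ (k + 1)) e
  have hO : ∀ y ∈ (e.extend (𝓡∂ (k + 1))).target, y ∈ overlap (𝓡∂ (k + 1)) e b := fun y hy =>
    ⟨hy, hes (extend_symm_mem_source hy)⟩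
  have hcc : ∀ y ∈ (e.extend (𝓡∂ (k + 1))).target, y ∈ tailL k ⁻¹' ψ.target ∧
      coordChange (𝓡∂ (k + 1)) e b y = F' y := by
    intro y hy
    have h1 := hee _ (extend_symm_mem_source hy)
    rw [(e.extend (𝓡∂ (k + 1))).right_inv hy] at h1
    have h2 := hF'F _ h1.1
    rw [← h1.2] at h2
    have h3 : tailL k y = ψ (tailL k (b.extend (𝓡∂ (k + 1)) ((e.extend (𝓡∂ (k + 1))).symm y))) :=
      congrArg (tailL k) h1.2
    exact ⟨by rw [mem_preimage, h3]; exact ψ.map_source h1.1, h2.symm⟩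
  have hpd : ∀ y ∈ (e.extend (𝓡∂ (k + 1))).target, ∀ a,
      partialDeriv (range (𝓡∂ (k + 1))) 0 (fun z => coordChange (𝓡∂ (k + 1)) e b z a) y =
        if a = 0 then 1 else 0 := by
    intro y hy a
    rw [hT.partialDeriv_congr (g := fun z => F' z a)
      (fun z hz => by simp only; rw [(hcc z hz).2]) hy]
    refine Fin.cases ?_ (fun a => ?_) a
    · exact (hT.partialDeriv_coord hy 0 0).trans (by simp)
    · have h1 := (hψs'.contDiffAt (ψ.open_target.mem_nhds (hcc y hy).1)).differentiableAt (by simp)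
      have h2 := (EuclideanSpace.proj a : EuclideanSpace ℝ (Fin k) →L[ℝ] ℝ).hasFDerivAt.comp y
        (h1.hasFDerivAt.comp y (tailL k).hasFDerivAt)
      have h3 : partialDeriv (range (𝓡∂ (k + 1))) 0 (fun z => F' z a.succ) y = _ :=
        congrArg (fun A => A (EuclideanSpace.single 0 1))
          (h2.hasFDerivWithinAt.fderivWithin (hT.uniqueDiffOn y (hT.subset hy)))
      have h4 : tailL k (EuclideanSpace.single 0 1) = 0 := by
        ext i
        simp
      rw [h3]
      simp [h4]
  refine ⟨e, ⟨he, hcoord, fun y hy j => ?_⟩, hpe, ?_⟩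
  · rw [chartMetric_coordChange he hb.mem (hO y hy)]
    simp only [hpd y hy, ite_mul, one_mul, zero_mul, mul_ite, mul_zero]
    rw [Finset.sum_comm]
    simp only [Finset.sum_ite_eq', Finset.mem_univ, if_true,
      hb.metric _ (mapsTo_coordChange e b (hO y hy)), Matrix.one_apply, ite_mul, one_mul, zero_mul,
      Finset.sum_ite_eq]
    rw [hT.partialDeriv_congr (g := fun z => z 0)
      (fun z hz => by simp only; rw [(hcc z hz).2]; rfl) hy, hT.partialDeriv_coord hy]
  · filter_upwards [IsHeight.isEmbedding_incl.continuous.continuousAt.eventually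
      (e.open_source.mem_nhds hpe)] with q hq
    rw [(hee _ hq).2, hF]
    simp only
    rw [hb.coord _ (hes hq), hr.apply_incl]
    congr 1
    change f ((hr.sliceChart hb).symm (hr.sliceChart hb q)) = f q
    rw [(hr.sliceChart hb).left_inv (hes hq)]

/-- If the Ricci tensor vanishes, so does that of the slice. -/
theorem IsHeight.isRicciFlat_slice (hr : IsHeight (n := k + 1) r)
    (hric : ∀ e ∈ IsManifold.maximalAtlas (𝓡∂ (k + 1)) ∞ M,
      ∀ y ∈ (e.extend (𝓡∂ (k + 1))).target, ∀ i j,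
      coordRicci (range (𝓡∂ (k + 1))) (chartMetric (𝓡∂ (k + 1)) e) i j y = 0) :
    IsRicciFlat (𝓡 k) hr.Slice := by
  intro f hf p hp i j
  obtain ⟨e, he, hpe, hev⟩ := IsBoxChart.exists_of_sliceChart hf hp
  have hev' : ∀ᶠ q in 𝓝 p, hr.incl q ∈ e.source :=
    IsHeight.isEmbedding_incl.continuous.continuousAt.eventually (e.open_source.mem_nhds hpe)
  -- The Ricci tensor contains derivatives, so the two metrics must be compared on a whole
  -- neighbourhood of `p`.
  obtain ⟨V, hVs, hV, hpV⟩ := eventually_nhds_iff.1 (hev.eventually_nhds.and hev')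
  have hO : IsOpen (f.target ∩ f.symm ⁻¹' V) := f.isOpen_inter_preimage_symm hV
  have hsub : f.target ∩ f.symm ⁻¹' V ⊆ (f.extend (𝓡 k)).target := fun z hz => by
    rw [f.extend_target]
    exact ⟨hz.1, z, rfl⟩
  have h1 := isCoordMetric_chartMetric hf
  have h2 : IsCoordMetric (range (𝓡 k)) (f.target ∩ f.symm ⁻¹' V) (chartMetric (𝓡 k) f) :=
    { toIsCoordDomain := IsCoordDomain.of_isOpen hO h1.uniqueDiffOn (hsub.trans h1.subset)
      smooth := fun i j => (h1.smooth i j).mono hsub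
      symm := fun y hy => h1.symm y (hsub hy)
      isUnit_det := fun y hy => h1.isUnit_det y (hsub hy) }
  have h3 : ∀ z ∈ f.target ∩ f.symm ⁻¹' V,
      consE 0 z = e.extend (𝓡∂ (k + 1)) (hr.incl (f.symm z)) := by
    intro z hz
    rw [(hVs _ hz.2).1.self_of_nhds, f.right_inv hz.1]
  have hz : f.extend (𝓡 k) p ∈ f.target ∩ f.symm ⁻¹' V := by
    refine ⟨f.map_source hp, ?_⟩
    change f.symm (f p) ∈ V
    rwa [f.left_inv hp]
  rw [ricciComp, (he.isSplitMetric hr).coordRicci_slice h2 (fun z hz => ?_) (fun z hz i j => ?_) hz]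
  · refine hric e he.mem _ ?_ _ _
    rw [h3 _ hz]
    exact (e.extend (𝓡∂ (k + 1))).map_source (by rw [e.extend_source]; exact (hVs _ hz.2).2)
  · rw [h3 _ hz]
    exact (e.extend (𝓡∂ (k + 1))).map_source (by rw [e.extend_source]; exact (hVs _ hz.2).2)
  · have h4 := he.chartMetric_slice hf (f.map_target hz.1) (hVs _ hz.2).2 (hVs _ hz.2).1 i j
    rw [← h3 z hz] at h4
    have h5 : f.extend (𝓡 k) (f.symm z) = z := f.right_inv hz.1
    rwa [h5] at h4

end SliceRicci

/-! ## The splitting -/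

section HalfLine

theorem contMDiff_halfLineCoord : ContMDiff (𝓡∂ 1) 𝓘(ℝ, ℝ) ∞ halfLineCoord :=
  (contDiff_coord 0).contMDiff.comp (𝓡∂ 1).contMDiff

theorem halfLineCoord_injective : Function.Injective halfLineCoord := fun s t h => by
  refine Subtype.ext (PiLp.ext fun i => ?_)
  rw [Subsingleton.elim i 0]
  exact h

/-- A nonnegative number as a point of the half-line. -/
noncomputable def halfLinePoint (t : NNReal) : EuclideanHalfSpace 1 :=
  ⟨WithLp.toLp 2 fun _ => (t : ℝ), t.2⟩

/-- A point of the half-line as a nonnegative number. -/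
noncomputable def halfLineHeight (t : EuclideanHalfSpace 1) : NNReal := ⟨halfLineCoord t, t.2⟩

theorem contMDiff_halfLinePoint {n : ℕ} {H : Type*} [TopologicalSpace H]
    {I : ModelWithCorners ℝ (EuclideanSpace ℝ (Fin n)) H} {M : Type*} [TopologicalSpace M]
    [ChartedSpace H M] {s : M → NNReal} (hs : ContMDiff I 𝓘(ℝ, ℝ) ∞ fun x => (s x : ℝ)) :
    ContMDiff I (𝓡∂ 1) ∞ fun x => halfLinePoint (s x) := by
  have h1 : ContMDiff I 𝓘(ℝ, EuclideanSpace ℝ (Fin 1)) ∞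
      fun x => (𝓡∂ 1) (halfLinePoint (s x)) := by
    have : ContDiff ℝ ∞ fun t : ℝ => (WithLp.toLp 2 fun _ => t : EuclideanSpace ℝ (Fin 1)) :=
      contDiff_euclidean.2 fun _ => contDiff_id
    exact this.contMDiff.comp hs
  have h2 := (𝓡∂ 1).contMDiffOn_symm.comp_contMDiff h1 fun x => mem_range_self _
  refine h2.congr fun x => ((𝓡∂ 1).left_inv _).symm

end HalfLine

/-! ### The product decomposition. -/

section Splitting

set_option linter.unusedSectionVars false

variable {k : ℕ} {M : Type*} [EMetricSpace M] [CompleteSpace M]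
  [ChartedSpace (EuclideanHalfSpace (k + 1)) M] [IsManifold (𝓡∂ (k + 1)) ∞ M]
  [RiemannianBundle (fun x : M => TangentSpace (𝓡∂ (k + 1)) x)]
  [IsContMDiffRiemannianBundle (𝓡∂ (k + 1)) ∞ (EuclideanSpace ℝ (Fin (k + 1)))
    (fun x : M => TangentSpace (𝓡∂ (k + 1)) x)] [IsRiemannianManifold (𝓡∂ (k + 1)) M]
  {r : M → ℝ}

/-- The diffeomorphism of `M` with the product of the slice of height zero and the half-line. -/
noncomputable def IsHeight.splitting (hr : IsHeight (n := k + 1) r) :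
    M ≃ₘ^∞⟮𝓡∂ (k + 1), (𝓡 k).prod (𝓡∂ 1)⟯ (hr.Slice × EuclideanHalfSpace 1) where
  toFun x := (hr.proj x, halfLinePoint (hr.toNNReal x))
  invFun p := hr.transport (hr.incl p.1) (halfLineHeight p.2)
  left_inv x := by
    change hr.transport (hr.transport x 0) (hr.toNNReal x) = x
    rw [hr.transport_transport, hr.transport_self]
  right_inv p := by
    refine Prod.ext (IsHeight.isEmbedding_incl.injective ?_) (halfLineCoord_injective ?_)
    · change hr.transport (hr.transport (hr.incl p.1) _) 0 = hr.incl p.1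
      rw [hr.transport_transport, ← IsHeight.toNNReal_incl p.1, hr.transport_self]
    · change r (hr.transport (hr.incl p.1) _) = halfLineCoord p.2
      rw [hr.apply_transport]
      rfl
  contMDiff_toFun := IsHeight.contMDiff_proj.prodMk (contMDiff_halfLinePoint hr.smooth)
  contMDiff_invFun p := hr.contMDiffAt_transport (f := fun p : hr.Slice × EuclideanHalfSpace 1 =>
      hr.incl p.1) (s := fun p => halfLineHeight p.2)
    (IsHeight.contMDiff_incl.comp contMDiff_fst).contMDiffAt
    (contMDiff_halfLineCoord.comp contMDiff_snd).contMDiffAt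

/-- Projection followed by inclusion is transport to height zero, so this is
`IsHeight.inner_mfderiv_transport` at that height. -/
theorem IsHeight.isProductIsometry_splitting (hr : IsHeight (n := k + 1) r) :
    IsProductIsometry (𝓡∂ (k + 1)) hr.splitting := by
  intro x u v
  change inner ℝ u v = inner ℝ (mfderiv (𝓡∂ (k + 1)) (𝓡 k) hr.proj x u)
    (mfderiv (𝓡∂ (k + 1)) (𝓡 k) hr.proj x v) +
    mvfderiv (𝓡∂ (k + 1)) r x u * mvfderiv (𝓡∂ (k + 1)) r x v
  have h1 := mfderiv_comp x
    ((IsHeight.contMDiff_incl (hr := hr) (hr.proj x)).mdifferentiableAt (by simp))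
    ((IsHeight.contMDiff_proj (hr := hr) x).mdifferentiableAt (by simp))
  have h2 : ∀ u, mfderiv (𝓡 k) (𝓡∂ (k + 1)) hr.incl (hr.proj x)
      (mfderiv (𝓡∂ (k + 1)) (𝓡 k) hr.proj x u) =
      mfderiv (𝓡∂ (k + 1)) (𝓡∂ (k + 1)) (fun y => hr.transport y 0) x u := fun u =>
    (congrArg (fun A => A u) h1).symm
  rw [inner_slice, h2, h2]
  have h3 := hr.inner_mfderiv_transport x 0 u v
  exact (sub_eq_iff_eq_add.1 h3.symm)

end Splitting

/-! ### The dichotomy. -/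

theorem mainTheorem3 (n : ℕ) [NeZero n] (m : ℝ) (hm : 0 < m) (hm1 : m ≠ 1)
    (M : Type u) [EMetricSpace M] [ConnectedSpace M] [SecondCountableTopology M]
    [ChartedSpace (EuclideanHalfSpace n) M] [IsManifold (𝓡∂ n) ∞ M]
    [RiemannianBundle (fun x : M => TangentSpace (𝓡∂ n) x)]
    [IsContMDiffRiemannianBundle (𝓡∂ n) ∞ (EuclideanSpace ℝ (Fin n))
      (fun x : M => TangentSpace (𝓡∂ n) x)]
    [IsRiemannianManifold (𝓡∂ n) M] [CompleteSpace M]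
    (w : M → ℝ) (hw : IsQuasiEinstein (𝓡∂ n) 0 m w)
    (hscal : HasConstantScalarCurvature (𝓡∂ n) M) :
    (IsRicciFlat (𝓡∂ n) M ∧ (𝓡∂ n).boundary M = ∅) ∨
    (∃ (F : Type u) (_ : TopologicalSpace F) (_ : T2Space F) (_ : SecondCountableTopology F)
      (_ : ChartedSpace (EuclideanSpace ℝ (Fin (n - 1))) F) (_ : IsManifold (𝓡 (n - 1)) ∞ F)
      (_ : RiemannianBundle (fun p : F => TangentSpace (𝓡 (n - 1)) p))
      (_ : IsContMDiffRiemannianBundle (𝓡 (n - 1)) ∞ (EuclideanSpace ℝ (Fin (n - 1)))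
        (fun p : F => TangentSpace (𝓡 (n - 1)) p))
      (Φ : M ≃ₘ^∞⟮𝓡∂ n, (𝓡 (n - 1)).prod (𝓡∂ 1)⟯ (F × EuclideanHalfSpace 1)) (a : ℝ),
      IsRicciFlat (𝓡 (n - 1)) F ∧ IsProductIsometry (𝓡∂ n) Φ ∧
      0 < a ∧ ∀ x, w x = a * halfLineCoord (Φ x).2) := by
  obtain ⟨k, rfl⟩ := Nat.exists_eq_succ_of_ne_zero (NeZero.ne n)
  obtain ⟨c, hc⟩ := hscal
  have hric : ∀ e ∈ IsManifold.maximalAtlas (𝓡∂ (k + 1)) ∞ M,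
      ∀ y ∈ (e.extend (𝓡∂ (k + 1))).target, ∀ i j,
      coordRicci (range (𝓡∂ (k + 1))) (chartMetric (𝓡∂ (k + 1)) e) i j y = 0 :=
    fun e he y hy i j => coordRicci_eq_zero_of_scalarCurvature hm hm1 hw hc he hy i j
  -- Ricci flatness holds in either case; the alternative is decided by whether the boundary is
  -- empty.
  rcases ((𝓡∂ (k + 1)).boundary M).eq_empty_or_nonempty with hb | hb
  · exact Or.inl ⟨fun e he x hx i j => hric e he _
      ((e.extend (𝓡∂ (k + 1))).map_source (by rwa [e.extend_source])) i j, hb⟩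
  · obtain ⟨a, r, ha, hr, hwr⟩ := exists_isHeight hm hm1 hw hc hb
    exact Or.inr ⟨hr.Slice, inferInstance, inferInstance, inferInstance,
      (inferInstance : ChartedSpace (EuclideanSpace ℝ (Fin k)) hr.Slice),
      (inferInstance : IsManifold (𝓡 k) ∞ hr.Slice),
      (inferInstance : RiemannianBundle (fun p : hr.Slice => TangentSpace (𝓡 k) p)),
      (inferInstance : IsContMDiffRiemannianBundle (𝓡 k) ∞ (EuclideanSpace ℝ (Fin k))
        (fun p : hr.Slice => TangentSpace (𝓡 k) p)),
      hr.splitting, a, hr.isRicciFlat_slice hric, hr.isProductIsometry_splitting, ha, hwr⟩
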